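/- **Setting.** Let $Q$ be a bounded open interval and write $\langle f\rangle_J=\frac1{|J|}\int_J f$. For a weight $w>0$ on $Q$ with $w,\log w$ integrable put $[w]_{A_\infty(Q)}=\sup_{J\subset Q}\langle w\rangle_J\,e^{-\langle\log w\rangle_J}$ (supremum over subintervals $J$ of $Q$). Let $C\ge1$, $\Omega_C=\{x\in\mathbb R^2: e^{x_1}\le x_2\le Ce^{x_1}\}$, and for $x\in\Omega_C$ $$E_x=\{\varphi\in L^1(Q):\ \langle\varphi\rangle_Q=x_1,\ \langle e^\varphi\rangle_Q=x_2,\ [e^\varphi]_{A_\infty(Q)}\le C\}.$$ Define on $\Omega_C$, for $p\in[1,2]$, $\delta\ge1$, $\lambda\in\mathbb R$, $$\boldsymbol b_{p,C}(x)=\inf_{\varphi\in E_x}\langle|\varphi|^p\rangle_Q,\quad \boldsymbol B_{2,C}(x)=\sup_{\varphi\in E_x}\langle\varphi^2\rangle_Q,\quad \boldsymbol A_{\delta,C}(x)=\sup_{\varphi\in E_x}\langle e^{\delta\varphi}\rangle_Q,\quad \boldsymbol D_{\lambda,C}(x)=\sup_{\varphi\in E_x}\tfrac1{|Q|}|\{t\in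 Q:\varphi(t)\ge\lambda\}|.$$ **Notation.** Let $\xi^\pm=\xi^\pm(C)$ be the solutions of $e^{-\xi}=C(1-\xi)$ with $\xi^-\le0\le\xi^+<1$. For $x\in\Omega_C$ let $u^\pm=u^\pm(x)$ be the solution of $$x_2=e^{u^\pm}\Big(\frac{x_1-u^\pm}{1-\xi^\pm}+1\Big)\quad\text{with}\quad u^+\le x_1\le u^++\xi^+,\qquad u^-+\xi^-\le x_1\le u^-.$$ Put $$b_{p,C}(x)=\frac p{\xi^+}e^{u^+/\xi^+}\Big[\int_{u^+}^\infty|s|^{p-1}\operatorname{sgn}(s)e^{-s/\xi^+}ds\Big](x_1-u^+)+|u^+|^p\qquad(1<p\le2),$$ $$b_{1,C}(x)=\begin{cases}-x_1,&x\in\Omega_-,\\ 2\frac{(1-\xi^-)(1-\xi^+)}{\xi^+-\xi^-}(x_2-1)+\frac{\xi^++\xi^--2}{\xi^+-\xi^-}x_1,&x\in\Omega_0,\\ x_1,&x\in\Omega_+,\end{cases}$$ $$B_{2,C}(x)=2u^-x_1-(u^-)^2+2\xi^-(x_1-u^-),\qquad A_{\delta,C}(x)=e^{\delta u^+}\Big(\frac{\delta}{1-\delta\xi^+}(x_1-u^+)+1\Big),$$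 $$D_{\lambda,C}(x)=\begin{cases}1,&x\in\Omega_4(\lambda),\\ \frac{1-\xi^-}{(\xi^+-\xi^-)^2}\big[x_1-\lambda+(1-x_2e^{-\lambda})(1-\xi^+)\big]+1,&x\in\Omega_3(\lambda),\\ \frac{x_1-v}{\lambda-v},&x\in\Omega_2(\lambda),\\ \frac{e^{(\xi^+-\xi^-+u^+-\lambda)/\xi^+}}{\xi^+-\xi^-}(x_1-u^+),&x\in\Omega_1(\lambda),\end{cases}$$ where $v=v(x)\ne\lambda$ is defined on $\Omega_2(\lambda)$ by $\frac{e^v-e^\lambda}{v-\lambda}=\frac{x_2-e^\lambda}{x_1-\lambda}$. With $T_\lambda^\pm(y)=e^\lambda\big(Ce^{\xi^\pm}(y-\lambda)+1\big)$, the subdomains are the following subsets of $\Omega_C$: - $\Omega_-$: $x_1\le\xi^-$, or $\xi^-\le x_1\le0$ and $x_2\le T_0^-(x_1)$. - $\Omega_0$: $\xi^-\le x_1\le0$ and $x_2\ge T_0^-(x_1)$, or $0\le x_1\le\xi^+$ and $x_2\ge T_0^+(x_1)$. - $\Omega_+$: $0\le x_1\le\xi^+$ and $x_2\le T_0^+(x_1)$,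 or $x_1\ge\xi^+$. - $\Omega_1(\lambda)$: $x_1\le\lambda+\xi^--\xi^+$, or $\lambda+\xi^--\xi^+\le x_1\le\lambda+\xi^-$ and $x_2\ge T_\lambda^-(x_1)$. - $\Omega_2(\lambda)$: $\lambda+\xi^--\xi^+\le x_1<\lambda$ and $x_2\le T_\lambda^-(x_1)$. - $\Omega_3(\lambda)$: $\lambda+\xi^-\le x_1\le\lambda$ and $x_2\ge T_\lambda^-(x_1)$, or $\lambda\le x_1\le\lambda+\xi^+$ and $x_2\ge T_\lambda^+(x_1)$. - $\Omega_4(\lambda)$: $\lambda\le x_1\le\lambda+\xi^+$ and $x_2\le T_\lambda^+(x_1)$, or $x_1\ge\lambda+\xi^+$. (For $C=1$, where $\xi^\pm=0$ and $\Omega_1$ is the curve $x_2=e^{x_1}$, each term above with a vanishing denominator carries a factor that vanishes and is read as $0$; the cases of $D_{\lambda,1}$ are taken in the listed order; and $1/\xi^+=\infty$.) **Theorem.** Let $C\ge1$. On $\Omega_C$: 1. If $p\in(1,2]$ and $C\ge\frac{e^{p-2}}{p-1}$, then $\boldsymbol b_{p,C}=b_{p,C}$. In particular, for every $C\ge1$,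 $\boldsymbol b_{2,C}(x)=b_{2,C}(x)=2u^+x_1-(u^+)^2+2\xi^+(x_1-u^+)$. 2. $\boldsymbol b_{1,C}=b_{1,C}$. 3. $\boldsymbol B_{2,C}=B_{2,C}$. 4. If $1\le\delta<1/\xi^+$, then $\boldsymbol A_{\delta,C}=A_{\delta,C}$. If $\delta\ge1/\xi^+$, then $\boldsymbol A_{\delta,C}(x)=e^{\delta x_1}$ if $x_2=e^{x_1}$, and $\boldsymbol A_{\delta,C}(x)=\infty$ if $x_2>e^{x_1}$. 5. For every $\lambda\in\mathbb R$, $\boldsymbol D_{\lambda,C}=D_{\lambda,C}$. -/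

import Mathlib

open MeasureTheory Set
open scoped ENNReal

noncomputable section

namespace AInfBellman

/-! ## Weights and test functions on an interval `Q = (a, b)` -/

/-- The characteristic `[w]_{A_∞(Q)} = sup_J ⟨w⟩_J exp (-⟨log w⟩_J)`, the supremum being over all
subintervals `J = (c, d)` of `Q = (a, b)`. -/
def char (w : ℝ → ℝ) (a b : ℝ) : ℝ≥0∞ :=
  ⨆ (c : ℝ) (d : ℝ) (_ : a ≤ c ∧ c < d ∧ d ≤ b),
    (⨍⁻ t in Ioo c d, ENNReal.ofReal (w t) ∂volume) *
      ENNReal.ofReal (Real.exp (-(⨍ t in Ioo c d, Real.log (w t))))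

/-- `w ∈ A_∞(Q)` for `Q = (a, b)`. -/
structure MemAInf (w : ℝ → ℝ) (a b : ℝ) : Prop where
  pos : ∀ᵐ t ∂(volume.restrict (Ioo a b)), 0 < w t
  integrable : IntegrableOn w (Ioo a b)
  integrable_log : IntegrableOn (fun t => Real.log (w t)) (Ioo a b)
  char_lt_top : char w a b < ⊤

/-- The class `A_∞^C(Q)` of weights `w ∈ A_∞(Q)` with `[w]_{A_∞(Q)} ≤ C`. -/
def AInfC (C a b : ℝ) : Set (ℝ → ℝ) :=
  {w | MemAInf w a b ∧ char w a b ≤ ENNReal.ofReal C}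

/-- The domain `Ω_C`. -/
def Omega (C : ℝ) : Set (ℝ × ℝ) :=
  {x | Real.exp x.1 ≤ x.2 ∧ x.2 ≤ C * Real.exp x.1}

/-- The set `E_{x,C,Q}` of test functions, `Q = (a, b)`. -/
def testFunctions (x : ℝ × ℝ) (C a b : ℝ) : Set (ℝ → ℝ) :=
  {φ | IntegrableOn φ (Ioo a b) ∧ (⨍ t in Ioo a b, φ t) = x.1 ∧
    (⨍ t in Ioo a b, Real.exp (φ t)) = x.2 ∧ (fun t => Real.exp (φ t)) ∈ AInfC C a b}

/-! ## The Bellman functions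

The averages of the nonnegative quantities are taken in `[0, ∞]`, and the extremal values in the
extended reals. -/

/-- The lower Bellman function for `⟨|φ|^p⟩_Q`. -/
def bellmanLower (p C a b : ℝ) (x : ℝ × ℝ) : EReal :=
  ⨅ φ ∈ testFunctions x C a b,
    ((⨍⁻ t in Ioo a b, ENNReal.ofReal (|φ t| ^ p) ∂volume : ℝ≥0∞) : EReal)

/-- The upper Bellman function for `⟨φ²⟩_Q`. -/
def bellmanSq (C a b : ℝ) (x : ℝ × ℝ) : EReal :=
  ⨆ φ ∈ testFunctions x C a b,
    ((⨍⁻ t in Ioo a b, ENNReal.ofReal (φ t ^ 2) ∂volume : ℝ≥0∞) : EReal)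

/-- The upper Bellman function for `⟨e^{δφ}⟩_Q`. -/
def bellmanExp (δ C a b : ℝ) (x : ℝ × ℝ) : EReal :=
  ⨆ φ ∈ testFunctions x C a b,
    ((⨍⁻ t in Ioo a b, ENNReal.ofReal (Real.exp (δ * φ t)) ∂volume : ℝ≥0∞) : EReal)

/-- The upper Bellman function for the distribution `|{t ∈ Q : φ(t) ≥ lam}| / |Q|`. -/
def bellmanDist (lam C a b : ℝ) (x : ℝ × ℝ) : EReal :=
  ⨆ φ ∈ testFunctions x C a b,
    ((volume {t ∈ Ioo a b | lam ≤ φ t} / volume (Ioo a b) : ℝ≥0∞) : EReal)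

/-! ## The numbers `ξ^±(C)` -/

/-- `ξ` is the solution in `[0, 1)` of `e^{-ξ} = C (1 - ξ)`. -/
def IsXiPlus (C ξ : ℝ) : Prop := 0 ≤ ξ ∧ ξ < 1 ∧ Real.exp (-ξ) = C * (1 - ξ)

/-- `ξ` is the solution in `(-∞, 0]` of `e^{-ξ} = C (1 - ξ)`. -/
def IsXiMinus (C ξ : ℝ) : Prop := ξ ≤ 0 ∧ Real.exp (-ξ) = C * (1 - ξ)

theorem existsUnique_xiPlus {C : ℝ} (hC : 1 ≤ C) : ∃! ξ, IsXiPlus C ξ := by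
  have hcont : ContinuousOn (fun ξ : ℝ => C * (1 - ξ) - Real.exp (-ξ)) (Icc 0 1) := by fun_prop
  have hivt := intermediate_value_Icc' (zero_le_one (α := ℝ)) hcont
  have h0 : (0 : ℝ) ∈ Icc (C * (1 - 1) - Real.exp (-1)) (C * (1 - 0) - Real.exp (-0)) := by
    have := Real.exp_pos (-1)
    constructor
    · linarith
    · simp; linarith
  obtain ⟨ξ, hξ, h⟩ := hivt h0
  have h' : Real.exp (-ξ) = C * (1 - ξ) := by simp only at h; linarith
  refine ⟨ξ, ⟨hξ.1, ?_, h'⟩, ?_⟩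
  · by_contra hlt
    have : C * (1 - ξ) ≤ 0 := by nlinarith
    linarith [Real.exp_pos (-ξ)]
  · have key : ∀ s t : ℝ, IsXiPlus C s → IsXiPlus C t → ¬ s < t := by
      intro s t hs ht hst
      have h1 : Real.exp (-t) = Real.exp (-s) * Real.exp (s - t) := by
        rw [← Real.exp_add]; congr 1; ring
      have h2 : s - t + 1 < Real.exp (s - t) := Real.add_one_lt_exp (by linarith)
      have h3 : Real.exp (-s) ≤ 1 := by
        rw [Real.exp_le_one_iff]; linarith [hs.1]
      have h4 := Real.exp_pos (-s)
      have h5 := hs.2.2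
      have h6 := ht.2.2
      nlinarith
    intro η hη
    rcases lt_trichotomy η ξ with hlt | heq | hgt
    · exact absurd hlt (key _ _ hη ⟨hξ.1, by
        by_contra hlt'
        have : C * (1 - ξ) ≤ 0 := by nlinarith
        linarith [Real.exp_pos (-ξ)], h'⟩)
    · exact heq
    · exact absurd hgt (key _ _ ⟨hξ.1, by linarith [hη.2.1], h'⟩ hη)

theorem existsUnique_xiMinus {C : ℝ} (hC : 1 ≤ C) : ∃! ξ, IsXiMinus C ξ := by
  have hcont : ContinuousOn (fun ξ : ℝ => C * (1 - ξ) - Real.exp (-ξ)) (Icc (-(2 * C)) 0) := by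
    fun_prop
  have hivt := intermediate_value_Icc (by linarith : -(2 * C) ≤ 0) hcont
  have h0 : (0 : ℝ) ∈ Icc (C * (1 - -(2 * C)) - Real.exp (- -(2 * C)))
      (C * (1 - 0) - Real.exp (-0)) := by
    constructor
    · have := Real.quadratic_le_exp_of_nonneg (by linarith : 0 ≤ 2 * C)
      rw [neg_neg]; nlinarith
    · simp; linarith
  obtain ⟨ξ, hξ, h⟩ := hivt h0
  have h' : Real.exp (-ξ) = C * (1 - ξ) := by simp only at h; linarith
  have key : ∀ s t : ℝ, IsXiMinus C s → IsXiMinus C t → ¬ s < t := by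
    intro s t hs ht hst
    have h1 : Real.exp (-s) = Real.exp (-t) * Real.exp (t - s) := by
      rw [← Real.exp_add]; congr 1; ring
    have h2 : t - s + 1 < Real.exp (t - s) := Real.add_one_lt_exp (by linarith)
    have h3 : (1 : ℝ) = Real.exp (-t) * Real.exp t := by
      rw [← Real.exp_add]; simp
    have h4 : t + 1 ≤ Real.exp t := Real.add_one_le_exp t
    have h5 := hs.2
    have h6 := ht.2
    have h7 := ht.1
    have h8 := Real.exp_pos (-t)
    have h9 : Real.exp (-t) * (t - s + 1) < Real.exp (-s) := by
      rw [h1]; exact mul_lt_mul_of_pos_left h2 h8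
    have h10 : Real.exp (-t) * (t + 1) ≤ 1 := by
      calc Real.exp (-t) * (t + 1) ≤ Real.exp (-t) * Real.exp t :=
            mul_le_mul_of_nonneg_left h4 h8.le
        _ = 1 := h3.symm
    rw [h6] at h9 h10
    rw [h5] at h9
    have h11 : C * (1 - t) * (t - s) < C * (t - s) := by nlinarith
    have h12 : 0 ≤ C * (t - s) := by nlinarith
    nlinarith
  refine ⟨ξ, ⟨hξ.2, h'⟩, fun η hη => ?_⟩
  rcases lt_trichotomy η ξ with hlt | heq | hgt
  · exact absurd hlt (key _ _ hη ⟨hξ.2, h'⟩)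
  · exact heq
  · exact absurd hgt (key _ _ ⟨hξ.2, h'⟩ hη)

/-- The number `ξ⁺(C)`. -/
def xiPlus (C : ℝ) : ℝ := Classical.epsilon (IsXiPlus C)

/-- The number `ξ⁻(C)`. -/
def xiMinus (C : ℝ) : ℝ := Classical.epsilon (IsXiMinus C)

theorem xiPlus_spec {C : ℝ} (hC : 1 ≤ C) : IsXiPlus C (xiPlus C) :=
  Classical.epsilon_spec (existsUnique_xiPlus hC).exists

theorem xiMinus_spec {C : ℝ} (hC : 1 ≤ C) : IsXiMinus C (xiMinus C) :=
  Classical.epsilon_spec (existsUnique_xiMinus hC).exists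

/-! ## The functions `u^±` -/

/-- `u` is the abscissa of the initial point, on `x₂ = e^{x₁}`, of the one-sided tangent `ℓ⁺(x)` to
`x₂ = C e^{x₁}` that passes through `x` and whose point of tangency, at `u + ξ⁺`, lies to the right
of `x`. -/
def IsUPlus (C : ℝ) (x : ℝ × ℝ) (u : ℝ) : Prop :=
  u ≤ x.1 ∧ x.1 ≤ u + xiPlus C ∧
    x.2 = Real.exp u * ((x.1 - u) / (1 - xiPlus C) + 1)

/-- `u` is the abscissa of the initial point, on `x₂ = e^{x₁}`, of the one-sided tangent `ℓ⁻(x)` to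
`x₂ = C e^{x₁}` that passes through `x` and whose point of tangency, at `u + ξ⁻`, lies to the left
of `x`. -/
def IsUMinus (C : ℝ) (x : ℝ × ℝ) (u : ℝ) : Prop :=
  x.1 ≤ u ∧ u + xiMinus C ≤ x.1 ∧
    x.2 = Real.exp u * ((x.1 - u) / (1 - xiMinus C) + 1)

theorem existsUnique_uPlus {C : ℝ} (hC : 1 ≤ C) {x : ℝ × ℝ} (hx : x ∈ Omega C) :
    ∃! u, IsUPlus C x u := by
  obtain ⟨h0, h1, h2⟩ := xiPlus_spec hC
  unfold IsUPlus
  set ξ := xiPlus C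
  have hpos : 0 < 1 - ξ := by linarith
  have hCe : Real.exp (-ξ) / (1 - ξ) = C := by rw [h2]; field_simp
  have hcont : ContinuousOn (fun u : ℝ => Real.exp u * ((x.1 - u) / (1 - ξ) + 1))
      (Icc (x.1 - ξ) x.1) := by fun_prop
  have hivt := intermediate_value_Icc' (by linarith : x.1 - ξ ≤ x.1) hcont
  have hmem : x.2 ∈ Icc (Real.exp x.1 * ((x.1 - x.1) / (1 - ξ) + 1))
      (Real.exp (x.1 - ξ) * ((x.1 - (x.1 - ξ)) / (1 - ξ) + 1)) := by
    constructor
    · simpa using hx.1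
    · have e1 : Real.exp (x.1 - ξ) * ((x.1 - (x.1 - ξ)) / (1 - ξ) + 1) = C * Real.exp x.1 := by
        rw [← hCe, sub_eq_add_neg x.1 ξ, Real.exp_add]; field_simp; ring
      rw [e1]; exact hx.2
  obtain ⟨u, hu, hux⟩ := hivt hmem
  refine ⟨u, ⟨hu.2, by linarith [hu.1], hux.symm⟩, ?_⟩
  have key : ∀ s t : ℝ, (s ≤ x.1 ∧ x.1 ≤ s + ξ ∧
      x.2 = Real.exp s * ((x.1 - s) / (1 - ξ) + 1)) → (t ≤ x.1 ∧ x.1 ≤ t + ξ ∧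
      x.2 = Real.exp t * ((x.1 - t) / (1 - ξ) + 1)) → ¬ s < t := by
    rintro s t ⟨hs1, hs2, hs3⟩ ⟨ht1, ht2, ht3⟩ hst
    have e1 : Real.exp s = Real.exp t * Real.exp (s - t) := by
      rw [← Real.exp_add]; congr 1; ring
    have e2 : s - t + 1 < Real.exp (s - t) := Real.add_one_lt_exp (by linarith)
    have e3 : Real.exp s * ((x.1 - s) / (1 - ξ) + 1) =
      Real.exp t * ((x.1 - t) / (1 - ξ) + 1) := by rw [← hs3, ht3]
    rw [e1, mul_assoc] at e3
    have e4 := mul_left_cancel₀ (Real.exp_pos t).ne' e3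
    field_simp at e4
    nlinarith
  intro w hw
  rcases lt_trichotomy w u with hlt | heq | hgt
  · exact absurd hlt (key _ _ hw ⟨hu.2, by linarith [hu.1], hux.symm⟩)
  · exact heq
  · exact absurd hgt (key _ _ ⟨hu.2, by linarith [hu.1], hux.symm⟩ hw)

theorem existsUnique_uMinus {C : ℝ} (hC : 1 ≤ C) {x : ℝ × ℝ} (hx : x ∈ Omega C) :
    ∃! u, IsUMinus C x u := by
  obtain ⟨h0, h2⟩ := xiMinus_spec hC
  unfold IsUMinus
  set ξ := xiMinus C
  have hpos : 0 < 1 - ξ := by linarith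
  have hCe : Real.exp (-ξ) / (1 - ξ) = C := by rw [h2]; field_simp
  have hcont : ContinuousOn (fun u : ℝ => Real.exp u * ((x.1 - u) / (1 - ξ) + 1))
      (Icc x.1 (x.1 - ξ)) := by fun_prop
  have hivt := intermediate_value_Icc (by linarith : x.1 ≤ x.1 - ξ) hcont
  have hmem : x.2 ∈ Icc (Real.exp x.1 * ((x.1 - x.1) / (1 - ξ) + 1))
      (Real.exp (x.1 - ξ) * ((x.1 - (x.1 - ξ)) / (1 - ξ) + 1)) := by
    constructor
    · simpa using hx.1
    · have e1 : Real.exp (x.1 - ξ) * ((x.1 - (x.1 - ξ)) / (1 - ξ) + 1) = C * Real.exp x.1 := by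
        rw [← hCe, sub_eq_add_neg x.1 ξ, Real.exp_add]; field_simp; ring
      rw [e1]; exact hx.2
  obtain ⟨u, hu, hux⟩ := hivt hmem
  refine ⟨u, ⟨hu.1, by linarith [hu.2], hux.symm⟩, ?_⟩
  have key : ∀ s t : ℝ, (x.1 ≤ s ∧ s + ξ ≤ x.1 ∧
      x.2 = Real.exp s * ((x.1 - s) / (1 - ξ) + 1)) → (x.1 ≤ t ∧ t + ξ ≤ x.1 ∧
      x.2 = Real.exp t * ((x.1 - t) / (1 - ξ) + 1)) → ¬ s < t := by
    rintro s t ⟨hs1, hs2, hs3⟩ ⟨ht1, ht2, ht3⟩ hst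
    have e1 : Real.exp t = Real.exp s * Real.exp (t - s) := by
      rw [← Real.exp_add]; congr 1; ring
    have e2 : t - s + 1 < Real.exp (t - s) := Real.add_one_lt_exp (by linarith)
    have e3 : Real.exp s * ((x.1 - s) / (1 - ξ) + 1) =
      Real.exp t * ((x.1 - t) / (1 - ξ) + 1) := by rw [← hs3, ht3]
    rw [e1, mul_assoc] at e3
    have e4 := mul_left_cancel₀ (Real.exp_pos s).ne' e3
    field_simp at e4
    nlinarith
  intro w hw
  rcases lt_trichotomy w u with hlt | heq | hgt
  · exact absurd hlt (key _ _ hw ⟨hu.1, by linarith [hu.2], hux.symm⟩)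
  · exact heq
  · exact absurd hgt (key _ _ ⟨hu.1, by linarith [hu.2], hux.symm⟩ hw)

/-- The function `u⁺` on `Ω_C`. -/
def uPlus (C : ℝ) (x : ℝ × ℝ) : ℝ := Classical.epsilon (IsUPlus C x)

/-- The function `u⁻` on `Ω_C`. -/
def uMinus (C : ℝ) (x : ℝ × ℝ) : ℝ := Classical.epsilon (IsUMinus C x)

theorem uPlus_spec {C : ℝ} (hC : 1 ≤ C) {x : ℝ × ℝ} (hx : x ∈ Omega C) :
    IsUPlus C x (uPlus C x) :=
  Classical.epsilon_spec (existsUnique_uPlus hC hx).exists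

theorem uMinus_spec {C : ℝ} (hC : 1 ≤ C) {x : ℝ × ℝ} (hx : x ∈ Omega C) :
    IsUMinus C x (uMinus C x) :=
  Classical.epsilon_spec (existsUnique_uMinus hC hx).exists

/-! ## The explicit functions

For `C = 1` one has `ξ⁺ = ξ⁻ = 0` and `Ω_1` is the curve `x₂ = e^{x₁}`, where `u⁺ = u⁻ = x₁`. Every
coefficient below whose denominator then vanishes has a zero factor next to it, and the convention
`y / 0 = 0` makes these products zero, as they should be. -/

/-- The function `b_{p,C}`, `1 < p ≤ 2`. -/
def bCand (p C : ℝ) (x : ℝ × ℝ) : ℝ :=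
  p / xiPlus C * Real.exp (uPlus C x / xiPlus C) *
      (∫ s in Ioi (uPlus C x), |s| ^ (p - 1) * Real.sign s * Real.exp (-s / xiPlus C)) *
      (x.1 - uPlus C x) + |uPlus C x| ^ p

/-- The function `b_{2,C}`. -/
def b2Cand (C : ℝ) (x : ℝ × ℝ) : ℝ :=
  2 * uPlus C x * x.1 - uPlus C x ^ 2 + 2 * xiPlus C * (x.1 - uPlus C x)

/-- The function `B_{2,C}`. -/
def B2Cand (C : ℝ) (x : ℝ × ℝ) : ℝ :=
  2 * uMinus C x * x.1 - uMinus C x ^ 2 + 2 * xiMinus C * (x.1 - uMinus C x)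

/-- The function `A_{δ,C}`. -/
def ACand (δ C : ℝ) (x : ℝ × ℝ) : ℝ :=
  Real.exp (δ * uPlus C x) * (δ / (1 - δ * xiPlus C) * (x.1 - uPlus C x) + 1)

/-- The subdomain `Ω_-`. -/
def OmegaMinus (C : ℝ) : Set (ℝ × ℝ) :=
  {x | x.1 ≤ xiMinus C ∧ Real.exp x.1 ≤ x.2 ∧ x.2 ≤ C * Real.exp x.1} ∪
  {x | xiMinus C ≤ x.1 ∧ x.1 ≤ 0 ∧ Real.exp x.1 ≤ x.2 ∧
    x.2 ≤ C * Real.exp (xiMinus C) * x.1 + 1}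

/-- The subdomain `Ω_0`. -/
def OmegaZero (C : ℝ) : Set (ℝ × ℝ) :=
  {x | xiMinus C ≤ x.1 ∧ x.1 ≤ 0 ∧ C * Real.exp (xiMinus C) * x.1 + 1 ≤ x.2 ∧
    x.2 ≤ C * Real.exp x.1} ∪
  {x | 0 ≤ x.1 ∧ x.1 ≤ xiPlus C ∧ C * Real.exp (xiPlus C) * x.1 + 1 ≤ x.2 ∧
    x.2 ≤ C * Real.exp x.1}

/-- The subdomain `Ω_+`. -/
def OmegaPlus (C : ℝ) : Set (ℝ × ℝ) :=
  {x | 0 ≤ x.1 ∧ x.1 ≤ xiPlus C ∧ Real.exp x.1 ≤ x.2 ∧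
    x.2 ≤ C * Real.exp (xiPlus C) * x.1 + 1} ∪
  {x | xiPlus C ≤ x.1 ∧ Real.exp x.1 ≤ x.2 ∧ x.2 ≤ C * Real.exp x.1}

theorem omega_subset_parts (C : ℝ) :
    Omega C ⊆ OmegaMinus C ∪ OmegaZero C ∪ OmegaPlus C := by
  rintro x ⟨h1, h2⟩
  rcases le_total x.1 (xiMinus C) with a1 | a1
  · exact Or.inl (Or.inl (Or.inl ⟨a1, h1, h2⟩))
  rcases le_total (xiPlus C) x.1 with a3 | a3
  · exact Or.inr (Or.inr ⟨a3, h1, h2⟩)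
  rcases le_total x.1 0 with a2 | a2
  · rcases le_total x.2 (C * Real.exp (xiMinus C) * x.1 + 1) with a4 | a4
    · exact Or.inl (Or.inl (Or.inr ⟨a1, a2, h1, a4⟩))
    · exact Or.inl (Or.inr (Or.inl ⟨a1, a2, a4, h2⟩))
  · rcases le_total x.2 (C * Real.exp (xiPlus C) * x.1 + 1) with a4 | a4
    · exact Or.inr (Or.inl ⟨a2, a3, h1, a4⟩)
    · exact Or.inl (Or.inr (Or.inr ⟨a2, a3, a4, h2⟩))

open Classical in
/-- The function `b_{1,C}` (with the value `0` outside `Ω_C`). -/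
def b1Cand (C : ℝ) (x : ℝ × ℝ) : ℝ :=
  if x ∈ OmegaMinus C then -x.1
  else if x ∈ OmegaZero C then
    2 * ((1 - xiMinus C) * (1 - xiPlus C) / (xiPlus C - xiMinus C)) * (x.2 - 1) +
      (xiPlus C + xiMinus C - 2) / (xiPlus C - xiMinus C) * x.1
  else if x ∈ OmegaPlus C then x.1
  else 0

/-- The tangent drawn from `(lam, e^lam)` to `x₂ = C e^{x₁}`, with tangency at `lam + ξ`, for
`ξ = ξ⁺(C)` or `ξ = ξ⁻(C)`, as a function of the abscissa `y`. -/
def tangentLine (C lam ξ y : ℝ) : ℝ := Real.exp lam * (C * Real.exp ξ * (y - lam) + 1)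

/-- The subdomain `Ω_1(lam)`. -/
def Omega1 (C lam : ℝ) : Set (ℝ × ℝ) :=
  {x | x.1 ≤ lam + xiMinus C - xiPlus C ∧ Real.exp x.1 ≤ x.2 ∧ x.2 ≤ C * Real.exp x.1} ∪
  {x | lam + xiMinus C - xiPlus C ≤ x.1 ∧ x.1 ≤ lam + xiMinus C ∧
    tangentLine C lam (xiMinus C) x.1 ≤ x.2 ∧ x.2 ≤ C * Real.exp x.1}

/-- The subdomain `Ω_2(lam)`. -/
def Omega2 (C lam : ℝ) : Set (ℝ × ℝ) :=
  {x | lam + xiMinus C - xiPlus C ≤ x.1 ∧ x.1 < lam ∧ Real.exp x.1 ≤ x.2 ∧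
    x.2 ≤ tangentLine C lam (xiMinus C) x.1}

/-- The subdomain `Ω_3(lam)`. -/
def Omega3 (C lam : ℝ) : Set (ℝ × ℝ) :=
  {x | lam + xiMinus C ≤ x.1 ∧ x.1 ≤ lam ∧ tangentLine C lam (xiMinus C) x.1 ≤ x.2 ∧
    x.2 ≤ C * Real.exp x.1} ∪
  {x | lam ≤ x.1 ∧ x.1 ≤ lam + xiPlus C ∧ tangentLine C lam (xiPlus C) x.1 ≤ x.2 ∧
    x.2 ≤ C * Real.exp x.1}

/-- The subdomain `Ω_4(lam)`. -/
def Omega4 (C lam : ℝ) : Set (ℝ × ℝ) :=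
  {x | lam ≤ x.1 ∧ x.1 ≤ lam + xiPlus C ∧ Real.exp x.1 ≤ x.2 ∧
    x.2 ≤ tangentLine C lam (xiPlus C) x.1} ∪
  {x | lam + xiPlus C ≤ x.1 ∧ Real.exp x.1 ≤ x.2 ∧ x.2 ≤ C * Real.exp x.1}

theorem omega_subset_parts_lam (C lam : ℝ) :
    Omega C ⊆ Omega1 C lam ∪ Omega2 C lam ∪ Omega3 C lam ∪ Omega4 C lam := by
  rintro x ⟨h1, h2⟩
  rcases le_total x.1 (lam + xiMinus C - xiPlus C) with a0 | a0
  · exact Or.inl (Or.inl (Or.inl (Or.inl ⟨a0, h1, h2⟩)))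
  rcases le_total (lam + xiPlus C) x.1 with a3 | a3
  · exact Or.inr (Or.inr ⟨a3, h1, h2⟩)
  rcases lt_or_ge x.1 lam with a2 | a2
  · rcases le_total x.2 (tangentLine C lam (xiMinus C) x.1) with a4 | a4
    · exact Or.inl (Or.inl (Or.inr ⟨a0, a2, h1, a4⟩))
    · rcases le_total x.1 (lam + xiMinus C) with a1 | a1
      · exact Or.inl (Or.inl (Or.inl (Or.inr ⟨a0, a1, a4, h2⟩)))
      · exact Or.inl (Or.inr (Or.inl ⟨a1, a2.le, a4, h2⟩))
  · rcases le_total x.2 (tangentLine C lam (xiPlus C) x.1) with a5 | a5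
    · exact Or.inr (Or.inl ⟨a2, a3, h1, a5⟩)
    · exact Or.inl (Or.inr (Or.inr ⟨a2, a3, a5, h2⟩))

/-- `v` is the abscissa of the second point where the line through `(lam, e^lam)` and `x` meets the
curve `x₂ = e^{x₁}`. -/
def IsV (lam : ℝ) (x : ℝ × ℝ) (v : ℝ) : Prop :=
  v ≠ lam ∧
    (Real.exp v - Real.exp lam) / (v - lam) = (x.2 - Real.exp lam) / (x.1 - lam)

theorem existsUnique_v {C : ℝ} (hC : 1 ≤ C) {lam : ℝ} {x : ℝ × ℝ} (hx : x ∈ Omega2 C lam) :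
    ∃! v, IsV lam x v := by
  obtain ⟨-, hlt, hlow, hup⟩ := hx
  set m := (x.2 - Real.exp lam) / (x.1 - lam) with hm
  have hy : x.1 - lam < 0 := by linarith
  have hx2 : x.2 < Real.exp lam := by
    refine lt_of_le_of_lt hup ?_
    have h1 : 0 < C * Real.exp (xiMinus C) := by positivity
    have h2 := Real.exp_pos lam
    unfold tangentLine
    have h3 : C * Real.exp (xiMinus C) * (x.1 - lam) < 0 := mul_neg_of_pos_of_neg h1 hy
    nlinarith
  have hmpos : 0 < m := div_pos_of_neg_of_neg (by linarith) hy
  have hmx : m * (x.1 - lam) = x.2 - Real.exp lam := by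
    rw [hm, div_mul_cancel₀ _ hy.ne]
  have hle : lam - Real.exp lam / m ≤ x.1 := by
    have h1 : Real.exp lam / m * m = Real.exp lam := by field_simp
    have h2 : 0 < x.2 := lt_of_lt_of_le (Real.exp_pos _) hlow
    by_contra hcon
    push Not at hcon
    nlinarith
  have hcont : ContinuousOn (fun v : ℝ => Real.exp v - Real.exp lam - m * (v - lam))
      (Icc (lam - Real.exp lam / m) x.1) := by fun_prop
  have hivt := intermediate_value_Icc' hle hcont
  have hmem : (0 : ℝ) ∈ Icc (Real.exp x.1 - Real.exp lam - m * (x.1 - lam))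
      (Real.exp (lam - Real.exp lam / m) - Real.exp lam -
        m * (lam - Real.exp lam / m - lam)) := by
    constructor
    · rw [hmx]; linarith
    · have h1 : m * (lam - Real.exp lam / m - lam) = -Real.exp lam := by field_simp; ring
      rw [h1]; linarith [Real.exp_pos (lam - Real.exp lam / m)]
  obtain ⟨v, hv, hv0⟩ := hivt hmem
  have hvl : v < lam := by linarith [hv.2]
  have hvne : v - lam ≠ 0 := by linarith
  have hveq : (Real.exp v - Real.exp lam) / (v - lam) = m := by
    rw [div_eq_iff hvne]; simp only at hv0; linarith
  refine ⟨v, ⟨hvl.ne, hveq⟩, ?_⟩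
  rintro w ⟨hwne, hw⟩
  rw [← hm, ← hveq] at hw
  rcases lt_trichotomy w v with h | h | h
  · exact absurd hw (strictConvexOn_exp.secant_strict_mono (mem_univ lam) (mem_univ w)
      (mem_univ v) hwne hvl.ne h).ne
  · exact h
  · exact absurd hw (strictConvexOn_exp.secant_strict_mono (mem_univ lam) (mem_univ v)
      (mem_univ w) hvl.ne hwne h).ne'

/-- The function `v` on `Ω_2(lam)`. -/
def vFun (lam : ℝ) (x : ℝ × ℝ) : ℝ := Classical.epsilon (IsV lam x)

theorem vFun_spec {C : ℝ} (hC : 1 ≤ C) {lam : ℝ} {x : ℝ × ℝ} (hx : x ∈ Omega2 C lam) :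
    IsV lam x (vFun lam x) :=
  Classical.epsilon_spec (existsUnique_v hC hx).exists

open Classical in
/-- The function `D_{lam,C}` (with the value `0` outside `Ω_C`). The cases are tried in this order;
for `C = 1` this gives the value `1`, not `0`, at the point `(lam, e^lam)`. -/
def DCand (lam C : ℝ) (x : ℝ × ℝ) : ℝ :=
  if x ∈ Omega4 C lam then 1
  else if x ∈ Omega3 C lam then
    (1 - xiMinus C) / (xiPlus C - xiMinus C) ^ 2 *
      (x.1 - lam + (1 - x.2 * Real.exp (-lam)) * (1 - xiPlus C)) + 1
  else if x ∈ Omega2 C lam then (x.1 - vFun lam x) / (lam - vFun lam x)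
  else if x ∈ Omega1 C lam then
    Real.exp ((xiPlus C - xiMinus C + uPlus C x - lam) / xiPlus C) / (xiPlus C - xiMinus C) *
      (x.1 - uPlus C x)
  else 0

end AInfBellman

end

namespace AInfBellman

open Filter Topology

/-! By `mem_testFunctions_iff`, a test function is a `φ` whose pairs of averages `(⟨φ⟩, ⟨e^φ⟩)` over
all subintervals lie in the curved strip `Ω_C`. Suppose `M` is concave along every segment contained
in the strip, with boundary values `f t` at `(t, e^t)`. Split the interval repeatedly, so that each
time the segment joining the averages of the two parts stays in the strip. Concavity makes the
weighted sums of `M` decrease, Lebesgue differentiation drives the averages to `(φ t, e^{φ t})`, and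
`⟨f ∘ φ⟩ ≤ M(x)` results. Lower bounds are the same statement for `-B`.

Three obstacles have to be met. First, a segment between averages may leave the strip.
`ExpClass.exists_split` finds a good split with ratio bounded below, provided that `φ` belongs to a
strictly smaller constant `C'`. Second, `φ` has only the constant `C`. The function `sφ + (1 - s)k`
has constant `C^s` (`ExpClass.interpolate`), and `s` tends to `1`; for this limit continuity of the
candidate is replaced by the one-sided control in `HasVisibleMajorants`. Third, integrands may be
negative. A quadratic correction `κ(1 + φ²)` repairs this, once the upper bound for `φ²` itself has
given square integrability. These points are combined in `exists_lintegral_interpolate_le`.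

The candidates are built from foliations of the strip by segments along which they are affine. For
the four smooth functionals the segments are one-sided tangents to the upper curve. `TangentData`
reduces local concavity to an ordinary differential equation for the slope and the monotonicity of
one function of a real variable, and `TangentData.hasVisibleMajorants` draws the conclusion. For
`|φ|` and for the distribution function, regions with tangents, with chords of the lower curve and
with a single affine piece are glued together, and the planes are compared piece by piece.

Sharpness comes from explicit functions. The average point of `logTail` over `(0, c)` runs along the
upper curve while `c ≤ β` and down the tangent afterwards, so it realises any point on any tangent.
The remaining regions use step functions, possibly attached to such a tail. Points of the lower
curve, in particular the whole case `C = 1`, are separate: equality in Jensen's inequality forces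
`φ` to be constant almost everywhere. -/

/-! ### Pairs of averages and Jensen's inequality. -/

/-- The pair of averages of `φ` and `e^φ` over `(c, d)`. -/
noncomputable def meanPoint (φ : ℝ → ℝ) (c d : ℝ) : ℝ × ℝ :=
  ((∫ t in c..d, φ t) / (d - c), (∫ t in c..d, Real.exp (φ t)) / (d - c))

/-- Functions `φ` on `(a, b)` all of whose pairs of averages lie below `x₂ = C e^{x₁}`. -/
structure ExpClass (C : ℝ) (φ : ℝ → ℝ) (a b : ℝ) : Prop where
  int : IntervalIntegrable φ volume a b
  int_exp : IntervalIntegrable (fun t => Real.exp (φ t)) volume a b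
  le : ∀ c d, a ≤ c → c < d → d ≤ b →
    (meanPoint φ c d).2 ≤ C * Real.exp (meanPoint φ c d).1

theorem setAverage_Ioo_eq_div {c d : ℝ} (h : c < d) (g : ℝ → ℝ) :
    (⨍ t in Ioo c d, g t) = (∫ t in c..d, g t) / (d - c) := by
  rw [setAverage_eq, intervalIntegral.integral_of_le h.le, integral_Ioc_eq_integral_Ioo,
    smul_eq_mul, measureReal_def, Real.volume_Ioo, ENNReal.toReal_ofReal (by linarith)]
  ring

theorem setLAverage_Ioo_eq_div {c d : ℝ} (g : ℝ → ℝ≥0∞) :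
    (⨍⁻ t in Ioo c d, g t ∂volume) = (∫⁻ t in Ioc c d, g t) / ENNReal.ofReal (d - c) := by
  rw [setLAverage_eq, Real.volume_Ioo, restrict_Ioo_eq_restrict_Ioc]

theorem intervalIntegrable_sub {g : ℝ → ℝ} {a b c d : ℝ} (hg : IntervalIntegrable g volume a b)
    (h1 : a ≤ c) (h2 : c ≤ d) (h3 : d ≤ b) : IntervalIntegrable g volume c d := by
  apply hg.mono_set
  rw [uIcc_of_le h2, uIcc_of_le (by linarith)]
  exact Icc_subset_Icc h1 h3

theorem ofReal_mean_exp {φ : ℝ → ℝ} {c d : ℝ} (h : c < d)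
    (hi : IntervalIntegrable (fun t => Real.exp (φ t)) volume c d) :
    (⨍⁻ t in Ioo c d, ENNReal.ofReal (Real.exp (φ t)) ∂volume) =
      ENNReal.ofReal (meanPoint φ c d).2 := by
  have hi' := (intervalIntegrable_iff_integrableOn_Ioo_of_le h.le).1 hi
  have := ofReal_setAverage hi' (ae_of_all _ fun t => (Real.exp_pos _).le)
  rw [setLAverage_eq, ← this, setAverage_Ioo_eq_div h, meanPoint]

/-- A supremum is at most `C` exactly when each of its terms is, and the term of `(c, d)` is the
second average divided by the exponential of the first. Finiteness of `char` is then automatic, and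
extended nonnegative averages disappear from the description of the class. -/
theorem mem_testFunctions_iff {C a b : ℝ} (hab : a < b) (hC : 0 ≤ C) {x : ℝ × ℝ} {φ : ℝ → ℝ} :
    φ ∈ testFunctions x C a b ↔ ExpClass C φ a b ∧ meanPoint φ a b = x := by
  have key : ∀ c d, c < d → IntervalIntegrable (fun t => Real.exp (φ t)) volume c d →
      ((⨍⁻ t in Ioo c d, ENNReal.ofReal (Real.exp (φ t)) ∂volume) *
        ENNReal.ofReal (Real.exp (-(⨍ t in Ioo c d, Real.log (Real.exp (φ t))))) ≤
          ENNReal.ofReal C ↔ (meanPoint φ c d).2 ≤ C * Real.exp (meanPoint φ c d).1) := by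
    intro c d hcd hi
    rw [ofReal_mean_exp hcd hi]
    simp only [Real.log_exp]
    rw [setAverage_Ioo_eq_div hcd, ← ENNReal.ofReal_mul', ENNReal.ofReal_le_ofReal_iff hC]
    · change _ * Real.exp (-(meanPoint φ c d).1) ≤ C ↔ _
      rw [Real.exp_neg, ← div_eq_mul_inv, div_le_iff₀ (Real.exp_pos _)]
    · positivity
  unfold testFunctions AInfC
  simp only [mem_ofPred_eq]
  constructor
  · rintro ⟨h1, h2, h3, h4, h5⟩
    have hi := (intervalIntegrable_iff_integrableOn_Ioo_of_le hab.le).2 h4.integrable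
    refine ⟨⟨(intervalIntegrable_iff_integrableOn_Ioo_of_le hab.le).2 h1, hi, ?_⟩, ?_⟩
    · intro c d hc hcd hd
      rw [← key c d hcd (intervalIntegrable_sub hi hc hcd.le hd)]
      refine le_trans ?_ h5
      unfold char
      exact le_iSup_of_le c (le_iSup_of_le d (le_iSup_of_le ⟨hc, hcd, hd⟩ le_rfl))
    · rw [setAverage_Ioo_eq_div hab] at h2 h3
      exact Prod.ext h2 h3
  · rintro ⟨⟨h1, h2, h3⟩, h4⟩
    have hc : char (fun t => Real.exp (φ t)) a b ≤ ENNReal.ofReal C := by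
      unfold char
      refine iSup_le fun c => iSup_le fun d => iSup_le fun h => ?_
      exact (key c d h.2.1 (intervalIntegrable_sub h2 h.1 h.2.1.le h.2.2)).2 (h3 c d h.1 h.2.1 h.2.2)
    have h1' := (intervalIntegrable_iff_integrableOn_Ioo_of_le hab.le).1 h1
    refine ⟨h1', ?_, ?_, ⟨ae_of_all _ fun t => Real.exp_pos _,
      (intervalIntegrable_iff_integrableOn_Ioo_of_le hab.le).1 h2, ?_,
      hc.trans_lt ENNReal.ofReal_lt_top⟩, hc⟩
    · rw [setAverage_Ioo_eq_div hab, ← h4, meanPoint]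
    · rw [setAverage_Ioo_eq_div hab, ← h4, meanPoint]
    · simpa only [Real.log_exp] using h1'

/-- Jensen's inequality for the exponential function on an interval. -/
theorem exp_mean_le {φ : ℝ → ℝ} {c d : ℝ} (h : c < d) (h1 : IntervalIntegrable φ volume c d)
    (h2 : IntervalIntegrable (fun t => Real.exp (φ t)) volume c d) :
    Real.exp (meanPoint φ c d).1 ≤ (meanPoint φ c d).2 := by
  set m := (meanPoint φ c d).1 with hm
  have hpos : 0 < d - c := by linarith
  have hm' : ∫ t in c..d, φ t = m * (d - c) := by
    rw [hm, meanPoint]; field_simp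
  have h3 : ∫ t in c..d, Real.exp m * (1 - m + φ t) ≤ ∫ t in c..d, Real.exp (φ t) := by
    apply intervalIntegral.integral_mono_on h.le _ h2
    · intro t _
      have := Real.add_one_le_exp (φ t - m)
      calc Real.exp m * (1 - m + φ t) ≤ Real.exp m * Real.exp (φ t - m) := by
            apply mul_le_mul_of_nonneg_left _ (Real.exp_pos _).le; linarith
        _ = _ := by rw [← Real.exp_add]; ring_nf
    · exact (intervalIntegrable_const.add h1).const_mul _
  rw [intervalIntegral.integral_const_mul,
    intervalIntegral.integral_add intervalIntegrable_const h1,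
    intervalIntegral.integral_const, hm', smul_eq_mul] at h3
  change _ ≤ (∫ t in c..d, Real.exp (φ t)) / (d - c)
  rw [le_div_iff₀ hpos]
  calc _ = Real.exp m * ((d - c) * (1 - m) + m * (d - c)) := by ring
    _ ≤ _ := h3

theorem ExpClass.mem_Omega {C a b : ℝ} {φ : ℝ → ℝ} (h : ExpClass C φ a b) {c d : ℝ}
    (hc : a ≤ c) (hcd : c < d) (hd : d ≤ b) : meanPoint φ c d ∈ Omega C :=
  ⟨exp_mean_le hcd (intervalIntegrable_sub h.int hc hcd.le hd)
    (intervalIntegrable_sub h.int_exp hc hcd.le hd), h.le c d hc hcd hd⟩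

/-- Equality in Jensen's inequality. -/
theorem ae_eq_of_exp_mean_eq {φ : ℝ → ℝ} {c d : ℝ} (h : c < d)
    (h1 : IntervalIntegrable φ volume c d)
    (h2 : IntervalIntegrable (fun t => Real.exp (φ t)) volume c d)
    (heq : (meanPoint φ c d).2 = Real.exp (meanPoint φ c d).1) :
    ∀ᵐ t ∂(volume.restrict (Ioc c d)), φ t = (meanPoint φ c d).1 := by
  set m := (meanPoint φ c d).1 with hm
  have hpos : 0 < d - c := by linarith
  have hm' : ∫ t in c..d, φ t = m * (d - c) := by
    rw [hm, meanPoint]; field_simp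
  have he' : ∫ t in c..d, Real.exp (φ t) = Real.exp m * (d - c) := by
    rw [← heq, meanPoint]; field_simp
  have hi : IntervalIntegrable (fun t => Real.exp (φ t) - Real.exp m * (1 - m + φ t)) volume c d :=
    h2.sub ((intervalIntegrable_const.add h1).const_mul _)
  have hint : ∫ t in c..d, (Real.exp (φ t) - Real.exp m * (1 - m + φ t)) = 0 := by
    rw [intervalIntegral.integral_sub h2 ((intervalIntegrable_const.add h1).const_mul _),
      intervalIntegral.integral_const_mul,
      intervalIntegral.integral_add intervalIntegrable_const h1,
      intervalIntegral.integral_const, hm', he', smul_eq_mul]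
    ring
  have hfac : ∀ t, Real.exp (φ t) - Real.exp m * (1 - m + φ t) =
      Real.exp m * (Real.exp (φ t - m) - (φ t - m + 1)) := by
    intro t
    rw [mul_sub, ← Real.exp_add]; ring_nf
  have hnn : ∀ t, 0 ≤ Real.exp (φ t) - Real.exp m * (1 - m + φ t) := by
    intro t
    rw [hfac]
    exact mul_nonneg (Real.exp_pos _).le (by linarith [Real.add_one_le_exp (φ t - m)])
  rw [intervalIntegral.integral_of_le h.le, integral_eq_zero_iff_of_nonneg hnn
    ((intervalIntegrable_iff_integrableOn_Ioc_of_le h.le).1 hi)] at hint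
  filter_upwards [hint] with t ht
  simp only [Pi.zero_apply, hfac, mul_eq_zero, (Real.exp_pos m).ne', false_or] at ht
  by_contra hne
  linarith [Real.add_one_lt_exp (sub_ne_zero.2 hne)]

/-! ### Splitting an interval while keeping the segment of averages under the upper curve. -/

/-- The segment from `x` to `y` lies below the curve `x₂ = C e^{x₁}`. -/
def Under (C : ℝ) (x y : ℝ × ℝ) : Prop :=
  ∀ r ∈ Icc (0 : ℝ) 1, x.2 + r * (y.2 - x.2) ≤ C * Real.exp (x.1 + r * (y.1 - x.1))

theorem Under.symm {C : ℝ} {x y : ℝ × ℝ} (h : Under C x y) : Under C y x := by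
  intro r hr
  have := h (1 - r) ⟨by linarith [hr.2], by linarith [hr.1]⟩
  rw [show y.1 + r * (x.1 - y.1) = x.1 + (1 - r) * (y.1 - x.1) by ring]
  linarith

theorem exp_convex_comb (p q : ℝ) {s : ℝ} (h0 : 0 ≤ s) (h1 : s ≤ 1) :
    Real.exp (p + s * (q - p)) ≤ Real.exp p + s * (Real.exp q - Real.exp p) := by
  have := convexOn_exp.2 (mem_univ p) (mem_univ q) (by linarith : 0 ≤ 1 - s) h0 (by ring)
  simp only [smul_eq_mul] at this
  rw [show p + s * (q - p) = (1 - s) * p + s * q by ring]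
  linarith

/-- If a line leaves the region below `x₂ = C e^{x₁}` after a point of the region, it has not left
it before that point. -/
theorem under_extrapolate {C x1 x2 h1 h2 s s0 : ℝ} (hC : 0 ≤ C) (hx : x2 ≤ C * Real.exp x1)
    (hs0 : 0 ≤ s0) (hv : C * Real.exp (x1 + s0 * h1) < x2 + s0 * h2) (hs : s ≤ 0) :
    x2 + s * h2 ≤ C * Real.exp (x1 + s * h1) := by
  rcases hs0.eq_or_lt with h | h
  · subst h; simp at hv; linarith
  by_contra! hcon
  have hd : 0 < s0 - s := by linarith
  -- The region above a convex curve is convex: were the points of parameters `s` and `s0` both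
  -- above, so would be the one of parameter `0`.
  have := exp_convex_comb (x1 + s * h1) (x1 + s0 * h1) (s := -s / (s0 - s))
    (div_nonneg (by linarith) hd.le) (by rw [div_le_one hd]; linarith)
  have e : x1 + s * h1 + -s / (s0 - s) * (x1 + s0 * h1 - (x1 + s * h1)) = x1 := by
    field_simp; ring
  rw [e] at this
  have h3 := mul_le_mul_of_nonneg_left this hC
  have h4 : (s0 - s) * Real.exp x1 ≤ s0 * Real.exp (x1 + s * h1) + (-s) * Real.exp (x1 + s0 * h1) := by
    have := mul_le_mul_of_nonneg_left this hd.le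
    refine this.trans (le_of_eq ?_)
    field_simp; ring
  have h5 := mul_le_mul_of_nonneg_left h4 hC
  nlinarith

/-- A segment between points below `x₂ = C' e^{x₁}` that leaves the region below `x₂ = C e^{x₁}`
has a definite length. -/
theorem log_div_le_of_not_under {C' C : ℝ} (hC' : 0 < C') (hC : 0 < C) {x1 x2 h1 h2 r : ℝ}
    (hx : x2 ≤ C' * Real.exp x1) (hy : x2 + h2 ≤ C' * Real.exp (x1 + h1))
    (hr0 : 0 ≤ r) (hr1 : r ≤ 1) (hv : C * Real.exp (x1 + r * h1) < x2 + r * h2) :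
    Real.log (C / C') ≤ |h1| := by
  -- The abscissa of the intermediate point is within `|h1|` of both ends, so an ordinate
  -- interpolated between two points below `C' e^{x₁}` exceeds `C'` times the exponential there by a
  -- factor of at most `e^{|h1|}`.
  have e1 : Real.exp x1 ≤ Real.exp (x1 + r * h1) * Real.exp |h1| := by
    rw [← Real.exp_add, Real.exp_le_exp]
    have : -(r * h1) ≤ |h1| := by
      rcases abs_cases h1 with h | h <;> nlinarith
    linarith
  have e2 : Real.exp (x1 + h1) ≤ Real.exp (x1 + r * h1) * Real.exp |h1| := by
    rw [← Real.exp_add, Real.exp_le_exp]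
    have : (1 - r) * h1 ≤ |h1| := by
      rcases abs_cases h1 with h | h <;> nlinarith
    linarith
  have e3 : x2 + r * h2 ≤ C' * (Real.exp (x1 + r * h1) * Real.exp |h1|) := by
    have a1 := hx.trans (mul_le_mul_of_nonneg_left e1 hC'.le)
    have a2 := hy.trans (mul_le_mul_of_nonneg_left e2 hC'.le)
    nlinarith
  have e4 : C < C' * Real.exp |h1| := by
    have := Real.exp_pos (x1 + r * h1)
    by_contra! hcon
    nlinarith
  rw [Real.log_le_iff_le_exp (by positivity), div_le_iff₀ hC']
  linarith

/-- Chords of `Ω_C` have bounded length. -/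
theorem Under.abs_sub_le {C : ℝ} (hC : 1 ≤ C) {x y : ℝ × ℝ} (h : Under C x y)
    (hx : Real.exp x.1 ≤ x.2) (hy : Real.exp y.1 ≤ y.2) :
    |y.1 - x.1| ≤ 2 * Real.log (2 * C) := by
  -- The ordinate of the midpoint is at least half of that of either end, so the logarithms of the
  -- two can differ only by a bounded amount.
  have h1 := h (1 / 2) ⟨by norm_num, by norm_num⟩
  have key : ∀ p q : ℝ, Real.exp q ≤ 2 * C * Real.exp (p + 1 / 2 * (q - p)) →
      q - p ≤ 2 * Real.log (2 * C) := by
    intro p q hq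
    have : Real.exp ((q - p) / 2) ≤ 2 * C := by
      have e : Real.exp q = Real.exp ((q - p) / 2) * Real.exp (p + 1 / 2 * (q - p)) := by
        rw [← Real.exp_add]; congr 1; ring
      rw [e] at hq
      exact le_of_mul_le_mul_right hq (Real.exp_pos _)
    rw [← Real.le_log_iff_exp_le (by linarith)] at this
    linarith
  have p1 := Real.exp_pos x.1
  have p2 := Real.exp_pos y.1
  rw [abs_le]
  constructor
  · have := key y.1 x.1 (by
      rw [show y.1 + 1 / 2 * (x.1 - y.1) = x.1 + 1 / 2 * (y.1 - x.1) by ring]; linarith)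
    linarith
  · exact key x.1 y.1 (by linarith)

/-- The lower bound for the splitting ratio. -/
noncomputable def splitRatio (C' C : ℝ) : ℝ :=
  min (1 / 2) (Real.log (C / C') / (2 * Real.log (2 * C)))

theorem splitRatio_pos {C' C : ℝ} (hC' : 1 ≤ C') (hCC : C' < C) : 0 < splitRatio C' C := by
  unfold splitRatio
  refine lt_min (by norm_num) (div_pos (Real.log_pos ?_) (mul_pos two_pos (Real.log_pos ?_)))
  · rw [lt_div_iff₀ (by linarith)]; linarith
  · linarith

theorem splitRatio_le {C' C : ℝ} : splitRatio C' C ≤ 1 / 2 := min_le_left _ _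

/-- Here `P θ / θ` and `Q θ / θ` are the averages over the left part of ratio `θ`, and `h1`, `h2`
are the components of the vector from the overall average `x` to the right average. Let `θ` be the
supremum of the ratios for which the segment from `x` to the right average stays under the curve; by
`hv` it is less than `1 / 2`. Immediately beyond `θ` that segment leaves, hence is at least `log (C
/ C')` long in the first coordinate, and its extension backwards beyond `x` does not leave. Both
facts pass to the limit `θ`, so the full segment is under the curve. As a chord of the strip its
length `|h1 θ| / θ` is at most `2 log (2C)`, and this bounds `θ` from below by `splitRatio`. -/
theorem exists_split_aux {C' C : ℝ} (hC' : 1 ≤ C') (hCC : C' < C) {P Q : ℝ → ℝ} {x1 x2 : ℝ}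
    (hP : ContinuousOn P (Icc 0 1)) (hQ : ContinuousOn Q (Icc 0 1)) (hP0 : P 0 = 0)
    (hQ0 : Q 0 = 0)
    (hx : x2 ≤ C' * Real.exp x1)
    (hL : ∀ θ ∈ Ioc (0 : ℝ) 1, (P θ / θ, Q θ / θ) ∈ Omega C')
    (hR : ∀ θ ∈ Ico (0 : ℝ) 1, ((x1 - P θ) / (1 - θ), (x2 - Q θ) / (1 - θ)) ∈ Omega C')
    (hv : ∃ r ∈ Icc (0 : ℝ) 1, C * Real.exp (x1 + r * ((x1 - P (1 / 2)) / (1 - 1 / 2) - x1)) <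
      x2 + r * ((x2 - Q (1 / 2)) / (1 - 1 / 2) - x2)) :
    ∃ θ, splitRatio C' C ≤ θ ∧ θ ≤ 1 / 2 ∧
      Under C (P θ / θ, Q θ / θ) ((x1 - P θ) / (1 - θ), (x2 - Q θ) / (1 - θ)) := by
  have hCpos : 0 < C := by linarith
  set h1 : ℝ → ℝ := fun θ => (x1 - P θ) / (1 - θ) - x1 with hh1
  set h2 : ℝ → ℝ := fun θ => (x2 - Q θ) / (1 - θ) - x2 with hh2
  have hsub : Icc (0 : ℝ) (1 / 2) ⊆ Icc 0 1 := Icc_subset_Icc le_rfl (by norm_num)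
  have hne : ∀ θ ∈ Icc (0 : ℝ) (1 / 2), 1 - θ ≠ 0 := fun θ hθ => by linarith [hθ.2]
  have c1 : ContinuousOn h1 (Icc 0 (1 / 2)) :=
    ((continuousOn_const.sub (hP.mono hsub)).div (by fun_prop) hne).sub continuousOn_const
  have c2 : ContinuousOn h2 (Icc 0 (1 / 2)) :=
    ((continuousOn_const.sub (hQ.mono hsub)).div (by fun_prop) hne).sub continuousOn_const
  have cψ : ∀ s : ℝ, ContinuousOn
      (fun θ => x2 + s * h2 θ - C * Real.exp (x1 + s * h1 θ)) (Icc 0 (1 / 2)) := by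
    intro s; fun_prop
  have hclosed : ∀ s : ℝ, IsClosed (Icc (0 : ℝ) (1 / 2) ∩
      {θ | x2 + s * h2 θ ≤ C * Real.exp (x1 + s * h1 θ)}) := by
    intro s
    convert (cψ s).preimage_isClosed_of_isClosed isClosed_Icc (isClosed_Iic (a := (0 : ℝ))) using 2
    ext θ; simp
  set S : Set ℝ := {θ | θ ∈ Icc (0 : ℝ) (1 / 2) ∧
    ∀ s ∈ Icc (0 : ℝ) 1, x2 + s * h2 θ ≤ C * Real.exp (x1 + s * h1 θ)} with hS
  have hSc : IsClosed S := by
    have : S = ⋂ s ∈ Icc (0 : ℝ) 1, (Icc (0 : ℝ) (1 / 2) ∩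
        {θ | x2 + s * h2 θ ≤ C * Real.exp (x1 + s * h1 θ)}) := by
      ext θ
      simp only [hS, mem_ofPred_eq, mem_iInter, mem_inter_iff]
      exact ⟨fun h s hs => ⟨h.1, h.2 s hs⟩,
        fun h => ⟨(h 0 ⟨le_rfl, zero_le_one⟩).1, fun s hs => (h s hs).2⟩⟩
    rw [this]
    exact isClosed_biInter fun s _ => hclosed s
  have h10 : h1 0 = 0 := by simp [hh1, hP0]
  have h20 : h2 0 = 0 := by simp [hh2, hQ0]
  have hxC : x2 ≤ C * Real.exp x1 := hx.trans (by
    apply mul_le_mul_of_nonneg_right hCC.le (Real.exp_pos _).le)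
  have h0S : (0 : ℝ) ∈ S := by
    refine ⟨⟨le_rfl, by norm_num⟩, fun s _ => ?_⟩
    rw [h10, h20]; simpa using hxC
  have hbdd : BddAbove S := ⟨1 / 2, fun θ hθ => hθ.1.2⟩
  have hmem : sSup S ∈ S := hSc.csSup_mem ⟨0, h0S⟩ hbdd
  set θ := sSup S with hθ
  have hlt : θ < 1 / 2 := by
    refine lt_of_le_of_ne hmem.1.2 fun h => ?_
    obtain ⟨r, hr, hr'⟩ := hv
    have := hmem.2 r hr
    rw [h] at this
    simp only [hh1, hh2] at this
    linarith
  -- Closedness of `S` gives the good half of the segment at `θ` itself; the bad ratios above `θ`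
  -- give the length and the other half.
  have hstep : ∀ η ∈ Ioc θ (1 / 2), Real.log (C / C') ≤ |h1 η| ∧
      ∀ s ≤ 0, x2 + s * h2 η ≤ C * Real.exp (x1 + s * h1 η) := by
    intro η hη
    have hη0 : η ∈ Icc (0 : ℝ) (1 / 2) := ⟨hmem.1.1.trans hη.1.le, hη.2⟩
    have hnot : η ∉ S := fun h => absurd (le_csSup hbdd h) (not_le.2 hη.1)
    simp only [hS, mem_ofPred_eq, not_and, not_forall, not_le] at hnot
    obtain ⟨r, hr, hvr⟩ := hnot hη0
    have hRη := (hR η ⟨hη0.1, by linarith [hη0.2]⟩).2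
    refine ⟨log_div_le_of_not_under (by linarith) hCpos hx ?_ hr.1 hr.2 hvr, fun s hs =>
      under_extrapolate hCpos.le hxC hr.1 hvr hs⟩
    simpa [hh1, hh2] using hRη
  have hcl : θ ∈ closure (Ioc θ (1 / 2)) := by
    rw [closure_Ioc hlt.ne]; exact ⟨le_rfl, hlt.le⟩
  have hIoc : Ioc θ (1 / 2) ⊆ Icc (0 : ℝ) (1 / 2) := fun η hη =>
    ⟨hmem.1.1.trans hη.1.le, hη.2⟩
  have hlim1 : Real.log (C / C') ≤ |h1 θ| := by
    have hc : IsClosed (Icc (0 : ℝ) (1 / 2) ∩ (fun η => |h1 η|) ⁻¹' (Ici (Real.log (C / C')))) :=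
      c1.abs.preimage_isClosed_of_isClosed isClosed_Icc isClosed_Ici
    have hs : Ioc θ (1 / 2) ⊆ Icc (0 : ℝ) (1 / 2) ∩
        (fun η => |h1 η|) ⁻¹' (Ici (Real.log (C / C'))) := fun η hη => ⟨hIoc hη, (hstep η hη).1⟩
    exact (closure_minimal hs hc hcl).2
  have hlim2 : ∀ s ≤ 0, x2 + s * h2 θ ≤ C * Real.exp (x1 + s * h1 θ) := by
    intro s hs
    have hsub : Ioc θ (1 / 2) ⊆ Icc (0 : ℝ) (1 / 2) ∩
        {θ | x2 + s * h2 θ ≤ C * Real.exp (x1 + s * h1 θ)} :=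
      fun η hη => ⟨hIoc hη, (hstep η hη).2 s hs⟩
    exact (closure_minimal hsub (hclosed s) hcl).2
  have hlogpos : 0 < Real.log (C / C') := Real.log_pos (by
    rw [lt_div_iff₀ (by linarith)]; linarith)
  have hθpos : 0 < θ := by
    refine lt_of_le_of_ne hmem.1.1 fun h => ?_
    rw [← h, h10, abs_zero] at hlim1
    linarith
  have hθ1 : (1 : ℝ) - θ ≠ 0 := by linarith
  have hU : Under C (P θ / θ, Q θ / θ) ((x1 - P θ) / (1 - θ), (x2 - Q θ) / (1 - θ)) := by
    intro r hr
    -- The segment is written as `x + s h`: negative `s` runs from the left average to `x`, and `s ∈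
    -- [0, 1]` from `x` to the right average.
    set s : ℝ := (r - (1 - θ)) / θ with hs
    have e1 : P θ / θ + r * ((x1 - P θ) / (1 - θ) - P θ / θ) = x1 + s * h1 θ := by
      simp only [hs, hh1]; field_simp; ring
    have e2 : Q θ / θ + r * ((x2 - Q θ) / (1 - θ) - Q θ / θ) = x2 + s * h2 θ := by
      simp only [hs, hh2]; field_simp; ring
    simp only
    rw [e1, e2]
    rcases le_total s 0 with h | h
    · exact hlim2 s h
    · exact hmem.2 s ⟨h, by rw [hs, div_le_one hθpos]; linarith [hr.2]⟩
  refine ⟨θ, ?_, hlt.le, hU⟩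
  -- The overall average divides the chord in the ratio `θ`, so the chord has length `|h1 θ| / θ`.
  have hlen := hU.abs_sub_le (by linarith) (hL θ ⟨hθpos, by linarith⟩).1
    (hR θ ⟨hθpos.le, by linarith⟩).1
  have e : (x1 - P θ) / (1 - θ) - P θ / θ = h1 θ / θ := by
    simp only [hh1]; field_simp; ring
  simp only at hlen
  rw [e, abs_div, abs_of_pos hθpos, div_le_iff₀ hθpos] at hlen
  refine (min_le_right _ _).trans ?_
  rw [div_le_iff₀ (mul_pos two_pos (Real.log_pos (by linarith)))]
  linarith

/-- Every interval splits in a definite ratio so that the segment between the pairs of averages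
over the two parts lies below `x₂ = C e^{x₁}`. -/
theorem ExpClass.exists_split {C' C a b : ℝ} (hC' : 1 ≤ C') (hCC : C' < C) {φ : ℝ → ℝ}
    (hφ : ExpClass C' φ a b) {c d : ℝ} (hc : a ≤ c) (hcd : c < d) (hd : d ≤ b) :
    ∃ m, c + splitRatio C' C * (d - c) ≤ m ∧ m ≤ d - splitRatio C' C * (d - c) ∧
      Under C (meanPoint φ c m) (meanPoint φ m d) := by
  have hδ := splitRatio_pos hC' hCC
  have hδ2 : splitRatio C' C ≤ 1 / 2 := splitRatio_le
  set δ := splitRatio C' C with hδdef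
  have hl : 0 < d - c := by linarith
  have hlne : d - c ≠ 0 := hl.ne'
  set e : ℝ → ℝ := fun t => Real.exp (φ t) with he
  have hiφ := intervalIntegrable_sub hφ.int hc hcd.le hd
  have hie : IntervalIntegrable e volume c d := intervalIntegrable_sub hφ.int_exp hc hcd.le hd
  set F : (ℝ → ℝ) → ℝ → ℝ := fun g θ => (∫ t in c..(c + θ * (d - c)), g t) / (d - c) with hF
  have hrange : ∀ θ ∈ Icc (0 : ℝ) 1, c ≤ c + θ * (d - c) ∧ c + θ * (d - c) ≤ d := fun θ hθ =>
    ⟨by nlinarith [hθ.1], by nlinarith [hθ.2]⟩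
  have hcont : ∀ g : ℝ → ℝ, IntervalIntegrable g volume c d → ContinuousOn (F g) (Icc 0 1) := by
    intro g hg
    have hg' : IntegrableOn g (uIcc c d) := by
      rw [uIcc_of_le hcd.le]
      exact (intervalIntegrable_iff_integrableOn_Icc_of_le hcd.le).1 hg
    have := intervalIntegral.continuousOn_primitive_interval hg'
    rw [uIcc_of_le hcd.le] at this
    refine ContinuousOn.div_const (this.comp (by fun_prop) fun θ hθ => hrange θ hθ) _
  have hadd : ∀ g : ℝ → ℝ, IntervalIntegrable g volume c d → ∀ θ ∈ Icc (0 : ℝ) 1,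
      (∫ t in c..d, g t) / (d - c) - F g θ = (∫ t in (c + θ * (d - c))..d, g t) / (d - c) := by
    intro g hg θ hθ
    obtain ⟨r1, r2⟩ := hrange θ hθ
    rw [← intervalIntegral.integral_add_adjacent_intervals
      (intervalIntegrable_sub hg le_rfl r1 r2) (intervalIntegrable_sub hg r1 r2 le_rfl)]
    simp only [hF]; ring
  have hF0 : ∀ g, F g 0 = 0 := by intro g; simp [hF]
  have hF1 : ∀ g, F g 1 = (∫ t in c..d, g t) / (d - c) := by intro g; simp [hF]
  have hLeq : ∀ θ ∈ Ioc (0 : ℝ) 1, (F φ θ / θ, F e θ / θ) = meanPoint φ c (c + θ * (d - c)) := by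
    intro θ hθ
    have := hθ.1.ne'
    simp only [hF, meanPoint]
    ext <;> simp only [add_sub_cancel_left, he] <;> field_simp
  have hReq : ∀ θ ∈ Ico (0 : ℝ) 1, ((F φ 1 - F φ θ) / (1 - θ), (F e 1 - F e θ) / (1 - θ)) =
      meanPoint φ (c + θ * (d - c)) d := by
    intro θ hθ
    have h1 : 1 - θ ≠ 0 := by linarith [hθ.2]
    have h2 : d - (c + θ * (d - c)) = (1 - θ) * (d - c) := by ring
    rw [hF1, hF1, hadd φ hiφ θ ⟨hθ.1, hθ.2.le⟩, hadd e hie θ ⟨hθ.1, hθ.2.le⟩]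
    simp only [meanPoint, h2]
    ext <;> simp only [he] <;> field_simp
  have hL : ∀ θ ∈ Ioc (0 : ℝ) 1, (F φ θ / θ, F e θ / θ) ∈ Omega C' := by
    intro θ hθ
    rw [hLeq θ hθ]
    exact hφ.mem_Omega hc (by nlinarith [hθ.1]) ((hrange θ ⟨hθ.1.le, hθ.2⟩).2.trans hd)
  have hR : ∀ θ ∈ Ico (0 : ℝ) 1,
      ((F φ 1 - F φ θ) / (1 - θ), (F e 1 - F e θ) / (1 - θ)) ∈ Omega C' := by
    intro θ hθ
    rw [hReq θ hθ]
    exact hφ.mem_Omega (hc.trans (hrange θ ⟨hθ.1, hθ.2.le⟩).1) (by nlinarith [hθ.2]) hd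
  have hx : F e 1 ≤ C' * Real.exp (F φ 1) := by
    have := (hL 1 ⟨one_pos, le_rfl⟩).2
    simpa using this
  suffices h : ∃ θ, δ ≤ θ ∧ θ ≤ 1 - δ ∧ Under C (F φ θ / θ, F e θ / θ)
      ((F φ 1 - F φ θ) / (1 - θ), (F e 1 - F e θ) / (1 - θ)) by
    obtain ⟨θ, h1, h2, h3⟩ := h
    rw [hLeq θ ⟨by linarith, by linarith⟩, hReq θ ⟨by linarith, by linarith⟩] at h3
    exact ⟨c + θ * (d - c), by nlinarith, by nlinarith, h3⟩
  by_cases hmid : Under C (F φ (1 / 2) / (1 / 2), F e (1 / 2) / (1 / 2))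
      ((F φ 1 - F φ (1 / 2)) / (1 - 1 / 2), (F e 1 - F e (1 / 2)) / (1 - 1 / 2))
  · exact ⟨1 / 2, hδ2, by linarith, hmid⟩
  unfold Under at hmid
  push Not at hmid
  obtain ⟨r, hr, hvr⟩ := hmid
  simp only at hvr
  -- At equal division `x` is the midpoint of the segment. If the bad point lies on the right half,
  -- its parameter on that half is `2 * r - 1`; otherwise the interval is reflected.
  rcases le_total (1 / 2) r with hr2 | hr2
  · obtain ⟨θ, h1, h2, h3⟩ := exists_split_aux hC' hCC (hcont φ hiφ) (hcont e hie) (hF0 φ) (hF0 e)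
      hx hL hR ⟨2 * r - 1, ⟨by linarith, by linarith [hr.2]⟩, by
        have e1 : ∀ A B : ℝ, A + (2 * r - 1) * ((A - B) / (1 - 1 / 2) - A) =
          B / (1 / 2) + r * ((A - B) / (1 - 1 / 2) - B / (1 / 2)) := by intro A B; ring
        rw [e1, e1]; exact hvr⟩
    exact ⟨θ, h1, by linarith, h3⟩
  · have hmaps : MapsTo (fun θ : ℝ => 1 - θ) (Icc 0 1) (Icc 0 1) := fun θ hθ =>
      ⟨by linarith [hθ.2], by linarith [hθ.1]⟩
    obtain ⟨θ, h1, h2, h3⟩ := exists_split_aux hC' hCC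
      (P := fun θ => F φ 1 - F φ (1 - θ)) (Q := fun θ => F e 1 - F e (1 - θ))
      (x1 := F φ 1) (x2 := F e 1)
      (continuousOn_const.sub ((hcont φ hiφ).comp (by fun_prop) hmaps))
      (continuousOn_const.sub ((hcont e hie).comp (by fun_prop) hmaps))
      (by simp) (by simp) hx
      (fun θ hθ => by
        have := hR (1 - θ) ⟨by linarith [hθ.2], by linarith [hθ.1]⟩
        simpa using this)
      (fun θ hθ => by
        have := hL (1 - θ) ⟨by linarith [hθ.2], by linarith [hθ.1]⟩
        simpa using this)
      ⟨1 - 2 * r, ⟨by linarith, by linarith [hr.1]⟩, by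
        have e1 : ∀ A B : ℝ, A + (1 - 2 * r) * ((A - (A - B)) / (1 - 1 / 2) - A) =
          B / (1 / 2) + r * ((A - B) / (1 - 1 / 2) - B / (1 / 2)) := by intro A B; ring
        rw [show (1 : ℝ) - 1 / 2 = 1 / 2 by norm_num] at e1 hvr ⊢
        rw [e1, e1]; exact hvr⟩
    refine ⟨1 - θ, by linarith, by linarith, ?_⟩
    have := h3.symm
    simpa using this

/-! ### Bellman induction along a tree of intervals. -/

/-- The `n`-th generation interval, containing `t`, of the tree of intervals obtained from `(c, d)`
by splitting according to `σ`. -/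
noncomputable def bisect (σ : ℝ → ℝ → ℝ) : ℕ → ℝ → ℝ → ℝ → ℝ × ℝ
  | 0, c, d, _ => (c, d)
  | n + 1, c, d, t => if t ≤ σ c d then bisect σ n c (σ c d) t else bisect σ n (σ c d) d t

theorem measurable_bisect (σ : ℝ → ℝ → ℝ) (G : ℝ × ℝ → ℝ≥0∞) (n : ℕ) :
    ∀ c d, Measurable fun t => G (bisect σ n c d t) := by
  induction n with
  | zero => intro c d; simp only [bisect]; exact measurable_const
  | succ n ih =>
    intro c d
    simp only [bisect, apply_ite G]
    exact Measurable.ite measurableSet_Iic (ih _ _) (ih _ _)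

/-- `σ` splits subintervals of `(a, b)` with ratio at least `δ`. -/
def IsSplitting (σ : ℝ → ℝ → ℝ) (δ a b : ℝ) : Prop :=
  ∀ c d, a ≤ c → c < d → d ≤ b → c + δ * (d - c) ≤ σ c d ∧ σ c d ≤ d - δ * (d - c)

theorem bisect_spec {σ : ℝ → ℝ → ℝ} {δ a b : ℝ} (hδ : 0 < δ) (hσ : IsSplitting σ δ a b) (n : ℕ) :
    ∀ c d t, a ≤ c → c < d → d ≤ b → t ∈ Ioc c d →
      t ∈ Ioc (bisect σ n c d t).1 (bisect σ n c d t).2 ∧ a ≤ (bisect σ n c d t).1 ∧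
      (bisect σ n c d t).2 ≤ b ∧
      (bisect σ n c d t).2 - (bisect σ n c d t).1 ≤ (1 - δ) ^ n * (d - c) := by
  induction n with
  | zero => intro c d t h1 h2 h3 h4; simp [bisect, h1, h3, h4.1, h4.2]
  | succ n ih =>
    intro c d t h1 h2 h3 h4
    obtain ⟨s1, s2⟩ := hσ c d h1 h2 h3
    have hp : 0 < δ * (d - c) := mul_pos hδ (by linarith)
    have hδ1 : 0 ≤ 1 - δ := by
      by_contra! h
      nlinarith
    simp only [bisect]
    split_ifs with h
    · obtain ⟨q1, q2, q3, q4⟩ := ih c (σ c d) t h1 (by linarith) (by linarith) ⟨h4.1, h⟩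
      refine ⟨q1, q2, q3, q4.trans ?_⟩
      rw [pow_succ, mul_assoc]
      exact mul_le_mul_of_nonneg_left (by linarith) (by positivity)
    · obtain ⟨q1, q2, q3, q4⟩ := ih (σ c d) d t (by linarith) (by linarith) h3 ⟨not_le.1 h, h4.2⟩
      refine ⟨q1, q2, q3, q4.trans ?_⟩
      rw [pow_succ, mul_assoc]
      exact mul_le_mul_of_nonneg_left (by linarith) (by positivity)

/-- The sum of `V` over the intervals of a generation never exceeds `V` of the root, and `G`
weighted by length is bounded by `V` on each of them. The bound does not depend on the generation.
-/
theorem lintegral_bisect_le {σ : ℝ → ℝ → ℝ} {δ a b : ℝ} (hδ : 0 < δ) (hσ : IsSplitting σ δ a b)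
    {G : ℝ × ℝ → ℝ≥0∞} {V : ℝ → ℝ → ℝ}
    (h0 : ∀ c d, a ≤ c → c < d → d ≤ b → 0 ≤ V c d)
    (hG : ∀ c d, a ≤ c → c < d → d ≤ b →
      ENNReal.ofReal (d - c) * G (c, d) ≤ ENNReal.ofReal (V c d))
    (hV : ∀ c d, a ≤ c → c < d → d ≤ b → V c (σ c d) + V (σ c d) d ≤ V c d) (n : ℕ) :
    ∀ c d, a ≤ c → c < d → d ≤ b →
      ∫⁻ t in Ioc c d, G (bisect σ n c d t) ≤ ENNReal.ofReal (V c d) := by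
  induction n with
  | zero =>
    intro c d h1 h2 h3
    simp only [bisect, lintegral_const, Measure.restrict_apply MeasurableSet.univ, univ_inter,
      Real.volume_Ioc]
    rw [mul_comm]; exact hG c d h1 h2 h3
  | succ n ih =>
    intro c d h1 h2 h3
    obtain ⟨s1, s2⟩ := hσ c d h1 h2 h3
    have hp : 0 < δ * (d - c) := mul_pos hδ (by linarith)
    have a1 : c < σ c d := by linarith
    have a2 : σ c d < d := by linarith
    rw [← Ioc_union_Ioc_eq_Ioc a1.le a2.le, lintegral_union measurableSet_Ioc
      (Ioc_disjoint_Ioc_of_le le_rfl)]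
    have e1 : ∫⁻ t in Ioc c (σ c d), G (bisect σ (n + 1) c d t) =
        ∫⁻ t in Ioc c (σ c d), G (bisect σ n c (σ c d) t) := by
      apply setLIntegral_congr_fun measurableSet_Ioc
      intro t ht
      simp only [bisect, if_pos ht.2]
    have e2 : ∫⁻ t in Ioc (σ c d) d, G (bisect σ (n + 1) c d t) =
        ∫⁻ t in Ioc (σ c d) d, G (bisect σ n (σ c d) d t) := by
      apply setLIntegral_congr_fun measurableSet_Ioc
      intro t ht
      simp only [bisect, if_neg (not_le.2 ht.1)]
    rw [e1, e2]
    calc _ ≤ ENNReal.ofReal (V c (σ c d)) + ENNReal.ofReal (V (σ c d) d) :=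
          add_le_add (ih _ _ h1 a1 (by linarith)) (ih _ _ (by linarith) a2 h3)
      _ = ENNReal.ofReal (V c (σ c d) + V (σ c d) d) :=
          (ENNReal.ofReal_add (h0 _ _ h1 a1 (by linarith)) (h0 _ _ (by linarith) a2 h3)).symm
      _ ≤ _ := ENNReal.ofReal_le_ofReal (hV c d h1 h2 h3)

/-- Lebesgue differentiation along shrinking intervals. -/
theorem ae_tendsto_mean {g : ℝ → ℝ} {a b : ℝ} (hab : a < b) (hg : IntervalIntegrable g volume a b) :
    ∀ᵐ t ∂(volume.restrict (Ioc a b)), ∀ I : ℕ → ℝ × ℝ,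
      (∀ n, t ∈ Ioc (I n).1 (I n).2) → (∀ n, a ≤ (I n).1 ∧ (I n).2 ≤ b) →
      Tendsto (fun n => (I n).2 - (I n).1) atTop (𝓝 0) →
      Tendsto (fun n => (∫ s in (I n).1..(I n).2, g s) / ((I n).2 - (I n).1)) atTop (𝓝 (g t)) := by
  have hgI : Integrable ((Ioc a b).indicator g) :=
    (integrable_indicator_iff measurableSet_Ioc).2
      ((intervalIntegrable_iff_integrableOn_Ioc_of_le hab.le).1 hg)
  have h := IsUnifLocDoublingMeasure.ae_tendsto_average volume hgI.locallyIntegrable 1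
  rw [ae_restrict_iff' measurableSet_Ioc]
  filter_upwards [h] with t ht htab I hI hIab hlen
  have hpos : ∀ n, 0 < (I n).2 - (I n).1 := fun n => by linarith [(hI n).1, (hI n).2]
  have hball : ∀ n, Metric.closedBall (((I n).1 + (I n).2) / 2) (((I n).2 - (I n).1) / 2) =
      Icc (I n).1 (I n).2 := by
    intro n; rw [Real.closedBall_eq_Icc]; congr 1 <;> ring
  have := ht (l := atTop) (fun n => ((I n).1 + (I n).2) / 2) (fun n => ((I n).2 - (I n).1) / 2)
    (by
      rw [tendsto_nhdsWithin_iff]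
      refine ⟨by simpa using hlen.div_const 2, Eventually.of_forall fun n => ?_⟩
      exact half_pos (hpos n))
    (Eventually.of_forall fun n => by
      rw [one_mul, hball]; exact Ioc_subset_Icc_self (hI n))
  rw [indicator_of_mem htab] at this
  refine this.congr fun n => ?_
  rw [hball, setAverage_eq, integral_Icc_eq_integral_Ioc, smul_eq_mul, measureReal_def,
    Real.volume_Icc, ENNReal.toReal_ofReal (hpos n).le,
    intervalIntegral.integral_of_le (by linarith [hpos n]), div_eq_inv_mul]
  congr 1
  apply setIntegral_congr_fun measurableSet_Ioc
  intro s hs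
  exact indicator_of_mem (Ioc_subset_Ioc (hIab n).1 (hIab n).2 hs) g

/-- `M` admits at each point of `Ω_C` an affine majorant that is exact at the point and valid at
all points of `Ω_C` visible from it. -/
def HasVisibleMajorants (C : ℝ) (M : ℝ × ℝ → ℝ) : Prop :=
  ∀ x ∈ Omega C, ∃ p q : ℝ, ∀ y ∈ Omega C, Under C x y →
    M y ≤ M x + p * (y.1 - x.1) + q * (y.2 - x.2)

/-- `f` bounds from below the lower limits of `M` at the points of the curve `x₂ = e^{x₁}`. -/
def BoundaryMinorant (C : ℝ) (M : ℝ × ℝ → ℝ) (f : ℝ → ℝ) : Prop :=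
  ∀ t : ℝ, ∀ ε > 0, ∀ᶠ x in 𝓝[Omega C] (t, Real.exp t), f t - ε ≤ M x

theorem Omega_mono {C C' : ℝ} (h : C ≤ C') : Omega C ⊆ Omega C' := fun _ hx =>
  ⟨hx.1, hx.2.trans (mul_le_mul_of_nonneg_right h (Real.exp_pos _).le)⟩

theorem Under.left {C : ℝ} {x y : ℝ × ℝ} (h : Under C x y) {θ : ℝ} (h0 : 0 ≤ θ) (h1 : θ ≤ 1) :
    Under C (x.1 + θ * (y.1 - x.1), x.2 + θ * (y.2 - x.2)) x := by
  intro r hr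
  have := h (θ * (1 - r)) ⟨mul_nonneg h0 (by linarith [hr.2]), by
    have : θ * (1 - r) ≤ 1 * 1 := mul_le_mul h1 (by linarith [hr.1]) (by linarith [hr.2]) zero_le_one
    linarith⟩
  simp only
  rw [show x.1 + θ * (y.1 - x.1) + r * (x.1 - (x.1 + θ * (y.1 - x.1))) =
      x.1 + θ * (1 - r) * (y.1 - x.1) by ring]
  linarith

theorem Under.right {C : ℝ} {x y : ℝ × ℝ} (h : Under C x y) {θ : ℝ} (h0 : 0 ≤ θ) (h1 : θ ≤ 1) :
    Under C (x.1 + θ * (y.1 - x.1), x.2 + θ * (y.2 - x.2)) y := by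
  have := h.symm.left (θ := 1 - θ) (by linarith) (by linarith)
  convert this using 2 <;> ring

/-- Concavity along chords of `Ω_C`. -/
theorem HasVisibleMajorants.concave {C : ℝ} {M : ℝ × ℝ → ℝ} (hM : HasVisibleMajorants C M)
    {x y : ℝ × ℝ} (hx : x ∈ Omega C) (hy : y ∈ Omega C) (h : Under C x y) {θ : ℝ} (h0 : 0 ≤ θ)
    (h1 : θ ≤ 1) :
    (1 - θ) * M x + θ * M y ≤ M (x.1 + θ * (y.1 - x.1), x.2 + θ * (y.2 - x.2)) := by
  set z : ℝ × ℝ := (x.1 + θ * (y.1 - x.1), x.2 + θ * (y.2 - x.2)) with hz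
  have hzO : z ∈ Omega C := by
    refine ⟨?_, h θ ⟨h0, h1⟩⟩
    have := exp_convex_comb x.1 y.1 h0 h1
    simp only [hz]
    nlinarith [hx.1, hy.1]
  obtain ⟨p, q, hpq⟩ := hM z hzO
  have a1 := hpq x hx (h.left h0 h1)
  have a2 := hpq y hy (h.right h0 h1)
  have a3 := mul_le_mul_of_nonneg_left a1 (by linarith : 0 ≤ 1 - θ)
  have a4 := mul_le_mul_of_nonneg_left a2 h0
  simp only [hz] at a3 a4 ⊢
  linarith

/-- This is the Bellman induction for a constant with room to spare: the splits of
`ExpClass.exists_split` keep every chord of averages inside the larger strip, where `M` is concave.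
Since the splitting ratio is bounded below, the intervals shrink, and Fatou's lemma with Lebesgue
differentiation recovers `f ∘ φ`; only lower limits of `M` at the lower curve are needed. -/
theorem lintegral_le_of_majorants {C' C a b : ℝ} (hC' : 1 ≤ C') (hCC : C' < C) (hab : a < b)
    {M : ℝ × ℝ → ℝ} {f : ℝ → ℝ} {κ : ℝ} (hκ : 0 ≤ κ) (hM : HasVisibleMajorants C M)
    (hf : BoundaryMinorant C M f) (hgrowth : ∀ x ∈ Omega C, 0 ≤ M x + κ * (1 + x.1 ^ 2))
    {φ : ℝ → ℝ} (hφ : ExpClass C' φ a b)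
    (hsq : IntervalIntegrable (fun t => κ * (1 + φ t ^ 2)) volume a b) :
    0 ≤ (b - a) * M (meanPoint φ a b) + ∫ t in a..b, κ * (1 + φ t ^ 2) ∧
    ∫⁻ t in Ioc a b, ENNReal.ofReal (f (φ t) + κ * (1 + φ t ^ 2)) ≤
      ENNReal.ofReal ((b - a) * M (meanPoint φ a b) + ∫ t in a..b, κ * (1 + φ t ^ 2)) := by
  set δ := splitRatio C' C with hδdef
  have hδ : 0 < δ := splitRatio_pos hC' hCC
  have hδ2 : δ ≤ 1 / 2 := splitRatio_le
  have hsplit : ∀ c d, ∃ m, a ≤ c → c < d → d ≤ b → c + δ * (d - c) ≤ m ∧ m ≤ d - δ * (d - c) ∧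
      Under C (meanPoint φ c m) (meanPoint φ m d) := by
    intro c d
    by_cases h : a ≤ c ∧ c < d ∧ d ≤ b
    · obtain ⟨m, hm⟩ := hφ.exists_split hC' hCC h.1 h.2.1 h.2.2
      exact ⟨m, fun _ _ _ => hm⟩
    · exact ⟨0, fun h1 h2 h3 => absurd ⟨h1, h2, h3⟩ h⟩
  choose σ hσ using hsplit
  have hσs : IsSplitting σ δ a b := fun c d h1 h2 h3 =>
    ⟨(hσ c d h1 h2 h3).1, (hσ c d h1 h2 h3).2.1⟩
  have hO : ∀ c d, a ≤ c → c < d → d ≤ b → meanPoint φ c d ∈ Omega C := fun c d h1 h2 h3 =>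
    Omega_mono hCC.le (hφ.mem_Omega h1 h2 h3)
  set k : ℝ → ℝ := fun t => κ * (1 + φ t ^ 2) with hk
  set N : ℝ × ℝ → ℝ := fun x => M x + κ * (1 + x.1 ^ 2) with hN
  -- The correction is integrated rather than evaluated at the averages. It is then additive in the
  -- interval, so concavity of `M` alone gives superadditivity, while Jensen's inequality for
  -- squares (`hkint`) keeps `V` above the length times `N`, which is nonnegative.
  set V : ℝ → ℝ → ℝ := fun c d => (d - c) * M (meanPoint φ c d) + ∫ t in c..d, k t with hV
  set G : ℝ × ℝ → ℝ≥0∞ := fun I => ENNReal.ofReal (N (meanPoint φ I.1 I.2)) with hG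
  have hkint : ∀ c d, a ≤ c → c < d → d ≤ b →
      (d - c) * (κ * (1 + (meanPoint φ c d).1 ^ 2)) ≤ ∫ t in c..d, k t := by
    intro c d h1 h2 h3
    set m := (meanPoint φ c d).1 with hm
    have hm' : ∫ t in c..d, φ t = m * (d - c) := by
      have : d - c ≠ 0 := by linarith
      rw [hm, meanPoint]; field_simp
    have hi := intervalIntegrable_sub hφ.int h1 h2.le h3
    have := intervalIntegral.integral_mono_on (f := fun t => κ * (1 - m ^ 2 + 2 * m * φ t)) (g := k)
      h2.le ((intervalIntegrable_const.add (hi.const_mul _)).const_mul _)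
      (intervalIntegrable_sub hsq h1 h2.le h3)
      (fun t _ => mul_le_mul_of_nonneg_left (by nlinarith [sq_nonneg (φ t - m)]) hκ)
    rw [intervalIntegral.integral_const_mul,
      intervalIntegral.integral_add intervalIntegrable_const (hi.const_mul _),
      intervalIntegral.integral_const_mul, intervalIntegral.integral_const, hm', smul_eq_mul] at this
    refine le_trans (le_of_eq ?_) this
    ring
  have hN0 : ∀ c d, a ≤ c → c < d → d ≤ b → (d - c) * N (meanPoint φ c d) ≤ V c d := by
    intro c d h1 h2 h3
    have := hkint c d h1 h2 h3
    simp only [hN, hV]; linarith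
  have hNnn : ∀ c d, a ≤ c → c < d → d ≤ b → 0 ≤ N (meanPoint φ c d) := fun c d h1 h2 h3 =>
    hgrowth _ (hO c d h1 h2 h3)
  have hVnn : ∀ c d, a ≤ c → c < d → d ≤ b → 0 ≤ V c d := fun c d h1 h2 h3 =>
    (mul_nonneg (by linarith) (hNnn c d h1 h2 h3)).trans (hN0 c d h1 h2 h3)
  have hbound := lintegral_bisect_le (V := V) (G := G) hδ hσs hVnn
    (fun c d h1 h2 h3 => by
      simp only [hG]
      rw [← ENNReal.ofReal_mul (by linarith)]
      exact ENNReal.ofReal_le_ofReal (hN0 c d h1 h2 h3))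
    (fun c d h1 h2 h3 => by
      obtain ⟨s1, s2, s3⟩ := hσ c d h1 h2 h3
      have hp : 0 < δ * (d - c) := mul_pos hδ (by linarith)
      set m := σ c d
      have a1 : c < m := by linarith
      have a2 : m < d := by linarith
      have hd : 0 < d - c := by linarith
      have hdne := hd.ne'
      have hmc : m - c ≠ 0 := by linarith
      have hdm : d - m ≠ 0 := by linarith
      have hθ1 : (d - m) / (d - c) ≤ 1 := by rw [div_le_one hd]; linarith
      have := hM.concave (hO c m h1 a1 (by linarith)) (hO m d (by linarith) a2 h3) s3
        (θ := (d - m) / (d - c)) (div_nonneg (by linarith) hd.le) hθ1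
      have hadd : ∀ g : ℝ → ℝ, IntervalIntegrable g volume a b →
          (∫ t in c..m, g t) + (∫ t in m..d, g t) = ∫ t in c..d, g t := fun g hg =>
        intervalIntegral.integral_add_adjacent_intervals
          (intervalIntegrable_sub hg h1 a1.le (by linarith))
          (intervalIntegrable_sub hg (by linarith) a2.le h3)
      have hcomb : ∀ A B : ℝ, A / (m - c) + (d - m) / (d - c) * (B / (d - m) - A / (m - c)) =
          (A + B) / (d - c) := by
        intro A B; field_simp; ring
      have e : ((meanPoint φ c m).1 + (d - m) / (d - c) * ((meanPoint φ m d).1 -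
          (meanPoint φ c m).1), (meanPoint φ c m).2 + (d - m) / (d - c) *
          ((meanPoint φ m d).2 - (meanPoint φ c m).2)) = meanPoint φ c d := by
        simp only [meanPoint, hcomb]
        rw [hadd _ hφ.int, hadd _ hφ.int_exp]
      rw [e] at this
      have h4 := mul_le_mul_of_nonneg_left this hd.le
      have h5 : (d - c) * ((1 - (d - m) / (d - c)) * M (meanPoint φ c m) +
          (d - m) / (d - c) * M (meanPoint φ m d)) =
          (m - c) * M (meanPoint φ c m) + (d - m) * M (meanPoint φ m d) := by
        field_simp; ring
      simp only [hV]
      rw [← hadd _ hsq]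
      linarith)
  have hpt : ∀ᵐ t ∂(volume.restrict (Ioc a b)), ENNReal.ofReal (f (φ t) + k t) ≤
      liminf (fun n => G (bisect σ n a b t)) atTop := by
    filter_upwards [ae_tendsto_mean hab hφ.int, ae_tendsto_mean hab hφ.int_exp,
      ae_restrict_mem measurableSet_Ioc] with t h1 h2 htab
    set I : ℕ → ℝ × ℝ := fun n => bisect σ n a b t with hI
    have hspec := fun n => bisect_spec hδ hσs n a b t le_rfl hab le_rfl htab
    have hlen : Tendsto (fun n => (I n).2 - (I n).1) atTop (𝓝 0) := by
      have hz : Tendsto (fun n : ℕ => (1 - δ) ^ n * (b - a)) atTop (𝓝 0) := by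
        simpa using (tendsto_pow_atTop_nhds_zero_of_lt_one (by linarith : 0 ≤ 1 - δ)
          (by linarith)).mul_const (b - a)
      refine squeeze_zero (fun n => ?_) (fun n => (hspec n).2.2.2) hz
      linarith [(hspec n).1.1, (hspec n).1.2]
    have l1 := h1 I (fun n => (hspec n).1) (fun n => ⟨(hspec n).2.1, (hspec n).2.2.1⟩) hlen
    have l2 := h2 I (fun n => (hspec n).1) (fun n => ⟨(hspec n).2.1, (hspec n).2.2.1⟩) hlen
    have l3 : Tendsto (fun n => meanPoint φ (I n).1 (I n).2) atTop
        (𝓝[Omega C] (φ t, Real.exp (φ t))) := by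
      rw [tendsto_nhdsWithin_iff]
      refine ⟨l1.prodMk_nhds l2, Eventually.of_forall fun n => hO _ _ (hspec n).2.1
        (lt_of_lt_of_le (hspec n).1.1 (hspec n).1.2) (hspec n).2.2.1⟩
    have l4 : Tendsto (fun n => κ * (1 + (meanPoint φ (I n).1 (I n).2).1 ^ 2)) atTop
        (𝓝 (k t)) := ((l1.pow 2).const_add 1).const_mul κ
    have hε : ∀ ε > 0, ENNReal.ofReal (f (φ t) + k t - ε) ≤
        liminf (fun n => G (I n)) atTop := by
      intro ε hε
      refine le_liminf_of_le (by isBoundedDefault) ?_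
      filter_upwards [l3.eventually (hf (φ t) (ε / 2) (by linarith)),
        l4.eventually (lt_mem_nhds (show k t - ε / 2 < k t by linarith))] with n n1 n2
      apply ENNReal.ofReal_le_ofReal
      simp only [hN]
      linarith
    have hlim : Tendsto (fun ε : ℝ => ENNReal.ofReal (f (φ t) + k t - ε)) (𝓝[>] 0)
        (𝓝 (ENNReal.ofReal (f (φ t) + k t - 0))) :=
      ((ENNReal.continuous_ofReal.comp (by fun_prop)).tendsto 0).mono_left nhdsWithin_le_nhds
    rw [sub_zero] at hlim
    exact le_of_tendsto hlim (eventually_mem_nhdsWithin.mono fun ε h => hε ε h)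
  refine ⟨hVnn a b le_rfl hab le_rfl, ?_⟩
  calc _ ≤ ∫⁻ t in Ioc a b, liminf (fun n => G (bisect σ n a b t)) atTop := lintegral_mono_ae hpt
    _ ≤ liminf (fun n => ∫⁻ t in Ioc a b, G (bisect σ n a b t)) atTop :=
        lintegral_liminf_le fun n => measurable_bisect σ G n a b
    _ ≤ ENNReal.ofReal (V a b) :=
        liminf_le_of_le (by isBoundedDefault) fun B hB => by
          obtain ⟨n, hn⟩ := hB.exists
          exact hn.trans (hbound n a b le_rfl hab le_rfl)

/-! ### Scaling towards a constant and the main estimate. -/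

theorem exp_interpolate_le (p c : ℝ) {s : ℝ} (h0 : 0 ≤ s) (h1 : s ≤ 1) :
    Real.exp (s * p + (1 - s) * c) ≤ Real.exp p + Real.exp c := by
  have := exp_convex_comb c p h0 h1
  rw [show c + s * (p - c) = s * p + (1 - s) * c by ring] at this
  nlinarith [Real.exp_pos p, Real.exp_pos c]

theorem intervalIntegrable_exp_interpolate {φ : ℝ → ℝ} {c d k s : ℝ} (h0 : 0 ≤ s) (h1 : s ≤ 1)
    (hi : IntervalIntegrable φ volume c d)
    (he : IntervalIntegrable (fun t => Real.exp (φ t)) volume c d) :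
    IntervalIntegrable (fun t => Real.exp (s * φ t + (1 - s) * k)) volume c d := by
  refine (he.add (intervalIntegrable_const (c := Real.exp k))).mono_fun ?_ ?_
  · exact Real.continuous_exp.comp_aestronglyMeasurable
      ((hi.def'.aestronglyMeasurable.const_mul s).add aestronglyMeasurable_const)
  · refine ae_of_all _ fun t => ?_
    have := exp_interpolate_le (φ t) k h0 h1
    beta_reduce
    rw [Real.norm_eq_abs, Real.norm_eq_abs, abs_of_pos (Real.exp_pos _),
      abs_of_pos (add_pos (Real.exp_pos _) (Real.exp_pos _))]
    exact this

/-- This is Jensen's inequality for the concave power `y ↦ y^s`. After normalising by the average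
`Y` of `e^φ`, the bound `e^{s(φ - L)} ≤ 1 - s + s e^φ / Y` with `L = log Y` has a right side of
average one. -/
theorem mean_exp_interpolate_le {φ : ℝ → ℝ} {c d k s : ℝ} (hcd : c < d) (h0 : 0 ≤ s) (h1 : s ≤ 1)
    (hi : IntervalIntegrable φ volume c d)
    (he : IntervalIntegrable (fun t => Real.exp (φ t)) volume c d) :
    (meanPoint (fun t => s * φ t + (1 - s) * k) c d).2 ≤
      Real.exp (s * Real.log (meanPoint φ c d).2 + (1 - s) * k) := by
  have hpos : 0 < d - c := by linarith
  set Y := (meanPoint φ c d).2 with hY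
  have hYpos : 0 < Y := (Real.exp_pos _).trans_le (exp_mean_le hcd hi he)
  have hY' : ∫ t in c..d, Real.exp (φ t) = Y * (d - c) := by
    rw [hY, meanPoint]; field_simp
  set L := Real.log Y with hL
  have hm := intervalIntegral.integral_mono_on
    (g := fun t => Real.exp (s * L + (1 - s) * k) * ((1 - s) + s * (Y⁻¹ * Real.exp (φ t))))
    hcd.le (intervalIntegrable_exp_interpolate (k := k) h0 h1 hi he)
    ((intervalIntegrable_const.add ((he.const_mul _).const_mul _)).const_mul _) (fun t _ => by
      have := exp_convex_comb 0 (φ t - L) h0 h1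
      rw [Real.exp_zero, zero_add, sub_zero, Real.exp_sub, hL, Real.exp_log hYpos] at this
      calc Real.exp (s * φ t + (1 - s) * k) =
            Real.exp (s * L + (1 - s) * k) * Real.exp (s * (φ t - L)) := by
              rw [← Real.exp_add]; congr 1; ring
        _ ≤ _ := by
          apply mul_le_mul_of_nonneg_left _ (Real.exp_pos _).le
          rw [← hL] at this
          refine this.trans (le_of_eq ?_)
          field_simp; ring)
  rw [intervalIntegral.integral_const_mul, intervalIntegral.integral_add intervalIntegrable_const
    ((he.const_mul _).const_mul _), intervalIntegral.integral_const_mul,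
    intervalIntegral.integral_const_mul, hY', intervalIntegral.integral_const, smul_eq_mul] at hm
  change (∫ t in c..d, Real.exp (s * φ t + (1 - s) * k)) / (d - c) ≤ _
  rw [div_le_iff₀ hpos]
  refine hm.trans (le_of_eq ?_)
  field_simp; ring

theorem meanPoint_interpolate_fst {φ : ℝ → ℝ} {c d k s : ℝ} (hcd : c < d)
    (hi : IntervalIntegrable φ volume c d) :
    (meanPoint (fun t => s * φ t + (1 - s) * k) c d).1 =
      s * (meanPoint φ c d).1 + (1 - s) * k := by
  have hpos : d - c ≠ 0 := by linarith
  simp only [meanPoint]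
  rw [intervalIntegral.integral_add (hi.const_mul s) intervalIntegrable_const,
    intervalIntegral.integral_const_mul, intervalIntegral.integral_const, smul_eq_mul]
  field_simp

/-- Scaling towards a constant decreases the characteristic. -/
theorem ExpClass.interpolate {C a b : ℝ} (hC : 0 < C) {φ : ℝ → ℝ} (hφ : ExpClass C φ a b)
    {s : ℝ} (h0 : 0 ≤ s) (h1 : s ≤ 1) (k : ℝ) :
    ExpClass (Real.exp (s * Real.log C)) (fun t => s * φ t + (1 - s) * k) a b := by
  refine ⟨(hφ.int.const_mul s).add intervalIntegrable_const,
    intervalIntegrable_exp_interpolate h0 h1 hφ.int hφ.int_exp, fun c d h2 h3 h4 => ?_⟩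
  have hi := intervalIntegrable_sub hφ.int h2 h3.le h4
  have he := intervalIntegrable_sub hφ.int_exp h2 h3.le h4
  refine (mean_exp_interpolate_le h3 h0 h1 hi he).trans ?_
  rw [meanPoint_interpolate_fst h3 hi, ← Real.exp_add, Real.exp_le_exp]
  have hO := hφ.mem_Omega h2 h3 h4
  have hlog : Real.log (meanPoint φ c d).2 ≤ Real.log C + (meanPoint φ c d).1 := by
    rw [← Real.log_exp (meanPoint φ c d).1, ← Real.log_mul hC.ne' (Real.exp_pos _).ne']
    exact Real.log_le_log ((Real.exp_pos _).trans_le hO.1) hO.2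
  nlinarith

/-- Points below the tangent at `x` to the level curve through `x` are visible from `x`. -/
theorem under_of_le_tangent {C : ℝ} {x y : ℝ × ℝ} (hx0 : 0 ≤ x.2) (hx : x.2 ≤ C * Real.exp x.1)
    (hy : y.2 ≤ x.2 * (1 + (y.1 - x.1))) : Under C x y := by
  intro r hr
  calc x.2 + r * (y.2 - x.2) ≤ x.2 * (1 + r * (y.1 - x.1)) := by
        nlinarith [mul_le_mul_of_nonneg_left hy hr.1]
    _ ≤ x.2 * Real.exp (r * (y.1 - x.1)) := mul_le_mul_of_nonneg_left (by
        linarith [Real.add_one_le_exp (r * (y.1 - x.1))]) hx0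
    _ ≤ C * Real.exp x.1 * Real.exp (r * (y.1 - x.1)) :=
        mul_le_mul_of_nonneg_right hx (Real.exp_pos _).le
    _ = _ := by rw [mul_assoc, ← Real.exp_add]

theorem tendsto_meanPoint_interpolate {φ : ℝ → ℝ} {c d : ℝ} (k : ℝ)
    (hi : IntervalIntegrable φ volume c d)
    (he : IntervalIntegrable (fun t => Real.exp (φ t)) volume c d) :
    Tendsto (fun s : ℝ => (meanPoint (fun t => s * φ t + (1 - s) * k) c d).2) (𝓝[<] 1)
      (𝓝 (meanPoint φ c d).2) := by
  apply Tendsto.div_const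
  refine intervalIntegral.tendsto_integral_filter_of_dominated_convergence
    (fun t => Real.exp (φ t) + Real.exp k) ?_ ?_ (he.add intervalIntegrable_const) ?_
  · refine Eventually.of_forall fun s => ?_
    exact Real.continuous_exp.comp_aestronglyMeasurable
      ((hi.def'.aestronglyMeasurable.const_mul s).add aestronglyMeasurable_const)
  · filter_upwards [Ioo_mem_nhdsLT (zero_lt_one (α := ℝ))] with s hs
    refine ae_of_all _ fun t _ => ?_
    rw [Real.norm_eq_abs, abs_of_pos (Real.exp_pos _)]
    exact exp_interpolate_le (φ t) k hs.1.le hs.2.le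
  · refine ae_of_all _ fun t _ => ?_
    have : Continuous fun s : ℝ => Real.exp (s * φ t + (1 - s) * k) := by fun_prop
    have := (this.tendsto 1).mono_left (nhdsWithin_le_nhds (s := Iio 1))
    simpa using this

/-- The main estimate: for `φ` in the class of constant `C`, up to scaling towards a constant
function, `M` controls the averages of `f ∘ φ`. -/
theorem exists_lintegral_interpolate_le {C a b : ℝ} (hC : 1 < C) (hab : a < b)
    {M : ℝ × ℝ → ℝ} {f : ℝ → ℝ} {κ : ℝ} (hκ : 0 ≤ κ) (hM : HasVisibleMajorants C M)
    (hf : BoundaryMinorant C M f) (hgrowth : ∀ x ∈ Omega C, 0 ≤ M x + κ * (1 + x.1 ^ 2))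
    {φ : ℝ → ℝ} (hφ : ExpClass C φ a b)
    (hsq : IntervalIntegrable (fun t => κ * (1 + φ t ^ 2)) volume a b)
    (hx : Real.exp (meanPoint φ a b).1 < (meanPoint φ a b).2) (k : ℝ) :
    ∃ r : ℝ → ℝ, Tendsto r (𝓝[<] 1) (𝓝 (M (meanPoint φ a b))) ∧ ∀ᶠ s in 𝓝[<] (1 : ℝ),
      IntervalIntegrable (fun t => κ * (1 + (s * φ t + (1 - s) * k) ^ 2)) volume a b ∧
      0 ≤ (b - a) * r s + ∫ t in a..b, κ * (1 + (s * φ t + (1 - s) * k) ^ 2) ∧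
      ∫⁻ t in Ioc a b, ENNReal.ofReal
        (f (s * φ t + (1 - s) * k) + κ * (1 + (s * φ t + (1 - s) * k) ^ 2)) ≤
      ENNReal.ofReal ((b - a) * r s + ∫ t in a..b, κ * (1 + (s * φ t + (1 - s) * k) ^ 2)) := by
  set x := meanPoint φ a b with hxdef
  have hxO : x ∈ Omega C := hφ.mem_Omega le_rfl hab le_rfl
  obtain ⟨p, q, hpq⟩ := hM x hxO
  set X : ℝ → ℝ × ℝ := fun s => meanPoint (fun t => s * φ t + (1 - s) * k) a b with hX
  have hX1 : ∀ s, (X s).1 = s * x.1 + (1 - s) * k := fun s =>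
    meanPoint_interpolate_fst hab hφ.int
  have hxpos : 0 < x.2 := (Real.exp_pos _).trans hx
  have hlogC : 0 < Real.log C := Real.log_pos hC
  have lim1 : Tendsto (fun s => (X s).1) (𝓝[<] 1) (𝓝 x.1) := by
    have : Continuous fun s : ℝ => s * x.1 + (1 - s) * k := by fun_prop
    have := (this.tendsto 1).mono_left (nhdsWithin_le_nhds (s := Iio 1))
    simp only [hX1]
    simpa using this
  have lim2 : Tendsto (fun s => (X s).2) (𝓝[<] 1) (𝓝 x.2) :=
    tendsto_meanPoint_interpolate k hφ.int hφ.int_exp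
  -- `M` need not be continuous, so its values at `X s` are replaced by those of the affine majorant
  -- at `x`, which do converge to `M x`. The price is that `X s` must be visible from `x`.
  refine ⟨fun s => M x + p * ((X s).1 - x.1) + q * ((X s).2 - x.2), ?_, ?_⟩
  · have := (((lim1.sub_const x.1).const_mul p).const_add (M x)).add
      ((lim2.sub_const x.2).const_mul q)
    simpa using this
  set L := Real.log x.2 with hL
  have hLx : x.1 < L := by rw [hL, Real.lt_log_iff_exp_lt hxpos]; exact hx
  have ev1 : ∀ᶠ s in 𝓝[<] (1 : ℝ), |(1 - s) * (k - L)| < 1 := by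
    have : Continuous fun s : ℝ => |(1 - s) * (k - L)| := by fun_prop
    have := (this.tendsto 1).mono_left (nhdsWithin_le_nhds (s := Iio 1))
    exact this.eventually (gt_mem_nhds (by simp))
  have ev2 : ∀ᶠ s in 𝓝[<] (1 : ℝ), (1 - s) * (k - L) ^ 2 < L - x.1 := by
    have : Continuous fun s : ℝ => (1 - s) * (k - L) ^ 2 := by fun_prop
    have := (this.tendsto 1).mono_left (nhdsWithin_le_nhds (s := Iio 1))
    exact this.eventually (gt_mem_nhds (by simp; linarith))
  filter_upwards [ev1, ev2, Ioo_mem_nhdsLT (zero_lt_one (α := ℝ))] with s e1 e2 hs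
  have hcls := hφ.interpolate (by linarith) hs.1.le hs.2.le k
  have hC1 : 1 ≤ Real.exp (s * Real.log C) := by
    rw [← Real.exp_zero, Real.exp_le_exp]; exact mul_nonneg hs.1.le hlogC.le
  have hC2 : Real.exp (s * Real.log C) < C := by
    conv_rhs => rw [← Real.exp_log (by linarith : 0 < C)]
    rw [Real.exp_lt_exp]; nlinarith [hs.2]
  have hXO : X s ∈ Omega C := Omega_mono hC2.le (hcls.mem_Omega le_rfl hab le_rfl)
  -- To first order in `1 - s`, the ordinate of `X s` is at most `x.2 * (1 + (1 - s) * (k - L))`,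
  -- while the tangent at `x` has `k - x.1` in place of `k - L`. Since `x` is strictly above the
  -- lower curve, `x.1 < L`, and this gap absorbs the quadratic error by `e2`.
  have hvis : Under C x (X s) := by
    refine under_of_le_tangent hxpos.le hxO.2 ?_
    have h2 := mean_exp_interpolate_le (k := k) hab hs.1.le hs.2.le hφ.int hφ.int_exp
    have h3 : Real.exp (s * L + (1 - s) * k) = x.2 * Real.exp ((1 - s) * (k - L)) := by
      conv_rhs => rw [← Real.exp_log hxpos]
      rw [← Real.exp_add, ← hL]; congr 1; ring
    change (X s).2 ≤ Real.exp (s * L + (1 - s) * k) at h2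
    rw [h3] at h2
    refine h2.trans (mul_le_mul_of_nonneg_left ?_ hxpos.le)
    have h4 := (abs_le.1 (Real.abs_exp_sub_one_sub_id_le e1.le)).2
    rw [hX1]
    nlinarith [hs.2]
  have hsq' : IntervalIntegrable (fun t => κ * (1 + (s * φ t + (1 - s) * k) ^ 2)) volume a b := by
    convert ((hsq.const_mul (s ^ 2)).add (hφ.int.const_mul (2 * κ * s * (1 - s) * k))).add
      (intervalIntegrable_const (c := κ * (1 - s ^ 2 + ((1 - s) * k) ^ 2))) using 2 with t
    ring
  have hmaj := mul_le_mul_of_nonneg_left (hpq (X s) hXO hvis) (by linarith : 0 ≤ b - a)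
  obtain ⟨h0, hle⟩ := lintegral_le_of_majorants hC1 hC2 hab hκ hM hf hgrowth hcls hsq'
  exact ⟨hsq', by linarith, hle.trans (ENNReal.ofReal_le_ofReal (by linarith))⟩

/-! ### Tangents to the upper curve and functions affine along them. -/

/-- A point visible from a point above a tangent to `x₂ = C e^{x₁}`, on the other side of the point
of tangency, lies below that tangent. -/
theorem Under.le_tangent {C p : ℝ} (hC : 0 < C) {x y : ℝ × ℝ} (h : Under C x y)
    (hp : (x.1 - p) * (y.1 - p) ≤ 0) (hx : C * Real.exp p * (1 + (x.1 - p)) ≤ x.2) :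
    y.2 ≤ C * Real.exp p * (1 + (y.1 - p)) := by
  by_contra! hcon
  set K := C * Real.exp p with hK
  have hKpos : 0 < K := mul_pos hC (Real.exp_pos p)
  obtain ⟨δ, hδ⟩ : ∃ δ, δ = y.2 - K * (1 + (y.1 - p)) := ⟨_, rfl⟩
  have hδpos : 0 < δ := by linarith
  have key : ∀ r ∈ Icc (0 : ℝ) 1, K * (1 + (x.1 + r * (y.1 - x.1) - p)) + r * δ ≤
      K * Real.exp (x.1 + r * (y.1 - x.1) - p) := by
    intro r hr
    have h1 := h r hr
    have h2 : C * Real.exp (x.1 + r * (y.1 - x.1)) = K * Real.exp (x.1 + r * (y.1 - x.1) - p) := by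
      rw [hK, mul_assoc, ← Real.exp_add]; congr 2; ring
    rw [h2] at h1
    refine le_trans ?_ h1
    have := mul_le_mul_of_nonneg_left hx (by linarith [hr.2] : 0 ≤ 1 - r)
    rw [hδ]
    nlinarith
  -- Away from the point of tangency the segment crosses the abscissa `p`, where curve and tangent
  -- agree. If it starts there, the curve departs from its tangent only quadratically, so a linear
  -- excess `r * δ` is impossible for small `r`.
  rcases eq_or_ne x.1 p with hxp | hxp
  · set d := y.1 - x.1 with hd
    obtain ⟨r, hr0, hr1, hr2, hr3⟩ : ∃ r : ℝ, 0 < r ∧ r ≤ 1 ∧ r * |d| ≤ 1 ∧ r * (K * d ^ 2) < δ := by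
      have ev : ∀ g : ℝ, ∀ B > 0, ∀ᶠ r in 𝓝[>] (0 : ℝ), r * g < B := by
        intro g B hB
        have : Continuous fun r : ℝ => r * g := by fun_prop
        have := (this.tendsto 0).mono_left (nhdsWithin_le_nhds (s := Ioi 0))
        exact this.eventually (gt_mem_nhds (by simpa using hB))
      obtain ⟨r, h1, h2, h3, h4⟩ := (((ev |d| 1 one_pos).and (ev (K * d ^ 2) δ hδpos)).and
        (((ev 1 1 one_pos)).and eventually_mem_nhdsWithin)).exists.imp
        (fun r h => And.intro h.1.1 (And.intro h.1.2 h.2))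
      exact ⟨r, h4, by linarith, h1.le, h2⟩
    have h1 := key r ⟨hr0.le, hr1⟩
    rw [show x.1 + r * d - p = r * d by rw [hxp]; ring] at h1
    have h2 : Real.exp (r * d) ≤ 1 + r * d + (r * d) ^ 2 := by
      have := (abs_le.1 (Real.abs_exp_sub_one_sub_id_le (x := r * d) (by
        rw [abs_mul, abs_of_pos hr0]; exact hr2))).2
      linarith
    have h3 := mul_le_mul_of_nonneg_left h2 hKpos.le
    have h4 : r * δ ≤ r * (r * (K * d ^ 2)) := by nlinarith
    have h5 := le_of_mul_le_mul_left h4 hr0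
    linarith
  · have hne : y.1 - x.1 ≠ 0 := by
      intro h0
      have : y.1 = x.1 := by linarith
      rw [this] at hp
      have : 0 < (x.1 - p) * (x.1 - p) := mul_self_pos.2 (sub_ne_zero.2 hxp)
      linarith
    have hsq : 0 < (y.1 - x.1) ^ 2 := by positivity
    have hr : (p - x.1) / (y.1 - x.1) = (p - x.1) * (y.1 - x.1) / (y.1 - x.1) ^ 2 := by
      field_simp
    have hxp2 : 0 < (x.1 - p) ^ 2 := by
      have := sub_ne_zero.2 hxp
      positivity
    have hr0 : 0 < (p - x.1) / (y.1 - x.1) := by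
      rw [hr]
      refine div_pos ?_ hsq
      nlinarith
    have hr1 : (p - x.1) / (y.1 - x.1) ≤ 1 := by
      rw [hr, div_le_one hsq]
      nlinarith [sq_nonneg (y.1 - p)]
    have h1 := key _ ⟨hr0.le, hr1⟩
    rw [div_mul_cancel₀ _ hne] at h1
    simp only [add_sub_cancel, sub_self, add_zero, Real.exp_zero, mul_one] at h1
    have := mul_pos hr0 hδpos
    linarith

theorem le_of_hasDerivAt_nonneg {F F' : ℝ → ℝ} {α β : ℝ} (hαβ : α ≤ β)
    (hF : ∀ s, HasDerivAt F (F' s) s) (h : ∀ s ∈ Icc α β, 0 ≤ F' s) : F α ≤ F β := by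
  refine monotoneOn_of_deriv_nonneg (convex_Icc α β)
    (fun s _ => (hF s).continuousAt.continuousWithinAt)
    (fun s _ => (hF s).differentiableAt.differentiableWithinAt) (fun s hs => ?_)
    (left_mem_Icc.2 hαβ) (right_mem_Icc.2 hαβ) hαβ
  rw [(hF s).deriv]
  exact h s (interior_subset hs)

/-- The height of the curve `x₂ / e^{x₁}` of a tangent to `x₂ = C e^{x₁}`, at the point that divides
in the ratio `τ` the segment between the curve `x₂ = e^{x₁}` and the point of tangency. -/
noncomputable def tangentHeight (ξ τ : ℝ) : ℝ := Real.exp (-(τ * ξ)) * (1 + τ * ξ / (1 - ξ))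

/-- The factor `1 - τ` is the point: the height strictly increases up to the contact parameter `1`
and decreases afterwards. -/
theorem hasDerivAt_tangentHeight {ξ : ℝ} (hξ : ξ < 1) (τ : ℝ) :
    HasDerivAt (tangentHeight ξ) (Real.exp (-(τ * ξ)) * (ξ ^ 2 * (1 - τ) / (1 - ξ))) τ := by
  have h1 : (1 : ℝ) - ξ ≠ 0 := by linarith
  have e1 : HasDerivAt (fun τ : ℝ => τ * ξ) ξ τ := by simpa using (hasDerivAt_id τ).mul_const ξ
  have e2 : HasDerivAt (fun τ : ℝ => Real.exp (-(τ * ξ))) (Real.exp (-(τ * ξ)) * -ξ) τ := e1.neg.exp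
  refine (e2.mul ((e1.div_const (1 - ξ)).const_add 1)).congr_deriv ?_
  field_simp
  ring

theorem tangentHeight_zero (ξ : ℝ) : tangentHeight ξ 0 = 1 := by simp [tangentHeight]

theorem tangentHeight_strictMonoOn {ξ : ℝ} (hξ : ξ < 1) (h0 : ξ ≠ 0) :
    StrictMonoOn (tangentHeight ξ) (Iic 1) := by
  refine strictMonoOn_of_deriv_pos (convex_Iic 1)
    (fun s _ => (hasDerivAt_tangentHeight hξ s).continuousAt.continuousWithinAt) fun s hs => ?_
  rw [interior_Iic] at hs
  rw [(hasDerivAt_tangentHeight hξ s).deriv]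
  have h1 : (0 : ℝ) < 1 - ξ := by linarith
  have h2 : (0 : ℝ) < 1 - s := by linarith [mem_Iio.1 hs]
  positivity

theorem tangentHeight_le {C ξ : ℝ} (hξ : ξ < 1) (h : Real.exp (-ξ) = C * (1 - ξ)) (τ : ℝ) :
    tangentHeight ξ τ ≤ C := by
  have h1 : (0 : ℝ) < 1 - ξ := by linarith
  have h2 := Real.add_one_le_exp (ξ * (τ - 1))
  have h3 : C * (1 - ξ) = Real.exp (-(τ * ξ)) * Real.exp (ξ * (τ - 1)) := by
    rw [← h, ← Real.exp_add]; congr 1; ring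
  have h4 : tangentHeight ξ τ * (1 - ξ) = Real.exp (-(τ * ξ)) * (ξ * (τ - 1) + 1) := by
    rw [tangentHeight]; field_simp; ring
  have h5 := mul_le_mul_of_nonneg_left h2 (Real.exp_pos (-(τ * ξ))).le
  rw [← h3, ← h4] at h5
  exact le_of_mul_le_mul_right h5 h1

/-- Data of a function that is affine along the tangents with parameter `ξ`: its boundary values
`f`, its slope `m` along the tangents, and the derivative `n` of `m`; the monotonicity amounts to
local concavity. -/
structure TangentData (ξ : ℝ) (m f n : ℝ → ℝ) : Prop where
  lt_one : ξ < 1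
  ne_zero : ξ ≠ 0
  hasDerivAt_slope : ∀ v, HasDerivAt m (n v) v
  hasDerivAt_boundary : ∀ v, HasDerivAt f (m v - ξ * n v) v
  mono : (0 < ξ ∧ Monotone fun v => Real.exp (-v) * n v) ∨
    (ξ < 0 ∧ Antitone fun v => Real.exp (-v) * n v)

/-- The tangent plane along the tangent issuing from `(u, e^u)`. -/
noncomputable def tangentPlane (ξ : ℝ) (m f n : ℝ → ℝ) (u : ℝ) (y : ℝ × ℝ) : ℝ :=
  m u * (y.1 - u) + f u +
    (1 - ξ) * (Real.exp (-u) * n u) * (y.2 - Real.exp u * (1 + (y.1 - u) / (1 - ξ)))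

namespace TangentData

variable {ξ : ℝ} {m f n : ℝ → ℝ}

theorem plane_eq (y : ℝ × ℝ) (τ : ℝ) :
    tangentPlane ξ m f n (y.1 - τ * ξ) y = m (y.1 - τ * ξ) * (τ * ξ) + f (y.1 - τ * ξ) +
      (1 - ξ) * (Real.exp (-(y.1 - τ * ξ)) * n (y.1 - τ * ξ)) *
        (y.2 - Real.exp y.1 * tangentHeight ξ τ) := by
  rw [tangentPlane, tangentHeight, ← mul_assoc (Real.exp y.1), ← Real.exp_add, ← sub_eq_add_neg]
  simp only [sub_sub_cancel]

/-- This is the `x₂`-coefficient of the tangent plane, as a function of the position `τ` of a fixed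
abscissa on its tangent. In this variable the two alternatives of `mono` become the same statement,
and both families of tangents can be treated together. -/
theorem antitone_coeff (h : TangentData ξ m f n) (y : ℝ) :
    Antitone fun τ => (1 - ξ) * (Real.exp (-(y - τ * ξ)) * n (y - τ * ξ)) := by
  intro s t hst
  have h1 : (0 : ℝ) ≤ 1 - ξ := by linarith [h.lt_one]
  apply mul_le_mul_of_nonneg_left _ h1
  rcases h.mono with ⟨h0, hm⟩ | ⟨h0, hm⟩
  · exact hm (by nlinarith)
  · exact hm (by nlinarith)

/-- With the `x₂`-coefficient frozen at `k`, the derivative of the plane in `τ` is a product whose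
first factor compares `k` with the true coefficient. The relation between `f`, `m` and `n` in
`hasDerivAt_boundary` is exactly what makes the other terms cancel, and for `k` equal to the true
coefficient the planes are stationary. -/
theorem hasDerivAt_aux (h : TangentData ξ m f n) (y : ℝ × ℝ) (k s : ℝ) :
    HasDerivAt (fun τ => m (y.1 - τ * ξ) * (τ * ξ) + f (y.1 - τ * ξ) +
        k * (y.2 - Real.exp y.1 * tangentHeight ξ τ))
      ((k - (1 - ξ) * (Real.exp (-(y.1 - s * ξ)) * n (y.1 - s * ξ))) *
        (-(Real.exp (y.1 - s * ξ) * (ξ ^ 2 * (1 - s) / (1 - ξ))))) s := by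
  have h1 : (1 : ℝ) - ξ ≠ 0 := by linarith [h.lt_one]
  have e1 : HasDerivAt (fun τ : ℝ => τ * ξ) ξ s := by simpa using (hasDerivAt_id s).mul_const ξ
  have e2 := e1.const_sub y.1
  have e3 := (h.hasDerivAt_slope (y.1 - s * ξ)).comp s e2
  have e4 := (h.hasDerivAt_boundary (y.1 - s * ξ)).comp s e2
  have e5 := (((hasDerivAt_tangentHeight h.lt_one s).const_mul (Real.exp y.1)).const_sub y.2).const_mul k
  have e6 := ((e3.mul e1).add e4).add e5
  refine e6.congr_deriv ?_
  simp only [Function.comp_apply]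
  rw [← mul_assoc (Real.exp y.1), ← Real.exp_add, ← sub_eq_add_neg, Real.exp_neg]
  have := (Real.exp_pos (y.1 - s * ξ)).ne'
  field_simp
  ring

theorem slope_nonneg (h : TangentData ξ m f n) {s : ℝ} (z : ℝ) (hs : s ≤ 1) :
    0 ≤ Real.exp z * (ξ ^ 2 * (1 - s) / (1 - ξ)) := by
  have h1 : (0 : ℝ) < 1 - ξ := by linarith [h.lt_one]
  have h2 : (0 : ℝ) ≤ 1 - s := by linarith
  positivity

theorem slope_nonpos (h : TangentData ξ m f n) {s : ℝ} (z : ℝ) (hs : 1 ≤ s) :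
    Real.exp z * (ξ ^ 2 * (1 - s) / (1 - ξ)) ≤ 0 := by
  have h1 : (0 : ℝ) < 1 - ξ := by linarith [h.lt_one]
  have h2 : (0 : ℝ) ≤ s - 1 := by linarith
  have : 0 ≤ Real.exp z * (ξ ^ 2 * (s - 1) / (1 - ξ)) := by positivity
  have e : Real.exp z * (ξ ^ 2 * (1 - s) / (1 - ξ)) =
      -(Real.exp z * (ξ ^ 2 * (s - 1) / (1 - ξ))) := by ring
  linarith

/-- Pass from `τ₁` to `τ` in two moves: change the coefficient at `τ₁`, which helps because the
point lies on or above that tangent, then move with the coefficient frozen, which helps because the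
coefficient is antitone and the height increases up to `1`. -/
theorem plane_le_of_le (h : TangentData ξ m f n) {y : ℝ × ℝ} {τ τ₁ : ℝ} (h1 : τ ≤ τ₁)
    (h2 : τ₁ ≤ 1) (hG : Real.exp y.1 * tangentHeight ξ τ₁ ≤ y.2) :
    tangentPlane ξ m f n (y.1 - τ₁ * ξ) y ≤ tangentPlane ξ m f n (y.1 - τ * ξ) y := by
  rw [plane_eq, plane_eq]
  set T : ℝ → ℝ := fun τ => (1 - ξ) * (Real.exp (-(y.1 - τ * ξ)) * n (y.1 - τ * ξ)) with hT
  have hTa : Antitone T := h.antitone_coeff y.1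
  have := le_of_hasDerivAt_nonneg h1 (fun s => (h.hasDerivAt_aux y (T τ) s).neg) (fun s hs => by
    have a1 := hTa hs.1
    have a2 := h.slope_nonneg (y.1 - s * ξ) (hs.2.trans h2)
    have : 0 ≤ (T τ - T s) * (Real.exp (y.1 - s * ξ) * (ξ ^ 2 * (1 - s) / (1 - ξ))) :=
      mul_nonneg (by linarith) a2
    simp only [hT] at this ⊢
    linarith)
  have a3 := hTa h1
  simp only [Pi.neg_apply] at this
  simp only [hT] at this a3 ⊢
  nlinarith

/-- The same two moves for a point on or below the tangents. Beyond the contact parameter the height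
decreases, so the coefficient is frozen at the other end there. -/
theorem plane_le_of_ge (h : TangentData ξ m f n) {y : ℝ × ℝ} {τ τ₁ : ℝ} (h1 : τ₁ ≤ τ)
    (hG1 : y.2 ≤ Real.exp y.1 * tangentHeight ξ τ₁)
    (hG : y.2 ≤ Real.exp y.1 * tangentHeight ξ τ) :
    tangentPlane ξ m f n (y.1 - τ₁ * ξ) y ≤ tangentPlane ξ m f n (y.1 - τ * ξ) y := by
  set T : ℝ → ℝ := fun τ => (1 - ξ) * (Real.exp (-(y.1 - τ * ξ)) * n (y.1 - τ * ξ)) with hT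
  have hTa : Antitone T := h.antitone_coeff y.1
  have hi : ∀ τ τ₁, τ₁ ≤ τ → 1 ≤ τ₁ → y.2 ≤ Real.exp y.1 * tangentHeight ξ τ →
      tangentPlane ξ m f n (y.1 - τ₁ * ξ) y ≤ tangentPlane ξ m f n (y.1 - τ * ξ) y := by
    intro τ τ₁ h1 h2 hG
    rw [plane_eq, plane_eq]
    have := le_of_hasDerivAt_nonneg h1 (fun s => h.hasDerivAt_aux y (T τ₁) s) (fun s hs => by
      have a1 := hTa hs.1
      have a2 := h.slope_nonpos (y.1 - s * ξ) (h2.trans hs.1)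
      have : 0 ≤ (T τ₁ - T s) * (-(Real.exp (y.1 - s * ξ) * (ξ ^ 2 * (1 - s) / (1 - ξ)))) :=
        mul_nonneg (by linarith) (by linarith)
      simpa only [hT] using this)
    have a3 := hTa h1
    simp only [hT] at this a3 ⊢
    nlinarith
  have lo : ∀ τ τ₁, τ₁ ≤ τ → τ ≤ 1 → y.2 ≤ Real.exp y.1 * tangentHeight ξ τ₁ →
      tangentPlane ξ m f n (y.1 - τ₁ * ξ) y ≤ tangentPlane ξ m f n (y.1 - τ * ξ) y := by
    intro τ τ₁ h1 h2 hG
    rw [plane_eq, plane_eq]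
    have := le_of_hasDerivAt_nonneg h1 (fun s => h.hasDerivAt_aux y (T τ) s) (fun s hs => by
      have a1 := hTa hs.2
      have a2 := h.slope_nonneg (y.1 - s * ξ) (hs.2.trans h2)
      have : 0 ≤ (T s - T τ) * (Real.exp (y.1 - s * ξ) * (ξ ^ 2 * (1 - s) / (1 - ξ))) :=
        mul_nonneg (by linarith) a2
      simp only [hT] at this ⊢
      linarith)
    have a3 := hTa h1
    simp only [hT] at this a3 ⊢
    nlinarith
  -- The derivative changes its sign pattern at the contact parameter `1`; parameters on different
  -- sides are joined through it.
  rcases le_total τ 1 with h2 | h2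
  · exact lo τ τ₁ h1 h2 hG1
  · rcases le_total 1 τ₁ with h3 | h3
    · exact hi τ τ₁ h1 h3 hG
    · exact (lo 1 τ₁ h3 le_rfl hG1).trans (hi τ 1 h2 le_rfl hG)

end TangentData

/-- A point visible from a point `x` of a tangent segment lies below the tangent, or beyond it in
the direction of its initial point. -/
theorem Under.le_tangentHeight {C ξ : ℝ} (hC : 0 < C) (hξ : ξ < 1) (h0 : ξ ≠ 0)
    (hC' : Real.exp (-ξ) = C * (1 - ξ)) {x y : ℝ × ℝ} (h : Under C x y) {τx τy τ : ℝ}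
    (hx1 : τx ≤ 1) (hx : x.2 = Real.exp x.1 * tangentHeight ξ τx)
    (hy : y.2 = Real.exp y.1 * tangentHeight ξ τy) (hτ : y.1 - τ * ξ = x.1 - τx * ξ)
    (hlt : τy ≤ τ) : y.2 ≤ Real.exp y.1 * tangentHeight ξ τ := by
  rcases le_total τ 1 with h1 | h1
  · rw [hy]
    exact mul_le_mul_of_nonneg_left ((tangentHeight_strictMonoOn hξ h0).monotoneOn
      (mem_Iic.2 (hlt.trans h1)) (mem_Iic.2 h1) hlt) (Real.exp_pos _).le
  have h2 : (1 : ℝ) - ξ ≠ 0 := by linarith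
  have hline : ∀ z s : ℝ, z - s * ξ = x.1 - τx * ξ → Real.exp z * tangentHeight ξ s =
      C * Real.exp (x.1 - τx * ξ + ξ) * (1 + (z - (x.1 - τx * ξ + ξ))) := by
    intro z s hzs
    rw [tangentHeight, ← mul_assoc, ← Real.exp_add, ← sub_eq_add_neg, ← hzs]
    have : Real.exp (z - s * ξ) = C * (1 - ξ) * Real.exp (z - s * ξ + ξ) := by
      rw [← hC', ← Real.exp_add]; congr 1; ring
    rw [this]
    field_simp; ring
  rw [hline y.1 τ hτ]
  apply h.le_tangent hC
  · have e1 : x.1 - (x.1 - τx * ξ + ξ) = (τx - 1) * ξ := by ring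
    have e2 : y.1 - (x.1 - τx * ξ + ξ) = (τ - 1) * ξ := by rw [← hτ]; ring
    rw [e1, e2]
    have : 0 ≤ (1 - τx) * (τ - 1) * ξ ^ 2 :=
      mul_nonneg (mul_nonneg (by linarith) (by linarith)) (sq_nonneg _)
    nlinarith
  · rw [← hline x.1 τx rfl, hx]

/-- The left side is the value at `y` of the plane of the tangent through `y`. The line of `x`,
continued to the abscissa of `y`, has there a parameter `τ` that need not lie in `[0, 1]`. If `τ ≤
τy` the planes compare without further assumption; otherwise visibility is needed, to put `y` below
the line of `x`. -/
theorem TangentData.le_plane {C ξ : ℝ} {m f n : ℝ → ℝ} (h : TangentData ξ m f n) (hC : 0 < C)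
    (hC' : Real.exp (-ξ) = C * (1 - ξ)) {x y : ℝ × ℝ} (hU : Under C x y) {τx τy : ℝ}
    (hx1 : τx ≤ 1) (hx : x.2 = Real.exp x.1 * tangentHeight ξ τx)
    (hy1 : τy ≤ 1) (hy : y.2 = Real.exp y.1 * tangentHeight ξ τy) :
    m (y.1 - τy * ξ) * (τy * ξ) + f (y.1 - τy * ξ) ≤ tangentPlane ξ m f n (x.1 - τx * ξ) y := by
  have e : m (y.1 - τy * ξ) * (τy * ξ) + f (y.1 - τy * ξ) =
      tangentPlane ξ m f n (y.1 - τy * ξ) y := by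
    rw [plane_eq, hy, sub_self, mul_zero, add_zero]
  rw [e]
  obtain ⟨τ, hτ⟩ : ∃ τ, y.1 - τ * ξ = x.1 - τx * ξ :=
    ⟨(y.1 - (x.1 - τx * ξ)) / ξ, by rw [div_mul_cancel₀ _ h.ne_zero]; ring⟩
  rw [← hτ]
  rcases le_total τ τy with h1 | h1
  · exact h.plane_le_of_le h1 hy1 hy.ge
  · exact h.plane_le_of_ge h1 hy.le
      (hU.le_tangentHeight hC h.lt_one h.ne_zero hC' hx1 hx hy hτ h1)

theorem TangentData.hasVisibleMajorants {C ξ : ℝ} {m f n : ℝ → ℝ} (h : TangentData ξ m f n)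
    (hC : 0 < C) (hC' : Real.exp (-ξ) = C * (1 - ξ)) {M : ℝ × ℝ → ℝ}
    (hM : ∀ x ∈ Omega C, ∃ τ, 0 ≤ τ ∧ τ ≤ 1 ∧ x.2 = Real.exp x.1 * tangentHeight ξ τ ∧
      M x = m (x.1 - τ * ξ) * (τ * ξ) + f (x.1 - τ * ξ)) :
    HasVisibleMajorants C M := by
  intro x hx
  obtain ⟨τx, -, hx1, hx2, hxM⟩ := hM x hx
  set u := x.1 - τx * ξ with hu
  set T := (1 - ξ) * (Real.exp (-u) * n u) with hT
  refine ⟨m u - T * (Real.exp u / (1 - ξ)), T, fun y hy hU => ?_⟩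
  obtain ⟨τy, -, hy1, hy2, hyM⟩ := hM y hy
  have key := h.le_plane hC hC' hU hx1 hx2 hy1 hy2
  rw [hyM]
  refine key.trans (le_of_eq ?_)
  have e : M x = tangentPlane ξ m f n u x := by
    rw [hu, plane_eq, hx2, sub_self, mul_zero, add_zero, hxM]
  rw [e]
  simp only [tangentPlane, ← hu, ← hT]
  ring

/-! ### The numbers `ξ^±`, the functions `u^±`, and upper bounds for nonnegative integrands. -/

theorem xiPlus_pos {C : ℝ} (hC : 1 < C) : 0 < xiPlus C := by
  obtain ⟨h0, h1, h2⟩ := xiPlus_spec hC.le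
  refine lt_of_le_of_ne h0 fun h => ?_
  rw [← h] at h2; simp at h2; linarith

theorem xiMinus_neg {C : ℝ} (hC : 1 < C) : xiMinus C < 0 := by
  obtain ⟨h0, h2⟩ := xiMinus_spec hC.le
  refine lt_of_le_of_ne h0 fun h => ?_
  rw [h] at h2; simp at h2; linarith

theorem uPlus_eq_of {C : ℝ} (hC : 1 ≤ C) {x : ℝ × ℝ} (hx : x ∈ Omega C) {u : ℝ}
    (h : IsUPlus C x u) : uPlus C x = u :=
  (existsUnique_uPlus hC hx).unique (uPlus_spec hC hx) h

theorem uMinus_eq_of {C : ℝ} (hC : 1 ≤ C) {x : ℝ × ℝ} (hx : x ∈ Omega C) {u : ℝ}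
    (h : IsUMinus C x u) : uMinus C x = u :=
  (existsUnique_uMinus hC hx).unique (uMinus_spec hC hx) h

theorem uPlus_of_eq_exp {C : ℝ} (hC : 1 ≤ C) {x : ℝ × ℝ} (hx : x ∈ Omega C)
    (h : x.2 = Real.exp x.1) : uPlus C x = x.1 :=
  uPlus_eq_of hC hx ⟨le_rfl, by linarith [(xiPlus_spec hC).1], by simp [h]⟩

theorem uMinus_of_eq_exp {C : ℝ} (hC : 1 ≤ C) {x : ℝ × ℝ} (hx : x ∈ Omega C)
    (h : x.2 = Real.exp x.1) : uMinus C x = x.1 :=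
  uMinus_eq_of hC hx ⟨le_rfl, by linarith [(xiMinus_spec hC).1], by simp [h]⟩

/-- The coordinate `τ = (x.1 - u⁺) / ξ⁺` vanishes on the lower curve and equals one on the upper
one. It is the parameter in which the comparison of tangent planes was carried out. -/
theorem exists_tau_plus {C : ℝ} (hC : 1 < C) {x : ℝ × ℝ} (hx : x ∈ Omega C) :
    ∃ τ, 0 ≤ τ ∧ τ ≤ 1 ∧ x.2 = Real.exp x.1 * tangentHeight (xiPlus C) τ ∧
      x.1 - τ * xiPlus C = uPlus C x ∧ τ * xiPlus C = x.1 - uPlus C x := by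
  obtain ⟨h1, h2, h3⟩ := uPlus_spec hC.le hx
  have hξ := xiPlus_pos hC
  set u := uPlus C x
  set ξ := xiPlus C
  have e : (x.1 - u) / ξ * ξ = x.1 - u := div_mul_cancel₀ _ hξ.ne'
  refine ⟨(x.1 - u) / ξ, div_nonneg (by linarith) hξ.le, by rw [div_le_one hξ]; linarith, ?_, ?_, e⟩
  · rw [tangentHeight, e, ← mul_assoc, ← Real.exp_add, h3]
    ring_nf
  · rw [e]; ring

theorem exists_tau_minus {C : ℝ} (hC : 1 < C) {x : ℝ × ℝ} (hx : x ∈ Omega C) :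
    ∃ τ, 0 ≤ τ ∧ τ ≤ 1 ∧ x.2 = Real.exp x.1 * tangentHeight (xiMinus C) τ ∧
      x.1 - τ * xiMinus C = uMinus C x ∧ τ * xiMinus C = x.1 - uMinus C x := by
  obtain ⟨h1, h2, h3⟩ := uMinus_spec hC.le hx
  have hξ := xiMinus_neg hC
  set u := uMinus C x
  set ξ := xiMinus C
  have e : (x.1 - u) / ξ * ξ = x.1 - u := div_mul_cancel₀ _ hξ.ne
  refine ⟨(x.1 - u) / ξ, div_nonneg_of_nonpos (by linarith) hξ.le, by
    rw [div_le_one_of_neg hξ]; linarith, ?_, ?_, e⟩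
  · rw [tangentHeight, e, ← mul_assoc, ← Real.exp_add, h3]
    ring_nf
  · rw [e]; ring

theorem boundaryMinorant_of_le {C : ℝ} {M : ℝ × ℝ → ℝ} {f : ℝ → ℝ} (hf : Continuous f)
    (h : ∀ x ∈ Omega C, f x.1 ≤ M x) : BoundaryMinorant C M f := by
  intro t ε hε
  have h1 : Tendsto (fun x : ℝ × ℝ => f x.1) (𝓝[Omega C] (t, Real.exp t)) (𝓝 (f t)) :=
    ((hf.comp continuous_fst).tendsto (t, Real.exp t)).mono_left nhdsWithin_le_nhds
  filter_upwards [h1.eventually (lt_mem_nhds (show f t - ε < f t by linarith)),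
    self_mem_nhdsWithin] with x hx hxO
  exact hx.le.trans (h x hxO)

/-- Upper bound for averages of a continuous nonnegative function of `φ`. -/
theorem lintegral_le_of_visibleMajorants {C a b : ℝ} (hC : 1 < C) (hab : a < b)
    {M : ℝ × ℝ → ℝ} {f : ℝ → ℝ} (hM : HasVisibleMajorants C M) (hfc : Continuous f)
    (hf : BoundaryMinorant C M f) (hM0 : ∀ x ∈ Omega C, 0 ≤ M x)
    {φ : ℝ → ℝ} (hφ : ExpClass C φ a b)
    (hx : Real.exp (meanPoint φ a b).1 < (meanPoint φ a b).2) :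
    ∫⁻ t in Ioc a b, ENNReal.ofReal (f (φ t)) ≤
      ENNReal.ofReal ((b - a) * M (meanPoint φ a b)) := by
  -- For nonnegative `M` no correction is needed, so `κ = 0`; the scaling is towards `0` and is
  -- removed by Fatou's lemma as `s` increases to `1`.
  obtain ⟨r, hr, hev⟩ := exists_lintegral_interpolate_le hC hab le_rfl hM hf
    (by simpa using hM0) hφ (by simp) hx 0
  simp only [zero_mul, add_zero, mul_zero, intervalIntegral.integral_zero] at hev
  have hmeas : AEMeasurable φ (volume.restrict (Ioc a b)) :=
    ((intervalIntegrable_iff_integrableOn_Ioc_of_le hab.le).1 hφ.int).aemeasurable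
  have hpt : ∀ t, ENNReal.ofReal (f (φ t)) =
      liminf (fun s : ℝ => ENNReal.ofReal (f (s * φ t))) (𝓝[<] 1) := by
    intro t
    have hc : Continuous fun s : ℝ => ENNReal.ofReal (f (s * φ t)) :=
      ENNReal.continuous_ofReal.comp (hfc.comp (by fun_prop))
    have := (hc.tendsto 1).mono_left (nhdsWithin_le_nhds (s := Iio 1))
    rw [one_mul] at this
    exact this.liminf_eq.symm
  calc ∫⁻ t in Ioc a b, ENNReal.ofReal (f (φ t))
      = ∫⁻ t in Ioc a b, liminf (fun s : ℝ => ENNReal.ofReal (f (s * φ t))) (𝓝[<] 1) := by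
        simp only [← hpt]
    _ ≤ liminf (fun s : ℝ => ∫⁻ t in Ioc a b, ENNReal.ofReal (f (s * φ t))) (𝓝[<] 1) :=
        lintegral_liminf_le' fun s => (ENNReal.continuous_ofReal.comp hfc).measurable.comp_aemeasurable
          (hmeas.const_mul s)
    _ ≤ liminf (fun s : ℝ => ENNReal.ofReal ((b - a) * r s)) (𝓝[<] 1) :=
        liminf_le_liminf (hev.mono fun s h => h.2.2)
    _ = _ := ((ENNReal.continuous_ofReal.tendsto _).comp (hr.const_mul (b - a))).liminf_eq

theorem ae_eq_const_of_mem {C a b : ℝ} (hab : a < b) {φ : ℝ → ℝ} (hφ : ExpClass C φ a b)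
    (hx : (meanPoint φ a b).2 = Real.exp (meanPoint φ a b).1) :
    ∀ᵐ t ∂(volume.restrict (Ioc a b)), φ t = (meanPoint φ a b).1 :=
  ae_eq_of_exp_mean_eq hab hφ.int hφ.int_exp hx

theorem lintegral_const_of_mem {C a b : ℝ} (hab : a < b) {φ : ℝ → ℝ} (hφ : ExpClass C φ a b)
    (hx : (meanPoint φ a b).2 = Real.exp (meanPoint φ a b).1) (F : ℝ → ℝ≥0∞) :
    ∫⁻ t in Ioc a b, F (φ t) = ENNReal.ofReal (b - a) * F (meanPoint φ a b).1 := by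
  have : ∀ᵐ t ∂(volume.restrict (Ioc a b)), F (φ t) = F (meanPoint φ a b).1 :=
    (ae_eq_const_of_mem hab hφ hx).mono fun t h => by rw [h]
  rw [lintegral_congr_ae this, lintegral_const, Measure.restrict_apply MeasurableSet.univ,
    univ_inter, Real.volume_Ioc, mul_comm]

theorem eq_exp_or_lt {C : ℝ} {x : ℝ × ℝ} (hx : x ∈ Omega C) :
    x.2 = Real.exp x.1 ∨ Real.exp x.1 < x.2 := by
  rcases hx.1.eq_or_lt with h | h
  · exact Or.inl h.symm
  · exact Or.inr h

theorem one_lt_of_exp_lt {C : ℝ} {x : ℝ × ℝ} (hx : x ∈ Omega C) (h : Real.exp x.1 < x.2) :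
    1 < C := by
  have h1 := hx.2
  have h2 := Real.exp_pos x.1
  by_contra! hC
  nlinarith

/-! ### The upper Bellman function for `φ²` -/

theorem tangentData_sq {C : ℝ} (hC : 1 < C) :
    TangentData (xiMinus C) (fun u => 2 * u + 2 * xiMinus C) (fun u => u ^ 2) fun _ => 2 where
  lt_one := by linarith [xiMinus_neg hC]
  ne_zero := (xiMinus_neg hC).ne
  hasDerivAt_slope v := by
    simpa using ((hasDerivAt_id v).const_mul 2).add_const (2 * xiMinus C)
  hasDerivAt_boundary v := by
    refine (hasDerivAt_pow 2 v).congr_deriv ?_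
    push_cast; ring
  mono := Or.inr ⟨xiMinus_neg hC, fun s t h =>
    mul_le_mul_of_nonneg_right (Real.exp_le_exp.2 (by linarith)) zero_le_two⟩

theorem hasVisibleMajorants_B2Cand {C : ℝ} (hC : 1 < C) : HasVisibleMajorants C (B2Cand C) := by
  refine (tangentData_sq hC).hasVisibleMajorants (by linarith) (xiMinus_spec hC.le).2 fun x hx => ?_
  obtain ⟨τ, h0, h1, h2, h3, h4⟩ := exists_tau_minus hC hx
  refine ⟨τ, h0, h1, h2, ?_⟩
  rw [h3, h4, B2Cand]; ring

theorem sq_le_B2Cand {C : ℝ} (hC : 1 ≤ C) {x : ℝ × ℝ} (hx : x ∈ Omega C) :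
    x.1 ^ 2 ≤ B2Cand C x := by
  obtain ⟨h1, h2, -⟩ := uMinus_spec hC hx
  have h3 := (xiMinus_spec hC).1
  have : B2Cand C x = x.1 ^ 2 + (uMinus C x - x.1) * (x.1 - uMinus C x - 2 * xiMinus C) := by
    rw [B2Cand]; ring
  rw [this]
  nlinarith [mul_nonneg (sub_nonneg.2 h1) (by linarith : 0 ≤ x.1 - uMinus C x - 2 * xiMinus C)]

theorem lintegral_sq_le {C a b : ℝ} (hC : 1 ≤ C) (hab : a < b) {φ : ℝ → ℝ}
    (hφ : ExpClass C φ a b) :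
    ∫⁻ t in Ioc a b, ENNReal.ofReal (φ t ^ 2) ≤
      ENNReal.ofReal ((b - a) * B2Cand C (meanPoint φ a b)) := by
  have hO := hφ.mem_Omega le_rfl hab le_rfl
  rcases eq_exp_or_lt hO with h | h
  · rw [lintegral_const_of_mem hab hφ h (fun t => ENNReal.ofReal (t ^ 2)),
      ← ENNReal.ofReal_mul (by linarith)]
    exact ENNReal.ofReal_le_ofReal (mul_le_mul_of_nonneg_left (sq_le_B2Cand hC hO) (by linarith))
  · have hC1 := one_lt_of_exp_lt hO h
    exact lintegral_le_of_visibleMajorants hC1 hab (hasVisibleMajorants_B2Cand hC1)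
      (continuous_pow 2) (boundaryMinorant_of_le (continuous_pow 2) fun x hx => sq_le_B2Cand hC hx)
      (fun x hx => (sq_nonneg _).trans (sq_le_B2Cand hC hx)) hφ h

/-- Finiteness of the upper bound for `φ²` is the a priori integrability that all lower estimates
rely on, since these compare with integrands bounded by a multiple of `1 + φ²`. -/
theorem ExpClass.int_sq {C a b : ℝ} (hC : 1 ≤ C) (hab : a < b) {φ : ℝ → ℝ}
    (hφ : ExpClass C φ a b) : IntervalIntegrable (fun t => φ t ^ 2) volume a b := by
  rw [intervalIntegrable_iff_integrableOn_Ioc_of_le hab.le]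
  have hm := ((intervalIntegrable_iff_integrableOn_Ioc_of_le hab.le).1 hφ.int).aestronglyMeasurable
  refine ⟨hm.pow 2, ?_⟩
  rw [hasFiniteIntegral_iff_ofReal (ae_of_all _ fun t => sq_nonneg _)]
  exact (lintegral_sq_le hC hab hφ).trans_lt ENNReal.ofReal_lt_top

/-- Lower bound for averages of a continuous nonnegative function of `φ`. -/
theorem le_lintegral_of_visibleMajorants {C a b : ℝ} (hC : 1 < C) (hab : a < b)
    {B : ℝ × ℝ → ℝ} {g : ℝ → ℝ} {κ : ℝ} (hκ : 0 ≤ κ) (hM : HasVisibleMajorants C fun x => -B x)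
    (hgc : Continuous g) (hg0 : ∀ t, 0 ≤ g t) (hgκ : ∀ t, g t ≤ κ * (1 + t ^ 2))
    (hgs : ∀ s ∈ Icc (0 : ℝ) 1, ∀ t, g (s * t) ≤ g t)
    (hg : BoundaryMinorant C (fun x => -B x) fun t => -g t)
    (hBκ : ∀ x ∈ Omega C, B x ≤ κ * (1 + x.1 ^ 2))
    {φ : ℝ → ℝ} (hφ : ExpClass C φ a b)
    (hx : Real.exp (meanPoint φ a b).1 < (meanPoint φ a b).2) :
    ENNReal.ofReal ((b - a) * B (meanPoint φ a b)) ≤ ∫⁻ t in Ioc a b, ENNReal.ofReal (g (φ t)) := by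
  have hsq := hφ.int_sq hC.le hab
  obtain ⟨r, hr, hev⟩ := exists_lintegral_interpolate_le hC hab hκ hM hg
    (fun x hx => by linarith [hBκ x hx]) hφ ((intervalIntegrable_const.add hsq).const_mul κ) hx 0
  simp only [mul_zero, add_zero] at hev
  have hmeas : AEStronglyMeasurable φ (volume.restrict (Ioc a b)) :=
    ((intervalIntegrable_iff_integrableOn_Ioc_of_le hab.le).1 hφ.int).aestronglyMeasurable
  have hint : ∀ ψ : ℝ → ℝ, AEStronglyMeasurable ψ (volume.restrict (Ioc a b)) →
      IntervalIntegrable (fun t => κ * (1 + ψ t ^ 2)) volume a b →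
      IntervalIntegrable (fun t => g (ψ t)) volume a b := by
    intro ψ hψ hi
    rw [intervalIntegrable_iff_integrableOn_Ioc_of_le hab.le] at hi ⊢
    refine Integrable.mono' hi (hgc.comp_aestronglyMeasurable hψ) (ae_of_all _ fun t => ?_)
    rw [Real.norm_eq_abs, abs_of_nonneg (hg0 _)]
    exact hgκ _
  have hgφ := hint φ hmeas ((intervalIntegrable_const.add hsq).const_mul κ)
  rw [← ofReal_integral_eq_lintegral_ofReal
    ((intervalIntegrable_iff_integrableOn_Ioc_of_le hab.le).1 hgφ) (ae_of_all _ fun t => hg0 _),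
    ← intervalIntegral.integral_of_le hab.le]
  apply ENNReal.ofReal_le_ofReal
  have hlim : Tendsto (fun s => -((b - a) * r s)) (𝓝[<] 1)
      (𝓝 (-((b - a) * -B (meanPoint φ a b)))) := (hr.const_mul (b - a)).neg
  rw [show -((b - a) * -B (meanPoint φ a b)) = (b - a) * B (meanPoint φ a b) by ring] at hlim
  refine le_of_tendsto hlim ?_
  filter_upwards [hev, Ioo_mem_nhdsLT (zero_lt_one (α := ℝ))] with s ⟨h1, h2, h3⟩ hs
  have hgs' := hint (fun t => s * φ t) (hmeas.const_mul s) h1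
  have hdiff := (h1.sub hgs')
  have e : ∀ t, -g (s * φ t) + κ * (1 + (s * φ t) ^ 2) =
      κ * (1 + (s * φ t) ^ 2) - g (s * φ t) := fun t => by ring
  simp only [e] at h3
  rw [← ofReal_integral_eq_lintegral_ofReal
    ((intervalIntegrable_iff_integrableOn_Ioc_of_le hab.le).1 hdiff)
    (ae_of_all _ fun t => sub_nonneg.2 (hgκ _)), ENNReal.ofReal_le_ofReal_iff h2,
    ← intervalIntegral.integral_of_le hab.le, intervalIntegral.integral_sub h1 hgs'] at h3
  -- Scaling towards `0` only decreases `g ∘ φ`, so on this side no limit in `s` is required.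
  have h4 : ∫ t in a..b, g (s * φ t) ≤ ∫ t in a..b, g (φ t) :=
    intervalIntegral.integral_mono_on hab.le hgs' hgφ fun t _ => hgs s ⟨hs.1.le, hs.2.le⟩ _
  linarith

/-! ### The upper Bellman function for `e^{δφ}` -/

theorem tangentData_exp {C δ : ℝ} (hC : 1 < C) (hδ : 1 ≤ δ) (hδξ : δ * xiPlus C < 1) :
    TangentData (xiPlus C) (fun u => δ / (1 - δ * xiPlus C) * Real.exp (δ * u))
      (fun u => Real.exp (δ * u)) fun u => δ / (1 - δ * xiPlus C) * (δ * Real.exp (δ * u)) := by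
  have hξ := xiPlus_pos hC
  have hexp : ∀ v : ℝ, HasDerivAt (fun u : ℝ => Real.exp (δ * u)) (δ * Real.exp (δ * v)) v := by
    intro v
    have : HasDerivAt (fun u : ℝ => δ * u) δ v := by simpa using (hasDerivAt_id v).const_mul δ
    exact this.exp.congr_deriv (mul_comm _ _)
  have hpos : 0 < 1 - δ * xiPlus C := by linarith
  refine ⟨(xiPlus_spec hC.le).2.1, hξ.ne', fun v => (hexp v).const_mul _, fun v => ?_, Or.inl
    ⟨hξ, fun s t h => ?_⟩⟩
  · refine (hexp v).congr_deriv ?_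
    field_simp
  · have e : ∀ v, Real.exp (-v) * (δ / (1 - δ * xiPlus C) * (δ * Real.exp (δ * v))) =
        δ * δ / (1 - δ * xiPlus C) * Real.exp ((δ - 1) * v) := by
      intro v
      rw [show (δ - 1) * v = -v + δ * v by ring, Real.exp_add]; ring
    simp only [e]
    exact mul_le_mul_of_nonneg_left (Real.exp_le_exp.2 (by nlinarith)) (by positivity)

theorem hasVisibleMajorants_ACand {C δ : ℝ} (hC : 1 < C) (hδ : 1 ≤ δ) (hδξ : δ * xiPlus C < 1) :
    HasVisibleMajorants C (ACand δ C) := by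
  refine (tangentData_exp hC hδ hδξ).hasVisibleMajorants (by linarith)
    (xiPlus_spec hC.le).2.2 fun x hx => ?_
  obtain ⟨τ, h0, h1, h2, h3, h4⟩ := exists_tau_plus hC hx
  refine ⟨τ, h0, h1, h2, ?_⟩
  rw [h3, h4, ACand]; ring

/-- With `z = δ (x.1 - u⁺)`, which is at most `δ ξ⁺ < 1`, the claim follows from `e^z ≤ 1 / (1 - z)
= 1 + z / (1 - z)`. It supplies the boundary behaviour and the positivity of the candidate at once.
-/
theorem exp_le_ACand {C δ : ℝ} (hC : 1 ≤ C) (hδ : 1 ≤ δ) (hδξ : δ * xiPlus C < 1) {x : ℝ × ℝ}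
    (hx : x ∈ Omega C) : Real.exp (δ * x.1) ≤ ACand δ C x := by
  obtain ⟨h1, h2, -⟩ := uPlus_spec hC hx
  set u := uPlus C x with hu
  set z := δ * (x.1 - u) with hz
  have hz0 : 0 ≤ z := mul_nonneg (by linarith) (by linarith)
  have hzξ : z ≤ δ * xiPlus C := mul_le_mul_of_nonneg_left (by linarith) (by linarith)
  have h3 : Real.exp z ≤ 1 / (1 - z) := by
    rw [le_div_iff₀ (by linarith)]
    have := Real.add_one_le_exp (-z)
    have := mul_le_mul_of_nonneg_left this (Real.exp_pos z).le
    rw [← Real.exp_add, add_neg_cancel, Real.exp_zero] at this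
    linarith
  have h4 : 1 / (1 - z) = z / (1 - z) + 1 := by
    have : 1 - z ≠ 0 := by linarith
    field_simp; ring
  have h5 : z / (1 - z) ≤ z / (1 - δ * xiPlus C) :=
    div_le_div_of_nonneg_left hz0 (by linarith) (by linarith)
  rw [ACand, ← hu, show δ * x.1 = δ * u + z by rw [hz]; ring, Real.exp_add]
  apply mul_le_mul_of_nonneg_left _ (Real.exp_pos _).le
  calc _ ≤ z / (1 - δ * xiPlus C) + 1 := by linarith
    _ = _ := by rw [hz]; ring

theorem lintegral_exp_le {C δ a b : ℝ} (hC : 1 ≤ C) (hδ : 1 ≤ δ) (hδξ : δ * xiPlus C < 1)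
    (hab : a < b) {φ : ℝ → ℝ} (hφ : ExpClass C φ a b) :
    ∫⁻ t in Ioc a b, ENNReal.ofReal (Real.exp (δ * φ t)) ≤
      ENNReal.ofReal ((b - a) * ACand δ C (meanPoint φ a b)) := by
  have hO := hφ.mem_Omega le_rfl hab le_rfl
  rcases eq_exp_or_lt hO with h | h
  · rw [lintegral_const_of_mem hab hφ h (fun t => ENNReal.ofReal (Real.exp (δ * t))),
      ← ENNReal.ofReal_mul (by linarith)]
    exact ENNReal.ofReal_le_ofReal
      (mul_le_mul_of_nonneg_left (exp_le_ACand hC hδ hδξ hO) (by linarith))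
  · have hC1 := one_lt_of_exp_lt hO h
    have hc : Continuous fun t : ℝ => Real.exp (δ * t) := by fun_prop
    exact lintegral_le_of_visibleMajorants hC1 hab (hasVisibleMajorants_ACand hC1 hδ hδξ)
      hc (boundaryMinorant_of_le hc fun x hx => exp_le_ACand hC hδ hδξ hx)
      (fun x hx => (Real.exp_pos _).le.trans (exp_le_ACand hC hδ hδξ hx)) hφ h

/-! ### Lower Bellman functions that are affine along tangents -/

/-- Near the lower curve the ratio of `x.2` to `e^{x.1}` tends to one, and strict monotonicity of
`tangentHeight` turns this into `τ → 0`. -/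
theorem tendsto_uPlus {C : ℝ} (hC : 1 < C) (t : ℝ) :
    Tendsto (uPlus C) (𝓝[Omega C] (t, Real.exp t)) (𝓝 t) := by
  have hξ := xiPlus_pos hC
  obtain ⟨-, hξ1, -⟩ := xiPlus_spec hC.le
  have hfst : Tendsto (fun x : ℝ × ℝ => x.1) (𝓝[Omega C] (t, Real.exp t)) (𝓝 t) :=
    (continuous_fst.tendsto (t, Real.exp t)).mono_left nhdsWithin_le_nhds
  have hdiff : Tendsto (fun x : ℝ × ℝ => x.1 - uPlus C x) (𝓝[Omega C] (t, Real.exp t)) (𝓝 0) := by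
    rw [Metric.tendsto_nhds]
    intro ε hε
    set η := min 1 (ε / (2 * xiPlus C)) with hη
    have hη0 : 0 < η := lt_min one_pos (by positivity)
    have hη1 : η ≤ 1 := min_le_left _ _
    have hmono := tangentHeight_strictMonoOn hξ1 hξ.ne'
    have hlt : 1 < tangentHeight (xiPlus C) η := by
      rw [← tangentHeight_zero (xiPlus C)]
      exact hmono (by simp) (mem_Iic.2 hη1) hη0
    have hopen : ∀ᶠ x : ℝ × ℝ in 𝓝[Omega C] (t, Real.exp t),
        x.2 < Real.exp x.1 * tangentHeight (xiPlus C) η := by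
      apply nhdsWithin_le_nhds
      have h1 : Continuous fun x : ℝ × ℝ => Real.exp x.1 * tangentHeight (xiPlus C) η - x.2 := by
        fun_prop
      have h2 := h1.tendsto (t, Real.exp t)
      have h3 : 0 < Real.exp t * tangentHeight (xiPlus C) η - Real.exp t := by
        nlinarith [Real.exp_pos t]
      filter_upwards [h2.eventually (lt_mem_nhds h3)] with x hx
      linarith
    filter_upwards [hopen, self_mem_nhdsWithin] with x hx hxO
    obtain ⟨τ, h0, h1, h2, h3, h4⟩ := exists_tau_plus hC hxO
    rw [h2] at hx
    have h5 := lt_of_mul_lt_mul_left hx (Real.exp_pos _).le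
    have h6 : τ < η := (hmono.lt_iff_lt (mem_Iic.2 h1) (mem_Iic.2 hη1)).1 h5
    rw [Real.dist_eq, sub_zero, ← h4, abs_of_nonneg (mul_nonneg h0 hξ.le)]
    have h7 : τ < ε / (2 * xiPlus C) := h6.trans_le (min_le_right _ _)
    rw [lt_div_iff₀ (by positivity)] at h7
    nlinarith
  simpa using hfst.sub hdiff

/-- Lower bound for averages, for a candidate that is affine along the tangents. -/
theorem le_lintegral_of_tangentData {C a b : ℝ} (hC : 1 < C) (hab : a < b) {m g n : ℝ → ℝ}
    (hT : TangentData (xiPlus C) (fun u => -m u) (fun u => -g u) fun u => -n u)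
    (hg0 : ∀ t, 0 ≤ g t) (hgs : ∀ s ∈ Icc (0 : ℝ) 1, ∀ t, g (s * t) ≤ g t)
    {κ : ℝ} (hκ : 0 ≤ κ) (hgκ : ∀ t, g t ≤ κ * (1 + t ^ 2)) (hmκ : ∀ t, m t ≤ κ * (1 + |t|))
    {B : ℝ × ℝ → ℝ} (hB : ∀ x ∈ Omega C, B x = m (uPlus C x) * (x.1 - uPlus C x) + g (uPlus C x))
    {φ : ℝ → ℝ} (hφ : ExpClass C φ a b)
    (hx : Real.exp (meanPoint φ a b).1 < (meanPoint φ a b).2) :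
    ENNReal.ofReal ((b - a) * B (meanPoint φ a b)) ≤ ∫⁻ t in Ioc a b, ENNReal.ofReal (g (φ t)) := by
  have hξ := xiPlus_pos hC
  obtain ⟨-, hξ1, hξC⟩ := xiPlus_spec hC.le
  have hgc : Continuous g := by
    have : Continuous fun u => -g u :=
      continuous_iff_continuousAt.2 fun v => (hT.hasDerivAt_boundary v).continuousAt
    exact this.neg.congr fun u => neg_neg _
  have hmc : Continuous m := by
    have : Continuous fun u => -m u :=
      continuous_iff_continuousAt.2 fun v => (hT.hasDerivAt_slope v).continuousAt
    exact this.neg.congr fun u => neg_neg _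
  -- The candidate is bounded through values at `u⁺`, and `|u⁺| ≤ |x.1| + 1`; the factor `6` absorbs
  -- this shift.
  refine le_lintegral_of_visibleMajorants (κ := 6 * κ) hC hab (by linarith) ?_ hgc hg0
    (fun t => ?_) hgs ?_ (fun x hxO => ?_) hφ hx
  · refine hT.hasVisibleMajorants (by linarith) hξC fun x hxO => ?_
    obtain ⟨τ, h0, h1, h2, h3, h4⟩ := exists_tau_plus hC hxO
    refine ⟨τ, h0, h1, h2, ?_⟩
    rw [hB x hxO, h3, h4]; ring
  · exact (hgκ t).trans (mul_le_mul_of_nonneg_right (by linarith) (by positivity))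
  · intro t ε hε
    have h1 := tendsto_uPlus hC t
    have h2 : Tendsto (fun x : ℝ × ℝ => x.1) (𝓝[Omega C] (t, Real.exp t)) (𝓝 t) :=
      (continuous_fst.tendsto (t, Real.exp t)).mono_left nhdsWithin_le_nhds
    have h3 := (((hmc.tendsto t).comp h1).mul (h2.sub h1)).add ((hgc.tendsto t).comp h1)
    rw [sub_self, mul_zero, zero_add] at h3
    filter_upwards [h3.eventually (gt_mem_nhds (show g t < g t + ε by linarith)),
      self_mem_nhdsWithin] with x hx1 hxO
    simp only [Function.comp_apply] at hx1
    rw [hB x hxO]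
    linarith
  · obtain ⟨h1, h2, -⟩ := uPlus_spec hC.le hxO
    rw [hB x hxO]
    set u := uPlus C x
    have hu : |u| ≤ |x.1| + 1 := by
      rw [abs_le]
      constructor <;> rcases abs_cases x.1 with h | h <;> linarith
    have e1 : m u * (x.1 - u) ≤ κ * (1 + |u|) := by
      have hp : 0 ≤ κ * (1 + |u|) := by positivity
      calc m u * (x.1 - u) ≤ κ * (1 + |u|) * (x.1 - u) :=
            mul_le_mul_of_nonneg_right (hmκ u) (by linarith)
        _ ≤ κ * (1 + |u|) * 1 := mul_le_mul_of_nonneg_left (by linarith) hp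
        _ = _ := mul_one _
    have e2 := hgκ u
    have e3 : u ^ 2 ≤ (|x.1| + 1) ^ 2 := by
      rw [← sq_abs u]; exact pow_le_pow_left₀ (abs_nonneg u) hu 2
    have e4 : (1 + |u|) + (1 + u ^ 2) ≤ 6 * (1 + x.1 ^ 2) := by
      nlinarith [sq_abs x.1, sq_nonneg (|x.1| - 1)]
    have := mul_le_mul_of_nonneg_left e4 hκ
    linarith

theorem tangentData_b2 {C : ℝ} (hC : 1 < C) :
    TangentData (xiPlus C) (fun u => -(2 * u + 2 * xiPlus C)) (fun u => -u ^ 2) fun _ => -2 where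
  lt_one := (xiPlus_spec hC.le).2.1
  ne_zero := (xiPlus_pos hC).ne'
  hasDerivAt_slope v := by
    have : HasDerivAt (fun u : ℝ => 2 * u + 2 * xiPlus C) 2 v := by
      simpa using ((hasDerivAt_id v).const_mul 2).add_const (2 * xiPlus C)
    exact this.neg
  hasDerivAt_boundary v := by
    refine (hasDerivAt_pow 2 v).neg.congr_deriv ?_
    push_cast; ring
  mono := Or.inl ⟨xiPlus_pos hC, fun s t h => by
    have := Real.exp_le_exp.2 (neg_le_neg h)
    simp only
    linarith⟩

theorem b2Cand_of_eq_exp {C : ℝ} (hC : 1 ≤ C) {x : ℝ × ℝ} (hx : x ∈ Omega C)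
    (h : x.2 = Real.exp x.1) : b2Cand C x = x.1 ^ 2 := by
  rw [b2Cand, uPlus_of_eq_exp hC hx h]; ring

theorem le_lintegral_sq {C a b : ℝ} (hC : 1 ≤ C) (hab : a < b) {φ : ℝ → ℝ}
    (hφ : ExpClass C φ a b) : ENNReal.ofReal ((b - a) * b2Cand C (meanPoint φ a b)) ≤
      ∫⁻ t in Ioc a b, ENNReal.ofReal (φ t ^ 2) := by
  have hO := hφ.mem_Omega le_rfl hab le_rfl
  rcases eq_exp_or_lt hO with h | h
  · rw [lintegral_const_of_mem hab hφ h (fun t => ENNReal.ofReal (t ^ 2)),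
      ← ENNReal.ofReal_mul (by linarith), b2Cand_of_eq_exp hC hO h]
  · have hC1 := one_lt_of_exp_lt hO h
    have hξ1 := (xiPlus_spec hC1.le).2.1
    refine le_lintegral_of_tangentData (κ := 2) hC1 hab (tangentData_b2 hC1) (fun t => sq_nonneg t)
      (fun s hs t => ?_) zero_le_two (fun t => by nlinarith [sq_nonneg t])
      (fun t => by linarith [le_abs_self t]) (fun x _ => by rw [b2Cand]; ring) hφ h
    rw [mul_pow]
    have : s ^ 2 ≤ 1 := pow_le_one₀ hs.1 hs.2
    nlinarith [sq_nonneg t]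

/-! ### The slope function for `|φ|^p` -/

/-- The odd power `|s|^α sgn s`. -/
noncomputable def signPow (α s : ℝ) : ℝ := |s| ^ α * Real.sign s

theorem signPow_of_nonneg {α : ℝ} (hα : 0 < α) {s : ℝ} (hs : 0 ≤ s) : signPow α s = s ^ α := by
  rcases hs.eq_or_lt with h | h
  · rw [signPow, ← h, abs_zero, Real.sign_zero, mul_zero, Real.zero_rpow hα.ne']
  · rw [signPow, abs_of_pos h, Real.sign_of_pos h, mul_one]

theorem signPow_of_nonpos {α : ℝ} (hα : 0 < α) {s : ℝ} (hs : s ≤ 0) :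
    signPow α s = -(-s) ^ α := by
  rcases hs.eq_or_lt with h | h
  · rw [signPow, h, abs_zero, Real.sign_zero, mul_zero, neg_zero, Real.zero_rpow hα.ne', neg_zero]
  · rw [signPow, abs_of_neg h, Real.sign_of_neg h, mul_neg_one]

theorem continuous_signPow {α : ℝ} (hα : 0 < α) : Continuous (signPow α) := by
  have e : signPow α = fun s => (max s 0) ^ α - (max (-s) 0) ^ α := by
    ext s
    rcases le_total 0 s with h | h
    · rw [signPow_of_nonneg hα h, max_eq_left h, max_eq_right (by linarith),
        Real.zero_rpow hα.ne', sub_zero]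
    · rw [signPow_of_nonpos hα h, max_eq_right h, max_eq_left (by linarith),
        Real.zero_rpow hα.ne', zero_sub]
  rw [e]
  exact ((continuous_id.max continuous_const).rpow_const fun _ => Or.inr hα.le).sub
    ((continuous_neg.max continuous_const).rpow_const fun _ => Or.inr hα.le)

theorem abs_signPow_le {α : ℝ} (h0 : 0 < α) (h1 : α ≤ 1) (s : ℝ) : |signPow α s| ≤ 1 + |s| := by
  have key : ∀ r : ℝ, 0 ≤ r → r ^ α ≤ 1 + r := by
    intro r hr
    rcases le_total r 1 with h | h
    · linarith [Real.rpow_le_one hr h h0.le]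
    · have := Real.rpow_le_rpow_of_exponent_le h h1
      rw [Real.rpow_one] at this; linarith
  rcases le_total 0 s with h | h
  · rw [signPow_of_nonneg h0 h, abs_of_nonneg (Real.rpow_nonneg h _), abs_of_nonneg h]
    exact key s h
  · rw [signPow_of_nonpos h0 h, abs_neg, abs_of_nonneg (Real.rpow_nonneg (by linarith) _),
      abs_of_nonpos h]
    exact key (-s) (by linarith)

theorem integrableOn_mul_exp {ξ : ℝ} (hξ : 0 < ξ) {k : ℝ → ℝ} (hk : Continuous k) {A : ℝ}
    (hkA : ∀ s, |k s| ≤ A * (1 + |s|)) (u : ℝ) :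
    IntegrableOn (fun s => k s * Real.exp (-s / ξ)) (Ioi u) := by
  refine integrable_of_isBigO_exp_neg (b := (2 * ξ)⁻¹) (by positivity) (by fun_prop) ?_
  have hA : 0 ≤ A := by
    have := (abs_nonneg _).trans (hkA 0); simpa using this
  refine Asymptotics.IsBigO.of_bound (A * (1 + 2 * ξ)) ?_
  filter_upwards [eventually_ge_atTop 0] with s hs
  rw [norm_mul, Real.norm_eq_abs, Real.norm_eq_abs, Real.norm_eq_abs, abs_of_pos (Real.exp_pos _),
    abs_of_pos (Real.exp_pos _)]
  have h1 := hkA s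
  rw [abs_of_nonneg hs] at h1
  have h2 := Real.add_one_le_exp (s / (2 * ξ))
  have h3 : 0 ≤ s / (2 * ξ) := by positivity
  have h4 : 1 + s ≤ (1 + 2 * ξ) * Real.exp (s / (2 * ξ)) := by
    have e : s = 2 * ξ * (s / (2 * ξ)) := by field_simp
    nlinarith
  have h5 : Real.exp (-s / ξ) = Real.exp (-(2 * ξ)⁻¹ * s) * (Real.exp (s / (2 * ξ)))⁻¹ := by
    rw [← Real.exp_neg, ← Real.exp_add]; congr 1; field_simp; ring
  have h6 := h1.trans (mul_le_mul_of_nonneg_left h4 hA)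
  have hE := Real.exp_pos (s / (2 * ξ))
  rw [h5]
  calc _ ≤ A * ((1 + 2 * ξ) * Real.exp (s / (2 * ξ))) *
        (Real.exp (-(2 * ξ)⁻¹ * s) * (Real.exp (s / (2 * ξ)))⁻¹) :=
        mul_le_mul_of_nonneg_right h6 (by positivity)
    _ = _ := by field_simp

theorem integral_affine_mul_exp {ξ : ℝ} (hξ : 0 < ξ) (k c u : ℝ) :
    ∫ s in Ioi u, (k * s + c) * Real.exp (-s / ξ) =
      ξ * (k * u + k * ξ + c) * Real.exp (-u / ξ) := by
  have hint : IntegrableOn (fun s => (k * s + c) * Real.exp (-s / ξ)) (Ioi u) := by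
    refine integrableOn_mul_exp hξ (by fun_prop) (A := |k| + |c|) (fun s => ?_) u
    calc |k * s + c| ≤ |k * s| + |c| := abs_add_le _ _
      _ ≤ _ := by
        rw [abs_mul]
        nlinarith [mul_nonneg (abs_nonneg k) (abs_nonneg s), mul_nonneg (abs_nonneg c) (abs_nonneg s),
          abs_nonneg k, abs_nonneg c]
  have hexp : ∀ s : ℝ, HasDerivAt (fun s : ℝ => Real.exp (-s / ξ)) (Real.exp (-s / ξ) * (-1 / ξ)) s := by
    intro s
    have : HasDerivAt (fun s : ℝ => -s / ξ) (-1 / ξ) s := (hasDerivAt_id s).neg.div_const ξ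
    exact this.exp
  have hd : ∀ s : ℝ, HasDerivAt (fun s => -(ξ * (k * s + k * ξ + c) * Real.exp (-s / ξ)))
      ((k * s + c) * Real.exp (-s / ξ)) s := by
    intro s
    have h1 : HasDerivAt (fun s : ℝ => ξ * (k * s + k * ξ + c)) (ξ * k) s := by
      have := (((hasDerivAt_id s).const_mul k).add_const (k * ξ)).add_const c
      simpa using this.const_mul ξ
    refine ((h1.mul (hexp s)).neg).congr_deriv ?_
    field_simp
    ring
  have hlim : Tendsto (fun s => -(ξ * (k * s + k * ξ + c) * Real.exp (-s / ξ))) atTop (𝓝 0) := by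
    have h1 : Tendsto (fun s : ℝ => s / ξ) atTop atTop := tendsto_id.atTop_div_const hξ
    have h2 : Tendsto (fun s : ℝ => s * Real.exp (-s)) atTop (𝓝 0) := by
      simpa using Real.tendsto_pow_mul_exp_neg_atTop_nhds_zero 1
    have h3 := Real.tendsto_exp_neg_atTop_nhds_zero
    have h4 := (((h2.comp h1).const_mul (-(ξ * k * ξ))).add
      ((h3.comp h1).const_mul (-(ξ * (k * ξ + c)))))
    simp only [mul_zero, add_zero] at h4
    refine h4.congr fun s => ?_
    simp only [Function.comp_apply, neg_div]
    field_simp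
    ring
  rw [integral_Ioi_of_hasDerivAt_of_tendsto (hd u).continuousAt.continuousWithinAt
    (fun s _ => hd s) hint hlim]
  ring

/-- The slope of `b_{p,C}` along the tangents. -/
noncomputable def powSlope (p ξ u : ℝ) : ℝ :=
  p / ξ * Real.exp (u / ξ) * ∫ s in Ioi u, signPow (p - 1) s * Real.exp (-s / ξ)

/-- The derivative of `powSlope`. -/
noncomputable def powSlopeDeriv (p ξ u : ℝ) : ℝ := (powSlope p ξ u - p * signPow (p - 1) u) / ξ

section

variable {p ξ : ℝ}

theorem integrableOn_signPow_mul_exp (hp : 1 < p) (hp2 : p ≤ 2) (hξ : 0 < ξ) (u : ℝ) :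
    IntegrableOn (fun s => signPow (p - 1) s * Real.exp (-s / ξ)) (Ioi u) :=
  integrableOn_mul_exp hξ (continuous_signPow (by linarith)) (A := 1)
    (fun s => by rw [one_mul]; exact abs_signPow_le (by linarith) (by linarith) s) u

theorem hasDerivAt_exp_div (ξ u : ℝ) :
    HasDerivAt (fun u : ℝ => Real.exp (u / ξ)) (Real.exp (u / ξ) * (1 / ξ)) u := by
  have : HasDerivAt (fun u : ℝ => u / ξ) (1 / ξ) u := (hasDerivAt_id u).div_const ξ
  exact this.exp

theorem hasDerivAt_exp_neg_div (ξ u : ℝ) :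
    HasDerivAt (fun u : ℝ => Real.exp (-u / ξ)) (Real.exp (-u / ξ) * (-1 / ξ)) u := by
  have : HasDerivAt (fun u : ℝ => -u / ξ) (-1 / ξ) u := (hasDerivAt_id u).neg.div_const ξ
  exact this.exp

/-- The slope solves `ξ m' = m - p |u|^{p-1} sgn u`, the equation that `TangentData` imposes for the
boundary values `|u|^p`. The integral from `u` to infinity selects the solution without exponential
growth. -/
theorem hasDerivAt_powSlope (hp : 1 < p) (hp2 : p ≤ 2) (hξ : 0 < ξ) (u : ℝ) :
    HasDerivAt (powSlope p ξ) (powSlopeDeriv p ξ u) u := by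
  set k : ℝ → ℝ := fun s => signPow (p - 1) s * Real.exp (-s / ξ) with hk
  have hkc : Continuous k := by
    have := continuous_signPow (show 0 < p - 1 by linarith)
    fun_prop
  have hJ : HasDerivAt (fun u => ∫ s in Ioi u, k s) (-k u) u := by
    have h1 := ((hkc.integral_hasStrictDerivAt u u).hasDerivAt).const_sub (∫ s in Ioi u, k s)
    refine h1.congr_of_eventuallyEq (Eventually.of_forall fun v => ?_)
    have := intervalIntegral.integral_Ioi_sub_Ioi' (integrableOn_signPow_mul_exp hp hp2 hξ u)
      (integrableOn_signPow_mul_exp hp hp2 hξ v)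
    simp only [hk] at this ⊢
    linarith
  refine (((hasDerivAt_exp_div ξ u).const_mul (p / ξ)).mul hJ).congr_deriv ?_
  have e : Real.exp (-u / ξ) = (Real.exp (u / ξ))⁻¹ := by rw [← Real.exp_neg, neg_div]
  simp only [hk, powSlopeDeriv, powSlope, e]
  have := (Real.exp_pos (u / ξ)).ne'
  field_simp
  ring

/-- The weight `e^{(u - s)/ξ} / ξ` on `s > u` is a probability density of mean `u + ξ`, so an
integrand of linear growth gives linear growth in `u`. -/
theorem abs_powSlope_le (hp : 1 < p) (hp2 : p ≤ 2) (hξ : 0 < ξ) (hξ1 : ξ < 1) (u : ℝ) :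
    |powSlope p ξ u| ≤ 6 * (1 + |u|) := by
  have h1 : |∫ s in Ioi u, signPow (p - 1) s * Real.exp (-s / ξ)| ≤
      ∫ s in Ioi u, (1 * s + (1 + 2 * |u|)) * Real.exp (-s / ξ) := by
    refine abs_integral_le_integral_abs.trans ?_
    refine setIntegral_mono_on (integrableOn_signPow_mul_exp hp hp2 hξ u).abs ?_ measurableSet_Ioi
      fun s hs => ?_
    · refine integrableOn_mul_exp hξ (by fun_prop) (A := 1 + 2 * |u|) (fun s => ?_) u
      rw [abs_le]
      constructor <;> rcases abs_cases s with h | h <;> nlinarith [abs_nonneg u]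
    · rw [abs_mul, abs_of_pos (Real.exp_pos _)]
      apply mul_le_mul_of_nonneg_right _ (Real.exp_pos _).le
      have := abs_signPow_le (show 0 < p - 1 by linarith) (by linarith) s
      have hs' : u < s := hs
      rcases abs_cases s with h | h <;> rcases abs_cases u with h' | h' <;> linarith
  rw [integral_affine_mul_exp hξ] at h1
  rw [powSlope, abs_mul, abs_of_pos (mul_pos (div_pos (by linarith) hξ) (Real.exp_pos _))]
  have e : Real.exp (-u / ξ) = (Real.exp (u / ξ))⁻¹ := by rw [← Real.exp_neg, neg_div]
  have hE := Real.exp_pos (u / ξ)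
  calc _ ≤ p / ξ * Real.exp (u / ξ) * (ξ * (1 * u + 1 * ξ + (1 + 2 * |u|)) * Real.exp (-u / ξ)) :=
        mul_le_mul_of_nonneg_left h1 (by positivity)
    _ = p * (u + ξ + (1 + 2 * |u|)) := by rw [e]; field_simp
    _ ≤ 2 * (u + ξ + (1 + 2 * |u|)) := by
        apply mul_le_mul_of_nonneg_right hp2
        rcases abs_cases u with h | h <;> linarith
    _ ≤ _ := by linarith [le_abs_self u]

theorem powSlope_two (hξ : 0 < ξ) (u : ℝ) : powSlope 2 ξ u = 2 * u + 2 * ξ := by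
  have h : ∀ s : ℝ, signPow (2 - 1) s * Real.exp (-s / ξ) = (1 * s + 0) * Real.exp (-s / ξ) := by
    intro s
    congr 1
    rw [show (2 : ℝ) - 1 = 1 by norm_num]
    rcases le_total 0 s with h | h
    · rw [signPow_of_nonneg one_pos h, Real.rpow_one]; ring
    · rw [signPow_of_nonpos one_pos h, Real.rpow_one]; ring
  rw [powSlope]
  simp only [h]
  rw [integral_affine_mul_exp hξ]
  have e : Real.exp (-u / ξ) = (Real.exp (u / ξ))⁻¹ := by rw [← Real.exp_neg, neg_div]
  have := (Real.exp_pos (u / ξ)).ne'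
  rw [e]; field_simp; ring

/-- Concavity bound on the positive half-line. -/
theorem powSlopeDeriv_le_of_pos (hp : 1 < p) (hp2 : p ≤ 2) (hξ : 0 < ξ) {u : ℝ} (hu : 0 < u) :
    powSlopeDeriv p ξ u ≤ p * (p - 1) * u ^ (p - 2) := by
  set α := p - 1 with hα
  have hα0 : 0 < α := by linarith
  set c := α * u ^ (p - 2) with hc
  have huα : u ^ α = u ^ (p - 2) * u := by
    rw [hα, show p - 1 = (p - 2) + 1 by ring, Real.rpow_add_one hu.ne']
  have hle : ∀ s ∈ Ioi u, signPow α s * Real.exp (-s / ξ) ≤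
      (c * s + (u ^ α - c * u)) * Real.exp (-s / ξ) := by
    intro s hs
    have hs' : u < s := hs
    apply mul_le_mul_of_nonneg_right _ (Real.exp_pos _).le
    rw [signPow_of_nonneg hα0 (by linarith)]
    -- Bernoulli's inequality for an exponent in `(0, 1]`: the concave power lies below its tangent
    -- at `u`, and the affine integrand can be integrated explicitly.
    have hb := rpow_one_add_le_one_add_mul_self (s := s / u - 1) (p := α) (by
      have : 0 < s / u := div_pos (hu.trans hs') hu
      linarith) hα0.le (by linarith)
    rw [add_sub_cancel, Real.div_rpow (by linarith) hu.le, div_le_iff₀ (by positivity)] at hb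
    refine hb.trans (le_of_eq ?_)
    rw [hc, huα]
    field_simp
    ring
  have hint2 : IntegrableOn (fun s => (c * s + (u ^ α - c * u)) * Real.exp (-s / ξ)) (Ioi u) := by
    refine integrableOn_mul_exp hξ (by fun_prop) (A := |c| + |u ^ α - c * u|) (fun s => ?_) u
    calc _ ≤ |c * s| + |u ^ α - c * u| := abs_add_le _ _
      _ ≤ _ := by
        rw [abs_mul]
        nlinarith [mul_nonneg (abs_nonneg (u ^ α - c * u)) (abs_nonneg s), abs_nonneg c]
  have h1 := setIntegral_mono_on (integrableOn_signPow_mul_exp hp hp2 hξ u) hint2 measurableSet_Ioi hle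
  rw [integral_affine_mul_exp hξ] at h1
  have e : Real.exp (-u / ξ) = (Real.exp (u / ξ))⁻¹ := by rw [← Real.exp_neg, neg_div]
  have hE := Real.exp_pos (u / ξ)
  have h2 : powSlope p ξ u ≤ p * (u ^ α + c * ξ) := by
    rw [powSlope]
    calc _ ≤ p / ξ * Real.exp (u / ξ) * (ξ * (c * u + c * ξ + (u ^ α - c * u)) * Real.exp (-u / ξ)) :=
          mul_le_mul_of_nonneg_left h1 (by have : 0 < p := by linarith
                                           positivity)
      _ = _ := by rw [e]; field_simp; ring
  rw [powSlopeDeriv, signPow_of_nonneg hα0 hu.le, div_le_iff₀ hξ]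
  linarith

/-- `Γ` is convex and takes the value one at both `1` and `2`. -/
theorem Gamma_le_one (hp : 1 ≤ p) (hp2 : p ≤ 2) : Real.Gamma p ≤ 1 := by
  have := Real.convexOn_Gamma.2 (show (1 : ℝ) ∈ Ioi (0 : ℝ) by simp) (show (2 : ℝ) ∈ Ioi (0 : ℝ) by simp)
    (by linarith : 0 ≤ 2 - p) (by linarith : 0 ≤ p - 1) (by ring)
  simp only [smul_eq_mul, Real.Gamma_one, Real.Gamma_two] at this
  rw [show (2 - p) * 1 + (p - 1) * 2 = p by ring] at this
  linarith

theorem powSlope_zero_le (hp : 1 < p) (hp2 : p ≤ 2) (hξ : 0 < ξ) :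
    powSlope p ξ 0 ≤ p * ξ ^ (p - 1) := by
  have h : ∫ s in Ioi (0 : ℝ), signPow (p - 1) s * Real.exp (-s / ξ) =
      ∫ s in Ioi (0 : ℝ), s ^ (p - 1) * Real.exp (-(ξ⁻¹ * s)) := by
    apply setIntegral_congr_fun measurableSet_Ioi
    intro s hs
    simp only
    rw [signPow_of_nonneg (by linarith) (mem_Ioi.1 hs).le]
    congr 2; field_simp
  rw [powSlope, h, Real.integral_rpow_mul_exp_neg_mul_Ioi (by linarith) (inv_pos.2 hξ), one_div,
    inv_inv, zero_div, Real.exp_zero, mul_one]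
  have e : ξ ^ p = ξ ^ (p - 1) * ξ := by
    conv_lhs => rw [show p = (p - 1) + 1 by ring, Real.rpow_add_one hξ.ne']
  rw [e]
  have := Gamma_le_one hp.le hp2
  calc _ = p * ξ ^ (p - 1) * Real.Gamma p := by field_simp
    _ ≤ p * ξ ^ (p - 1) * 1 := mul_le_mul_of_nonneg_left this (by positivity)
    _ = _ := mul_one _

end

section

variable {p ξ : ℝ}

theorem hasDerivAt_signPow {α : ℝ} (hα : 0 < α) {u : ℝ} (hu : u ≠ 0) :
    HasDerivAt (signPow α) (α * |u| ^ (α - 1)) u := by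
  rcases lt_or_gt_of_ne hu with h | h
  · have h1 : HasDerivAt (fun s : ℝ => -(-s) ^ α) (α * |u| ^ (α - 1)) u := by
      have := (((hasDerivAt_id u).neg).rpow_const (p := α) (Or.inl (by simpa using hu))).neg
      refine this.congr_deriv ?_
      rw [abs_of_neg h]; simp
    refine h1.congr_of_eventuallyEq ?_
    filter_upwards [Iio_mem_nhds h] with s hs
    exact signPow_of_nonpos hα (mem_Iio.1 hs).le
  · have h1 : HasDerivAt (fun s : ℝ => s ^ α) (α * |u| ^ (α - 1)) u := by
      rw [abs_of_pos h]
      exact Real.hasDerivAt_rpow_const (Or.inl hu)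
    refine h1.congr_of_eventuallyEq ?_
    filter_upwards [Ioi_mem_nhds h] with s hs
    exact signPow_of_nonneg hα (mem_Ioi.1 hs).le

theorem hasDerivAt_powSlopeDeriv (hp : 1 < p) (hp2 : p ≤ 2) (hξ : 0 < ξ) {u : ℝ} (hu : u ≠ 0) :
    HasDerivAt (powSlopeDeriv p ξ)
      ((powSlopeDeriv p ξ u - p * (p - 1) * |u| ^ (p - 2)) / ξ) u := by
  refine (((hasDerivAt_powSlope hp hp2 hξ u).sub
    ((hasDerivAt_signPow (show 0 < p - 1 by linarith) hu).const_mul p)).div_const ξ).congr_deriv ?_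
  rw [show p - 1 - 1 = p - 2 by ring]; ring

theorem continuous_powSlopeDeriv (hp : 1 < p) (hp2 : p ≤ 2) (hξ : 0 < ξ) :
    Continuous (powSlopeDeriv p ξ) := by
  have h1 : Continuous (powSlope p ξ) :=
    continuous_iff_continuousAt.2 fun v => (hasDerivAt_powSlope hp hp2 hξ v).continuousAt
  exact (h1.sub ((continuous_signPow (by linarith)).const_mul p)).div_const ξ

/-- Comparison with a linear solution. For `c = (2 - p)^{p-2}` the function `p c (u + ξ)` satisfies
the slope equation with `c u` in place of the odd power, and on `[-(2 - p), 0]` the odd power is at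
most `c u`. Hence `e^{-u/ξ}` times the difference of the two slopes is nondecreasing there. At `0`
it is nonpositive, by `powSlope_zero_le` and `2 - p ≤ ξ`, so it is nonpositive at `-(2 - p)` as
well. -/
theorem powSlopeDeriv_critical_le (hp : 1 < p) (hp2 : p < 2) (hξ : 0 < ξ) (hq : 2 - p ≤ ξ) :
    powSlopeDeriv p ξ (-(2 - p)) ≤ p * (2 - p) ^ (p - 2) := by
  set q := 2 - p with hqdef
  have hq0 : 0 < q := by linarith
  set c := q ^ (p - 2) with hc
  have hα : 0 < p - 1 := by linarith
  have hΘ : ∀ u, HasDerivAt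
      (fun u => Real.exp (-u / ξ) * (powSlope p ξ u + p * c * (-u - ξ)))
      (Real.exp (-u / ξ) * (p / ξ) * (-signPow (p - 1) u + c * u)) u := by
    intro u
    have h1 : HasDerivAt (fun u : ℝ => p * c * (-u - ξ)) (p * c * -1) u :=
      ((hasDerivAt_id u).neg.sub_const ξ).const_mul (p * c)
    refine ((hasDerivAt_exp_neg_div ξ u).mul
      ((hasDerivAt_powSlope hp hp2.le hξ u).add h1)).congr_deriv ?_
    simp only [Pi.add_apply, powSlopeDeriv]
    field_simp
    ring
  have hmono := le_of_hasDerivAt_nonneg (by linarith : -q ≤ 0) hΘ (fun u hu => by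
    have hE := Real.exp_pos (-u / ξ)
    have hpos : 0 ≤ Real.exp (-u / ξ) * (p / ξ) := by
      have : 0 < p := by linarith
      positivity
    refine mul_nonneg hpos ?_
    rw [signPow_of_nonpos hα hu.2, neg_neg]
    rcases hu.2.eq_or_lt with h | h
    · rw [h]; simp [Real.zero_rpow hα.ne']
    · have h1 : (-u) ^ (p - 1) = (-u) ^ (p - 2) * (-u) := by
        rw [show p - 1 = (p - 2) + 1 by ring, Real.rpow_add_one (by linarith)]
      have h2 : c ≤ (-u) ^ (p - 2) :=
        Real.rpow_le_rpow_of_nonpos (by linarith) (by linarith [hu.1]) (by linarith)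
      rw [h1]
      nlinarith)
  have h0 := powSlope_zero_le hp hp2.le hξ
  have h1 : ξ ^ (p - 1) ≤ c * ξ := by
    rw [show p - 1 = (p - 2) + 1 by ring, Real.rpow_add_one hξ.ne']
    exact mul_le_mul_of_nonneg_right
      (Real.rpow_le_rpow_of_nonpos hq0 hq (by linarith)) hξ.le
  have h2 := mul_le_mul_of_nonneg_left h1 (by linarith : 0 ≤ p)
  simp only [neg_zero, zero_div, Real.exp_zero, one_mul, zero_sub, neg_neg] at hmono
  have h3 : powSlope p ξ (-q) + p * c * (q - ξ) ≤ 0 := by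
    by_contra! hcon
    have := mul_pos (Real.exp_pos (q / ξ)) hcon
    linarith
  have h4 : q ^ (p - 1) = c * q := by
    rw [show p - 1 = (p - 2) + 1 by ring, Real.rpow_add_one hq0.ne']
  rw [powSlopeDeriv, signPow_of_nonpos hα (by linarith), neg_neg, h4, div_le_iff₀ hξ]
  linarith

/-- After multiplication by the integrating factor `e^{-u/ξ}`, the derivative of the difference `Ψ`
of the two sides no longer contains the slope: its sign is that of `(2 - p)/|u| - 1`. So `Ψ` is
minimal at `u = -(2 - p)`. There `powSlopeDeriv_critical_le` leaves a positive multiple of `ξ - (2 -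
p)`, which is where the condition on `C` enters. -/
theorem powSlopeDeriv_le_of_neg (hp : 1 < p) (hp2 : p < 2) (hξ : 0 < ξ) (hξ1 : ξ < 1)
    (hq : 2 - p ≤ ξ) {u : ℝ} (hu : u < 0) :
    (1 - ξ) * powSlopeDeriv p ξ u ≤ p * (p - 1) * |u| ^ (p - 2) := by
  set q := 2 - p with hqdef
  have hq0 : 0 < q := by linarith
  set Ψ : ℝ → ℝ := fun u =>
    Real.exp (-u / ξ) * (p * (p - 1) * |u| ^ (p - 2) - (1 - ξ) * powSlopeDeriv p ξ u) with hΨ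
  have habs : ∀ u < (0 : ℝ), HasDerivAt (fun u : ℝ => |u| ^ (p - 2)) (q * |u| ^ (p - 2) / |u|) u := by
    intro u hu
    have h1 : HasDerivAt (fun s : ℝ => (-s) ^ (p - 2)) (q * |u| ^ (p - 2) / |u|) u := by
      have := ((hasDerivAt_id u).neg).rpow_const (p := p - 2) (Or.inl (by simpa using hu.ne))
      refine this.congr_deriv ?_
      have hu' : 0 < -u := by linarith
      simp only [Pi.neg_apply, id_eq]
      rw [abs_of_neg hu, Real.rpow_sub_one hu'.ne', hqdef]; ring
    refine h1.congr_of_eventuallyEq ?_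
    filter_upwards [Iio_mem_nhds hu] with s hs
    rw [abs_of_neg (mem_Iio.1 hs)]
  have hd : ∀ u < (0 : ℝ), HasDerivAt Ψ
      (Real.exp (-u / ξ) * (p * (p - 1) * |u| ^ (p - 2)) * (-1 + q / |u|)) u := by
    intro u hu
    have hu' : |u| ≠ 0 := abs_ne_zero.2 hu.ne
    refine ((hasDerivAt_exp_neg_div ξ u).mul (((habs u hu).const_mul (p * (p - 1))).sub
      ((hasDerivAt_powSlopeDeriv hp hp2.le hξ hu.ne).const_mul (1 - ξ)))).congr_deriv ?_
    simp only [Pi.sub_apply]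
    field_simp
    ring
  have hcoef : ∀ u : ℝ, 0 ≤ Real.exp (-u / ξ) * (p * (p - 1) * |u| ^ (p - 2)) := by
    intro u
    have h1 := Real.exp_pos (-u / ξ)
    have h2 : 0 < p * (p - 1) := mul_pos (by linarith) (by linarith)
    have h3 := Real.rpow_nonneg (abs_nonneg u) (p - 2)
    positivity
  have hcrit : 0 ≤ Ψ (-q) := by
    have h1 := powSlopeDeriv_critical_le hp hp2 hξ hq
    simp only [hΨ]
    rw [abs_neg, abs_of_pos hq0]
    refine mul_nonneg (Real.exp_pos _).le ?_
    have h2 := Real.rpow_nonneg hq0.le (p - 2)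
    have h3 := mul_le_mul_of_nonneg_left h1 (by linarith : 0 ≤ 1 - ξ)
    have h4 : 0 ≤ p * q ^ (p - 2) * (p - 1 - (1 - ξ)) :=
      mul_nonneg (mul_nonneg (by linarith) h2) (by linarith)
    linarith
  have hΨu : 0 ≤ Ψ u := by
    rcases le_total u (-q) with h | h
    · have hanti : AntitoneOn Ψ (Iic (-q)) := by
        refine antitoneOn_of_deriv_nonpos (convex_Iic _)
          (fun s hs => (hd s (by linarith [mem_Iic.1 hs])).continuousAt.continuousWithinAt)
          (fun s hs => ?_) (fun s hs => ?_)
        all_goals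
          rw [interior_Iic] at hs
          have hs0 : s < 0 := by linarith [mem_Iio.1 hs]
        · exact (hd s hs0).differentiableAt.differentiableWithinAt
        · rw [(hd s hs0).deriv]
          refine mul_nonpos_of_nonneg_of_nonpos (hcoef s) ?_
          rw [abs_of_neg hs0]
          have : q / -s ≤ 1 := by
            rw [div_le_one (by linarith)]; linarith [mem_Iio.1 hs]
          linarith
      exact hcrit.trans (hanti (mem_Iic.2 h) (mem_Iic.2 le_rfl) h)
    · have hmono : MonotoneOn Ψ (Ico (-q) 0) := by
        refine monotoneOn_of_deriv_nonneg (convex_Ico _ _)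
          (fun s hs => (hd s hs.2).continuousAt.continuousWithinAt)
          (fun s hs => ?_) (fun s hs => ?_)
        all_goals rw [interior_Ico] at hs
        · exact (hd s hs.2).differentiableAt.differentiableWithinAt
        · rw [(hd s hs.2).deriv]
          refine mul_nonneg (hcoef s) ?_
          rw [abs_of_neg hs.2]
          have : 1 ≤ q / -s := by
            rw [le_div_iff₀ (by linarith [hs.2])]; linarith [hs.1]
          linarith
      exact hcrit.trans (hmono ⟨le_rfl, by linarith⟩ ⟨h, hu⟩ h)
  have := nonneg_of_mul_nonneg_right hΨu (Real.exp_pos _)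
  linarith

/-- Away from `0` the slope equation turns the sign of the derivative into the inequality of
`powSlopeDeriv_le_of_neg`, and of `powSlopeDeriv_le_of_pos` with the factor `1 - ξ ≤ 1` to spare. At
`0` continuity suffices to join the two half-lines. -/
theorem antitone_exp_neg_mul_powSlopeDeriv (hp : 1 < p) (hp2 : p < 2) (hξ : 0 < ξ) (hξ1 : ξ < 1)
    (hq : 2 - p ≤ ξ) : Antitone fun v => Real.exp (-v) * powSlopeDeriv p ξ v := by
  have hc : Continuous fun v => Real.exp (-v) * powSlopeDeriv p ξ v :=
    (Real.continuous_exp.comp continuous_neg).mul (continuous_powSlopeDeriv hp hp2.le hξ)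
  have hd : ∀ u ≠ (0 : ℝ), HasDerivAt (fun v => Real.exp (-v) * powSlopeDeriv p ξ v)
      (Real.exp (-u) / ξ * ((1 - ξ) * powSlopeDeriv p ξ u - p * (p - 1) * |u| ^ (p - 2))) u := by
    intro u hu
    refine ((hasDerivAt_neg u).exp.mul (hasDerivAt_powSlopeDeriv hp hp2.le hξ hu)).congr_deriv ?_
    field_simp
    ring
  have hle : ∀ u ≠ (0 : ℝ), (1 - ξ) * powSlopeDeriv p ξ u ≤ p * (p - 1) * |u| ^ (p - 2) := by
    intro u hu
    rcases lt_or_gt_of_ne hu with h | h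
    · exact powSlopeDeriv_le_of_neg hp hp2 hξ hξ1 hq h
    · have h1 := powSlopeDeriv_le_of_pos hp hp2.le hξ h
      have h2 : 0 ≤ p * (p - 1) * u ^ (p - 2) :=
        mul_nonneg (mul_nonneg (by linarith) (by linarith)) (Real.rpow_nonneg h.le _)
      rw [abs_of_pos h]
      have h3 := mul_le_mul_of_nonneg_left h1 (by linarith : 0 ≤ 1 - ξ)
      nlinarith
  have hneg : ∀ u ≠ (0 : ℝ), deriv (fun v => Real.exp (-v) * powSlopeDeriv p ξ v) u ≤ 0 := by
    intro u hu
    rw [(hd u hu).deriv]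
    exact mul_nonpos_of_nonneg_of_nonpos (div_nonneg (Real.exp_pos _).le hξ.le)
      (by linarith [hle u hu])
  refine AntitoneOn.Iic_union_Ici (a := 0) ?_ ?_
  · refine antitoneOn_of_deriv_nonpos (convex_Iic _) hc.continuousOn (fun s hs => ?_) fun s hs => ?_
    all_goals
      rw [interior_Iic] at hs
      have hs0 : s ≠ 0 := (mem_Iio.1 hs).ne
    · exact (hd s hs0).differentiableAt.differentiableWithinAt
    · exact hneg s hs0
  · refine antitoneOn_of_deriv_nonpos (convex_Ici _) hc.continuousOn (fun s hs => ?_) fun s hs => ?_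
    all_goals
      rw [interior_Ici] at hs
      have hs0 : s ≠ 0 := (mem_Ioi.1 hs).ne'
    · exact (hd s hs0).differentiableAt.differentiableWithinAt
    · exact hneg s hs0

end

/-! ### The lower bound for `|φ|^p`. -/

theorem hasDerivAt_abs_rpow_signPow {p : ℝ} (hp : 1 < p) (v : ℝ) :
    HasDerivAt (fun u : ℝ => |u| ^ p) (p * signPow (p - 1) v) v := by
  refine (hasDerivAt_abs_rpow v hp).congr_deriv ?_
  rcases lt_trichotomy v 0 with h | h | h
  · have h' : 0 < -v := by linarith
    rw [signPow_of_nonpos (by linarith) h.le, abs_of_neg h, show p - 1 = (p - 2) + 1 by ring,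
      Real.rpow_add_one h'.ne']; ring
  · rw [h, signPow_of_nonneg (by linarith) le_rfl, Real.zero_rpow (by linarith)]; simp
  · rw [signPow_of_nonneg (by linarith) h.le, abs_of_pos h, show p - 1 = (p - 2) + 1 by ring,
      Real.rpow_add_one h.ne']; ring

theorem tangentData_pow {p C : ℝ} (hp : 1 < p) (hp2 : p < 2) (hC : 1 < C)
    (hq : 2 - p ≤ xiPlus C) :
    TangentData (xiPlus C) (fun u => -powSlope p (xiPlus C) u) (fun u => -|u| ^ p)
      fun u => -powSlopeDeriv p (xiPlus C) u := by
  have hξ := xiPlus_pos hC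
  have hξ1 := (xiPlus_spec hC.le).2.1
  refine ⟨hξ1, hξ.ne', fun v => (hasDerivAt_powSlope hp hp2.le hξ v).neg, fun v => ?_,
    Or.inl ⟨hξ, fun s t h => ?_⟩⟩
  · refine (hasDerivAt_abs_rpow_signPow hp v).neg.congr_deriv ?_
    rw [powSlopeDeriv]; field_simp; ring
  · have := antitone_exp_neg_mul_powSlopeDeriv hp hp2 hξ hξ1 hq h
    simp only at this ⊢
    linarith

/-- The condition on `C` in terms of `ξ⁺`. -/
theorem two_sub_le_xiPlus {p C : ℝ} (hp : 1 < p) (hC : 1 ≤ C)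
    (h : Real.exp (p - 2) / (p - 1) ≤ C) : 2 - p ≤ xiPlus C := by
  obtain ⟨h0, h1, h2⟩ := xiPlus_spec hC
  set ξ := xiPlus C
  by_contra! hlt
  rw [div_le_iff₀ (by linarith)] at h
  have e1 : Real.exp (p - 2) * (1 - ξ) ≤ Real.exp (-ξ) * (p - 1) := by
    rw [h2]; nlinarith
  have e2 : Real.exp (p - 2) = Real.exp (-ξ) * Real.exp (p - 2 + ξ) := by
    rw [← Real.exp_add]; congr 1; ring
  rw [e2, mul_assoc] at e1
  have e3 := le_of_mul_le_mul_left e1 (Real.exp_pos _)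
  have e4 : p - 2 + ξ + 1 < Real.exp (p - 2 + ξ) := Real.add_one_lt_exp (by linarith)
  nlinarith

theorem bCand_eq {p C : ℝ} (x : ℝ × ℝ) : bCand p C x =
    powSlope p (xiPlus C) (uPlus C x) * (x.1 - uPlus C x) + |uPlus C x| ^ p := rfl

theorem bCand_of_eq_exp {p C : ℝ} (hC : 1 ≤ C) {x : ℝ × ℝ} (hx : x ∈ Omega C)
    (h : x.2 = Real.exp x.1) : bCand p C x = |x.1| ^ p := by
  rw [bCand_eq, uPlus_of_eq_exp hC hx h]; ring

theorem bCand_two {C : ℝ} (hC : 1 ≤ C) {x : ℝ × ℝ} (hx : x ∈ Omega C) :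
    bCand 2 C x = b2Cand C x := by
  rcases eq_exp_or_lt hx with h | h
  · rw [bCand_of_eq_exp hC hx h, b2Cand_of_eq_exp hC hx h, ← sq_abs x.1]
    exact Real.rpow_two _
  · rw [bCand_eq, powSlope_two (xiPlus_pos (one_lt_of_exp_lt hx h)), Real.rpow_two, sq_abs, b2Cand]
    ring

theorem le_lintegral_pow {p C a b : ℝ} (hp : 1 < p) (hp2 : p ≤ 2) (hC : 1 ≤ C)
    (hpC : Real.exp (p - 2) / (p - 1) ≤ C) (hab : a < b) {φ : ℝ → ℝ} (hφ : ExpClass C φ a b) :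
    ENNReal.ofReal ((b - a) * bCand p C (meanPoint φ a b)) ≤
      ∫⁻ t in Ioc a b, ENNReal.ofReal (|φ t| ^ p) := by
  have hO := hφ.mem_Omega le_rfl hab le_rfl
  -- The monotonicity argument needs a critical point `-(2 - p)` different from `0`; for `p = 2` the
  -- slope is explicit.
  rcases hp2.eq_or_lt with h2 | h2
  · subst h2
    rw [bCand_two hC hO]
    simpa only [Real.rpow_two, sq_abs] using le_lintegral_sq hC hab hφ
  rcases eq_exp_or_lt hO with h | h
  · rw [lintegral_const_of_mem hab hφ h (fun t => ENNReal.ofReal (|t| ^ p)),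
      ← ENNReal.ofReal_mul (by linarith), bCand_of_eq_exp hC hO h]
  · have hC1 := one_lt_of_exp_lt hO h
    have hξ1 := (xiPlus_spec hC1.le).2.1
    refine le_lintegral_of_tangentData (κ := 6) hC1 hab
      (tangentData_pow hp h2 hC1 (two_sub_le_xiPlus hp hC hpC))
      (fun t => Real.rpow_nonneg (abs_nonneg t) p)
      (fun s hs t => ?_) (by norm_num) (fun t => ?_)
      (fun t => (le_abs_self _).trans (abs_powSlope_le hp hp2 (xiPlus_pos hC1) hξ1 t))
      (fun x _ => bCand_eq x) hφ h
    · apply Real.rpow_le_rpow (abs_nonneg _) _ (by linarith)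
      rw [abs_mul, abs_of_nonneg hs.1]
      exact mul_le_of_le_one_left (abs_nonneg t) hs.2
    · rcases le_total |t| 1 with h1 | h1
      · have := Real.rpow_le_one (abs_nonneg t) h1 (by linarith : 0 ≤ p)
        nlinarith [sq_nonneg t]
      · have := Real.rpow_le_rpow_of_exponent_le h1 hp2
        rw [Real.rpow_two, sq_abs] at this
        nlinarith [sq_nonneg t]

/-! ### The lower bound for `|φ|`: an affine piece between two tangents. -/

theorem mul_exp_xi {C ξ : ℝ} (h : Real.exp (-ξ) = C * (1 - ξ)) : C * Real.exp ξ * (1 - ξ) = 1 := by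
  rw [mul_right_comm, ← h, ← Real.exp_add]; simp

theorem xiPlus_rho {C : ℝ} (hC : 1 ≤ C) :
    C * Real.exp (xiPlus C) * (1 - xiPlus C) = 1 := mul_exp_xi (xiPlus_spec hC).2.2

theorem xiMinus_rho {C : ℝ} (hC : 1 ≤ C) :
    C * Real.exp (xiMinus C) * (1 - xiMinus C) = 1 := mul_exp_xi (xiMinus_spec hC).2

/-- The chord of `Ω_C` from `(0, 1)` to `(ξ, C e^ξ)` lies above the lower boundary. -/
theorem exp_le_tangent_of_mem {C ξ s : ℝ} (hC : 1 ≤ C) (h : C * Real.exp ξ * (1 - ξ) = 1)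
    (hs : s ∈ Icc (0 : ℝ) 1) : Real.exp (s * ξ) ≤ C * Real.exp ξ * (s * ξ) + 1 := by
  have h1 := convexOn_exp.2 (mem_univ (0 : ℝ)) (mem_univ ξ) (by linarith [hs.2] : 0 ≤ 1 - s) hs.1
    (by ring)
  simp only [smul_eq_mul, mul_zero, zero_add, Real.exp_zero, mul_one] at h1
  have h2 : s * Real.exp ξ ≤ s * (C * Real.exp ξ) := by
    apply mul_le_mul_of_nonneg_left _ hs.1
    nlinarith [Real.exp_pos ξ]
  have h3 : s * (C * Real.exp ξ - 1) = C * Real.exp ξ * (s * ξ) := by linear_combination s * h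
  linarith

theorem exp_le_tangent_plus {C y : ℝ} (hC : 1 < C) (h0 : 0 ≤ y) (h1 : y ≤ xiPlus C) :
    Real.exp y ≤ C * Real.exp (xiPlus C) * y + 1 := by
  have hξ := xiPlus_pos hC
  have := exp_le_tangent_of_mem hC.le (xiPlus_rho hC.le) (s := y / xiPlus C)
    ⟨div_nonneg h0 hξ.le, (div_le_one hξ).2 h1⟩
  rwa [div_mul_cancel₀ _ hξ.ne'] at this

theorem exp_le_tangent_minus {C y : ℝ} (hC : 1 < C) (h0 : y ≤ 0) (h1 : xiMinus C ≤ y) :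
    Real.exp y ≤ C * Real.exp (xiMinus C) * y + 1 := by
  have hξ := xiMinus_neg hC
  have := exp_le_tangent_of_mem hC.le (xiMinus_rho hC.le) (s := y / xiMinus C)
    ⟨div_nonneg_of_nonpos h0 hξ.le, (div_le_one_of_neg hξ).2 h1⟩
  rwa [div_mul_cancel₀ _ hξ.ne] at this

theorem rho_minus_lt_rho_plus {C : ℝ} (hC : 1 < C) :
    C * Real.exp (xiMinus C) < C * Real.exp (xiPlus C) :=
  mul_lt_mul_of_pos_left (Real.exp_lt_exp.2 ((xiMinus_neg hC).trans (xiPlus_pos hC))) (by linarith)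

theorem boundaryMinorant_of_continuous {C : ℝ} {M F : ℝ × ℝ → ℝ} {f : ℝ → ℝ} (hF : Continuous F)
    (hFf : ∀ t, F (t, Real.exp t) = f t) (h : ∀ x ∈ Omega C, F x ≤ M x) :
    BoundaryMinorant C M f := by
  intro t ε hε
  have h1 : Tendsto F (𝓝[Omega C] (t, Real.exp t)) (𝓝 (f t)) := by
    rw [← hFf]; exact (hF.tendsto _).mono_left nhdsWithin_le_nhds
  filter_upwards [h1.eventually (lt_mem_nhds (show f t - ε < f t by linarith)),
    self_mem_nhdsWithin] with x hx hxO
  exact hx.le.trans (h x hxO)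

section

variable {C : ℝ} {x y : ℝ × ℝ}

/-- The affine function that equals `b_{1,C}` on `Ω_0`. -/
noncomputable def b1Plane (C : ℝ) (x : ℝ × ℝ) : ℝ :=
  2 * ((1 - xiMinus C) * (1 - xiPlus C) / (xiPlus C - xiMinus C)) * (x.2 - 1) +
    (xiPlus C + xiMinus C - 2) / (xiPlus C - xiMinus C) * x.1

/-- The plane agrees with `-x.1` on one of the two tangents from `(0, 1)` and, by `b1Plane_sub`,
with `x.1` on the other; elsewhere the sign of the difference tells on which side of the tangent a
point lies. -/
theorem b1Plane_add (hC : 1 < C) (x : ℝ × ℝ) : b1Plane C x + x.1 =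
    2 * ((1 - xiMinus C) * (1 - xiPlus C) / (xiPlus C - xiMinus C)) *
      (x.2 - (C * Real.exp (xiMinus C) * x.1 + 1)) := by
  have h := xiMinus_rho hC.le
  have hR : xiPlus C - xiMinus C ≠ 0 := by linarith [xiMinus_neg hC, xiPlus_pos hC]
  rw [b1Plane]
  field_simp
  linear_combination (2 * (1 - xiPlus C) * x.1) * h

theorem b1Plane_sub (hC : 1 < C) (x : ℝ × ℝ) : b1Plane C x - x.1 =
    2 * ((1 - xiMinus C) * (1 - xiPlus C) / (xiPlus C - xiMinus C)) *
      (x.2 - (C * Real.exp (xiPlus C) * x.1 + 1)) := by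
  have h := xiPlus_rho hC.le
  have hR : xiPlus C - xiMinus C ≠ 0 := by linarith [xiMinus_neg hC, xiPlus_pos hC]
  rw [b1Plane]
  field_simp
  linear_combination (2 * (1 - xiMinus C) * x.1) * h

theorem b1Plane_coeff_pos (hC : 1 < C) :
    0 < 2 * ((1 - xiMinus C) * (1 - xiPlus C) / (xiPlus C - xiMinus C)) := by
  have h1 := xiMinus_neg hC
  have h2 := xiPlus_pos hC
  have h3 := (xiPlus_spec hC.le).2.1
  exact mul_pos two_pos (div_pos (mul_pos (by linarith) (by linarith)) (by linarith))

theorem mem_OmegaZero_iff (hC : 1 < C) : x ∈ OmegaZero C ↔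
    xiMinus C ≤ x.1 ∧ x.1 ≤ xiPlus C ∧ C * Real.exp (xiMinus C) * x.1 + 1 ≤ x.2 ∧
      C * Real.exp (xiPlus C) * x.1 + 1 ≤ x.2 ∧ x.2 ≤ C * Real.exp x.1 := by
  have h1 := xiMinus_neg hC
  have h2 := xiPlus_pos hC
  have h3 := rho_minus_lt_rho_plus hC
  constructor
  · rintro (⟨a1, a2, a3, a4⟩ | ⟨a1, a2, a3, a4⟩)
    · exact ⟨a1, by linarith, a3, by nlinarith, a4⟩
    · exact ⟨by linarith, a2, by nlinarith, a3, a4⟩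
  · rintro ⟨a1, a2, a3, a4, a5⟩
    rcases le_total x.1 0 with h | h
    · exact Or.inl ⟨a1, h, a3, a5⟩
    · exact Or.inr ⟨h, a2, a4, a5⟩

theorem fst_nonpos_of_mem_OmegaMinus (hC : 1 ≤ C) (h : x ∈ OmegaMinus C) : x.1 ≤ 0 := by
  rcases h with h | h
  · exact h.1.trans (xiMinus_spec hC).1
  · exact h.2.1

theorem fst_nonneg_of_mem_OmegaPlus (hC : 1 ≤ C) (h : x ∈ OmegaPlus C) : 0 ≤ x.1 := by
  rcases h with h | h
  · exact h.1
  · exact (xiPlus_spec hC).1.trans h.1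

/-- On each of the three subdomains `b_{1,C}` is given by the corresponding formula, so that the
order of the cases in its definition is immaterial. -/
theorem b1Cand_cases (hx : x ∈ Omega C) :
    (x ∈ OmegaMinus C ∧ b1Cand C x = -x.1) ∨ (x ∈ OmegaZero C ∧ b1Cand C x = b1Plane C x) ∨
      (x ∈ OmegaPlus C ∧ b1Cand C x = x.1) := by
  by_cases h1 : x ∈ OmegaMinus C
  · exact Or.inl ⟨h1, if_pos h1⟩
  by_cases h2 : x ∈ OmegaZero C
  · exact Or.inr (Or.inl ⟨h2, by rw [b1Cand, if_neg h1, if_pos h2, b1Plane]⟩)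
  have h3 : x ∈ OmegaPlus C := by
    rcases omega_subset_parts C hx with (h | h) | h
    · exact absurd h h1
    · exact absurd h h2
    · exact h
  exact Or.inr (Or.inr ⟨h3, by rw [b1Cand, if_neg h1, if_neg h2, if_pos h3]⟩)

theorem abs_le_b1Cand (hC : 1 < C) (hx : x ∈ Omega C) : |x.1| ≤ b1Cand C x := by
  rcases b1Cand_cases hx with ⟨h, e⟩ | ⟨h, e⟩ | ⟨h, e⟩
  · rw [e, abs_of_nonpos (fst_nonpos_of_mem_OmegaMinus hC.le h)]
  · obtain ⟨-, -, a3, a4, -⟩ := (mem_OmegaZero_iff hC).1 h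
    have e1 := b1Plane_add hC x
    have e2 := b1Plane_sub hC x
    have k := b1Plane_coeff_pos hC
    rw [e, abs_le]
    constructor <;> nlinarith
  · rw [e, abs_of_nonneg (fst_nonneg_of_mem_OmegaPlus hC.le h)]

/-- A continuous upper bound for a function defined by cases. The correction vanishes on the lower
curve, so together with `abs_le_b1Cand` it yields the boundary values and their limits when `C > 1`.
-/
theorem b1Cand_le (hC : 1 < C) (hx : x ∈ Omega C) : b1Cand C x ≤ |x.1| +
    2 * ((1 - xiMinus C) * (1 - xiPlus C) / (xiPlus C - xiMinus C)) * (x.2 - Real.exp x.1) := by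
  have k := b1Plane_coeff_pos hC
  have hpos := mul_nonneg k.le (sub_nonneg.2 hx.1)
  rcases b1Cand_cases hx with ⟨h, e⟩ | ⟨h, e⟩ | ⟨h, e⟩
  · rw [e]; linarith [neg_abs_le x.1]
  · obtain ⟨a1, a2, -, -, -⟩ := (mem_OmegaZero_iff hC).1 h
    rw [e]
    rcases le_total x.1 0 with h0 | h0
    · have e1 := b1Plane_add hC x
      have := exp_le_tangent_minus hC h0 a1
      rw [abs_of_nonpos h0]; nlinarith
    · have e1 := b1Plane_sub hC x
      have := exp_le_tangent_plus hC h0 a2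
      rw [abs_of_nonneg h0]; nlinarith
  · rw [e]; linarith [le_abs_self x.1]

theorem b1Cand_of_eq_exp (hC : 1 ≤ C) (hx : x ∈ Omega C) (h : x.2 = Real.exp x.1) :
    b1Cand C x = |x.1| := by
  -- For `C = 1` the middle region forces `x.1 = 0`, and the formula is read with zero denominators.
  rcases hC.eq_or_lt with h1 | h1
  · rcases b1Cand_cases hx with ⟨h, e⟩ | ⟨h, e⟩ | ⟨h, e⟩
    · rw [e, abs_of_nonpos (fst_nonpos_of_mem_OmegaMinus hC h)]
    · have e1 := xiPlus_spec hC
      have e2 := xiMinus_spec hC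
      have h3 : xiPlus C = 0 := (existsUnique_xiPlus hC).unique e1 ⟨le_rfl, one_pos, by simp [← h1]⟩
      have h4 : xiMinus C = 0 := (existsUnique_xiMinus hC).unique e2 ⟨le_rfl, by simp [← h1]⟩
      have h5 : x.1 = 0 := by
        rcases h with h | h
        · rw [h4] at h; exact le_antisymm h.2.1 h.1
        · rw [h3] at h; exact le_antisymm h.2.1 h.1
      rw [e, b1Plane, h3, h4, h5]; simp
    · rw [e, abs_of_nonneg (fst_nonneg_of_mem_OmegaPlus hC h)]
  · refine le_antisymm ((b1Cand_le h1 hx).trans ?_) (abs_le_b1Cand h1 hx)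
    rw [h]; simp

/-- On the outer regions the claim is that `y` lies below the corresponding tangent from `(0, 1)`.
Between `0` and the contact abscissa this is part of the description of the region; beyond it, it
follows from visibility, since `x` lies above the tangent on the other side of the point of contact.
-/
theorem Under.b1Plane_le (hC : 1 < C) (h : Under C x y) (hx : x ∈ OmegaZero C)
    (hy : y ∈ Omega C) : b1Plane C y ≤ b1Cand C y := by
  obtain ⟨a1, a2, a3, a4, -⟩ := (mem_OmegaZero_iff hC).1 hx
  have k := b1Plane_coeff_pos hC
  have r1 := xiMinus_rho hC.le
  have r2 := xiPlus_rho hC.le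
  rcases b1Cand_cases hy with ⟨hm, e⟩ | ⟨-, e⟩ | ⟨hm, e⟩
  · rw [e]
    have e1 := b1Plane_add hC y
    have : y.2 ≤ C * Real.exp (xiMinus C) * y.1 + 1 := by
      rcases hm with hm | hm
      · have := h.le_tangent (p := xiMinus C) (by linarith)
          (mul_nonpos_of_nonneg_of_nonpos (by linarith) (by linarith [hm.1])) (by linarith)
        linarith
      · exact hm.2.2.2
    nlinarith
  · exact e.ge
  · rw [e]
    have e1 := b1Plane_sub hC y
    have : y.2 ≤ C * Real.exp (xiPlus C) * y.1 + 1 := by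
      rcases hm with hm | hm
      · exact hm.2.2.2
      · have := h.le_tangent (p := xiPlus C) (by linarith)
          (mul_nonpos_of_nonpos_of_nonneg (by linarith) (by linarith [hm.1])) (by linarith)
        linarith
    nlinarith

/-- On the outer regions the affine functions `±x.1` bound the candidate from below on the whole
strip, by `abs_le_b1Cand`. Visibility matters only for points of the middle region. -/
theorem hasVisibleMajorants_neg_b1Cand (hC : 1 < C) :
    HasVisibleMajorants C fun x => -b1Cand C x := by
  intro x hx
  rcases b1Cand_cases hx with ⟨-, e⟩ | ⟨h, e⟩ | ⟨-, e⟩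
  · refine ⟨1, 0, fun y hy _ => ?_⟩
    simp only [e]; linarith [abs_le_b1Cand hC hy, neg_abs_le y.1]
  · refine ⟨-((xiPlus C + xiMinus C - 2) / (xiPlus C - xiMinus C)),
      -(2 * ((1 - xiMinus C) * (1 - xiPlus C) / (xiPlus C - xiMinus C))), fun y hy hxy => ?_⟩
    have := hxy.b1Plane_le hC h hy
    simp only [e, b1Plane]
    rw [b1Plane] at this
    linarith
  · refine ⟨-1, 0, fun y hy _ => ?_⟩
    simp only [e]; linarith [abs_le_b1Cand hC hy, le_abs_self y.1]

end

theorem le_lintegral_abs {C a b : ℝ} (hC : 1 ≤ C) (hab : a < b) {φ : ℝ → ℝ}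
    (hφ : ExpClass C φ a b) :
    ENNReal.ofReal ((b - a) * b1Cand C (meanPoint φ a b)) ≤
      ∫⁻ t in Ioc a b, ENNReal.ofReal |φ t| := by
  have hO := hφ.mem_Omega le_rfl hab le_rfl
  rcases eq_exp_or_lt hO with h | h
  · rw [lintegral_const_of_mem hab hφ h (fun t => ENNReal.ofReal |t|),
      ← ENNReal.ofReal_mul (by linarith), b1Cand_of_eq_exp hC hO h]
  · have hC1 := one_lt_of_exp_lt hO h
    set k := 2 * ((1 - xiMinus C) * (1 - xiPlus C) / (xiPlus C - xiMinus C)) with hk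
    have hk0 : 0 < k := b1Plane_coeff_pos hC1
    have hξ1 := (xiPlus_spec hC).2.1
    have hK : 0 ≤ k * (C * Real.exp 1) := by positivity
    refine le_lintegral_of_visibleMajorants (κ := 1 + k * (C * Real.exp 1)) hC1 hab (by positivity)
      (hasVisibleMajorants_neg_b1Cand hC1) continuous_abs (fun t => abs_nonneg t) (fun t => ?_)
      (fun s hs t => ?_) ?_ (fun x hx => ?_) hφ h
    · have : |t| ≤ 1 + t ^ 2 := by nlinarith [sq_abs t, sq_nonneg (|t| - 1)]
      nlinarith [sq_nonneg t]
    · rw [abs_mul, abs_of_nonneg hs.1]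
      exact mul_le_of_le_one_left (abs_nonneg t) hs.2
    · refine boundaryMinorant_of_continuous
        (F := fun x : ℝ × ℝ => -(|x.1| + k * (x.2 - Real.exp x.1))) (by fun_prop) (fun t => by simp)
        fun x hx => neg_le_neg (b1Cand_le hC1 hx)
    · have h1 : |x.1| ≤ 1 + x.1 ^ 2 := by nlinarith [sq_abs x.1, sq_nonneg (|x.1| - 1)]
      have h2 : b1Cand C x ≤ |x.1| + k * (C * Real.exp 1) := by
        rcases b1Cand_cases hx with ⟨-, e⟩ | ⟨hm, e⟩ | ⟨-, e⟩
        · rw [e]; linarith [neg_abs_le x.1]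
        · refine (b1Cand_le hC1 hx).trans ?_
          obtain ⟨-, a2, -, -, a5⟩ := (mem_OmegaZero_iff hC1).1 hm
          have : Real.exp x.1 ≤ Real.exp 1 := Real.exp_le_exp.2 (by linarith)
          have h3 : x.2 - Real.exp x.1 ≤ C * Real.exp 1 := by nlinarith [Real.exp_pos x.1]
          have := mul_le_mul_of_nonneg_left h3 hk0.le
          linarith
        · rw [e]; linarith [le_abs_self x.1]
      nlinarith [sq_nonneg x.1]

/-! ### The distribution function: geometry of the subdomains -/

section

variable {C : ℝ} {x y : ℝ × ℝ}

theorem tangentLine_zero (C ξ y : ℝ) : tangentLine C 0 ξ y = C * Real.exp ξ * y + 1 := by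
  simp [tangentLine]

theorem Omega3_zero (C : ℝ) : Omega3 C 0 = OmegaZero C := by
  simp only [Omega3, OmegaZero, tangentLine_zero, zero_add]

/-- Dividing the defining equations of `ξ⁺` and `ξ⁻` shows that the tangent from `(0, 1)` with
contact at `ξ⁻` meets the lower curve again at abscissa `ξ⁻ - ξ⁺`. This chord separates the tangents
of `Ω_1` from the chords of `Ω_2`. -/
theorem exp_neg_gap (hC : 1 ≤ C) : Real.exp (-(xiPlus C - xiMinus C)) =
    1 - (xiPlus C - xiMinus C) * (C * Real.exp (xiMinus C)) := by
  have h1 := xiMinus_rho hC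
  have h2 := xiPlus_rho hC
  have h3 : C * Real.exp (xiMinus C) =
      C * Real.exp (xiPlus C) * Real.exp (-(xiPlus C - xiMinus C)) := by
    rw [mul_assoc, ← Real.exp_add]; congr 2; ring
  set E := Real.exp (-(xiPlus C - xiMinus C))
  set ρ := C * Real.exp (xiMinus C)
  set σ := C * Real.exp (xiPlus C)
  linear_combination (-E) * h2 + h1 - (1 - xiPlus C) * h3

theorem gap_pos (hC : 1 < C) : 0 < xiPlus C - xiMinus C := by
  linarith [xiMinus_neg hC, xiPlus_pos hC]

theorem rho_minus_pos (hC : 1 ≤ C) : 0 < C * Real.exp (xiMinus C) :=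
  mul_pos (by linarith) (Real.exp_pos _)

theorem rho_minus_lt_one (hC : 1 < C) : C * Real.exp (xiMinus C) < 1 := by
  have h1 := xiMinus_rho hC.le
  have h2 := rho_minus_pos hC.le
  have h3 := xiMinus_neg hC
  nlinarith

/-- Slopes of the chords of the graph of the exponential function issuing from `(0, 1)`. -/
theorem exp_slope_lt {s t : ℝ} (h : s < t) (ht : t < 0) :
    Real.exp t - 1 < (Real.exp s - 1) / s * t := by
  have h1 := strictConvexOn_exp.secant_strict_mono (mem_univ (0 : ℝ)) (mem_univ s) (mem_univ t)
    (h.trans ht).ne ht.ne h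
  rw [Real.exp_zero, sub_zero, sub_zero] at h1
  rwa [lt_div_iff_of_neg ht] at h1

/-- The line cuts the lower curve at the abscissas `-(ξ⁺ - ξ⁻)` and `0`; by convexity it runs below
the curve to the left of the first and above it in between. -/
theorem tangent_lt_exp_of_lt (hC : 1 < C) {t : ℝ} (h : t < -(xiPlus C - xiMinus C)) :
    C * Real.exp (xiMinus C) * t + 1 < Real.exp t := by
  have hR := gap_pos hC
  have h1 := exp_slope_lt h (by linarith)
  rw [exp_neg_gap hC.le] at h1
  have ht : t < 0 := by linarith
  rw [div_mul_eq_mul_div, lt_div_iff_of_neg ht] at h1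
  nlinarith

theorem exp_le_tangent_of_gap_le (hC : 1 < C) {t : ℝ} (h : -(xiPlus C - xiMinus C) ≤ t)
    (ht : t ≤ 0) : Real.exp t ≤ C * Real.exp (xiMinus C) * t + 1 := by
  have hR := gap_pos hC
  have ha : 0 ≤ -t / (xiPlus C - xiMinus C) := div_nonneg (by linarith) hR.le
  have hb : 0 ≤ 1 - -t / (xiPlus C - xiMinus C) := by
    rw [sub_nonneg, div_le_one hR]; linarith
  have := convexOn_exp.2 (mem_univ (-(xiPlus C - xiMinus C))) (mem_univ (0 : ℝ)) ha hb (by ring)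
  simp only [smul_eq_mul, mul_zero, add_zero, Real.exp_zero, mul_one, exp_neg_gap hC.le] at this
  rw [show -t / (xiPlus C - xiMinus C) * -(xiPlus C - xiMinus C) = t by field_simp] at this
  refine this.trans (le_of_eq ?_)
  field_simp
  ring

/-- The tangent from `(0, 1)` that touches the upper boundary at `ξ⁻` is also the one that issues
from the point of abscissa `ξ⁻ - ξ⁺` of the lower boundary. -/
theorem tangent_minus_eq (hC : 1 < C) (y : ℝ) : C * Real.exp (xiMinus C) * y + 1 =
    Real.exp y * tangentHeight (xiPlus C) ((y + (xiPlus C - xiMinus C)) / xiPlus C) := by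
  have hξ := xiPlus_pos hC
  have h1 := xiMinus_rho hC.le
  have h2 := exp_neg_gap hC.le
  have hξ1 := (xiPlus_spec hC.le).2.1
  have h4 : 1 - xiPlus C ≠ 0 := by linarith
  rw [tangentHeight, ← mul_assoc, ← Real.exp_add, div_mul_cancel₀ _ hξ.ne',
    show y + -(y + (xiPlus C - xiMinus C)) = -(xiPlus C - xiMinus C) by ring, h2]
  field_simp
  linear_combination (y + (xiPlus C - xiMinus C)) * h1

/-- By `tangent_minus_eq` the line belongs to the family of tangents with parameter `ξ⁺`, with
initial abscissa `-(ξ⁺ - ξ⁻)`. Up to the contact point, higher points have a larger `τ` and hence a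
smaller `u⁺`. -/
theorem uPlus_lt_of_tangent_lt (hC : 1 < C) (hx : x ∈ Omega C) (h1 : x.1 ≤ xiMinus C)
    (h2 : C * Real.exp (xiMinus C) * x.1 + 1 < x.2) :
    uPlus C x < -(xiPlus C - xiMinus C) := by
  obtain ⟨τ, -, hτ1, hτ2, hτ3, -⟩ := exists_tau_plus hC hx
  have hξ := xiPlus_pos hC
  have hmono := tangentHeight_strictMonoOn (xiPlus_spec hC.le).2.1 hξ.ne'
  rw [tangent_minus_eq hC, hτ2] at h2
  have h3 := lt_of_mul_lt_mul_left h2 (Real.exp_pos _).le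
  have h4 := (hmono.lt_iff_lt (mem_Iic.2 (by rw [div_le_one hξ]; linarith)) (mem_Iic.2 hτ1)).1 h3
  rw [div_lt_iff₀ hξ] at h4
  linarith

theorem le_uPlus_of_le_tangent (hC : 1 < C) (hx : x ∈ Omega C)
    (h2 : x.2 ≤ C * Real.exp (xiMinus C) * x.1 + 1) :
    -(xiPlus C - xiMinus C) ≤ uPlus C x := by
  rcases le_total (xiMinus C) x.1 with h1 | h1
  · linarith [(uPlus_spec hC.le hx).2.1]
  obtain ⟨τ, -, hτ1, hτ2, hτ3, -⟩ := exists_tau_plus hC hx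
  have hξ := xiPlus_pos hC
  have hmono := tangentHeight_strictMonoOn (xiPlus_spec hC.le).2.1 hξ.ne'
  rw [tangent_minus_eq hC, hτ2] at h2
  have h3 := le_of_mul_le_mul_left h2 (Real.exp_pos _)
  have h4 := (hmono.le_iff_le (mem_Iic.2 hτ1) (mem_Iic.2 (by rw [div_le_one hξ]; linarith))).1 h3
  rw [le_div_iff₀ hξ] at h4
  linarith

/-- A point of `Ω_2` as a point of the chord from `(0, 1)` to `(v, e^v)`. -/
theorem vFun_zero_spec (hC : 1 < C) (hx : x ∈ Omega2 C 0) :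
    -(xiPlus C - xiMinus C) ≤ vFun 0 x ∧ vFun 0 x < 0 ∧ vFun 0 x ≤ x.1 ∧
      x.2 = 1 + x.1 / vFun 0 x * (Real.exp (vFun 0 x) - 1) := by
  obtain ⟨hne, hv⟩ := vFun_spec hC.le hx
  obtain ⟨h1, h2, h3, h4⟩ := hx
  rw [tangentLine_zero] at h4
  rw [Real.exp_zero, sub_zero, sub_zero] at hv
  set v := vFun 0 x
  have hR := gap_pos hC
  have hv' : (Real.exp v - 1) / v * x.1 = x.2 - 1 := by
    rw [hv, div_mul_cancel₀ _ h2.ne]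
  have hx1 : v ≤ x.1 := by
    by_contra! hcon
    have := strictConvexOn_exp.secant_strict_mono (mem_univ (0 : ℝ)) (mem_univ x.1) (mem_univ v)
      h2.ne hne hcon
    rw [Real.exp_zero, sub_zero, sub_zero, hv] at this
    rw [div_lt_iff_of_neg h2, div_mul_cancel₀ _ h2.ne] at this
    linarith
  refine ⟨?_, by linarith, hx1, by linear_combination -hv'⟩
  by_contra! hcon
  have := strictConvexOn_exp.secant_strict_mono (mem_univ (0 : ℝ)) (mem_univ v)
    (mem_univ (-(xiPlus C - xiMinus C))) (by linarith) (by linarith) hcon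
  rw [Real.exp_zero, sub_zero, sub_zero, hv, exp_neg_gap hC.le] at this
  rw [show (1 - (xiPlus C - xiMinus C) * (C * Real.exp (xiMinus C)) - 1) /
    -(xiPlus C - xiMinus C) = C * Real.exp (xiMinus C) by field_simp; ring] at this
  rw [div_lt_iff_of_neg h2] at this
  linarith

/-- The affine function that equals `D_{0,C}` on `Ω_3(0)`. -/
noncomputable def distPlane (C : ℝ) (x : ℝ × ℝ) : ℝ :=
  (1 - xiMinus C) / (xiPlus C - xiMinus C) ^ 2 * (x.1 + (1 - x.2) * (1 - xiPlus C)) + 1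

/-- The slope of `D_{0,C}` along the tangents in `Ω_1(0)`. -/
noncomputable def distSlope (C u : ℝ) : ℝ :=
  Real.exp ((xiPlus C - xiMinus C + u) / xiPlus C) / (xiPlus C - xiMinus C)

/-- The tangent plane to the graph of `D_{0,C}` along the chord from `(0, 1)` to `(v, e^v)`. -/
noncomputable def chordPlane (v : ℝ) (y : ℝ × ℝ) : ℝ :=
  1 + (y.2 - 1 - Real.exp v * y.1) / (1 - Real.exp v * (1 - v))

/-- The order of the cases in the definition is used up here. Points on the separating tangent are
assigned to the third alternative, where a point is `s` times `(w, e^w)` plus `1 - s` times `(0,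
1)`; this allows a strict inequality in the fourth. -/
theorem DCand_zero_cases (hC : 1 < C) (hx : x ∈ Omega C) :
    (0 ≤ x.1 ∧ (x.1 ≤ xiPlus C → x.2 ≤ C * Real.exp (xiPlus C) * x.1 + 1) ∧ DCand 0 C x = 1) ∨
    (x ∈ OmegaZero C ∧ DCand 0 C x = distPlane C x) ∨
    (x.1 < 0 ∧ x.2 ≤ C * Real.exp (xiMinus C) * x.1 + 1 ∧ ∃ w s : ℝ,
      -(xiPlus C - xiMinus C) ≤ w ∧ w < 0 ∧ 0 ≤ s ∧ s ≤ 1 ∧ x.1 = s * w ∧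
        x.2 = 1 + s * (Real.exp w - 1) ∧ DCand 0 C x = 1 - s) ∨
    (x.1 ≤ xiMinus C ∧ C * Real.exp (xiMinus C) * x.1 + 1 < x.2 ∧
      DCand 0 C x = distSlope C (uPlus C x) * (x.1 - uPlus C x)) := by
  have hξ := xiPlus_pos hC
  by_cases h4 : x ∈ Omega4 C 0
  · refine Or.inl ?_
    have e : DCand 0 C x = 1 := if_pos h4
    rcases h4 with ⟨a1, a2, a3, a4⟩ | ⟨a1, a2, a3⟩
    · rw [tangentLine_zero] at a4
      exact ⟨a1, fun _ => a4, e⟩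
    · rw [zero_add] at a1
      refine ⟨hξ.le.trans a1, fun h => ?_, e⟩
      have h5 : x.1 = xiPlus C := le_antisymm h a1
      have := xiPlus_rho hC.le
      rw [h5] at a3 ⊢
      linarith
  by_cases h3 : x ∈ Omega3 C 0
  · refine Or.inr (Or.inl ⟨by rwa [← Omega3_zero], ?_⟩)
    rw [DCand, if_neg h4, if_pos h3, distPlane]; simp
  by_cases h2 : x ∈ Omega2 C 0
  · refine Or.inr (Or.inr (Or.inl ⟨h2.2.1, by simpa only [tangentLine_zero] using h2.2.2.2, ?_⟩))
    obtain ⟨a1, a2, a3, a4⟩ := vFun_zero_spec hC h2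
    refine ⟨vFun 0 x, x.1 / vFun 0 x, a1, a2, div_nonneg_of_nonpos h2.2.1.le a2.le,
      (div_le_one_of_neg a2).2 a3, by rw [div_mul_cancel₀ _ a2.ne], a4, ?_⟩
    rw [DCand, if_neg h4, if_neg h3, if_pos h2]
    have := a2.ne
    rw [zero_sub]
    field_simp
    ring
  have h1 : x ∈ Omega1 C 0 := by
    rcases omega_subset_parts_lam C 0 hx with ((h | h) | h) | h
    exacts [h, absurd h h2, absurd h h3, absurd h h4]
  refine Or.inr (Or.inr (Or.inr ⟨?_, ?_, ?_⟩))
  · rcases h1 with h | h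
    · linarith [h.1]
    · linarith [h.2.1]
  · have hle : x.1 < 0 := by
      have := xiMinus_neg hC
      rcases h1 with h | h
      · linarith [h.1]
      · linarith [h.2.1]
    by_contra! hcon
    apply h2
    have h5 : -(xiPlus C - xiMinus C) ≤ x.1 := by
      by_contra! hlt
      linarith [tangent_lt_exp_of_lt hC hlt, hx.1]
    exact ⟨by linarith, hle, hx.1, by rwa [tangentLine_zero]⟩
  · rw [DCand, if_neg h4, if_neg h3, if_neg h2, if_pos h1, distSlope, sub_zero]

/-- Zero boundary values force `m = ξ m'`, so the slope is exponential. Its constant makes the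
function climb from `0` to `1` along the chord from abscissa `-(ξ⁺ - ξ⁻)` to `(0, 1)`. -/
theorem tangentData_dist (hC : 1 < C) :
    TangentData (xiPlus C) (distSlope C) (fun _ => 0) fun u => distSlope C u / xiPlus C where
  lt_one := (xiPlus_spec hC.le).2.1
  ne_zero := (xiPlus_pos hC).ne'
  hasDerivAt_slope v := by
    have := ((((hasDerivAt_id v).const_add (xiPlus C - xiMinus C)).div_const (xiPlus C)).exp).div_const
      (xiPlus C - xiMinus C)
    refine this.congr_deriv ?_
    simp only [id_eq, distSlope]; ring
  hasDerivAt_boundary v := by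
    refine (hasDerivAt_const v (0 : ℝ)).congr_deriv ?_
    have := (xiPlus_pos hC).ne'
    field_simp; ring
  mono := Or.inl ⟨xiPlus_pos hC, fun s t h => by
    have hξ := xiPlus_pos hC
    have hξ1 := (xiPlus_spec hC.le).2.1
    have hR := gap_pos hC
    have e : ∀ v, Real.exp (-v) * (distSlope C v / xiPlus C) =
        Real.exp ((xiPlus C - xiMinus C + v) / xiPlus C - v) /
          ((xiPlus C - xiMinus C) * xiPlus C) := by
      intro v
      rw [sub_eq_add_neg _ v, Real.exp_add, distSlope]
      field_simp
    simp only [e]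
    apply div_le_div_of_nonneg_right _ (by positivity)
    rw [Real.exp_le_exp]
    have h1 : t - s ≤ (t - s) / xiPlus C := by
      rw [le_div_iff₀ hξ]; nlinarith
    rw [sub_div] at h1
    rw [add_div, add_div]
    linarith⟩

theorem one_sub_chord_pos {v : ℝ} (h : v < 0) : 0 < 1 - Real.exp v * (1 - v) := by
  have h1 : -v + 1 < Real.exp (-v) := Real.add_one_lt_exp (by linarith)
  have h2 : Real.exp v * Real.exp (-v) = 1 := by rw [← Real.exp_add]; simp
  nlinarith [Real.exp_pos v]

/-- The regions with tangents and with chords share one segment, and there the two planes coincide: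
gradients match across the interface, so concavity survives the gluing. -/
theorem tangentPlane_gap (hC : 1 < C) (y : ℝ × ℝ) :
    tangentPlane (xiPlus C) (distSlope C) (fun _ => 0) (fun u => distSlope C u / xiPlus C)
      (-(xiPlus C - xiMinus C)) y = chordPlane (-(xiPlus C - xiMinus C)) y := by
  have hξ := xiPlus_pos hC
  have hξ1 := (xiPlus_spec hC.le).2.1
  have hR := gap_pos hC
  have hρ := rho_minus_pos hC.le
  have h1 := xiMinus_rho hC.le
  have hE := exp_neg_gap hC.le
  have hE' : Real.exp (-(-(xiPlus C - xiMinus C))) =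
      (1 - (xiPlus C - xiMinus C) * (C * Real.exp (xiMinus C)))⁻¹ := by
    rw [Real.exp_neg, hE]
  have hs : distSlope C (-(xiPlus C - xiMinus C)) = 1 / (xiPlus C - xiMinus C) := by
    rw [distSlope]; simp
  have hD : 1 - (1 - (xiPlus C - xiMinus C) * (C * Real.exp (xiMinus C))) *
      (1 - -(xiPlus C - xiMinus C)) =
      (xiPlus C - xiMinus C) * (C * Real.exp (xiMinus C)) * xiPlus C := by
    linear_combination (xiPlus C - xiMinus C) * h1
  have hE2 : 1 - (xiPlus C - xiMinus C) * (C * Real.exp (xiMinus C)) =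
      C * Real.exp (xiMinus C) * (1 - xiPlus C) := by linear_combination -h1
  rw [tangentPlane, chordPlane, hs, hE', hE, hD, hE2]
  set ρ := C * Real.exp (xiMinus C)
  have h3 : 1 - xiPlus C ≠ 0 := by linarith
  have h4 : xiPlus C - xiMinus C ≠ 0 := hR.ne'
  field_simp
  linear_combination -h1

end

/-! ### The distribution function: majorants of the candidate. -/

section

variable {C : ℝ} {x y : ℝ × ℝ}

/-- The tangent to the exponential at `v`, evaluated at `-(ξ⁺ - ξ⁻)`, lies below it. For negative
`v` this says that `chordPlane v`, along the separating tangent, grows at a rate of at most `1 / (ξ⁺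
- ξ⁻)`. -/
theorem chord_coeff_le (hC : 1 ≤ C) {v : ℝ} :
    (xiPlus C - xiMinus C) * (C * Real.exp (xiMinus C) - Real.exp v) ≤
      1 - Real.exp v * (1 - v) := by
  have h1 := exp_neg_gap hC
  have h2 := Real.add_one_le_exp (-(xiPlus C - xiMinus C) - v)
  have h3 : Real.exp (-(xiPlus C - xiMinus C)) =
      Real.exp v * Real.exp (-(xiPlus C - xiMinus C) - v) := by
    rw [← Real.exp_add]; congr 1; ring
  have h4 := mul_le_mul_of_nonneg_left h2 (Real.exp_pos v).le
  rw [← h3, h1] at h4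
  linarith

theorem chord_coeff_gap (hC : 1 ≤ C) :
    (xiPlus C - xiMinus C) * (C * Real.exp (xiMinus C) - Real.exp (-(xiPlus C - xiMinus C))) =
      1 - Real.exp (-(xiPlus C - xiMinus C)) * (1 - -(xiPlus C - xiMinus C)) := by
  rw [exp_neg_gap hC]; ring

theorem chord_denom_le {v R : ℝ} (hv : -R ≤ v) (hv0 : v < 0) :
    1 - Real.exp v * (1 - v) ≤ 1 - Real.exp (-R) * (1 - -R) := by
  have h1 := Real.add_one_le_exp (v + R)
  have h2 : Real.exp (-R) * Real.exp (v + R) = Real.exp v := by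
    rw [← Real.exp_add]; congr 1; ring
  have h3 : Real.exp (-R) * (v + R + 1) ≤ Real.exp v := by
    rw [← h2]; exact mul_le_mul_of_nonneg_left h1 (Real.exp_pos _).le
  have h4 := mul_le_mul_of_nonneg_right h3 (by linarith : 0 ≤ 1 - v)
  have h5 : 0 ≤ Real.exp (-R) * (-v * (v + R)) :=
    mul_nonneg (Real.exp_pos _).le (mul_nonneg (by linarith) (by linarith))
  nlinarith

/-- Decompose the ordinate into the value on the separating tangent and the height above it. For the
plane of the extreme chord the rate along the tangent is largest (`chord_coeff_le`) and the
coefficient of the height smallest (`chord_denom_le`). With `y.1 ≤ 0` and nonnegative height, both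
comparisons go the same way. -/
theorem chordPlane_gap_le (hC : 1 < C) {v : ℝ} (hv : -(xiPlus C - xiMinus C) ≤ v) (hv0 : v < 0)
    (h1 : y.1 ≤ 0) (h2 : C * Real.exp (xiMinus C) * y.1 + 1 ≤ y.2) :
    chordPlane (-(xiPlus C - xiMinus C)) y ≤ chordPlane v y := by
  have hR := gap_pos hC
  have k0 := one_sub_chord_pos (show -(xiPlus C - xiMinus C) < 0 by linarith)
  have k1 := one_sub_chord_pos hv0
  have e0 := chord_coeff_gap hC.le
  have e1 := chord_coeff_le hC.le (v := v)
  have e2 := chord_denom_le hv hv0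
  rw [chordPlane, chordPlane]
  set R := xiPlus C - xiMinus C
  set ρ := C * Real.exp (xiMinus C)
  set E := Real.exp (-R)
  set k := 1 - E * (1 - -R)
  set l := 1 - Real.exp v * (1 - v)
  have a0 : (y.2 - 1 - E * y.1) / k = (y.2 - 1 - ρ * y.1) / k + y.1 / R := by
    field_simp
    linear_combination y.1 * e0
  have a1 : (y.2 - 1 - ρ * y.1) / l + y.1 / R ≤ (y.2 - 1 - Real.exp v * y.1) / l := by
    have : (y.2 - 1 - Real.exp v * y.1) / l - ((y.2 - 1 - ρ * y.1) / l + y.1 / R) =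
        (-y.1) * (l - R * (ρ - Real.exp v)) / (l * R) := by
      field_simp; ring
    have h3 : 0 ≤ (-y.1) * (l - R * (ρ - Real.exp v)) / (l * R) :=
      div_nonneg (mul_nonneg (by linarith) (by linarith)) (by positivity)
    linarith
  have a2 : (y.2 - 1 - ρ * y.1) / k ≤ (y.2 - 1 - ρ * y.1) / l :=
    div_le_div_of_nonneg_left (by linarith) k1 e2
  linarith

theorem distSlope_plane_eq (hC : 1 < C) (hy : y ∈ Omega C) :
    tangentPlane (xiPlus C) (distSlope C) (fun _ => 0) (fun u => distSlope C u / xiPlus C)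
      (uPlus C y) y = distSlope C (uPlus C y) * (y.1 - uPlus C y) := by
  obtain ⟨τ, -, -, h2, h3, h4⟩ := exists_tau_plus hC hy
  rw [← h3, TangentData.plane_eq, h2]
  ring

/-- By `tangentPlane_gap` both sides are tangent planes of one family evaluated at `y`: that of the
tangent through `y`, and that of the separating one. -/
theorem distSlope_le_chordPlane_gap (hC : 1 < C) (hy : y ∈ Omega C) (h1 : y.1 ≤ xiMinus C)
    (h2 : C * Real.exp (xiMinus C) * y.1 + 1 < y.2) :
    distSlope C (uPlus C y) * (y.1 - uPlus C y) ≤ chordPlane (-(xiPlus C - xiMinus C)) y := by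
  have hu := uPlus_lt_of_tangent_lt hC hy h1 h2
  have hξ := xiPlus_pos hC
  rw [← distSlope_plane_eq hC hy, ← tangentPlane_gap hC]
  obtain ⟨τ, h0, hτ1, hτ2, h3, h4⟩ := exists_tau_plus hC hy
  have e : y.1 - (y.1 + (xiPlus C - xiMinus C)) / xiPlus C * xiPlus C =
      -(xiPlus C - xiMinus C) := by rw [div_mul_cancel₀ _ hξ.ne']; ring
  have := (tangentData_dist hC).plane_le_of_le (y := y)
    (τ := (y.1 + (xiPlus C - xiMinus C)) / xiPlus C) (τ₁ := τ)
    (by rw [div_le_iff₀ hξ]; linarith) hτ1 hτ2.ge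
  rwa [e, h3] at this

/-- The zero line of `chordPlane v` is the tangent to the lower curve at `v`, so the plane is
nonnegative at `(w, e^w)`. It equals one at `(0, 1)`, and `y` divides the chord between these
points. -/
theorem chord_le_chordPlane {v w s : ℝ} (hv0 : v < 0) (hs : 0 ≤ s) (h1 : y.1 = s * w)
    (h2 : y.2 = 1 + s * (Real.exp w - 1)) : 1 - s ≤ chordPlane v y := by
  have k1 := one_sub_chord_pos hv0
  rw [chordPlane, h1, h2]
  have h3 : Real.exp v * (1 + (w - v)) ≤ Real.exp w := by
    have := mul_le_mul_of_nonneg_left (Real.add_one_le_exp (w - v)) (Real.exp_pos v).le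
    rw [← Real.exp_add, add_sub_cancel] at this
    linarith
  have h4 : -s ≤ (1 + s * (Real.exp w - 1) - 1 - Real.exp v * (s * w)) /
      (1 - Real.exp v * (1 - v)) := by
    rw [le_div_iff₀ k1]
    have := mul_le_mul_of_nonneg_left h3 hs
    linarith
  linarith

theorem distPlane_sub_one (C : ℝ) (y : ℝ × ℝ) : distPlane C y - 1 =
    (1 - xiMinus C) / (xiPlus C - xiMinus C) ^ 2 * (y.1 + (1 - y.2) * (1 - xiPlus C)) := by
  rw [distPlane]; ring

theorem dist_coeff_pos (hC : 1 < C) : 0 < (1 - xiMinus C) / (xiPlus C - xiMinus C) ^ 2 :=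
  div_pos (by linarith [xiMinus_neg hC]) (pow_pos (gap_pos hC) 2)

theorem distPlane_le_one (hC : 1 < C) (h : C * Real.exp (xiPlus C) * y.1 + 1 ≤ y.2) :
    distPlane C y ≤ 1 := by
  have h1 := xiPlus_rho hC.le
  have h2 := (xiPlus_spec hC.le).2.1
  have h3 : y.1 + (1 - y.2) * (1 - xiPlus C) ≤ 0 := by
    have := mul_le_mul_of_nonneg_right h (by linarith : 0 ≤ 1 - xiPlus C)
    linear_combination this - y.1 * h1
  have := mul_nonpos_of_nonneg_of_nonpos (dist_coeff_pos hC).le h3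
  linarith [distPlane_sub_one C y]

theorem one_le_distPlane (hC : 1 < C) (h : y.2 ≤ C * Real.exp (xiPlus C) * y.1 + 1) :
    1 ≤ distPlane C y := by
  have h1 := xiPlus_rho hC.le
  have h2 := (xiPlus_spec hC.le).2.1
  have h3 : 0 ≤ y.1 + (1 - y.2) * (1 - xiPlus C) := by
    have := mul_le_mul_of_nonneg_right h (by linarith : 0 ≤ 1 - xiPlus C)
    linear_combination this + y.1 * h1
  have := mul_nonneg (dist_coeff_pos hC).le h3
  linarith [distPlane_sub_one C y]

theorem distPlane_eq (hC : 1 < C) (y : ℝ × ℝ) : distPlane C y = 1 + y.1 / (xiPlus C - xiMinus C) -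
    (1 - xiMinus C) / (xiPlus C - xiMinus C) ^ 2 * (1 - xiPlus C) *
      (y.2 - (C * Real.exp (xiMinus C) * y.1 + 1)) := by
  have h1 := xiMinus_rho hC.le
  have h2 := (gap_pos hC).ne'
  rw [distPlane]
  field_simp
  linear_combination (-(1 - xiPlus C) * y.1) * h1

theorem distPlane_le_chordPlane (hC : 1 < C) (hy : y ∈ OmegaZero C) {v : ℝ} (hv0 : v < 0) :
    distPlane C y ≤ chordPlane v y := by
  obtain ⟨a1, a2, a3, a4, a5⟩ := (mem_OmegaZero_iff hC).1 hy
  have k1 := one_sub_chord_pos hv0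
  have hR := gap_pos hC
  have hσ : 1 ≤ C * Real.exp (xiPlus C) := by
    have := xiPlus_pos hC
    nlinarith [Real.add_one_le_exp (xiPlus C)]
  rcases le_total 0 y.1 with h | h
  · refine (distPlane_le_one hC a4).trans ?_
    rw [chordPlane]
    have : 0 ≤ (y.2 - 1 - Real.exp v * y.1) / (1 - Real.exp v * (1 - v)) := by
      apply div_nonneg _ k1.le
      have : Real.exp v ≤ 1 := Real.exp_le_one_iff.2 hv0.le
      nlinarith
    linarith
  · rw [distPlane_eq hC, chordPlane]
    have h1 : 0 ≤ (1 - xiMinus C) / (xiPlus C - xiMinus C) ^ 2 * (1 - xiPlus C) *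
        (y.2 - (C * Real.exp (xiMinus C) * y.1 + 1)) :=
      mul_nonneg (mul_nonneg (dist_coeff_pos hC).le (by linarith [(xiPlus_spec hC.le).2.1]))
        (by linarith)
    have h2 : y.1 / (xiPlus C - xiMinus C) ≤
        (y.2 - 1 - Real.exp v * y.1) / (1 - Real.exp v * (1 - v)) := by
      rw [div_le_div_iff₀ hR k1]
      have := mul_le_mul_of_nonpos_left (chord_coeff_le hC.le (v := v)) h
      nlinarith
    linarith

theorem one_le_chordPlane (hy : y ∈ Omega C) (h : 0 ≤ y.1) {v : ℝ} (hv0 : v < 0) :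
    1 ≤ chordPlane v y := by
  rw [chordPlane]
  have : 0 ≤ (y.2 - 1 - Real.exp v * y.1) / (1 - Real.exp v * (1 - v)) := by
    apply div_nonneg _ (one_sub_chord_pos hv0).le
    have h1 : Real.exp v ≤ 1 := Real.exp_le_one_iff.2 hv0.le
    have h2 := Real.add_one_le_exp y.1
    nlinarith [hy.1]
  linarith

/-- For these planes no visibility is needed: they dominate the candidate on the whole strip. -/
theorem DCand_le_chordPlane (hC : 1 < C) (hy : y ∈ Omega C) {v : ℝ}
    (hv : -(xiPlus C - xiMinus C) ≤ v) (hv0 : v < 0) : DCand 0 C y ≤ chordPlane v y := by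
  rcases DCand_zero_cases hC hy with ⟨h0, -, e⟩ | ⟨h, e⟩ | ⟨-, -, w, s, -, -, hs, -, h1, h2, e⟩ |
    ⟨h1, h2, e⟩
  · rw [e]; exact one_le_chordPlane hy h0 hv0
  · rw [e]; exact distPlane_le_chordPlane hC h hv0
  · rw [e]; exact chord_le_chordPlane hv0 hs h1 h2
  · rw [e]
    exact (distSlope_le_chordPlane_gap hC hy h1 h2).trans
      (chordPlane_gap_le hC hv hv0 (by linarith [xiMinus_neg hC]) h2.le)

theorem distSlope_pos (hC : 1 < C) (u : ℝ) : 0 < distSlope C u :=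
  div_pos (Real.exp_pos _) (gap_pos hC)

theorem DCand_le_one (hC : 1 < C) (hy : y ∈ Omega C) : DCand 0 C y ≤ 1 := by
  rcases DCand_zero_cases hC hy with ⟨h0, -, e⟩ | ⟨h, e⟩ | ⟨-, -, w, s, -, -, hs, -, h1, h2, e⟩ |
    ⟨h1, h2, e⟩
  · exact e.le
  · rw [e]; exact distPlane_le_one hC ((mem_OmegaZero_iff hC).1 h).2.2.2.1
  · rw [e]; linarith
  · rw [e]
    have hu := uPlus_lt_of_tangent_lt hC hy h1 h2
    have hR := gap_pos hC
    have hξ := xiPlus_pos hC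
    obtain ⟨a1, a2, -⟩ := uPlus_spec hC.le hy
    have h3 : Real.exp ((xiPlus C - xiMinus C + uPlus C y) / xiPlus C) ≤ 1 := by
      rw [Real.exp_le_one_iff]
      exact div_nonpos_of_nonpos_of_nonneg (by linarith) hξ.le
    rw [distSlope, div_mul_eq_mul_div, div_le_one hR]
    have h4 := xiMinus_neg hC
    nlinarith

theorem DCand_nonneg (hC : 1 < C) (hy : y ∈ Omega C) : 0 ≤ DCand 0 C y := by
  rcases DCand_zero_cases hC hy with ⟨h0, -, e⟩ | ⟨h, e⟩ | ⟨-, -, w, s, -, -, hs, hs1, h1, h2, e⟩ |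
    ⟨h1, h2, e⟩
  · rw [e]; exact zero_le_one
  · obtain ⟨a1, a2, a3, a4, a5⟩ := (mem_OmegaZero_iff hC).1 h
    rw [e, distPlane]
    have hR := gap_pos hC
    have hξ1 := (xiPlus_spec hC.le).2.1
    have hr := xiMinus_rho hC.le
    -- The plane decreases in the ordinate, so the upper curve is the worst case. There the quantity
    -- becomes `e^{y.1 - ξ⁺}`, whose exponent lies in the interval where the exponential is below
    -- the separating chord.
    have b1 : C * Real.exp y.1 * (1 - xiPlus C) = Real.exp (y.1 - xiPlus C) := by
      rw [sub_eq_add_neg y.1, Real.exp_add, (xiPlus_spec hC.le).2.2]; ring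
    have b2 := exp_le_tangent_of_gap_le hC (t := y.1 - xiPlus C) (by linarith) (by linarith)
    have b3 : y.2 * (1 - xiPlus C) ≤ C * Real.exp (xiMinus C) * (y.1 - xiPlus C) + 1 :=
      ((mul_le_mul_of_nonneg_right a5 (by linarith)).trans b1.le).trans b2
    have b4 : -(xiPlus C - xiMinus C) ^ 2 ≤
        (1 - xiMinus C) * (y.1 + (1 - y.2) * (1 - xiPlus C)) := by
      have hm := xiMinus_neg hC
      have c1 := mul_le_mul_of_nonneg_left b3 (by linarith : 0 ≤ 1 - xiMinus C)
      have c2 : (1 - xiMinus C) * (C * Real.exp (xiMinus C) * (y.1 - xiPlus C) + 1) =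
          (y.1 - xiPlus C) + (1 - xiMinus C) := by linear_combination (y.1 - xiPlus C) * hr
      rw [c2] at c1
      have hξ := xiPlus_pos hC
      nlinarith
    have b5 : -1 ≤ (1 - xiMinus C) / (xiPlus C - xiMinus C) ^ 2 *
        (y.1 + (1 - y.2) * (1 - xiPlus C)) := by
      rw [div_mul_eq_mul_div, le_div_iff₀ (by positivity)]
      linarith
    linarith
  · rw [e]; linarith
  · rw [e]
    exact mul_nonneg (distSlope_pos hC _).le (by linarith [(uPlus_spec hC.le hy).1])

/-- Points of `Ω_2` seen from the chord plane of a point of `Ω_3`. -/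
theorem chord_le_distPlane (hC : 1 < C) {w s : ℝ} (hw : -(xiPlus C - xiMinus C) ≤ w) (hw0 : w < 0)
    (hs : 0 ≤ s) (h1 : y.1 = s * w) (h2 : y.2 = 1 + s * (Real.exp w - 1)) :
    1 - s ≤ distPlane C y := by
  have hR := gap_pos hC
  have b := exp_le_tangent_of_gap_le hC hw hw0.le
  have hc := mul_pos (dist_coeff_pos hC) (show 0 < 1 - xiPlus C by linarith [(xiPlus_spec hC.le).2.1])
  rw [distPlane_eq hC, h1, h2]
  have h3 : 0 ≤ (1 - xiMinus C) / (xiPlus C - xiMinus C) ^ 2 * (1 - xiPlus C) *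
      (s * (C * Real.exp (xiMinus C) * w + 1 - Real.exp w)) :=
    mul_nonneg hc.le (mul_nonneg hs (by linarith))
  have h4 : -s ≤ s * w / (xiPlus C - xiMinus C) := by
    rw [le_div_iff₀ hR]; nlinarith
  nlinarith

/-- Visibility from `Ω_3` is used at both ends: it puts points beyond `ξ⁺` below the right tangent,
where the plane is at least one, and it excludes points strictly above the left tangent to the left
of `ξ⁻`. -/
theorem Under.le_distPlane (hC : 1 < C) (h : Under C x y) (hx : x ∈ OmegaZero C)
    (hy : y ∈ Omega C) : DCand 0 C y ≤ distPlane C y := by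
  obtain ⟨a1, a2, a3, a4, -⟩ := (mem_OmegaZero_iff hC).1 hx
  rcases DCand_zero_cases hC hy with ⟨h0, h1, e⟩ | ⟨-, e⟩ | ⟨-, -, w, s, hw, hw0, hs, -, h1, h2, e⟩ |
    ⟨h1, h2, -⟩
  · rw [e]
    apply one_le_distPlane hC
    rcases le_total y.1 (xiPlus C) with h2 | h2
    · exact h1 h2
    · have r := xiPlus_rho hC.le
      have := h.le_tangent (p := xiPlus C) (by linarith)
        (mul_nonpos_of_nonpos_of_nonneg (by linarith) (by linarith)) (by linarith)
      linarith
  · exact e.le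
  · rw [e]; exact chord_le_distPlane hC hw hw0 hs h1 h2
  · have r := xiMinus_rho hC.le
    have := h.le_tangent (p := xiMinus C) (by linarith)
      (mul_nonpos_of_nonneg_of_nonpos (by linarith) (by linarith)) (by linarith)
    linarith

/-- Points visible from a point of `Ω_1 \ Ω_2` to the right of `ξ⁻` lie below the tangent at
`ξ⁻`. -/
theorem Under.lt_tangent_minus (hC : 1 < C) (h : Under C x y) (hx : x ∈ Omega C)
    (hu : uPlus C x < -(xiPlus C - xiMinus C)) (hy : xiMinus C ≤ y.1) :
    y.2 < C * Real.exp (xiMinus C) * y.1 + 1 := by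
  obtain ⟨b1, b2, b3⟩ := uPlus_spec hC.le hx
  have hξ1 := (xiPlus_spec hC.le).2.1
  have r := xiPlus_rho hC.le
  have rm := xiMinus_rho hC.le
  set u := uPlus C x
  set p := u + xiPlus C with hp
  have e : C * Real.exp p * (1 + (x.1 - p)) = x.2 := by
    rw [b3, hp, Real.exp_add]
    have : 1 - xiPlus C ≠ 0 := by linarith
    field_simp
    linear_combination (1 + x.1 - u - xiPlus C) * r
  have h1 := h.le_tangent (p := p) (by linarith)
    (mul_nonpos_of_nonpos_of_nonneg (by linarith) (by linarith)) e.le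
  refine h1.trans_lt ?_
  have h2 : Real.exp p = Real.exp (xiMinus C) * Real.exp (p - xiMinus C) := by
    rw [← Real.exp_add]; congr 1; ring
  have h3 : xiMinus C - p + 1 < Real.exp (xiMinus C - p) := Real.add_one_lt_exp (by linarith)
  have h4 : Real.exp (p - xiMinus C) * Real.exp (xiMinus C - p) = 1 := by
    rw [← Real.exp_add]; simp
  have h5 : Real.exp (p - xiMinus C) * (xiMinus C - p + 1) < 1 := by
    have := mul_lt_mul_of_pos_left h3 (Real.exp_pos (p - xiMinus C))
    rwa [h4] at this
  have h6 : Real.exp (p - xiMinus C) ≤ 1 := Real.exp_le_one_iff.2 (by linarith)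
  have h7 : Real.exp (p - xiMinus C) * (1 + (y.1 - p)) < 1 + (y.1 - xiMinus C) := by nlinarith
  rw [h2]
  have h8 := mul_lt_mul_of_pos_left h7 (rho_minus_pos hC.le)
  calc _ = C * Real.exp (xiMinus C) * (Real.exp (p - xiMinus C) * (1 + (y.1 - p))) := by ring
    _ < C * Real.exp (xiMinus C) * (1 + (y.1 - xiMinus C)) := h8
    _ = _ := by linear_combination rm

/-- From such a point nothing in `Ω_3` or `Ω_4` is visible. On `Ω_2` the candidate is first
dominated by the plane of the separating chord, which is a tangent plane, and then two planes of the
same family are compared. On `Ω_1` the general statement about tangents applies. -/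
theorem Under.le_tangentPlane_dist (hC : 1 < C) (h : Under C x y) (hx : x ∈ Omega C)
    (hu : uPlus C x < -(xiPlus C - xiMinus C)) (hy : y ∈ Omega C) :
    DCand 0 C y ≤ tangentPlane (xiPlus C) (distSlope C) (fun _ => 0)
      (fun u => distSlope C u / xiPlus C) (uPlus C x) y := by
  have hξ := xiPlus_pos hC
  obtain ⟨hξ0, hξ1, hξC⟩ := xiPlus_spec hC.le
  obtain ⟨τx, hx0, hx1, hx2, hx3, -⟩ := exists_tau_plus hC hx
  obtain ⟨τy, hy0, hy1, hy2, hy3, hy4⟩ := exists_tau_plus hC hy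
  have hR := gap_pos hC
  rcases DCand_zero_cases hC hy with ⟨h0, h1, e⟩ | ⟨hm, e⟩ |
    ⟨hn, ht, w, s, hw, hw0, hs, -, h1, h2, e⟩ | ⟨h1, h2, e⟩
  · exfalso
    have a1 := h.lt_tangent_minus hC hx hu (by linarith [xiMinus_neg hC])
    have a2 := Real.add_one_le_exp y.1
    have a3 := rho_minus_lt_one hC
    nlinarith [hy.1]
  · exfalso
    obtain ⟨a1, -, a3, -⟩ := (mem_OmegaZero_iff hC).1 hm
    linarith [h.lt_tangent_minus hC hx hu a1]
  · have a1 : DCand 0 C y ≤ chordPlane (-(xiPlus C - xiMinus C)) y :=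
      DCand_le_chordPlane hC hy le_rfl (by linarith)
    have a2 := le_uPlus_of_le_tangent hC hy ht
    rw [← tangentPlane_gap hC] at a1
    refine a1.trans ?_
    have e1 : y.1 - (y.1 + (xiPlus C - xiMinus C)) / xiPlus C * xiPlus C =
        -(xiPlus C - xiMinus C) := by rw [div_mul_cancel₀ _ hξ.ne']; ring
    have e2 : y.1 - (y.1 - uPlus C x) / xiPlus C * xiPlus C = uPlus C x := by
      rw [div_mul_cancel₀ _ hξ.ne']; ring
    have := (tangentData_dist hC).plane_le_of_ge (y := y)
      (τ₁ := (y.1 + (xiPlus C - xiMinus C)) / xiPlus C) (τ := (y.1 - uPlus C x) / xiPlus C)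
      (div_le_div_of_nonneg_right (by linarith) hξ.le) (by rwa [← tangent_minus_eq hC])
      (h.le_tangentHeight (by linarith) hξ1 hξ.ne' hξC hx1 hx2 hy2 (by rw [e2, hx3])
        (by rw [le_div_iff₀ hξ]; linarith))
    rwa [e1, e2] at this
  · have := (tangentData_dist hC).le_plane (by linarith) hξC h hx1 hx2 hy1 hy2
    rw [e]
    rw [hx3, hy3, hy4] at this
    linarith

theorem hasVisibleMajorants_DCand_zero (hC : 1 < C) : HasVisibleMajorants C (DCand 0 C) := by
  intro x hx
  rcases DCand_zero_cases hC hx with ⟨h0, h1, e⟩ | ⟨hm, e⟩ |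
    ⟨hn, ht, w, s, hw, hw0, hs, -, h1, h2, e⟩ | ⟨h1, h2, e⟩
  · exact ⟨0, 0, fun y hy _ => by rw [e]; linarith [DCand_le_one hC hy]⟩
  · refine ⟨(1 - xiMinus C) / (xiPlus C - xiMinus C) ^ 2,
      -((1 - xiMinus C) / (xiPlus C - xiMinus C) ^ 2 * (1 - xiPlus C)), fun y hy hxy => ?_⟩
    have := hxy.le_distPlane hC hm hy
    rw [e]
    rw [distPlane] at this ⊢
    linarith
  · have k1 := one_sub_chord_pos hw0
    refine ⟨-Real.exp w / (1 - Real.exp w * (1 - w)), 1 / (1 - Real.exp w * (1 - w)),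
      fun y hy _ => (DCand_le_chordPlane hC hy hw hw0).trans (le_of_eq ?_)⟩
    rw [e, chordPlane, h1, h2]
    field_simp
    ring
  · have hu := uPlus_lt_of_tangent_lt hC hx h1 h2
    set u := uPlus C x with hu_def
    set T := (1 - xiPlus C) * (Real.exp (-u) * (distSlope C u / xiPlus C)) with hT
    refine ⟨distSlope C u - T * (Real.exp u / (1 - xiPlus C)), T, fun y hy hU => ?_⟩
    refine (hU.le_tangentPlane_dist hC hx hu hy).trans (le_of_eq ?_)
    rw [e, ← distSlope_plane_eq hC hx, ← hu_def]
    simp only [tangentPlane, ← hT]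
    ring

/-- The open half-line is forced: points of the lower curve to the left of `(0, 1)` have value zero
and come arbitrarily close to it. -/
theorem boundaryMinorant_DCand_zero (hC : 1 < C) :
    BoundaryMinorant C (DCand 0 C) ((Ioi (0 : ℝ)).indicator 1) := by
  intro t ε hε
  rcases le_or_gt t 0 with ht | ht
  · filter_upwards [self_mem_nhdsWithin] with x hx
    rw [indicator_of_notMem (by simpa using ht)]
    linarith [DCand_nonneg hC hx]
  rw [indicator_of_mem (by simpa using ht), Pi.one_apply]
  have hfst : Tendsto (fun x : ℝ × ℝ => x.1) (𝓝[Omega C] (t, Real.exp t)) (𝓝 t) :=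
    (continuous_fst.tendsto (t, Real.exp t)).mono_left nhdsWithin_le_nhds
  have hm := xiMinus_neg hC
  rcases le_or_gt t (xiPlus C) with h1 | h1
  · have hc : Continuous (distPlane C) := by unfold distPlane; fun_prop
    have h2 : 1 ≤ distPlane C (t, Real.exp t) :=
      one_le_distPlane hC (exp_le_tangent_plus hC ht.le h1)
    have h3 := ((hc.tendsto (t, Real.exp t)).mono_left (nhdsWithin_le_nhds (s := Omega C))).eventually
      (lt_mem_nhds (show 1 - ε < distPlane C (t, Real.exp t) by linarith))
    filter_upwards [h3, hfst.eventually (lt_mem_nhds ht), self_mem_nhdsWithin] with x hx hx0 hxO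
    rcases DCand_zero_cases hC hxO with ⟨-, -, e⟩ | ⟨-, e⟩ | ⟨h, -⟩ | ⟨h, -⟩
    · rw [e]; linarith
    · rw [e]; exact hx.le
    · linarith
    · linarith
  · filter_upwards [hfst.eventually (lt_mem_nhds h1), self_mem_nhdsWithin] with x hx hxO
    have hξ := xiPlus_pos hC
    rcases DCand_zero_cases hC hxO with ⟨-, -, e⟩ | ⟨h, -⟩ | ⟨h, -⟩ | ⟨h, -⟩
    · rw [e]; linarith
    · linarith [((mem_OmegaZero_iff hC).1 h).2.1]
    · linarith
    · linarith

end

/-! ### The distribution function: upper bound -/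

/-- The action on pairs of averages of the subtraction of a constant. -/
noncomputable def shiftPoint (lam : ℝ) (x : ℝ × ℝ) : ℝ × ℝ := (x.1 - lam, x.2 * Real.exp (-lam))

section

variable {C lam : ℝ} {x : ℝ × ℝ}

theorem exp_shift_le_iff {s r : ℝ} :
    Real.exp (s - lam) ≤ r * Real.exp (-lam) ↔ Real.exp s ≤ r := by
  rw [sub_eq_add_neg, Real.exp_add, mul_le_mul_iff_left₀ (Real.exp_pos _)]

theorem le_exp_shift_iff {s r : ℝ} :
    r * Real.exp (-lam) ≤ C * Real.exp (s - lam) ↔ r ≤ C * Real.exp s := by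
  rw [sub_eq_add_neg, Real.exp_add, ← mul_assoc, mul_le_mul_iff_left₀ (Real.exp_pos _)]

theorem tangentLine_shift (C lam ξ y : ℝ) :
    tangentLine C 0 ξ (y - lam) = tangentLine C lam ξ y * Real.exp (-lam) := by
  have : Real.exp lam * Real.exp (-lam) = 1 := by rw [← Real.exp_add]; simp
  rw [tangentLine_zero, tangentLine]
  linear_combination (-(C * Real.exp ξ * (y - lam) + 1)) * this

theorem tangentLine_shift_le_iff {ξ y r : ℝ} :
    tangentLine C 0 ξ (y - lam) ≤ r * Real.exp (-lam) ↔ tangentLine C lam ξ y ≤ r := by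
  rw [tangentLine_shift, mul_le_mul_iff_left₀ (Real.exp_pos _)]

theorem le_tangentLine_shift_iff {ξ y r : ℝ} :
    r * Real.exp (-lam) ≤ tangentLine C 0 ξ (y - lam) ↔ r ≤ tangentLine C lam ξ y := by
  rw [tangentLine_shift, mul_le_mul_iff_left₀ (Real.exp_pos _)]

theorem shiftPoint_mem_Omega : shiftPoint lam x ∈ Omega C ↔ x ∈ Omega C := by
  simp only [Omega, shiftPoint, mem_ofPred_eq, exp_shift_le_iff, le_exp_shift_iff]

theorem shiftPoint_mem_Omega1 : shiftPoint lam x ∈ Omega1 C 0 ↔ x ∈ Omega1 C lam := by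
  simp only [Omega1, shiftPoint, mem_union, mem_ofPred_eq, exp_shift_le_iff, le_exp_shift_iff,
    tangentLine_shift_le_iff]
  refine or_congr (and_congr ?_ Iff.rfl) (and_congr ?_ (and_congr ?_ Iff.rfl)) <;>
    constructor <;> intro h <;> linarith

theorem shiftPoint_mem_Omega2 : shiftPoint lam x ∈ Omega2 C 0 ↔ x ∈ Omega2 C lam := by
  simp only [Omega2, shiftPoint, mem_ofPred_eq, exp_shift_le_iff,
    le_tangentLine_shift_iff, le_sub_iff_add_le, zero_add, sub_neg]
  ring_nf

theorem shiftPoint_mem_Omega3 : shiftPoint lam x ∈ Omega3 C 0 ↔ x ∈ Omega3 C lam := by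
  simp only [Omega3, shiftPoint, mem_union, mem_ofPred_eq, le_exp_shift_iff,
    tangentLine_shift_le_iff, sub_le_iff_le_add, le_sub_iff_add_le, zero_add]
  ring_nf

theorem shiftPoint_mem_Omega4 : shiftPoint lam x ∈ Omega4 C 0 ↔ x ∈ Omega4 C lam := by
  simp only [Omega4, shiftPoint, mem_union, mem_ofPred_eq, exp_shift_le_iff, le_exp_shift_iff,
    le_tangentLine_shift_iff, sub_le_iff_le_add, le_sub_iff_add_le, zero_add]
  ring_nf

theorem uPlus_shiftPoint (hC : 1 ≤ C) (hx : x ∈ Omega C) :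
    uPlus C (shiftPoint lam x) = uPlus C x - lam := by
  obtain ⟨h1, h2, h3⟩ := uPlus_spec hC hx
  refine uPlus_eq_of hC (shiftPoint_mem_Omega.2 hx) ⟨?_, ?_, ?_⟩
  · simp only [shiftPoint]; linarith
  · simp only [shiftPoint]; linarith
  · simp only [shiftPoint]
    rw [h3, sub_eq_add_neg (uPlus C x) lam, Real.exp_add]
    ring_nf

theorem vFun_shiftPoint (hC : 1 ≤ C) (hx : x ∈ Omega2 C lam) :
    vFun 0 (shiftPoint lam x) = vFun lam x - lam := by
  obtain ⟨h1, h2⟩ := vFun_spec hC hx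
  refine (existsUnique_v hC (shiftPoint_mem_Omega2.2 hx)).unique
    (vFun_spec hC (shiftPoint_mem_Omega2.2 hx)) ⟨sub_ne_zero.2 h1, ?_⟩
  have e : Real.exp lam * Real.exp (-lam) = 1 := by rw [← Real.exp_add]; simp
  have e1 : Real.exp (vFun lam x - lam) - Real.exp 0 =
      (Real.exp (vFun lam x) - Real.exp lam) * Real.exp (-lam) := by
    rw [sub_mul, e, ← Real.exp_add, Real.exp_zero, sub_eq_add_neg (vFun lam x)]
  have e2 : x.2 * Real.exp (-lam) - Real.exp 0 = (x.2 - Real.exp lam) * Real.exp (-lam) := by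
    rw [sub_mul, e, Real.exp_zero]
  simp only [shiftPoint, sub_zero]
  rw [e1, e2, mul_div_right_comm, h2, mul_div_right_comm]

/-- Subtracting a constant from `φ` preserves the class and moves the average point by `shiftPoint`,
so this equivariance reduces every threshold to `0`. -/
theorem DCand_shiftPoint (hC : 1 ≤ C) (hx : x ∈ Omega C) :
    DCand 0 C (shiftPoint lam x) = DCand lam C x := by
  by_cases h4 : x ∈ Omega4 C lam
  · rw [DCand, DCand, if_pos h4, if_pos (shiftPoint_mem_Omega4.2 h4)]
  rw [DCand, DCand, if_neg h4, if_neg (mt shiftPoint_mem_Omega4.1 h4)]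
  by_cases h3 : x ∈ Omega3 C lam
  · rw [if_pos h3, if_pos (shiftPoint_mem_Omega3.2 h3)]
    simp [shiftPoint]
  rw [if_neg h3, if_neg (mt shiftPoint_mem_Omega3.1 h3)]
  by_cases h2 : x ∈ Omega2 C lam
  · rw [if_pos h2, if_pos (shiftPoint_mem_Omega2.2 h2), vFun_shiftPoint hC h2]
    simp only [shiftPoint]
    ring_nf
  rw [if_neg h2, if_neg (mt shiftPoint_mem_Omega2.1 h2)]
  by_cases h1 : x ∈ Omega1 C lam
  · rw [if_pos h1, if_pos (shiftPoint_mem_Omega1.2 h1), uPlus_shiftPoint hC hx]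
    simp only [shiftPoint]
    ring_nf
  rw [if_neg h1, if_neg (mt shiftPoint_mem_Omega1.1 h1)]

theorem exp_lt_tangent_minus (hC : 1 < C) {t : ℝ} (h : xiMinus C ≤ t) (ht : t < 0) :
    Real.exp t < C * Real.exp (xiMinus C) * t + 1 := by
  have hR := gap_pos hC
  have h1 := exp_slope_lt (s := -(xiPlus C - xiMinus C)) (by linarith [xiPlus_pos hC]) ht
  rw [exp_neg_gap hC.le, show (1 - (xiPlus C - xiMinus C) * (C * Real.exp (xiMinus C)) - 1) /
    -(xiPlus C - xiMinus C) = C * Real.exp (xiMinus C) by field_simp; ring] at h1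
  linarith

theorem DCand_zero_of_eq_exp (hC : 1 < C) (hx : x ∈ Omega C) (h : x.2 = Real.exp x.1) :
    DCand 0 C x = (Ici (0 : ℝ)).indicator 1 x.1 := by
  rcases DCand_zero_cases hC hx with ⟨h0, -, e⟩ | ⟨hm, e⟩ |
    ⟨hn, ht, w, s, hw, hw0, hs, hs1, h1, h2, e⟩ | ⟨h1, h2, e⟩
  · rw [e, indicator_of_mem (by simpa using h0)]; rfl
  · obtain ⟨a1, a2, a3, a4, -⟩ := (mem_OmegaZero_iff hC).1 hm
    rcases lt_or_ge x.1 0 with h0 | h0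
    · linarith [exp_lt_tangent_minus hC a1 h0]
    · rw [e, indicator_of_mem (by simpa using h0), Pi.one_apply]
      refine le_antisymm (distPlane_le_one hC a4) (one_le_distPlane hC ?_)
      rw [h]; exact exp_le_tangent_plus hC h0 a2
  · rw [e, indicator_of_notMem (by simpa using hn)]
    rcases hs1.eq_or_lt with h3 | h3
    · rw [h3]; ring
    · exfalso
      have h4 := exp_slope_lt (s := w) (t := s * w) (by nlinarith) (by rw [← h1]; exact hn)
      have h5 : (Real.exp w - 1) / w * (s * w) = s * (Real.exp w - 1) := by
        field_simp [hw0.ne]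
      rw [h1] at h
      linarith
  · rw [e, uPlus_of_eq_exp hC.le hx h,
      indicator_of_notMem (by simpa using h1.trans_lt (xiMinus_neg hC))]
    ring

theorem DCand_of_eq_exp (hC : 1 ≤ C) (hx : x ∈ Omega C) (h : x.2 = Real.exp x.1) :
    DCand lam C x = (Ici lam).indicator 1 x.1 := by
  rcases hC.eq_or_lt with h1 | h1
  · have h3 : xiPlus C = 0 :=
      (existsUnique_xiPlus hC).unique (xiPlus_spec hC) ⟨le_rfl, one_pos, by simp [← h1]⟩
    have h4 : xiMinus C = 0 :=
      (existsUnique_xiMinus hC).unique (xiMinus_spec hC) ⟨le_rfl, by simp [← h1]⟩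
    rcases le_or_gt lam x.1 with h0 | h0
    · rw [indicator_of_mem (by simpa using h0)]
      exact if_pos (Or.inr ⟨by rw [h3, add_zero]; exact h0, hx⟩)
    · rw [indicator_of_notMem (by simpa using h0), DCand, if_neg, if_neg, if_neg, if_pos,
        uPlus_of_eq_exp hC hx h, sub_self, mul_zero]
      · exact Or.inl ⟨by rw [h3, h4]; linarith, hx⟩
      · rintro ⟨a, -⟩
        rw [h3, h4] at a; linarith
      · rintro (⟨a, -⟩ | ⟨a, -⟩)
        · rw [h4] at a; linarith
        · linarith
      · rintro (⟨a, -⟩ | ⟨a, -⟩)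
        · linarith
        · rw [h3] at a; linarith
  · rw [← DCand_shiftPoint hC hx, DCand_zero_of_eq_exp h1 (shiftPoint_mem_Omega.2 hx)]
    · simp [shiftPoint, indicator]
    · simp only [shiftPoint]
      rw [h, ← Real.exp_add, sub_eq_add_neg]

end

theorem meanPoint_sub_const {φ : ℝ → ℝ} {c d : ℝ} (hcd : c < d)
    (hi : IntervalIntegrable φ volume c d) (k : ℝ) :
    meanPoint (fun t => φ t - k) c d = shiftPoint k (meanPoint φ c d) := by
  have h : d - c ≠ 0 := by linarith
  refine Prod.ext ?_ ?_
  · simp only [meanPoint, shiftPoint]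
    rw [intervalIntegral.integral_sub hi intervalIntegrable_const, intervalIntegral.integral_const,
      smul_eq_mul]
    field_simp
  · simp only [meanPoint, shiftPoint, sub_eq_add_neg, Real.exp_add,
      intervalIntegral.integral_mul_const]
    ring

theorem ExpClass.sub_const {C a b : ℝ} {φ : ℝ → ℝ} (hφ : ExpClass C φ a b) (k : ℝ) :
    ExpClass C (fun t => φ t - k) a b := by
  refine ⟨hφ.int.sub intervalIntegrable_const, ?_, fun c d hc hcd hd => ?_⟩
  · simp only [sub_eq_add_neg, Real.exp_add]
    exact hφ.int_exp.mul_const _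
  · rw [meanPoint_sub_const hcd (intervalIntegrable_sub hφ.int hc hcd.le hd)]
    exact le_exp_shift_iff.2 (hφ.le c d hc hcd hd)

theorem volume_le_eq_lintegral {φ : ℝ → ℝ} {a b : ℝ}
    (hφ : AEMeasurable φ (volume.restrict (Ioc a b))) (lam : ℝ) :
    volume {t ∈ Ioo a b | lam ≤ φ t} =
      ∫⁻ t in Ioc a b, ENNReal.ofReal ((Ici lam).indicator 1 (φ t)) := by
  have h1 : NullMeasurableSet (φ ⁻¹' Ici lam) (volume.restrict (Ioc a b)) :=
    hφ.nullMeasurable measurableSet_Ici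
  have h2 : ∀ t, ENNReal.ofReal ((Ici lam).indicator 1 (φ t)) =
      (φ ⁻¹' Ici lam).indicator 1 t := by
    intro t
    by_cases h : lam ≤ φ t <;> simp [indicator, h]
  simp only [h2]
  rw [lintegral_indicator_one₀ h1, ← restrict_Ioo_eq_restrict_Ioc,
    Measure.restrict_apply' measurableSet_Ioo]
  congr 1
  ext t
  simp [and_comm]

theorem ExpClass.aemeasurable {C a b : ℝ} (hab : a < b) {φ : ℝ → ℝ} (hφ : ExpClass C φ a b) :
    AEMeasurable φ (volume.restrict (Ioc a b)) :=
  ((intervalIntegrable_iff_integrableOn_Ioc_of_le hab.le).1 hφ.int).aemeasurable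

/-- Scaling towards the constant `1`, and not `0`, makes up for the open half-line in the boundary
minorant: where `φ ≥ 0`, the scaled function is strictly positive for `s < 1`. -/
theorem lintegral_indicator_zero_le {C a b : ℝ} (hC : 1 < C) (hab : a < b) {φ : ℝ → ℝ}
    (hφ : ExpClass C φ a b) (hx : Real.exp (meanPoint φ a b).1 < (meanPoint φ a b).2) :
    ∫⁻ t in Ioc a b, ENNReal.ofReal ((Ici (0 : ℝ)).indicator 1 (φ t)) ≤
      ENNReal.ofReal ((b - a) * DCand 0 C (meanPoint φ a b)) := by
  obtain ⟨r, hr, hev⟩ := exists_lintegral_interpolate_le hC hab le_rfl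
    (hasVisibleMajorants_DCand_zero hC) (boundaryMinorant_DCand_zero hC)
    (fun x hx => by rw [zero_mul, add_zero]; exact DCand_nonneg hC hx) hφ (by simp) hx 1
  simp only [zero_mul, add_zero, intervalIntegral.integral_zero, mul_one] at hev
  refine ge_of_tendsto ((ENNReal.continuous_ofReal.tendsto _).comp (hr.const_mul (b - a))) ?_
  filter_upwards [hev, Ioo_mem_nhdsLT (zero_lt_one (α := ℝ))] with s ⟨_, _, h3⟩ hs
  refine (lintegral_mono fun t => ENNReal.ofReal_le_ofReal ?_).trans h3
  by_cases h : 0 ≤ φ t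
  · have h1 : 0 < s * φ t + (1 - s) := by
      have := mul_nonneg hs.1.le h
      linarith [hs.2]
    rw [indicator_of_mem (by simpa using h), indicator_of_mem (by simpa using h1)]
    simp
  · rw [indicator_of_notMem (by simpa using h)]
    exact indicator_nonneg (fun _ _ => zero_le_one) _

theorem volume_le_DCand {C lam a b : ℝ} (hC : 1 ≤ C) (hab : a < b) {φ : ℝ → ℝ}
    (hφ : ExpClass C φ a b) : volume {t ∈ Ioo a b | lam ≤ φ t} ≤
      ENNReal.ofReal ((b - a) * DCand lam C (meanPoint φ a b)) := by
  have hO := hφ.mem_Omega le_rfl hab le_rfl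
  rw [volume_le_eq_lintegral (hφ.aemeasurable hab)]
  rcases eq_exp_or_lt hO with h | h
  · rw [lintegral_const_of_mem hab hφ h (fun t => ENNReal.ofReal ((Ici lam).indicator 1 t)),
      ← ENNReal.ofReal_mul (by linarith), DCand_of_eq_exp hC hO h]
  · have hm := meanPoint_sub_const hab hφ.int lam
    have h2 := lintegral_indicator_zero_le (one_lt_of_exp_lt hO h) hab (hφ.sub_const lam) (by
      rw [hm, shiftPoint]
      by_contra! hcon
      have h3 : (meanPoint φ a b).2 * Real.exp (-lam) ≤
        1 * Real.exp ((meanPoint φ a b).1 - lam) := by rwa [one_mul]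
      rw [le_exp_shift_iff] at h3
      linarith)
    rw [hm, DCand_shiftPoint hC hO] at h2
    simpa [indicator] using h2

/-! ### Constructing functions of the class -/

/-- The tangents to `x₂ = C e^{x₁}` lie below the curve. -/
theorem tangent_le_mul_exp {C : ℝ} (hC : 0 ≤ C) (p z : ℝ) :
    C * Real.exp p * (1 + (z - p)) ≤ C * Real.exp z := by
  have h1 := mul_le_mul_of_nonneg_left (Real.add_one_le_exp (z - p)) (Real.exp_pos p).le
  rw [← Real.exp_add, add_sub_cancel] at h1
  have := mul_le_mul_of_nonneg_left h1 hC
  linarith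

/-- The region on or above the curve is convex: were `Y` strictly above it, the mixture `X` of `Z`
and `Y` would be strictly above too. -/
theorem below_of_mix {C : ℝ} (hC : 0 ≤ C) {X Y Z : ℝ × ℝ} {α β : ℝ} (hα : 0 ≤ α) (hβ : 0 < β)
    (h1 : (α + β) * X.1 = α * Z.1 + β * Y.1) (h2 : (α + β) * X.2 = α * Z.2 + β * Y.2)
    (hZ : C * Real.exp Z.1 ≤ Z.2) (hX : X.2 ≤ C * Real.exp X.1) : Y.2 ≤ C * Real.exp Y.1 := by
  have hs : 0 < α + β := by linarith
  have h3 := exp_convex_comb Z.1 Y.1 (s := β / (α + β)) (div_nonneg hβ.le hs.le)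
    ((div_le_one hs).2 (by linarith))
  have e : Z.1 + β / (α + β) * (Y.1 - Z.1) = X.1 := by
    field_simp; linarith
  rw [e] at h3
  have h4 : (α + β) * Real.exp X.1 ≤ α * Real.exp Z.1 + β * Real.exp Y.1 := by
    have := mul_le_mul_of_nonneg_left h3 hs.le
    refine this.trans (le_of_eq ?_)
    field_simp; ring
  have h5 := mul_le_mul_of_nonneg_left h4 hC
  have h6 := mul_le_mul_of_nonneg_left hX hs.le
  have h7 := mul_le_mul_of_nonneg_left hZ hα
  have h8 : β * Y.2 ≤ β * (C * Real.exp Y.1) := by linarith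
  exact le_of_mul_le_mul_left h8 hβ

/-- A line that enters the region below `x₂ = C e^{x₁}` at a point `X`, coming from a point `V` that
lies, like `X`, above a tangent whose point of tangency separates them, does not leave it again. -/
theorem below_of_beyond {C p : ℝ} (hC : 0 ≤ C) {V X Y : ℝ × ℝ} {α β : ℝ} (hα : 0 ≤ α) (hβ : 0 < β)
    (h1 : (α + β) * X.1 = α * V.1 + β * Y.1) (h2 : (α + β) * X.2 = α * V.2 + β * Y.2)
    (hp : (V.1 - p) * (X.1 - p) ≤ 0) (hV : C * Real.exp p * (1 + (V.1 - p)) ≤ V.2)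
    (hXp : C * Real.exp p * (1 + (X.1 - p)) ≤ X.2) (hX : X.2 ≤ C * Real.exp X.1) :
    Y.2 ≤ C * Real.exp Y.1 := by
  by_cases hne : X.1 = p
  · refine le_trans ?_ (tangent_le_mul_exp hC p Y.1)
    have h3 := mul_le_mul_of_nonneg_left hV hα
    have h4 := mul_le_mul_of_nonneg_left hX (by linarith : 0 ≤ α + β)
    have h5 : β * Y.2 ≤ β * (C * Real.exp p * (1 + (Y.1 - p))) := by
      rw [hne] at h4 h1
      have : (α + β) * (C * Real.exp p) - α * (C * Real.exp p * (1 + (V.1 - p))) =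
          β * (C * Real.exp p * (1 + (Y.1 - p))) := by
        linear_combination (C * Real.exp p) * h1
      linarith
    exact le_of_mul_le_mul_left h5 hβ
  · have hd : X.1 - V.1 ≠ 0 := by
      intro h
      have : V.1 = X.1 := by linarith
      rw [this] at hp
      have : X.1 - p ≠ 0 := sub_ne_zero.2 hne
      nlinarith [sq_pos_of_ne_zero this]
    have hxp : X.1 - p ≠ 0 := sub_ne_zero.2 hne
    -- The segment from `V` to `X` has, at abscissa `p`, a point above the tangent and hence on or
    -- above the curve. That point plays the role of `Z` in `below_of_mix`.
    set κ := (p - V.1) / (X.1 - V.1) with hκ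
    have e1 : 1 - κ = (X.1 - p) / (X.1 - V.1) := by
      rw [hκ]; field_simp; ring
    have hsq : 0 < (X.1 - V.1) ^ 2 := by positivity
    have hκ0 : 0 ≤ κ := by
      have : κ = (p - V.1) * (X.1 - V.1) / (X.1 - V.1) ^ 2 := by rw [hκ]; field_simp
      rw [this]
      apply div_nonneg _ hsq.le
      nlinarith [sq_nonneg (p - V.1)]
    have hκ1 : 0 < 1 - κ := by
      have : 1 - κ = (X.1 - p) * (X.1 - V.1) / (X.1 - V.1) ^ 2 := by rw [e1]; field_simp
      rw [this]
      apply div_pos _ hsq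
      nlinarith [sq_pos_of_ne_zero hxp]
    have eN : (1 - κ) * V.1 + κ * X.1 = p := by
      rw [e1, hκ]; field_simp; ring
    refine below_of_mix hC (α := α) (β := (1 - κ) * β) (X := X)
      (Z := ((1 - κ) * V.1 + κ * X.1, (1 - κ) * V.2 + κ * X.2)) hα (mul_pos hκ1 hβ) ?_ ?_ ?_ hX
    · linear_combination (1 - κ) * h1
    · linear_combination (1 - κ) * h2
    · simp only
      rw [eN]
      have h3 := mul_le_mul_of_nonneg_left hV hκ1.le
      have h4 := mul_le_mul_of_nonneg_left hXp hκ0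
      have : (1 - κ) * (C * Real.exp p * (1 + (V.1 - p))) +
          κ * (C * Real.exp p * (1 + (X.1 - p))) = C * Real.exp p := by
        linear_combination (C * Real.exp p) * eN
      linarith

theorem meanPoint_mix {φ : ℝ → ℝ} {b c d e : ℝ} (hbc : b < c) (hcd : c < d) (hde : d ≤ e)
    (h1 : IntervalIntegrable φ volume b e)
    (h2 : IntervalIntegrable (fun t => Real.exp (φ t)) volume b e) :
    ((c - b) + (d - c)) * (meanPoint φ b d).1 =
        (c - b) * (meanPoint φ b c).1 + (d - c) * (meanPoint φ c d).1 ∧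
      ((c - b) + (d - c)) * (meanPoint φ b d).2 =
        (c - b) * (meanPoint φ b c).2 + (d - c) * (meanPoint φ c d).2 := by
  have a1 : c - b ≠ 0 := by linarith
  have a2 : d - c ≠ 0 := by linarith
  have a3 : d - b ≠ 0 := by linarith
  simp only [meanPoint, sub_add_sub_cancel']
  rw [mul_div_cancel₀ _ a1, mul_div_cancel₀ _ a2, mul_div_cancel₀ _ a3, mul_div_cancel₀ _ a1,
    mul_div_cancel₀ _ a2, mul_div_cancel₀ _ a3]
  exact ⟨(intervalIntegral.integral_add_adjacent_intervals
      (intervalIntegrable_sub h1 le_rfl hbc.le (by linarith))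
      (intervalIntegrable_sub h1 hbc.le hcd.le hde)).symm,
    (intervalIntegral.integral_add_adjacent_intervals
      (intervalIntegrable_sub h2 le_rfl hbc.le (by linarith))
      (intervalIntegrable_sub h2 hbc.le hcd.le hde)).symm⟩

theorem integral_affine_eq {φ : ℝ → ℝ} {c d : ℝ} (hcd : c < d)
    (h1 : IntervalIntegrable φ volume c d) (k p : ℝ) :
    ∫ t in c..d, k * (1 + (φ t - p)) = (d - c) * (k * (1 + ((meanPoint φ c d).1 - p))) := by
  have h : d - c ≠ 0 := by linarith
  rw [intervalIntegral.integral_const_mul, intervalIntegral.integral_add intervalIntegrable_const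
    (h1.sub intervalIntegrable_const), intervalIntegral.integral_sub h1 intervalIntegrable_const]
  simp only [intervalIntegral.integral_const, smul_eq_mul, meanPoint]
  field_simp

theorem mean_le_tangent {k p : ℝ} {φ : ℝ → ℝ} {c d : ℝ} (hcd : c < d)
    (h1 : IntervalIntegrable φ volume c d)
    (h2 : IntervalIntegrable (fun t => Real.exp (φ t)) volume c d)
    (h : ∀ t ∈ Ioo c d, Real.exp (φ t) ≤ k * (1 + (φ t - p))) :
    (meanPoint φ c d).2 ≤ k * (1 + ((meanPoint φ c d).1 - p)) := by
  have := intervalIntegral.integral_mono_on_of_le_Ioo hcd.le h2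
    ((intervalIntegrable_const.add (h1.sub intervalIntegrable_const)).const_mul k) h
  rw [integral_affine_eq hcd h1] at this
  change (∫ t in c..d, Real.exp (φ t)) / (d - c) ≤ _
  rw [div_le_iff₀ (by linarith)]
  linarith

theorem tangent_le_mean {k p : ℝ} {φ : ℝ → ℝ} {c d : ℝ} (hcd : c < d)
    (h1 : IntervalIntegrable φ volume c d)
    (h2 : IntervalIntegrable (fun t => Real.exp (φ t)) volume c d)
    (h : ∀ t ∈ Ioo c d, k * (1 + (φ t - p)) ≤ Real.exp (φ t)) :
    k * (1 + ((meanPoint φ c d).1 - p)) ≤ (meanPoint φ c d).2 := by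
  have := intervalIntegral.integral_mono_on_of_le_Ioo hcd.le
    ((intervalIntegrable_const.add (h1.sub intervalIntegrable_const)).const_mul k) h2 h
  rw [integral_affine_eq hcd h1] at this
  change _ ≤ (∫ t in c..d, Real.exp (φ t)) / (d - c)
  rw [le_div_iff₀ (by linarith)]
  linarith

/-- If all points `(φ t, e^{φ t})` lie below one tangent, so does their average, and the tangent
lies below the curve. -/
theorem below_of_values {C p : ℝ} (hC : 0 ≤ C) {φ : ℝ → ℝ} {c d : ℝ} (hcd : c < d)
    (h1 : IntervalIntegrable φ volume c d)
    (h2 : IntervalIntegrable (fun t => Real.exp (φ t)) volume c d)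
    (h : ∀ t ∈ Ioo c d, Real.exp (φ t) ≤ C * Real.exp p * (1 + (φ t - p))) :
    (meanPoint φ c d).2 ≤ C * Real.exp (meanPoint φ c d).1 :=
  (mean_le_tangent hcd h1 h2 h).trans (tangent_le_mul_exp hC p _)

/-- It suffices to control the averages over initial intervals, provided that the others are
accounted for. -/
theorem expClass_of_initial {C b : ℝ} {φ : ℝ → ℝ}
    (h1 : IntervalIntegrable φ volume 0 b)
    (h2 : IntervalIntegrable (fun t => Real.exp (φ t)) volume 0 b)
    (hP : ∀ d, 0 < d → d ≤ b → (meanPoint φ 0 d).2 ≤ C * Real.exp (meanPoint φ 0 d).1)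
    (hQ : ∀ c d, 0 < c → c < d → d ≤ b → (meanPoint φ c d).2 ≤ C * Real.exp (meanPoint φ c d).1) :
    ExpClass C φ 0 b := by
  refine ⟨h1, h2, fun c d hc hcd hd => ?_⟩
  rcases hc.eq_or_lt with h | h
  · subst h; exact hP d hcd hd
  · exact hQ c d h hcd hd

theorem below_of_initial_above {C b c d : ℝ} (hC : 0 ≤ C) {φ : ℝ → ℝ}
    (h1 : IntervalIntegrable φ volume 0 b)
    (h2 : IntervalIntegrable (fun t => Real.exp (φ t)) volume 0 b)
    (hc : 0 < c) (hcd : c < d) (hd : d ≤ b)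
    (hZ : C * Real.exp (meanPoint φ 0 c).1 ≤ (meanPoint φ 0 c).2)
    (hX : (meanPoint φ 0 d).2 ≤ C * Real.exp (meanPoint φ 0 d).1) :
    (meanPoint φ c d).2 ≤ C * Real.exp (meanPoint φ c d).1 := by
  obtain ⟨e1, e2⟩ := meanPoint_mix hc hcd hd h1 h2
  exact below_of_mix hC (by linarith) (by linarith) e1 e2 hZ hX

/-! ### Transport from the unit interval -/

section

variable {a b : ℝ}

theorem meanPoint_comp_affine (hab : a < b) (ψ : ℝ → ℝ) (c d : ℝ) :
    meanPoint (fun t => ψ (t / (b - a) - a / (b - a))) c d =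
      meanPoint ψ (c / (b - a) - a / (b - a)) (d / (b - a) - a / (b - a)) := by
  have h : b - a ≠ 0 := by linarith
  have e : d / (b - a) - a / (b - a) - (c / (b - a) - a / (b - a)) = (d - c) / (b - a) := by ring
  refine Prod.ext ?_ ?_
  · simp only [meanPoint, e]
    rw [intervalIntegral.integral_comp_div_sub _ h, smul_eq_mul, div_div_eq_mul_div, mul_comm]
  · simp only [meanPoint, e]
    rw [intervalIntegral.integral_comp_div_sub (fun t => Real.exp (ψ t)) h, smul_eq_mul,
      div_div_eq_mul_div, mul_comm]

theorem intervalIntegrable_comp_affine (hab : a < b) {ψ : ℝ → ℝ}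
    (h : IntervalIntegrable ψ volume 0 1) :
    IntervalIntegrable (fun t => ψ (t / (b - a) - a / (b - a))) volume a b := by
  have hL : b - a ≠ 0 := by linarith
  have h1 := h.comp_sub_right (a / (b - a))
  have h2 := h1.comp_mul_left (c := (b - a)⁻¹)
  convert h2 using 2
  · rw [div_eq_inv_mul]
  · field_simp; ring
  · field_simp; ring

theorem ExpClass.comp_affine {C : ℝ} (hab : a < b) {ψ : ℝ → ℝ} (h : ExpClass C ψ 0 1) :
    ExpClass C (fun t => ψ (t / (b - a) - a / (b - a))) a b := by
  have hL : 0 < b - a := by linarith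
  refine ⟨intervalIntegrable_comp_affine hab h.int, intervalIntegrable_comp_affine hab h.int_exp,
    fun c d hc hcd hd => ?_⟩
  rw [meanPoint_comp_affine hab]
  apply h.le
  · rw [← sub_div]; exact div_nonneg (by linarith) hL.le
  · exact sub_lt_sub_right (div_lt_div_of_pos_right hcd hL) _
  · rw [← sub_div, div_le_one hL]; linarith

theorem lintegral_comp_affine (hab : a < b) (F : ℝ → ℝ≥0∞) :
    (⨍⁻ t in Ioo a b, F (t / (b - a) - a / (b - a)) ∂volume) = ∫⁻ t in Ioc 0 1, F t := by
  have hL : 0 < b - a := by linarith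
  have himg : (fun t => t / (b - a) - a / (b - a)) '' Ioc a b = Ioc 0 1 := by
    ext s
    constructor
    · rintro ⟨t, ht, rfl⟩
      simp only [← sub_div]
      exact ⟨div_pos (by linarith [ht.1]) hL, (div_le_one hL).2 (by linarith [ht.2])⟩
    · intro hs
      refine ⟨a + s * (b - a), ⟨by nlinarith [hs.1], by nlinarith [hs.2]⟩, ?_⟩
      field_simp; ring
  have h := lintegral_image_eq_lintegral_abs_deriv_mul (s := Ioc a b)
    (f := fun t => t / (b - a) - a / (b - a)) (f' := fun _ => 1 / (b - a)) measurableSet_Ioc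
    (fun t _ => (((hasDerivAt_id t).div_const (b - a)).sub_const _).hasDerivWithinAt)
    (fun s _ t _ hst => by
      simp only [sub_left_inj] at hst
      exact (div_left_inj' hL.ne').1 hst) F
  rw [himg, lintegral_const_mul' _ _ ENNReal.ofReal_ne_top] at h
  rw [h, setLAverage_Ioo_eq_div, abs_of_pos (by positivity), ENNReal.ofReal_div_of_pos hL,
    ENNReal.ofReal_one, ENNReal.div_eq_inv_mul, one_div]

theorem comp_affine_mem_testFunctions {C : ℝ} (hC : 0 ≤ C) (hab : a < b) {ψ : ℝ → ℝ}
    {x : ℝ × ℝ} (h : ExpClass C ψ 0 1) (hx : meanPoint ψ 0 1 = x) :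
    (fun t => ψ (t / (b - a) - a / (b - a))) ∈ testFunctions x C a b := by
  have hL : b - a ≠ 0 := by linarith
  rw [mem_testFunctions_iff hab hC]
  refine ⟨h.comp_affine hab, ?_⟩
  rw [meanPoint_comp_affine hab, sub_self, ← sub_div, div_self hL, hx]

theorem expClass_const {C : ℝ} (hC : 1 ≤ C) (k : ℝ) : ExpClass C (fun _ => k) 0 1 := by
  refine ⟨intervalIntegrable_const, intervalIntegrable_const, fun c d _ hcd _ => ?_⟩
  have h : d - c ≠ 0 := by linarith
  simp only [meanPoint, intervalIntegral.integral_const, smul_eq_mul]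
  rw [mul_div_cancel_left₀ _ h, mul_div_cancel_left₀ _ h]
  nlinarith [Real.exp_pos k]

theorem meanPoint_const (k : ℝ) : meanPoint (fun _ => k) 0 1 = (k, Real.exp k) := by
  simp [meanPoint]

end

/-! ### Functions with a logarithmic tail -/

theorem tendsto_mul_sq_log (A ξ : ℝ) :
    Tendsto (fun t : ℝ => t * (1 + (A - ξ * Real.log t) ^ 2)) (𝓝[>] 0) (𝓝 0) := by
  have h1 := tendsto_log_mul_rpow_nhdsGT_zero (r := 1 / 2) (by norm_num)
  have h2 : Tendsto (fun t : ℝ => t ^ (1 / 2 : ℝ)) (𝓝[>] 0) (𝓝 0) := by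
    have := (Real.continuousAt_rpow_const 0 (1 / 2) (Or.inr (by norm_num))).tendsto
    rw [Real.zero_rpow (by norm_num)] at this
    exact this.mono_left nhdsWithin_le_nhds
  have h3 := (h2.pow 2).add (((h2.const_mul A).sub (h1.const_mul ξ)).pow 2)
  norm_num at h3
  refine h3.congr' ?_
  filter_upwards [self_mem_nhdsWithin] with t ht
  have h4 : (t ^ (1 / 2 : ℝ)) ^ 2 = t := by
    rw [← Real.rpow_natCast, ← Real.rpow_mul (mem_Ioi.1 ht).le]; norm_num
  norm_num at h4
  linear_combination (1 + (A - ξ * Real.log t) ^ 2) * h4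

/-- `f` and `g` are such that `t g(A - ξ log t)` is an antiderivative of `f(A - ξ log t)` that
vanishes at `0`. -/
structure TailPair (ξ : ℝ) (f g g' : ℝ → ℝ) : Prop where
  hasDerivAt : ∀ s, HasDerivAt g (g' s) s
  eq : ∀ s, f s = g s - ξ * g' s
  lim : ∀ A, Tendsto (fun t => t * g (A - ξ * Real.log t)) (𝓝[>] 0) (𝓝 0)
  int : ∀ A c, 0 < c → IntervalIntegrable (fun t => f (A - ξ * Real.log t)) volume 0 c

section

variable {ξ : ℝ} {f g g' : ℝ → ℝ}

theorem hasDerivAt_mul_comp_log (hd : ∀ s, HasDerivAt g (g' s) s)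
    (heq : ∀ s, f s = g s - ξ * g' s) (A : ℝ) {t : ℝ} (ht : 0 < t) :
    HasDerivAt (fun t => t * g (A - ξ * Real.log t)) (f (A - ξ * Real.log t)) t := by
  have h1 := ((Real.hasDerivAt_log ht.ne').const_mul ξ).const_sub A
  refine ((hasDerivAt_id t).mul ((hd _).comp t h1)).congr_deriv ?_
  rw [heq]
  simp only [id_eq, Function.comp_apply]
  field_simp
  ring

theorem continuousOn_mul_comp_log (hd : ∀ s, HasDerivAt g (g' s) s)
    (heq : ∀ s, f s = g s - ξ * g' s) (A : ℝ)
    (hlim : Tendsto (fun t => t * g (A - ξ * Real.log t)) (𝓝[>] 0) (𝓝 0)) (c : ℝ) :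
    ContinuousOn (fun t => t * g (A - ξ * Real.log t)) (Icc 0 c) := by
  intro t ht
  rcases ht.1.eq_or_lt with h | h
  · subst h
    refine (continuousWithinAt_Ioi_iff_Ici.1 ?_).mono Icc_subset_Ici_self
    rw [ContinuousWithinAt, zero_mul]
    exact hlim
  · exact (hasDerivAt_mul_comp_log hd heq A h).continuousAt.continuousWithinAt

/-- A continuous function with nonnegative derivative has integrable derivative, so for nonnegative
`f` the explicit antiderivative also provides integrability near the singularity. -/
theorem TailPair.of_nonneg (hd : ∀ s, HasDerivAt g (g' s) s)
    (heq : ∀ s, f s = g s - ξ * g' s)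
    (hlim : ∀ A, Tendsto (fun t => t * g (A - ξ * Real.log t)) (𝓝[>] 0) (𝓝 0))
    (hf : ∀ s, 0 ≤ f s) : TailPair ξ f g g' := by
  refine ⟨hd, heq, hlim, fun A c hc => ?_⟩
  rw [intervalIntegrable_iff_integrableOn_Ioc_of_le hc.le]
  exact intervalIntegral.integrableOn_deriv_of_nonneg
    (continuousOn_mul_comp_log hd heq A (hlim A) c)
    (fun t ht => hasDerivAt_mul_comp_log hd heq A ht.1) fun t _ => hf _

theorem TailPair.integral_eq (h : TailPair ξ f g g') (A : ℝ) {c : ℝ} (hc : 0 < c) :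
    ∫ t in (0 : ℝ)..c, f (A - ξ * Real.log t) = c * g (A - ξ * Real.log c) := by
  rw [intervalIntegral.integral_eq_sub_of_hasDerivAt_of_le hc.le
    (continuousOn_mul_comp_log h.hasDerivAt h.eq A (h.lim A) c)
    (fun t ht => hasDerivAt_mul_comp_log h.hasDerivAt h.eq A ht.1) (h.int A c hc)]
  simp

theorem tendsto_mul_of_le_sq {K : ℝ} (hg : ∀ s, |g s| ≤ K * (1 + s ^ 2)) (A : ℝ) :
    Tendsto (fun t => t * g (A - ξ * Real.log t)) (𝓝[>] 0) (𝓝 0) := by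
  have h := (tendsto_mul_sq_log A ξ).const_mul K
  rw [mul_zero] at h
  refine squeeze_zero_norm' ?_ h
  filter_upwards [self_mem_nhdsWithin] with t ht
  rw [Real.norm_eq_abs, abs_mul, abs_of_pos (mem_Ioi.1 ht)]
  have := mul_le_mul_of_nonneg_left (hg (A - ξ * Real.log t)) (mem_Ioi.1 ht).le
  linarith

theorem tailPair_id (ξ : ℝ) : TailPair ξ (fun s => s) (fun s => s + ξ) fun _ => 1 where
  hasDerivAt s := (hasDerivAt_id s).add_const ξ
  eq s := by ring
  lim := tendsto_mul_of_le_sq (g := fun s => s + ξ) (K := 1 + |ξ|) fun s => by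
    have h1 := abs_add_le s ξ
    have h2 : |s| ≤ 1 + s ^ 2 := by nlinarith [sq_abs s, sq_nonneg (|s| - 1)]
    nlinarith [mul_nonneg (abs_nonneg ξ) (sq_nonneg s)]
  int A c _ := intervalIntegrable_const.sub (intervalIntegral.intervalIntegrable_log'.const_mul ξ)

theorem tailPair_exp {δ : ℝ} (h : δ * ξ < 1) : TailPair ξ (fun s => Real.exp (δ * s))
    (fun s => Real.exp (δ * s) / (1 - δ * ξ)) fun s => δ * Real.exp (δ * s) / (1 - δ * ξ) := by
  have h1 : 1 - δ * ξ ≠ 0 := by linarith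
  refine .of_nonneg (fun s => ?_) (fun s => ?_) (fun A => ?_) fun s => (Real.exp_pos _).le
  · refine (((hasDerivAt_id s).const_mul δ).exp.div_const (1 - δ * ξ)).congr_deriv ?_
    simp only [id_eq]; ring
  · field_simp
  · have h2 : Tendsto (fun t : ℝ => Real.exp (δ * A) / (1 - δ * ξ) *
        Real.exp ((1 - δ * ξ) * Real.log t)) (𝓝[>] 0) (𝓝 0) := by
      have := (Real.tendsto_exp_atBot.comp (Real.tendsto_log_nhdsGT_zero.const_mul_atBot
        (by linarith : 0 < 1 - δ * ξ))).const_mul (Real.exp (δ * A) / (1 - δ * ξ))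
      rwa [mul_zero] at this
    refine h2.congr' ?_
    filter_upwards [self_mem_nhdsWithin] with t ht
    have e : Real.exp ((1 - δ * ξ) * Real.log t) = t * Real.exp (-(δ * ξ) * Real.log t) := by
      conv_rhs => rw [← Real.exp_log (mem_Ioi.1 ht), Real.log_exp]
      rw [← Real.exp_add]; ring_nf
    have e2 : Real.exp (δ * (A - ξ * Real.log t)) =
        Real.exp (δ * A) * Real.exp (-(δ * ξ) * Real.log t) := by
      rw [← Real.exp_add]; ring_nf
    rw [e, e2]; ring

theorem tailPair_sq (ξ : ℝ) : TailPair ξ (fun s => s ^ 2) (fun s => s ^ 2 + 2 * ξ * s + 2 * ξ ^ 2)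
    fun s => 2 * s + 2 * ξ := by
  refine .of_nonneg (fun s => ?_) (fun s => by ring)
    (tendsto_mul_of_le_sq (g := fun s => s ^ 2 + 2 * ξ * s + 2 * ξ ^ 2) (K := 2 + 3 * ξ ^ 2)
      fun s => ?_) fun s => sq_nonneg s
  · refine (((hasDerivAt_pow 2 s).add ((hasDerivAt_id s).const_mul (2 * ξ))).add_const
      (2 * ξ ^ 2)).congr_deriv ?_
    push_cast; ring
  · have h : 0 ≤ s ^ 2 + 2 * ξ * s + 2 * ξ ^ 2 := by nlinarith [sq_nonneg (s + ξ), sq_nonneg ξ]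
    rw [abs_of_nonneg h]
    nlinarith [sq_nonneg (s - ξ), mul_nonneg (sq_nonneg ξ) (sq_nonneg s)]

/-- For `g = f + ξ m` the identity `f = g - ξ g'` is the equation `f' = m - ξ m'` of `TangentData`.
This is why logarithmic tails attain the candidate: the equation for the slope is the formula for
their averages. -/
theorem tailPair_pow {p : ℝ} (hp : 1 < p) (hp2 : p ≤ 2) (hξ : 0 < ξ) (hξ1 : ξ < 1) :
    TailPair ξ (fun s => |s| ^ p) (fun s => |s| ^ p + ξ * powSlope p ξ s)
      fun s => p * signPow (p - 1) s + ξ * powSlopeDeriv p ξ s := by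
  refine .of_nonneg (fun s => (hasDerivAt_abs_rpow_signPow hp s).add
    ((hasDerivAt_powSlope hp hp2 hξ s).const_mul ξ)) (fun s => ?_)
    (tendsto_mul_of_le_sq (g := fun s => |s| ^ p + ξ * powSlope p ξ s) (K := 20)
      fun s => ?_) fun s => Real.rpow_nonneg (abs_nonneg s) p
  · rw [powSlopeDeriv]; field_simp; ring
  · have h1 := abs_powSlope_le hp hp2 hξ hξ1 s
    have h2 : |s| ^ p ≤ 1 + s ^ 2 := by
      rcases le_total |s| 1 with h | h
      · have := Real.rpow_le_one (abs_nonneg s) h (by linarith : 0 ≤ p)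
        nlinarith [sq_nonneg s]
      · have := Real.rpow_le_rpow_of_exponent_le h hp2
        rw [Real.rpow_two, sq_abs] at this
        linarith
    have h3 : |s| ≤ 1 + s ^ 2 := by nlinarith [sq_abs s, sq_nonneg (|s| - 1)]
    have h4 := abs_add_le (|s| ^ p) (ξ * powSlope p ξ s)
    rw [abs_of_nonneg (Real.rpow_nonneg (abs_nonneg s) p), abs_mul, abs_of_pos hξ] at h4
    have h5 : ξ * |powSlope p ξ s| ≤ 1 * |powSlope p ξ s| :=
      mul_le_mul_of_nonneg_right hξ1.le (abs_nonneg _)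
    nlinarith [sq_nonneg s]

/-- The function with a logarithmic singularity at `0` that is equal to `u` to the right of `β`. -/
noncomputable def logTail (u ξ β t : ℝ) : ℝ :=
  if t < β then u + ξ * (Real.log β - Real.log t) else u

theorem logTail_of_lt {u β t : ℝ} (h : t < β) :
    logTail u ξ β t = u + ξ * Real.log β - ξ * Real.log t := by rw [logTail, if_pos h]; ring

theorem logTail_of_le {u β t : ℝ} (h : β ≤ t) : logTail u ξ β t = u := if_neg (by linarith)

theorem eqOn_logTail {u β c : ℝ} (f : ℝ → ℝ) (hc : 0 ≤ c) (hcβ : c ≤ β) :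
    EqOn (fun t => f (u + ξ * Real.log β - ξ * Real.log t)) (fun t => f (logTail u ξ β t))
      (uIoo 0 c) := by
  intro t ht
  rw [uIoo_of_le hc] at ht
  simp only
  rw [logTail_of_lt (ht.2.trans_le hcβ)]

theorem eqOn_logTail_const {u β c d : ℝ} (f : ℝ → ℝ) (hcd : c ≤ d) (hβc : β ≤ c) :
    EqOn (fun _ => f u) (fun t => f (logTail u ξ β t)) (uIoo c d) := by
  intro t ht
  rw [uIoo_of_le hcd] at ht
  simp only
  rw [logTail_of_le (hβc.trans ht.1.le)]

namespace TailPair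

variable {u β c : ℝ}

theorem intervalIntegrable_logTail (h : TailPair ξ f g g') (hβ : 0 ≤ β) (hc : 0 ≤ c) :
    IntervalIntegrable (fun t => f (logTail u ξ β t)) volume 0 c := by
  have h1 : ∀ c, 0 ≤ c → c ≤ β → IntervalIntegrable (fun t => f (logTail u ξ β t)) volume 0 c := by
    intro c hc hcβ
    rcases hc.eq_or_lt with h0 | h0
    · rw [← h0]
    · exact (h.int _ c h0).congr_uIoo (eqOn_logTail f hc hcβ)
  rcases le_total c β with hcβ | hcβ
  · exact h1 c hc hcβ
  · exact (h1 β hβ le_rfl).trans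
      (intervalIntegrable_const.congr_uIoo (eqOn_logTail_const f hcβ le_rfl))

theorem integral_logTail_of_le (h : TailPair ξ f g g') (hc : 0 < c) (hcβ : c ≤ β) :
    ∫ t in (0 : ℝ)..c, f (logTail u ξ β t) = c * g (u + ξ * (Real.log β - Real.log c)) := by
  rw [← intervalIntegral.integral_congr_uIoo (eqOn_logTail f hc.le hcβ), h.integral_eq _ hc]
  ring_nf

theorem integral_logTail_of_ge (h : TailPair ξ f g g') (hβ : 0 ≤ β) (hβc : β ≤ c) :
    ∫ t in (0 : ℝ)..c, f (logTail u ξ β t) = β * g u + (c - β) * f u := by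
  have hi : IntervalIntegrable (fun t => f (logTail u ξ β t)) volume β c :=
    intervalIntegrable_const.congr_uIoo (eqOn_logTail_const f hβc le_rfl)
  rw [← intervalIntegral.integral_add_adjacent_intervals
    (h.intervalIntegrable_logTail hβ hβ) hi,
    ← intervalIntegral.integral_congr_uIoo (eqOn_logTail_const (ξ := ξ) f hβc le_rfl),
    intervalIntegral.integral_const, smul_eq_mul]
  rcases hβ.eq_or_lt with h0 | h0
  · rw [← h0]; simp
  · rw [h.integral_logTail_of_le h0 le_rfl]; simp

end TailPair

end

section

variable {C ξ u β c d : ℝ}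

theorem tailPair_exp_one (hξ : ξ < 1) : TailPair ξ Real.exp (fun s => Real.exp s / (1 - ξ))
    fun s => Real.exp s / (1 - ξ) := by
  simpa using tailPair_exp (ξ := ξ) (δ := 1) (by simpa using hξ)

theorem intervalIntegrable_logTail (hβ : 0 ≤ β) (hc : 0 ≤ c) :
    IntervalIntegrable (logTail u ξ β) volume 0 c :=
  (tailPair_id ξ).intervalIntegrable_logTail hβ hc

theorem intervalIntegrable_exp_logTail (hξ : ξ < 1) (hβ : 0 ≤ β) (hc : 0 ≤ c) :
    IntervalIntegrable (fun t => Real.exp (logTail u ξ β t)) volume 0 c :=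
  (tailPair_exp_one hξ).intervalIntegrable_logTail hβ hc

theorem meanPoint_logTail_of_le (hξ : ξ < 1) (hc : 0 < c) (hcβ : c ≤ β) :
    meanPoint (logTail u ξ β) 0 c = (u + ξ * (Real.log β - Real.log c) + ξ,
      Real.exp (u + ξ * (Real.log β - Real.log c)) / (1 - ξ)) := by
  rw [meanPoint, (tailPair_id ξ).integral_logTail_of_le hc hcβ,
    (tailPair_exp_one hξ).integral_logTail_of_le hc hcβ, sub_zero, mul_div_cancel_left₀ _ hc.ne',
    mul_div_cancel_left₀ _ hc.ne']

theorem meanPoint_logTail_of_ge (hξ : ξ < 1) (hβ : 0 ≤ β) (hc : 0 < c) (hβc : β ≤ c) :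
    meanPoint (logTail u ξ β) 0 c = (u + β / c * ξ, Real.exp u * (1 + β / c * ξ / (1 - ξ))) := by
  have h1 : 1 - ξ ≠ 0 := by linarith
  have h2 := hc.ne'
  rw [meanPoint, (tailPair_id ξ).integral_logTail_of_ge hβ hβc,
    (tailPair_exp_one hξ).integral_logTail_of_ge hβ hβc, sub_zero]
  refine Prod.ext ?_ ?_
  · simp only; field_simp; ring
  · simp only; field_simp; ring

/-- The averages of `logTail` over initial intervals lie on tangents, as does `Ω_C`. -/
theorem exists_meanPoint_logTail (hξ : ξ < 1) (hβ : 0 ≤ β) (hc : 0 < c) :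
    ∃ τ, 0 ≤ τ ∧ τ ≤ 1 ∧ (meanPoint (logTail u ξ β) 0 c).2 =
        Real.exp (meanPoint (logTail u ξ β) 0 c).1 * tangentHeight ξ τ ∧
      (meanPoint (logTail u ξ β) 0 c).1 - τ * ξ = logTail u ξ β c := by
  rcases lt_or_ge c β with h | h
  · refine ⟨1, zero_le_one, le_rfl, ?_, ?_⟩
    · rw [meanPoint_logTail_of_le hξ hc h.le, tangentHeight, ← mul_assoc, ← Real.exp_add]
      have : 1 - ξ ≠ 0 := by linarith
      simp only [one_mul, add_neg_cancel_right]
      field_simp; ring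
    · rw [meanPoint_logTail_of_le hξ hc h.le, logTail, if_pos h]; ring
  · refine ⟨β / c, div_nonneg hβ hc.le, (div_le_one hc).2 h, ?_, ?_⟩
    · rw [meanPoint_logTail_of_ge hξ hβ hc h, tangentHeight, ← mul_assoc, ← Real.exp_add]
      simp only [add_neg_cancel_right]
    · rw [meanPoint_logTail_of_ge hξ hβ hc h, logTail_of_le h]; ring

theorem below_meanPoint_logTail (hξ : ξ < 1) (hξC : Real.exp (-ξ) = C * (1 - ξ)) (hβ : 0 ≤ β)
    (hc : 0 < c) : (meanPoint (logTail u ξ β) 0 c).2 ≤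
      C * Real.exp (meanPoint (logTail u ξ β) 0 c).1 := by
  obtain ⟨τ, -, -, h, -⟩ := exists_meanPoint_logTail (u := u) hξ hβ hc
  rw [h, mul_comm C]
  exact mul_le_mul_of_nonneg_left (tangentHeight_le hξ hξC τ) (Real.exp_pos _).le

theorem above_meanPoint_logTail (hξ : ξ < 1) (hξC : Real.exp (-ξ) = C * (1 - ξ))
    (hc : 0 < c) (hcβ : c ≤ β) : C * Real.exp (meanPoint (logTail u ξ β) 0 c).1 ≤
      (meanPoint (logTail u ξ β) 0 c).2 := by
  rw [meanPoint_logTail_of_le hξ hc hcβ]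
  have h1 := mul_exp_xi hξC
  have h2 : 1 - ξ ≠ 0 := by linarith
  apply le_of_eq
  simp only
  rw [Real.exp_add, eq_div_iff h2]
  linear_combination Real.exp (u + ξ * (Real.log β - Real.log c)) * h1

/-- Up to `β` the initial averages lie on the upper curve, so removing an initial interval leaves an
average below it. Beyond `β` the function is constant. -/
theorem expClass_logTail (hC : 1 ≤ C) (hξ : ξ < 1) (hξC : Real.exp (-ξ) = C * (1 - ξ))
    (hβ : 0 ≤ β) : ExpClass C (logTail u ξ β) 0 1 := by
  have i1 := intervalIntegrable_logTail (u := u) (ξ := ξ) hβ zero_le_one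
  have i2 := intervalIntegrable_exp_logTail (u := u) hξ hβ zero_le_one
  refine expClass_of_initial i1 i2 (fun d hd _ => below_meanPoint_logTail hξ hξC hβ hd)
    fun c d hc hcd hd => ?_
  rcases le_total c β with h | h
  · exact below_of_initial_above (by linarith) i1 i2 hc hcd hd (above_meanPoint_logTail hξ hξC hc h)
      (below_meanPoint_logTail hξ hξC hβ (hc.trans hcd))
  · have h1 : d - c ≠ 0 := by linarith
    rw [meanPoint, ← intervalIntegral.integral_congr_uIoo
      (eqOn_logTail_const (ξ := ξ) (u := u) (fun s => s) hcd.le h),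
      ← intervalIntegral.integral_congr_uIoo (eqOn_logTail_const (ξ := ξ) Real.exp hcd.le h)]
    simp only [intervalIntegral.integral_const, smul_eq_mul]
    rw [mul_div_cancel_left₀ _ h1, mul_div_cancel_left₀ _ h1]
    nlinarith [Real.exp_pos u]

theorem meanPoint_logTail_eq (hξ : ξ < 1) {x : ℝ × ℝ} {τ : ℝ} (h0 : 0 ≤ τ) (h1 : τ ≤ 1)
    (h2 : x.2 = Real.exp x.1 * tangentHeight ξ τ) :
    meanPoint (logTail (x.1 - τ * ξ) ξ τ) 0 1 = x := by
  rw [meanPoint_logTail_of_ge hξ h0 one_pos h1]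
  refine Prod.ext ?_ ?_
  · simp
  · simp only [div_one]
    rw [h2, tangentHeight, sub_eq_add_neg, Real.exp_add]; ring

/-- The integral of a nonnegative function of `logTail` over the unit interval. -/
theorem TailPair.lintegral_logTail {f g g' : ℝ → ℝ} (h : TailPair ξ f g g') (hf : ∀ s, 0 ≤ f s)
    (hβ : 0 ≤ β) (hβ1 : β ≤ 1) : ∫⁻ t in Ioc 0 1, ENNReal.ofReal (f (logTail u ξ β t)) =
      ENNReal.ofReal (β * g u + (1 - β) * f u) := by
  rw [← h.integral_logTail_of_ge hβ hβ1, intervalIntegral.integral_of_le zero_le_one,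
    ofReal_integral_eq_lintegral_ofReal _ (ae_of_all _ fun t => hf _)]
  exact (intervalIntegrable_iff_integrableOn_Ioc_of_le zero_le_one).1
    (h.intervalIntegrable_logTail hβ zero_le_one)

/-- On `(0, β]` the integrand is at least a multiple of `(β / t)^{δξ}`, and `δ ξ ≥ 1` makes this at
least `K / t`, which is not integrable. -/
theorem lintegral_exp_logTail_eq_top {δ : ℝ} (hδ : 1 ≤ δ * ξ) (hβ : 0 < β) (hβ1 : β ≤ 1) :
    ∫⁻ t in Ioc 0 1, ENNReal.ofReal (Real.exp (δ * logTail u ξ β t)) = ⊤ := by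
  set K := Real.exp (δ * u) * β with hK
  have hK0 : 0 < K := mul_pos (Real.exp_pos _) hβ
  have h1 : ∫⁻ t in Ioc 0 β, ENNReal.ofReal (K * t⁻¹) = ⊤ := by
    by_contra hne
    have hi : IntegrableOn (fun t : ℝ => K * t⁻¹) (Ioc 0 β) := by
      refine ⟨(measurable_inv.const_mul K).aestronglyMeasurable, ?_⟩
      rw [hasFiniteIntegral_iff_ofReal]
      · exact lt_top_iff_ne_top.2 hne
      · filter_upwards [ae_restrict_mem measurableSet_Ioc] with t ht
        exact mul_nonneg hK0.le (inv_nonneg.2 ht.1.le)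
    have h2 := ((intervalIntegrable_iff_integrableOn_Ioc_of_le hβ.le).2 hi).const_mul K⁻¹
    have h3 : IntervalIntegrable (fun t : ℝ => t⁻¹) volume 0 β := by
      convert h2 using 2
      field_simp
    rcases intervalIntegrable_inv_iff.1 h3 with h | h
    · exact hβ.ne h
    · exact h left_mem_uIcc
  rw [eq_top_iff, ← h1]
  refine (setLIntegral_mono' measurableSet_Ioc fun t ht => ENNReal.ofReal_le_ofReal ?_).trans
    (lintegral_mono_set (Ioc_subset_Ioc_right hβ1))
  rcases ht.2.eq_or_lt with h | h
  · rw [h, logTail_of_le le_rfl, hK, mul_assoc, mul_inv_cancel₀ hβ.ne', mul_one]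
  · rw [logTail, if_pos h, mul_add, Real.exp_add, hK, mul_assoc]
    apply mul_le_mul_of_nonneg_left _ (Real.exp_pos _).le
    have hl : Real.log t ≤ Real.log β := Real.log_le_log ht.1 h.le
    calc β * t⁻¹ = Real.exp (Real.log β - Real.log t) := by
          rw [Real.exp_sub, Real.exp_log hβ, Real.exp_log ht.1, div_eq_mul_inv]
      _ ≤ _ := by
          rw [Real.exp_le_exp]
          nlinarith

end

/-! ### Step functions -/

section

variable {f : ℝ → ℝ} {c d k : ℝ}

theorem intervalIntegrable_of_eq_const (hcd : c ≤ d) (h : ∀ t ∈ Ioo c d, f t = k) :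
    IntervalIntegrable f volume c d :=
  (intervalIntegrable_const (c := k)).congr_uIoo fun t ht => by
    rw [uIoo_of_le hcd] at ht
    exact (h t ht).symm

theorem integral_of_eq_const (hcd : c ≤ d) (h : ∀ t ∈ Ioo c d, f t = k) :
    ∫ t in c..d, f t = (d - c) * k := by
  rw [intervalIntegral.integral_congr_uIoo (g := fun _ => k) fun t ht => by
    rw [uIoo_of_le hcd] at ht
    exact h t ht]
  simp

theorem meanPoint_of_eq_const (hcd : c < d) (h : ∀ t ∈ Ioo c d, f t = k) :
    meanPoint f c d = (k, Real.exp k) := by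
  have h1 : d - c ≠ 0 := by linarith
  rw [meanPoint, integral_of_eq_const hcd.le h,
    integral_of_eq_const (f := fun t => Real.exp (f t)) hcd.le fun t ht => by rw [h t ht],
    mul_div_cancel_left₀ _ h1, mul_div_cancel_left₀ _ h1]

theorem meanPoint_congr {g : ℝ → ℝ} (hcd : c ≤ d) (h : ∀ t ∈ Ioo c d, f t = g t) :
    meanPoint f c d = meanPoint g c d := by
  have h' : EqOn f g (uIoo c d) := by rwa [uIoo_of_le hcd]
  have e1 : ∫ t in c..d, f t = ∫ t in c..d, g t := intervalIntegral.integral_congr_uIoo h'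
  have e2 : ∫ t in c..d, Real.exp (f t) = ∫ t in c..d, Real.exp (g t) :=
    intervalIntegral.integral_congr_uIoo fun t ht => congrArg Real.exp (h' ht)
  rw [meanPoint, meanPoint, e1, e2]

theorem le_lintegral_indicator {ψ : ℝ → ℝ} {T : ℝ} (h1 : T ≤ 1) (h : ∀ t ∈ Ioo 0 T, 0 ≤ ψ t) :
    ENNReal.ofReal T ≤ ∫⁻ t in Ioc 0 1, ENNReal.ofReal ((Ici (0 : ℝ)).indicator 1 (ψ t)) := by
  calc ENNReal.ofReal T = ∫⁻ t in Ioo 0 T, 1 := by simp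
    _ = ∫⁻ t in Ioo 0 T, ENNReal.ofReal ((Ici (0 : ℝ)).indicator 1 (ψ t)) :=
        setLIntegral_congr_fun measurableSet_Ioo fun t ht => by
          rw [indicator_of_mem (by simpa using h t ht)]
          simp
    _ ≤ _ := lintegral_mono_set
      (show Ioo 0 T ⊆ Ioc 0 1 from fun t ht => ⟨ht.1, ht.2.le.trans h1⟩)

end

section

variable {C : ℝ}

theorem exp_le_tangent_at_xiMinus (hC : 1 < C) {v : ℝ} (h0 : -(xiPlus C - xiMinus C) ≤ v)
    (h1 : v ≤ 0) : Real.exp v ≤ C * Real.exp (xiMinus C) * (1 + (v - xiMinus C)) := by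
  have := xiMinus_rho hC.le
  linarith [exp_le_tangent_of_gap_le hC h0 h1]

/-- The optimal functions on `Ω_2`. -/
theorem exists_expClass_chord (hC : 1 < C) {w s : ℝ} (hw : -(xiPlus C - xiMinus C) ≤ w)
    (hw0 : w < 0) (hs : 0 ≤ s) (hs1 : s ≤ 1) : ∃ ψ, ExpClass C ψ 0 1 ∧
      meanPoint ψ 0 1 = (s * w, 1 + s * (Real.exp w - 1)) ∧ ∀ t ∈ Ioo 0 (1 - s), 0 ≤ ψ t := by
  set ψ : ℝ → ℝ := fun t => if t < 1 - s then 0 else w with hψ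
  have e1 : ∀ t ∈ Ioo 0 (1 - s), ψ t = 0 := fun t ht => if_pos ht.2
  have e2 : ∀ t ∈ Ioo (1 - s) 1, ψ t = w := fun t ht => if_neg (by linarith [ht.1])
  have f1 : ∀ t ∈ Ioo 0 (1 - s), Real.exp (ψ t) = 1 := fun t ht => by rw [e1 t ht, Real.exp_zero]
  have f2 : ∀ t ∈ Ioo (1 - s) 1, Real.exp (ψ t) = Real.exp w := fun t ht => by rw [e2 t ht]
  have h1 : (0 : ℝ) ≤ 1 - s := by linarith
  have h2 : 1 - s ≤ 1 := by linarith
  have i1 : IntervalIntegrable ψ volume 0 1 :=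
    (intervalIntegrable_of_eq_const h1 e1).trans (intervalIntegrable_of_eq_const h2 e2)
  have i2 : IntervalIntegrable (fun t => Real.exp (ψ t)) volume 0 1 :=
    (intervalIntegrable_of_eq_const h1 f1).trans (intervalIntegrable_of_eq_const h2 f2)
  refine ⟨ψ, ⟨i1, i2, fun c d hc hcd hd => ?_⟩, ?_, fun t ht => (e1 t ht).ge⟩
  -- Both values lie in `[-(ξ⁺ - ξ⁻), 0]`, where the lower curve stays below the tangent with
  -- contact at `ξ⁻`.
  · refine below_of_values (p := xiMinus C) (by linarith) hcd (intervalIntegrable_sub i1 hc hcd.le hd)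
      (intervalIntegrable_sub i2 hc hcd.le hd) fun t _ => exp_le_tangent_at_xiMinus hC ?_ ?_
    · simp only [hψ]; split_ifs <;> linarith
    · simp only [hψ]; split_ifs <;> linarith
  · rw [meanPoint, ← intervalIntegral.integral_add_adjacent_intervals
        (intervalIntegrable_of_eq_const h1 e1) (intervalIntegrable_of_eq_const h2 e2),
      ← intervalIntegral.integral_add_adjacent_intervals
        (intervalIntegrable_of_eq_const h1 f1) (intervalIntegrable_of_eq_const h2 f2),
      integral_of_eq_const h1 e1, integral_of_eq_const h2 e2, integral_of_eq_const h1 f1,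
      integral_of_eq_const h2 f2]
    refine Prod.ext ?_ ?_ <;> · simp only; ring

theorem rho_sub_rho (hC : 1 ≤ C) : C * Real.exp (xiPlus C) - C * Real.exp (xiMinus C) =
    C * Real.exp (xiMinus C) * (C * Real.exp (xiPlus C)) * (xiPlus C - xiMinus C) := by
  have h1 := xiMinus_rho hC
  have h2 := xiPlus_rho hC
  linear_combination (-(C * Real.exp (xiPlus C))) * h1 + (C * Real.exp (xiMinus C)) * h2

/-- The optimal functions on `Ω_0` and `Ω_3`. -/
theorem exists_expClass_angle (hC : 1 < C) {x : ℝ × ℝ} (hx : x ∈ OmegaZero C) {α β : ℝ}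
    (hα : 0 ≤ α) (hβ : 0 ≤ β) (hαβ : α + β ≤ 1)
    (h1 : x.1 = β * xiPlus C - α * (xiPlus C - xiMinus C))
    (h2 : x.2 = β * (C * Real.exp (xiPlus C)) + (1 - α - β) +
      α * Real.exp (-(xiPlus C - xiMinus C))) :
    ∃ ψ, ExpClass C ψ 0 1 ∧ meanPoint ψ 0 1 = x ∧ (∀ t ∈ Ioo 0 (1 - α), 0 ≤ ψ t) ∧
      ∫⁻ t in Ioc 0 1, ENNReal.ofReal |ψ t| =
        ENNReal.ofReal (β * xiPlus C + α * (xiPlus C - xiMinus C)) := by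
  obtain ⟨a1, -, a3, -, a5⟩ := (mem_OmegaZero_iff hC).1 hx
  have hξ := xiPlus_pos hC
  obtain ⟨-, hξ1, hξC⟩ := xiPlus_spec hC.le
  have hR := gap_pos hC
  have hm := xiMinus_neg hC
  have rm := xiMinus_rho hC.le
  have rp := xiPlus_rho hC.le
  have hE := exp_neg_gap hC.le
  set R := xiPlus C - xiMinus C with hRdef
  -- `x` is the barycentre, with weights `β`, `1 - α - β` and `α`, of the contact point at `ξ⁺`, the
  -- point `(0, 1)` and the point of the lower curve at `-R`. These are realised, in this order, by
  -- a logarithmic tail, the value `0` and the value `-R`.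
  set ψ : ℝ → ℝ := fun t => if t < 1 - α then logTail 0 (xiPlus C) β t else -R with hψ
  have e1 : ∀ t ∈ Ioo 0 (1 - α), ψ t = logTail 0 (xiPlus C) β t := fun t ht => if_pos ht.2
  have e2 : ∀ t ∈ Ioo (1 - α) 1, ψ t = -R := fun t ht => if_neg (by linarith [ht.1])
  have hT0 : (0 : ℝ) ≤ 1 - α := by linarith
  have hT1 : 1 - α ≤ 1 := by linarith
  have hnn : ∀ t, 0 < t → 0 ≤ logTail 0 (xiPlus C) β t := by
    intro t ht
    rw [logTail]
    split_ifs with h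
    · have := Real.log_le_log ht h.le
      have := mul_nonneg hξ.le (sub_nonneg.2 this)
      linarith
    · exact le_rfl
  have hgen : ∀ (f g g' : ℝ → ℝ), TailPair (xiPlus C) f g g' →
      IntervalIntegrable (fun t => f (ψ t)) volume 0 (1 - α) ∧
      IntervalIntegrable (fun t => f (ψ t)) volume (1 - α) 1 ∧
      ∫ t in (0 : ℝ)..1, f (ψ t) = β * g 0 + (1 - α - β) * f 0 + α * f (-R) := by
    intro f g g' hp
    have c1 : EqOn (fun t => f (logTail 0 (xiPlus C) β t)) (fun t => f (ψ t)) (uIoo 0 (1 - α)) := by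
      intro t ht
      rw [uIoo_of_le hT0] at ht
      simp only
      rw [e1 t ht]
    have c2 : ∀ t ∈ Ioo (1 - α) 1, f (ψ t) = f (-R) := fun t ht => by rw [e2 t ht]
    have j1 := (hp.intervalIntegrable_logTail (u := 0) hβ hT0).congr_uIoo c1
    have j2 := intervalIntegrable_of_eq_const hT1 c2
    refine ⟨j1, j2, ?_⟩
    rw [← intervalIntegral.integral_add_adjacent_intervals j1 j2, integral_of_eq_const hT1 c2,
      ← intervalIntegral.integral_congr_uIoo c1, hp.integral_logTail_of_ge hβ (by linarith)]
    ring
  obtain ⟨i1, i1', s1⟩ := hgen _ _ _ (tailPair_id _)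
  obtain ⟨i2, i2', s2⟩ := hgen _ _ _ (tailPair_exp_one hξ1)
  have j1 := i1.trans i1'
  have j2 := i2.trans i2'
  have hmean : meanPoint ψ 0 1 = x := by
    rw [meanPoint, s1, s2]
    refine Prod.ext ?_ ?_
    · simp only; rw [h1]; ring
    · simp only
      rw [h2, Real.exp_zero]
      have : 1 / (1 - xiPlus C) = C * Real.exp (xiPlus C) := by
        rw [div_eq_iff (by linarith), rp]
      rw [this]; ring
  refine ⟨ψ, ?_, hmean, fun t ht => by rw [e1 t ht]; exact hnn t ht.1, ?_⟩
  · have hP : ∀ d, 0 < d → d ≤ 1 → (meanPoint ψ 0 d).2 ≤ C * Real.exp (meanPoint ψ 0 d).1 := by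
      intro d hd hd1
      rcases le_or_gt d (1 - α) with h | h
      · rw [meanPoint_congr hd.le fun t ht => e1 t ⟨ht.1, ht.2.trans_le h⟩]
        exact below_meanPoint_logTail hξ1 hξC hβ hd
      rcases hd1.eq_or_lt with h' | h'
      · rw [h', hmean]; exact a5
      -- `x` is a mixture of the average over `(0, d)` and of `(-R, e^{-R})`. The latter lies on the
      -- tangent with contact at `ξ⁻` and `x` lies on or above it, with the contact abscissa between
      -- them, so `below_of_beyond` applies.
      · obtain ⟨m1, m2⟩ := meanPoint_mix hd h' le_rfl j1 j2
        have hV := meanPoint_of_eq_const h' fun t ht => e2 t ⟨h.trans ht.1, ht.2⟩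
        rw [hmean, hV] at m1 m2
        refine below_of_beyond (p := xiMinus C) (V := (-R, Real.exp (-R))) (X := x)
          (α := 1 - d) (β := d) (by linarith) (by linarith) hd (by simp only at m1 ⊢; linarith)
          (by simp only at m2 ⊢; linarith) ?_ ?_ ?_ a5
        · exact mul_nonpos_of_nonpos_of_nonneg (by simp only; linarith) (by linarith)
        · simp only; rw [hE]; linarith
        · linarith
    refine expClass_of_initial j1 j2 hP fun c d hc hcd hd => ?_
    rcases le_total c β with h | h
    · refine below_of_initial_above (by linarith) j1 j2 hc hcd hd ?_ (hP d (hc.trans hcd) hd)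
      rw [meanPoint_congr hc.le fun t ht => e1 t ⟨ht.1, by linarith [ht.2]⟩]
      exact above_meanPoint_logTail hξ1 hξC hc h
    · refine below_of_values (p := xiMinus C) (by linarith) hcd
        (intervalIntegrable_sub j1 hc.le hcd.le hd) (intervalIntegrable_sub j2 hc.le hcd.le hd)
        fun t ht => ?_
      have hv : ψ t = 0 ∨ ψ t = -R := by
        simp only [hψ]
        split_ifs
        · exact Or.inl (logTail_of_le (h.trans ht.1.le))
        · exact Or.inr rfl
      rcases hv with hv | hv <;> rw [hv] <;> apply exp_le_tangent_at_xiMinus hC <;> linarith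
  · have k1 : ∀ t ∈ uIoo 0 (1 - α), ψ t = |ψ t| := by
      intro t ht
      rw [uIoo_of_le hT0] at ht
      rw [abs_of_nonneg]
      rw [e1 t ht]; exact hnn t ht.1
    have k2 : ∀ t ∈ Ioo (1 - α) 1, |ψ t| = R := fun t ht => by
      rw [e2 t ht, abs_neg, abs_of_pos hR]
    have k3 : ∀ t ∈ Ioo (1 - α) 1, ψ t = -R := e2
    rw [← ofReal_integral_eq_lintegral_ofReal
      ((intervalIntegrable_iff_integrableOn_Ioc_of_le zero_le_one).1 j1.abs)
      (ae_of_all _ fun t => abs_nonneg _), ← intervalIntegral.integral_of_le zero_le_one,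
      ← intervalIntegral.integral_add_adjacent_intervals i1.abs i1'.abs,
      integral_of_eq_const hT1 k2, ← intervalIntegral.integral_congr_uIoo k1]
    rw [← intervalIntegral.integral_add_adjacent_intervals i1 i1', integral_of_eq_const hT1 k3] at s1
    congr 1
    linarith

/-- Coordinates on `Ω_0`. -/
theorem exists_angle_coordinates (hC : 1 < C) {x : ℝ × ℝ} (hx : x ∈ OmegaZero C) :
    ∃ α β : ℝ, 0 ≤ α ∧ 0 ≤ β ∧ α + β ≤ 1 ∧
      x.1 = β * xiPlus C - α * (xiPlus C - xiMinus C) ∧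
      x.2 = β * (C * Real.exp (xiPlus C)) + (1 - α - β) +
        α * Real.exp (-(xiPlus C - xiMinus C)) ∧
      distPlane C x = 1 - α ∧ b1Plane C x = β * xiPlus C + α * (xiPlus C - xiMinus C) := by
  obtain ⟨a1, a2, a3, a4, a5⟩ := (mem_OmegaZero_iff hC).1 hx
  have hξ := xiPlus_pos hC
  have hξ1 := (xiPlus_spec hC.le).2.1
  have hm := xiMinus_neg hC
  have hR := gap_pos hC
  have rm := xiMinus_rho hC.le
  have rp := xiPlus_rho hC.le
  have hd := rho_sub_rho hC.le
  have hE := exp_neg_gap hC.le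
  have hd0 : 0 < C * Real.exp (xiPlus C) - C * Real.exp (xiMinus C) :=
    sub_pos.2 (rho_minus_lt_rho_plus hC)
  have hb1 := b1Plane_add hC x
  have hb2 := b1Plane_sub hC x
  -- A point below the upper curve is below its chord over `[ξ⁻, ξ⁺]`; this is what bounds `α + β`.
  have hchord : x.2 * (xiPlus C - xiMinus C) ≤
      C * Real.exp (xiMinus C) * (xiPlus C - xiMinus C) + (x.1 - xiMinus C) *
        (C * Real.exp (xiPlus C) - C * Real.exp (xiMinus C)) := by
    have h := exp_convex_comb (xiMinus C) (xiPlus C)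
      (s := (x.1 - xiMinus C) / (xiPlus C - xiMinus C)) (div_nonneg (by linarith) hR.le)
      ((div_le_one hR).2 (by linarith))
    rw [div_mul_cancel₀ _ hR.ne', add_sub_cancel] at h
    have h2 := mul_le_mul_of_nonneg_right
      (a5.trans (mul_le_mul_of_nonneg_left h (by linarith : 0 ≤ C))) hR.le
    refine h2.trans (le_of_eq ?_)
    field_simp
  have hdist : distPlane C x - 1 = (1 - xiMinus C) / (xiPlus C - xiMinus C) ^ 2 *
      (x.1 + (1 - x.2) * (1 - xiPlus C)) := distPlane_sub_one C x
  rw [hE]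
  set R := xiPlus C - xiMinus C with hRdef
  set ρ := C * Real.exp (xiMinus C)
  set σ := C * Real.exp (xiPlus C)
  have hk : (1 - xiMinus C) * (1 - xiPlus C) / R = 1 / (σ - ρ) := by
    rw [div_eq_div_iff hR.ne' hd0.ne', hd]
    linear_combination (σ * R * (1 - xiPlus C)) * rm + R * rp
  rw [hk] at hb1 hb2
  -- Barycentric coordinates: `α` vanishes on the tangent of slope `σ`, and `β` on the tangent of
  -- slope `ρ`.
  refine ⟨(x.2 - 1 - σ * x.1) / (R * (σ - ρ)), (x.2 - 1 - ρ * x.1) / (xiPlus C * (σ - ρ)),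
    div_nonneg (by linarith) (by positivity), div_nonneg (by linarith) (by positivity), ?_, ?_, ?_,
    ?_, ?_⟩
  · have hb : (x.2 - 1 - ρ * x.1) / (xiPlus C * (σ - ρ)) ≤ (x.1 - xiMinus C) / R := by
      rw [div_le_div_iff₀ (by positivity) hR]
      have e : (x.1 - xiMinus C) * (xiPlus C * (σ - ρ)) - (x.2 - 1 - ρ * x.1) * R =
          ρ * R + (x.1 - xiMinus C) * (σ - ρ) - x.2 * R := by
        have : xiPlus C * (σ - ρ) = (σ - ρ) - ρ * R := by
          rw [hd]; linear_combination (-(ρ * R)) * rp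
        rw [this]
        linear_combination (-R) * rm
      linarith
    have ha : (x.2 - 1 - σ * x.1) / (R * (σ - ρ)) ≤ 1 - (x.1 - xiMinus C) / R := by
      have e0 : 1 - (x.1 - xiMinus C) / R = (xiPlus C - x.1) / R := by
        field_simp; rw [hRdef]; ring
      rw [e0, div_le_div_iff₀ (by positivity) hR]
      have e1 : (x.2 - 1 - σ * x.1) * R ≤ -xiMinus C * ((xiPlus C - x.1) * (σ - ρ)) := by
        have : -xiMinus C * (σ - ρ) = σ * R - (σ - ρ) := by
          rw [hd]; linear_combination (σ * R) * rm
        have e2 : -xiMinus C * ((xiPlus C - x.1) * (σ - ρ)) =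
            (xiPlus C - x.1) * (σ * R - (σ - ρ)) := by rw [← this]; ring
        rw [e2]
        have e3 : (xiPlus C - x.1) * (σ * R - (σ - ρ)) - (x.2 - 1 - σ * x.1) * R =
            ρ * R + (x.1 - xiMinus C) * (σ - ρ) - x.2 * R := by
          rw [hRdef]
          linear_combination (-(xiPlus C - xiMinus C)) * rp
        linarith
      have e4 : 0 ≤ (xiPlus C - x.1) * (σ - ρ) := mul_nonneg (by linarith) hd0.le
      have e5 := mul_le_mul_of_nonneg_right (show -xiMinus C ≤ R by rw [hRdef]; linarith) e4
      calc _ ≤ _ := e1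
        _ ≤ _ := e5
        _ = _ := by ring
    linarith
  · field_simp; ring
  · have e1 : (x.2 - 1 - ρ * x.1) / (xiPlus C * (σ - ρ)) * (σ - 1) =
        σ * (x.2 - 1 - ρ * x.1) / (σ - ρ) := by
      rw [show σ - 1 = σ * xiPlus C by linear_combination rp]
      field_simp
    have e2 : (x.2 - 1 - σ * x.1) / (R * (σ - ρ)) * (-(ρ * R)) =
        -(ρ * (x.2 - 1 - σ * x.1)) / (σ - ρ) := by
      field_simp
    have e3 : σ * (x.2 - 1 - ρ * x.1) / (σ - ρ) + -(ρ * (x.2 - 1 - σ * x.1)) / (σ - ρ) =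
        x.2 - 1 := by
      field_simp
      ring
    linear_combination -e1 - e2 - e3
  · have : (1 - xiMinus C) / R ^ 2 * (x.1 + (1 - x.2) * (1 - xiPlus C)) =
        -((1 - xiMinus C) * (1 - xiPlus C) / R) * ((x.2 - 1 - σ * x.1) / R) := by
      have e : x.1 + (1 - x.2) * (1 - xiPlus C) = -(1 - xiPlus C) * (x.2 - 1 - σ * x.1) := by
        linear_combination (-x.1) * rp
      rw [e]
      field_simp
    rw [this, hk] at hdist
    have e : 1 / (σ - ρ) * ((x.2 - 1 - σ * x.1) / R) = (x.2 - 1 - σ * x.1) / (R * (σ - ρ)) := by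
      field_simp
    linarith
  · have e : (x.2 - 1 - ρ * x.1) / (xiPlus C * (σ - ρ)) * xiPlus C +
        (x.2 - 1 - σ * x.1) / (R * (σ - ρ)) * R =
        1 / (σ - ρ) * (x.2 - (ρ * x.1 + 1)) + 1 / (σ - ρ) * (x.2 - (σ * x.1 + 1)) := by
      field_simp; ring
    rw [e]
    linarith

end

/-! ### Optimal functions -/

section

variable {C ξ u β t : ℝ} {x : ℝ × ℝ}

theorem le_logTail (hξ : 0 ≤ ξ) (ht : 0 < t) : u ≤ logTail u ξ β t := by
  rw [logTail]
  split_ifs with h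
  · linarith [mul_nonneg hξ (sub_nonneg.2 (Real.log_le_log ht h.le))]
  · exact le_rfl

theorem logTail_le (hξ : ξ ≤ 0) (ht : 0 < t) : logTail u ξ β t ≤ u := by
  rw [logTail]
  split_ifs with h
  · linarith [mul_nonneg (neg_nonneg.2 hξ) (sub_nonneg.2 (Real.log_le_log ht h.le))]
  · exact le_rfl

/-- The optimal functions on `Ω_1`. -/
theorem exists_expClass_jump (hC : 1 < C) (hu : u < -(xiPlus C - xiMinus C)) (hβ : 0 < β)
    (hβ1 : β ≤ 1) : ∃ ψ, ExpClass C ψ 0 1 ∧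
      meanPoint ψ 0 1 = meanPoint (logTail u (xiPlus C) β) 0 1 ∧
      distSlope C u * (β * xiPlus C) ≤ 1 ∧
      ∀ t ∈ Ioo 0 (distSlope C u * (β * xiPlus C)), 0 ≤ ψ t := by
  have hξ := xiPlus_pos hC
  obtain ⟨-, hξ1, hξC⟩ := xiPlus_spec hC.le
  have hR := gap_pos hC
  have hm := xiMinus_neg hC
  have rm := xiMinus_rho hC.le
  have rp := xiPlus_rho hC.le
  have hE := exp_neg_gap hC.le
  have hle := tangent_minus_eq hC
  have hmono := tangentHeight_strictMonoOn hξ1 hξ.ne'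
  rw [distSlope]
  have hval : ∀ v, v = 0 ∨ v = -(xiPlus C - xiMinus C) →
      Real.exp v = C * Real.exp (xiMinus C) * (1 + (v - xiMinus C)) := by
    rintro v (rfl | rfl)
    · rw [Real.exp_zero]; linarith
    · rw [hE]; linarith
  set R := xiPlus C - xiMinus C with hRdef
  -- The tail takes the value `-R` at `τ₂`, and its average over `(0, τ₂)` is the contact point of
  -- abscissa `ξ⁻`, which lies on the chord from `(-R, e^{-R})` to `(0, 1)`. On `(0, τ₂)` the tail
  -- can therefore be replaced by the values `0` and `-R` without changing the average; `τ₁` is the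
  -- length on which the value is `0`, fixed by `τ₁ * R = τ₂ * ξ⁺`.
  set κ := Real.exp ((R + u) / xiPlus C) with hκ
  set τ₂ := β * κ with hτ₂
  set τ₁ := κ / R * (β * xiPlus C) with hτ₁
  have hκ0 : 0 < κ := Real.exp_pos _
  have hκ1 : κ < 1 := by
    rw [hκ, ← Real.exp_zero]
    exact Real.exp_lt_exp.2 (div_neg_of_neg_of_pos (by linarith) hξ)
  have h20 : 0 < τ₂ := mul_pos hβ hκ0
  have h2β : τ₂ < β := by nlinarith
  have h12 : τ₁ * R = τ₂ * xiPlus C := by rw [hτ₁, hτ₂]; field_simp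
  have h10 : 0 < τ₁ := by positivity
  have h1lt : τ₁ < τ₂ := by
    have : τ₁ * R < τ₂ * R := by rw [h12]; exact mul_lt_mul_of_pos_left (by linarith) h20
    exact lt_of_mul_lt_mul_right this hR.le
  have hlog : Real.log τ₂ = Real.log β + (R + u) / xiPlus C := by
    rw [hτ₂, Real.log_mul hβ.ne' hκ0.ne', hκ, Real.log_exp]
  have htail2 : u + xiPlus C * (Real.log β - Real.log τ₂) = -R := by
    rw [hlog]; field_simp; ring
  have htail_le : ∀ d, τ₂ ≤ d → logTail u (xiPlus C) β d ≤ -R := by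
    intro d hd
    rw [logTail]
    split_ifs with h
    · rw [← htail2]
      have := mul_le_mul_of_nonneg_left (Real.log_le_log h20 hd) hξ.le
      linarith
    · exact hu.le
  set T := logTail u (xiPlus C) β with hT
  have hTc : ExpClass C T 0 1 := expClass_logTail hC.le hξ1 hξC hβ.le
  set ψ : ℝ → ℝ := fun t => if t < τ₂ then (if t < τ₁ then 0 else -R) else T t with hψ
  have e1 : ∀ t ∈ Ioo 0 τ₁, ψ t = 0 := fun t ht => by
    simp only [hψ]; rw [if_pos (ht.2.trans h1lt), if_pos ht.2]
  have e2 : ∀ t ∈ Ioo τ₁ τ₂, ψ t = -R := fun t ht => by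
    simp only [hψ]; rw [if_pos ht.2, if_neg (by linarith [ht.1])]
  have e3 : ∀ t, τ₂ ≤ t → ψ t = T t := fun t ht => if_neg (by linarith)
  have hv : ∀ t, t < τ₂ → ψ t = 0 ∨ ψ t = -R := by
    intro t ht
    simp only [hψ]
    rw [if_pos ht]
    split_ifs
    · exact Or.inl rfl
    · exact Or.inr rfl
  have f1 : ∀ t ∈ Ioo 0 τ₁, Real.exp (ψ t) = 1 := fun t ht => by rw [e1 t ht, Real.exp_zero]
  have f2 : ∀ t ∈ Ioo τ₁ τ₂, Real.exp (ψ t) = Real.exp (-R) := fun t ht => by rw [e2 t ht]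
  have hfin : ∀ d, τ₂ ≤ d → d ≤ 1 → IntervalIntegrable ψ volume τ₂ d ∧
      IntervalIntegrable (fun t => Real.exp (ψ t)) volume τ₂ d ∧
      ∫ t in τ₂..d, ψ t = ∫ t in τ₂..d, T t ∧
      ∫ t in τ₂..d, Real.exp (ψ t) = ∫ t in τ₂..d, Real.exp (T t) := by
    intro d hd hd1
    have c1 : EqOn T ψ (uIoo τ₂ d) := fun t ht => by
      rw [uIoo_of_le hd] at ht; exact (e3 t ht.1.le).symm
    have c2 : EqOn (fun t => Real.exp (T t)) (fun t => Real.exp (ψ t)) (uIoo τ₂ d) :=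
      fun t ht => congrArg Real.exp (c1 ht)
    exact ⟨(intervalIntegrable_sub hTc.int h20.le hd hd1).congr_uIoo c1,
      (intervalIntegrable_sub hTc.int_exp h20.le hd hd1).congr_uIoo c2,
      (intervalIntegral.integral_congr_uIoo c1).symm,
      (intervalIntegral.integral_congr_uIoo c2).symm⟩
  have i1 := intervalIntegrable_of_eq_const h10.le e1
  have i2 := intervalIntegrable_of_eq_const h1lt.le e2
  have j1 := intervalIntegrable_of_eq_const h10.le f1
  have j2 := intervalIntegrable_of_eq_const h1lt.le f2
  have h21 : τ₂ ≤ 1 := h2β.le.trans hβ1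
  have ii : IntervalIntegrable ψ volume 0 1 := (i1.trans i2).trans (hfin 1 h21 le_rfl).1
  have jj : IntervalIntegrable (fun t => Real.exp (ψ t)) volume 0 1 :=
    (j1.trans j2).trans (hfin 1 h21 le_rfl).2.1
  have s1 : ∫ t in (0 : ℝ)..τ₂, ψ t = ∫ t in (0 : ℝ)..τ₂, T t := by
    rw [← intervalIntegral.integral_add_adjacent_intervals i1 i2, integral_of_eq_const h10.le e1,
      integral_of_eq_const h1lt.le e2,
      (tailPair_id (xiPlus C)).integral_logTail_of_le h20 h2β.le, htail2]
    linear_combination h12 + τ₂ * hRdef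
  have s2 : ∫ t in (0 : ℝ)..τ₂, Real.exp (ψ t) = ∫ t in (0 : ℝ)..τ₂, Real.exp (T t) := by
    rw [← intervalIntegral.integral_add_adjacent_intervals j1 j2, integral_of_eq_const h10.le f1,
      integral_of_eq_const h1lt.le f2,
      (tailPair_exp_one hξ1).integral_logTail_of_le h20 h2β.le, htail2]
    have e : Real.exp (-R) / (1 - xiPlus C) = C * Real.exp (xiMinus C) := by
      rw [div_eq_iff (by linarith), hE, hRdef]
      linear_combination -rm
    rw [e, hE]
    linear_combination (C * Real.exp (xiMinus C)) * h12 - τ₂ * rm -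
      τ₂ * (C * Real.exp (xiMinus C)) * hRdef
  have hmean : ∀ d, τ₂ ≤ d → d ≤ 1 → meanPoint ψ 0 d = meanPoint T 0 d := by
    intro d hd hd1
    obtain ⟨k1, k2, k3, k4⟩ := hfin d hd hd1
    rw [meanPoint, meanPoint, ← intervalIntegral.integral_add_adjacent_intervals (i1.trans i2) k1,
      ← intervalIntegral.integral_add_adjacent_intervals (j1.trans j2) k2, s1, s2, k3, k4,
      intervalIntegral.integral_add_adjacent_intervals
        (intervalIntegrable_sub hTc.int le_rfl h20.le h21)
        (intervalIntegrable_sub hTc.int h20.le hd hd1),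
      intervalIntegral.integral_add_adjacent_intervals
        (intervalIntegrable_sub hTc.int_exp le_rfl h20.le h21)
        (intervalIntegrable_sub hTc.int_exp h20.le hd hd1)]
  have hsmall : ∀ c d, 0 ≤ c → c < d → d ≤ τ₂ →
      (meanPoint ψ c d).2 ≤ C * Real.exp (meanPoint ψ c d).1 := fun c d hc hcd hd =>
    below_of_values (p := xiMinus C) (by linarith) hcd
      (intervalIntegrable_sub ii hc hcd.le (hd.trans h21))
      (intervalIntegrable_sub jj hc hcd.le (hd.trans h21))
      fun t ht => (hval _ (hv t (ht.2.trans_le hd))).le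
  refine ⟨ψ, expClass_of_initial ii jj (fun d hd hd1 => ?_) (fun c d hc hcd hd => ?_),
    hmean 1 h21 le_rfl, by linarith, fun t ht => (e1 t ht).ge⟩
  · rcases le_total τ₂ d with h | h
    · rw [hmean d h hd1]
      exact hTc.le 0 d le_rfl hd hd1
    · exact hsmall 0 d le_rfl hd h
  · rcases le_total d τ₂ with h | h
    · exact hsmall c d hc.le hcd h
    rcases le_or_gt τ₂ c with h' | h'
    · rw [meanPoint_congr hcd.le fun t ht => e3 t (h'.trans ht.1.le)]
      exact hTc.le c d hc.le hcd hd
    have hd0 : 0 < d := hc.trans hcd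
    obtain ⟨m1, m2⟩ := meanPoint_mix hc hcd hd ii jj
    rw [sub_zero, hmean d h hd] at m1 m2
    obtain ⟨τ, -, q1, q2, q3⟩ := exists_meanPoint_logTail (u := u) hξ1 hβ.le hd0
    rw [← hT] at q2 q3
    have q4 := htail_le d h
    have hX : (meanPoint T 0 d).1 ≤ xiMinus C := by
      have : τ * xiPlus C ≤ 1 * xiPlus C := mul_le_mul_of_nonneg_right q1 hξ.le
      linarith
    -- For `c < τ₂ ≤ d` the average over `(0, c)` lies on the tangent with contact at `ξ⁻`, not left
    -- of the contact point, and the average over `(0, d)` is on or above that tangent and not right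
    -- of it. The remaining average lies beyond.
    refine below_of_beyond (p := xiMinus C) (by linarith) hc.le (sub_pos.2 hcd) m1 m2
      (mul_nonpos_of_nonneg_of_nonpos (sub_nonneg.2 ?_) (sub_nonpos.2 hX)) ?_ ?_
      (hTc.le 0 d le_rfl hd0 hd)
    · rcases le_or_gt c τ₁ with g | g
      · rw [meanPoint_of_eq_const hc fun t ht => e1 t ⟨ht.1, ht.2.trans_le g⟩]
        exact hm.le
      · have g2 : ∀ t ∈ Ioo τ₁ c, ψ t = -R := fun t ht => e2 t ⟨ht.1, ht.2.trans h'⟩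
        rw [meanPoint, ← intervalIntegral.integral_add_adjacent_intervals i1
          (intervalIntegrable_of_eq_const g.le g2), integral_of_eq_const h10.le e1,
          integral_of_eq_const g.le g2]
        simp only
        rw [le_div_iff₀ (by linarith)]
        have := mul_le_mul_of_nonneg_right h'.le hξ.le
        rw [← h12] at this
        nlinarith
    · exact tangent_le_mean hc (intervalIntegrable_sub ii le_rfl hc.le (hcd.le.trans hd))
        (intervalIntegrable_sub jj le_rfl hc.le (hcd.le.trans hd))
        fun t ht => (hval _ (hv t (ht.2.trans h'))).ge
    · have e : C * Real.exp (xiMinus C) * (1 + ((meanPoint T 0 d).1 - xiMinus C)) =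
          C * Real.exp (xiMinus C) * (meanPoint T 0 d).1 + 1 := by linear_combination rm
      rw [e, hle, q2]
      have hcmp : ((meanPoint T 0 d).1 + R) / xiPlus C ≤ τ := by
        rw [div_le_iff₀ hξ]; linarith
      exact mul_le_mul_of_nonneg_left
        ((hmono.le_iff_le (mem_Iic.2 (hcmp.trans q1)) (mem_Iic.2 q1)).2 hcmp) (Real.exp_pos _).le

/-- The line is the tangent of the family issuing from `(0, 1)`, with parameter `y / ξ` at abscissa
`y`; lower points have smaller parameters. This yields the signs of `uPlus` and `uMinus`, hence
those of the extremal tails. -/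
theorem le_div_of_le_tangent {ξ τ y z : ℝ} (hξ : ξ < 1) (h0 : ξ ≠ 0)
    (hξC : C * Real.exp ξ * (1 - ξ) = 1) (hτ : τ ≤ 1) (hy : y / ξ ≤ 1)
    (h1 : z = Real.exp y * tangentHeight ξ τ) (h2 : z ≤ C * Real.exp ξ * y + 1) : τ ≤ y / ξ := by
  have h3 : C * Real.exp ξ * y + 1 = Real.exp y * tangentHeight ξ (y / ξ) := by
    have e : C * Real.exp ξ = 1 / (1 - ξ) := by rw [eq_div_iff (by linarith), hξC]
    rw [tangentHeight, div_mul_cancel₀ _ h0, ← mul_assoc, ← Real.exp_add, add_neg_cancel,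
      Real.exp_zero, e]
    ring
  rw [h3, h1] at h2
  exact ((tangentHeight_strictMonoOn hξ h0).le_iff_le (mem_Iic.2 hτ) (mem_Iic.2 hy)).1
    (le_of_mul_le_mul_left h2 (Real.exp_pos _))

theorem uPlus_nonneg (hC : 1 < C) (hx : x ∈ Omega C)
    (h : x.1 ≤ xiPlus C → x.2 ≤ C * Real.exp (xiPlus C) * x.1 + 1) : 0 ≤ uPlus C x := by
  have hξ := xiPlus_pos hC
  rcases le_total x.1 (xiPlus C) with h1 | h1
  · obtain ⟨τ, -, hτ1, hτ2, hτ3, -⟩ := exists_tau_plus hC hx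
    have := le_div_of_le_tangent (xiPlus_spec hC.le).2.1 hξ.ne' (xiPlus_rho hC.le) hτ1
      ((div_le_one hξ).2 h1) hτ2 (h h1)
    rw [le_div_iff₀ hξ] at this
    linarith
  · linarith [(uPlus_spec hC.le hx).2.1]

theorem uPlus_nonneg_of_mem_OmegaPlus (hC : 1 < C) (hx : x ∈ Omega C) (h : x ∈ OmegaPlus C) :
    0 ≤ uPlus C x := by
  rcases h with h | h
  · exact uPlus_nonneg hC hx fun _ => h.2.2.2
  · linarith [(uPlus_spec hC.le hx).2.1, h.1]

theorem uMinus_nonpos_of_mem_OmegaMinus (hC : 1 < C) (hx : x ∈ Omega C) (h : x ∈ OmegaMinus C) :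
    uMinus C x ≤ 0 := by
  have hξ := xiMinus_neg hC
  rcases h with h | h
  · linarith [(uMinus_spec hC.le hx).2.1, h.1]
  · obtain ⟨τ, -, hτ1, hτ2, hτ3, -⟩ := exists_tau_minus hC hx
    have := le_div_of_le_tangent (by linarith) hξ.ne (xiMinus_rho hC.le) hτ1
      ((div_le_one_of_neg hξ).2 h.1) hτ2 h.2.2.2
    rw [le_div_iff_of_neg hξ] at this
    linarith

theorem exists_expClass_plus (hC : 1 < C) (hx : x ∈ Omega C) : ∃ β, 0 ≤ β ∧ β ≤ 1 ∧
    β * xiPlus C = x.1 - uPlus C x ∧ ExpClass C (logTail (uPlus C x) (xiPlus C) β) 0 1 ∧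
    meanPoint (logTail (uPlus C x) (xiPlus C) β) 0 1 = x := by
  obtain ⟨-, hξ1, hξC⟩ := xiPlus_spec hC.le
  obtain ⟨τ, h0, h1, h2, h3, h4⟩ := exists_tau_plus hC hx
  refine ⟨τ, h0, h1, h4, expClass_logTail hC.le hξ1 hξC h0, ?_⟩
  rw [← h3]
  exact meanPoint_logTail_eq hξ1 h0 h1 h2

theorem exists_expClass_minus (hC : 1 < C) (hx : x ∈ Omega C) : ∃ β, 0 ≤ β ∧ β ≤ 1 ∧
    β * xiMinus C = x.1 - uMinus C x ∧ ExpClass C (logTail (uMinus C x) (xiMinus C) β) 0 1 ∧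
    meanPoint (logTail (uMinus C x) (xiMinus C) β) 0 1 = x := by
  have hξC := (xiMinus_spec hC.le).2
  have hξ1 : xiMinus C < 1 := by linarith [xiMinus_neg hC]
  obtain ⟨τ, h0, h1, h2, h3, h4⟩ := exists_tau_minus hC hx
  refine ⟨τ, h0, h1, h4, expClass_logTail hC.le hξ1 hξC h0, ?_⟩
  rw [← h3]
  exact meanPoint_logTail_eq hξ1 h0 h1 h2

/-- On `Ω_4` the initial abscissa is nonnegative, so the tail never drops below `0`; on the other
regions the construction keeps the function nonnegative on an initial interval whose length is the
candidate. -/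
theorem exists_expClass_dist_zero (hC : 1 < C) (hx : x ∈ Omega C) (hlt : Real.exp x.1 < x.2) :
    ∃ ψ, ExpClass C ψ 0 1 ∧ meanPoint ψ 0 1 = x ∧ ENNReal.ofReal (DCand 0 C x) ≤
      ∫⁻ t in Ioc 0 1, ENNReal.ofReal ((Ici (0 : ℝ)).indicator 1 (ψ t)) := by
  rcases DCand_zero_cases hC hx with ⟨-, h, e⟩ | ⟨h, e⟩ |
    ⟨-, -, w, s, hw, hw0, hs, hs1, h1, h2, e⟩ | ⟨h1, h2, e⟩
  · obtain ⟨β, -, -, -, hψ, hm⟩ := exists_expClass_plus hC hx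
    exact ⟨_, hψ, hm, by
      rw [e]
      exact le_lintegral_indicator le_rfl fun t ht =>
        (uPlus_nonneg hC hx h).trans (le_logTail (xiPlus_pos hC).le ht.1)⟩
  · obtain ⟨α, β, hα, hβ, hαβ, h1, h2, h3, -⟩ := exists_angle_coordinates hC h
    obtain ⟨ψ, hψ, hm, hn, -⟩ := exists_expClass_angle hC h hα hβ hαβ h1 h2
    refine ⟨ψ, hψ, hm, ?_⟩
    rw [e, h3]
    exact le_lintegral_indicator (by linarith) hn
  · obtain ⟨ψ, hψ, hm, hn⟩ := exists_expClass_chord hC hw hw0 hs hs1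
    refine ⟨ψ, hψ, hm.trans (Prod.ext h1.symm h2.symm), ?_⟩
    rw [e]
    exact le_lintegral_indicator (by linarith) hn
  · obtain ⟨β, hβ0, hβ1, hβ, hψ, hm⟩ := exists_expClass_plus hC hx
    have hpos : 0 < β := by
      refine hβ0.lt_of_ne fun h0 => hlt.ne' ?_
      rw [← h0] at hm
      rw [← hm, meanPoint_logTail_of_ge (xiPlus_spec hC.le).2.1 le_rfl one_pos zero_le_one]
      simp
    obtain ⟨ψ, hψ', hm', hT, hn⟩ :=
      exists_expClass_jump hC (uPlus_lt_of_tangent_lt hC hx h1 h2) hpos hβ1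
    rw [hβ] at hT hn
    refine ⟨ψ, hψ', hm'.trans hm, ?_⟩
    rw [e]
    exact le_lintegral_indicator hT hn

theorem exists_expClass_dist (lam : ℝ) (hC : 1 < C) (hx : x ∈ Omega C)
    (hlt : Real.exp x.1 < x.2) :
    ∃ ψ, ExpClass C ψ 0 1 ∧ meanPoint ψ 0 1 = x ∧ ENNReal.ofReal (DCand lam C x) ≤
      ∫⁻ t in Ioc 0 1, ENNReal.ofReal ((Ici lam).indicator 1 (ψ t)) := by
  have hlt' : Real.exp (shiftPoint lam x).1 < (shiftPoint lam x).2 := by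
    rw [shiftPoint, sub_eq_add_neg, Real.exp_add]
    exact mul_lt_mul_of_pos_right hlt (Real.exp_pos _)
  obtain ⟨ψ, hψ, hm, hD⟩ := exists_expClass_dist_zero hC (shiftPoint_mem_Omega.2 hx) hlt'
  refine ⟨fun t => ψ t - -lam, hψ.sub_const (-lam), ?_, ?_⟩
  · rw [meanPoint_sub_const one_pos hψ.int, hm, shiftPoint, shiftPoint]
    refine Prod.ext (by simp) ?_
    simp only
    rw [mul_assoc, ← Real.exp_add]
    simp
  · rw [DCand_shiftPoint hC.le hx] at hD
    refine hD.trans (le_of_eq (lintegral_congr fun t => ?_))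
    congr 1
    by_cases h : 0 ≤ ψ t
    · rw [indicator_of_mem (mem_Ici.2 h), indicator_of_mem (mem_Ici.2 (by linarith))]
      rfl
    · rw [indicator_of_notMem (by simpa using h), indicator_of_notMem (by simpa using h)]

theorem lintegral_abs_of_nonneg {ψ : ℝ → ℝ} (hψ : ExpClass C ψ 0 1)
    (h : ∀ t ∈ Ioc (0 : ℝ) 1, 0 ≤ ψ t) :
    ∫⁻ t in Ioc 0 1, ENNReal.ofReal |ψ t| = ENNReal.ofReal (meanPoint ψ 0 1).1 := by
  have h1 : ∫⁻ t in Ioc 0 1, ENNReal.ofReal |ψ t| = ∫⁻ t in Ioc 0 1, ENNReal.ofReal (ψ t) :=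
    setLIntegral_congr_fun measurableSet_Ioc fun t ht => by rw [abs_of_nonneg (h t ht)]
  rw [h1, meanPoint, sub_zero, div_one, intervalIntegral.integral_of_le zero_le_one,
    ofReal_integral_eq_lintegral_ofReal
      ((intervalIntegrable_iff_integrableOn_Ioc_of_le zero_le_one).1 hψ.int)
      ((ae_restrict_iff' measurableSet_Ioc).2 (ae_of_all _ h))]

theorem lintegral_abs_of_nonpos {ψ : ℝ → ℝ} (hψ : ExpClass C ψ 0 1)
    (h : ∀ t ∈ Ioc (0 : ℝ) 1, ψ t ≤ 0) :
    ∫⁻ t in Ioc 0 1, ENNReal.ofReal |ψ t| = ENNReal.ofReal (-(meanPoint ψ 0 1).1) := by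
  have h1 : ∫⁻ t in Ioc 0 1, ENNReal.ofReal |ψ t| = ∫⁻ t in Ioc 0 1, ENNReal.ofReal (-ψ t) :=
    setLIntegral_congr_fun measurableSet_Ioc fun t ht => by rw [abs_of_nonpos (h t ht)]
  rw [h1, meanPoint, sub_zero, div_one, ← intervalIntegral.integral_neg,
    intervalIntegral.integral_of_le zero_le_one,
    ofReal_integral_eq_lintegral_ofReal (f := fun t => -ψ t)
      ((intervalIntegrable_iff_integrableOn_Ioc_of_le zero_le_one).1 hψ.int).neg
      ((ae_restrict_iff' measurableSet_Ioc).2 (ae_of_all _ fun t ht => neg_nonneg.2 (h t ht)))]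

/-- On the outer regions the extremal tails have constant sign, so the integral of the absolute
value is the absolute value of the average. -/
theorem exists_expClass_abs (hC : 1 < C) (hx : x ∈ Omega C) :
    ∃ ψ, ExpClass C ψ 0 1 ∧ meanPoint ψ 0 1 = x ∧
      ∫⁻ t in Ioc 0 1, ENNReal.ofReal |ψ t| = ENNReal.ofReal (b1Cand C x) := by
  rcases b1Cand_cases hx with ⟨h, e⟩ | ⟨h, e⟩ | ⟨h, e⟩
  · obtain ⟨β, -, -, -, hψ, hm⟩ := exists_expClass_minus hC hx
    refine ⟨_, hψ, hm, ?_⟩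
    rw [lintegral_abs_of_nonpos hψ fun t ht => (logTail_le (xiMinus_neg hC).le ht.1).trans
      (uMinus_nonpos_of_mem_OmegaMinus hC hx h), hm, e]
  · obtain ⟨α, β, hα, hβ, hαβ, h1, h2, -, h3⟩ := exists_angle_coordinates hC h
    obtain ⟨ψ, hψ, hm, -, hn⟩ := exists_expClass_angle hC h hα hβ hαβ h1 h2
    exact ⟨ψ, hψ, hm, by rw [hn, e, h3]⟩
  · obtain ⟨β, -, -, -, hψ, hm⟩ := exists_expClass_plus hC hx
    refine ⟨_, hψ, hm, ?_⟩
    rw [lintegral_abs_of_nonneg hψ fun t ht => (uPlus_nonneg_of_mem_OmegaPlus hC hx h).trans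
      (le_logTail (xiPlus_pos hC).le ht.1), hm, e]

end

/-! ### The Bellman functions -/

section

variable {C a b r : ℝ} {x : ℝ × ℝ} {S : Set (ℝ → ℝ)} {F : (ℝ → ℝ) → ℝ≥0∞}

theorem coe_ofReal_of_nonneg (hr : 0 ≤ r) : ((ENNReal.ofReal r : ℝ≥0∞) : EReal) = (r : EReal) := by
  rw [EReal.coe_ennreal_ofReal, max_eq_left hr]

theorem biSup_coe_eq (hr : 0 ≤ r) (hle : ∀ φ ∈ S, F φ ≤ ENNReal.ofReal r)
    (hex : ∃ φ ∈ S, ENNReal.ofReal r ≤ F φ) : ⨆ φ ∈ S, (F φ : EReal) = (r : EReal) := by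
  rw [← coe_ofReal_of_nonneg hr]
  obtain ⟨φ, hφ, h⟩ := hex
  exact le_antisymm (iSup₂_le fun φ hφ => EReal.coe_ennreal_le_coe_ennreal_iff.2 (hle φ hφ))
    (le_iSup₂_of_le φ hφ (EReal.coe_ennreal_le_coe_ennreal_iff.2 h))

theorem biInf_coe_eq (hr : 0 ≤ r) (hle : ∀ φ ∈ S, ENNReal.ofReal r ≤ F φ)
    (hex : ∃ φ ∈ S, F φ ≤ ENNReal.ofReal r) : ⨅ φ ∈ S, (F φ : EReal) = (r : EReal) := by
  rw [← coe_ofReal_of_nonneg hr]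
  obtain ⟨φ, hφ, h⟩ := hex
  exact le_antisymm (iInf₂_le_of_le φ hφ (EReal.coe_ennreal_le_coe_ennreal_iff.2 h))
    (le_iInf₂ fun φ hφ => EReal.coe_ennreal_le_coe_ennreal_iff.2 (hle φ hφ))

theorem setLAverage_le_ofReal {g : ℝ → ℝ≥0∞} (hab : a < b)
    (h : ∫⁻ t in Ioc a b, g t ≤ ENNReal.ofReal ((b - a) * r)) :
    (⨍⁻ t in Ioo a b, g t ∂volume) ≤ ENNReal.ofReal r := by
  rw [setLAverage_Ioo_eq_div]
  exact ENNReal.div_le_of_le_mul' (h.trans_eq (ENNReal.ofReal_mul (by linarith)))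

theorem ofReal_le_setLAverage {g : ℝ → ℝ≥0∞} (hab : a < b)
    (h : ENNReal.ofReal ((b - a) * r) ≤ ∫⁻ t in Ioc a b, g t) :
    ENNReal.ofReal r ≤ (⨍⁻ t in Ioo a b, g t ∂volume) := by
  have h0 : ENNReal.ofReal (b - a) ≠ 0 := by simpa using hab
  rw [setLAverage_Ioo_eq_div, ENNReal.le_div_iff_mul_le (Or.inl h0) (Or.inl ENNReal.ofReal_ne_top),
    mul_comm, ← ENNReal.ofReal_mul (by linarith)]
  exact h

theorem exists_mem_testFunctions (hC : 1 ≤ C) (hab : a < b) (G : ℝ → ℝ≥0∞) {y : ℝ≥0∞}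
    (h : ∃ ψ, ExpClass C ψ 0 1 ∧ meanPoint ψ 0 1 = x ∧ ∫⁻ t in Ioc 0 1, G (ψ t) = y) :
    ∃ φ ∈ testFunctions x C a b, (⨍⁻ t in Ioo a b, G (φ t) ∂volume) = y := by
  obtain ⟨ψ, h1, h2, h3⟩ := h
  exact ⟨_, comp_affine_mem_testFunctions (by linarith) hab h1 h2,
    (lintegral_comp_affine hab fun t => G (ψ t)).trans h3⟩

theorem exists_expClass_const (hC : 1 ≤ C) (h : x.2 = Real.exp x.1) (G : ℝ → ℝ≥0∞) :
    ∃ ψ, ExpClass C ψ 0 1 ∧ meanPoint ψ 0 1 = x ∧ ∫⁻ t in Ioc 0 1, G (ψ t) = G x.1 :=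
  ⟨fun _ => x.1, expClass_const hC x.1, by rw [meanPoint_const, ← h], by simp⟩

theorem exists_expClass_pow {p : ℝ} (hp : 1 < p) (hp2 : p ≤ 2) (hC : 1 ≤ C) (hx : x ∈ Omega C) :
    0 ≤ bCand p C x ∧ ∃ ψ, ExpClass C ψ 0 1 ∧ meanPoint ψ 0 1 = x ∧
      ∫⁻ t in Ioc 0 1, ENNReal.ofReal (|ψ t| ^ p) = ENNReal.ofReal (bCand p C x) := by
  rcases eq_exp_or_lt hx with h | h
  · rw [bCand_of_eq_exp hC hx h]
    exact ⟨Real.rpow_nonneg (abs_nonneg _) _,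
      exists_expClass_const hC h fun t => ENNReal.ofReal (|t| ^ p)⟩
  have hC1 := one_lt_of_exp_lt hx h
  obtain ⟨β, h0, h1, h2, h3, h4⟩ := exists_expClass_plus hC1 hx
  have ht := tailPair_pow hp hp2 (xiPlus_pos hC1) (xiPlus_spec hC).2.1
  have e : β * (|uPlus C x| ^ p + xiPlus C * powSlope p (xiPlus C) (uPlus C x)) +
      (1 - β) * |uPlus C x| ^ p = bCand p C x := by
    rw [bCand_eq, ← h2]; ring
  refine ⟨?_, _, h3, h4, ?_⟩
  · rw [← e, ← ht.integral_logTail_of_ge h0 h1]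
    exact intervalIntegral.integral_nonneg zero_le_one fun t _ =>
      Real.rpow_nonneg (abs_nonneg _) _
  · rw [ht.lintegral_logTail (fun s => Real.rpow_nonneg (abs_nonneg _) _) h0 h1, e]

theorem b1Cand_nonneg (hC : 1 < C) (hx : x ∈ Omega C) : 0 ≤ b1Cand C x := by
  rcases b1Cand_cases hx with ⟨h, e⟩ | ⟨h, e⟩ | ⟨h, e⟩
  · rw [e]; linarith [fst_nonpos_of_mem_OmegaMinus hC.le h]
  · obtain ⟨α, β, hα, hβ, -, -, -, -, h3⟩ := exists_angle_coordinates hC h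
    rw [e, h3]
    exact add_nonneg (mul_nonneg hβ (xiPlus_pos hC).le) (mul_nonneg hα (gap_pos hC).le)
  · rw [e]; exact fst_nonneg_of_mem_OmegaPlus hC.le h

theorem exists_expClass_sq (hC : 1 ≤ C) (hx : x ∈ Omega C) :
    ∃ ψ, ExpClass C ψ 0 1 ∧ meanPoint ψ 0 1 = x ∧
      ∫⁻ t in Ioc 0 1, ENNReal.ofReal (ψ t ^ 2) = ENNReal.ofReal (B2Cand C x) := by
  rcases eq_exp_or_lt hx with h | h
  · have e : B2Cand C x = x.1 ^ 2 := by rw [B2Cand, uMinus_of_eq_exp hC hx h]; ring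
    rw [e]
    exact exists_expClass_const hC h fun t => ENNReal.ofReal (t ^ 2)
  obtain ⟨β, h0, h1, h2, h3, h4⟩ := exists_expClass_minus (one_lt_of_exp_lt hx h) hx
  refine ⟨_, h3, h4, ?_⟩
  rw [(tailPair_sq _).lintegral_logTail (fun s => sq_nonneg s) h0 h1, B2Cand]
  congr 1
  linear_combination (2 * uMinus C x + 2 * xiMinus C) * h2

theorem exists_expClass_exp {δ : ℝ} (hδ : δ * xiPlus C < 1) (hC : 1 ≤ C) (hx : x ∈ Omega C) :
    ∃ ψ, ExpClass C ψ 0 1 ∧ meanPoint ψ 0 1 = x ∧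
      ∫⁻ t in Ioc 0 1, ENNReal.ofReal (Real.exp (δ * ψ t)) = ENNReal.ofReal (ACand δ C x) := by
  rcases eq_exp_or_lt hx with h | h
  · have e : ACand δ C x = Real.exp (δ * x.1) := by rw [ACand, uPlus_of_eq_exp hC hx h]; ring
    rw [e]
    exact exists_expClass_const hC h fun t => ENNReal.ofReal (Real.exp (δ * t))
  obtain ⟨β, h0, h1, h2, h3, h4⟩ := exists_expClass_plus (one_lt_of_exp_lt hx h) hx
  refine ⟨_, h3, h4, ?_⟩
  rw [(tailPair_exp hδ).lintegral_logTail (fun s => (Real.exp_pos _).le) h0 h1, ACand, ← h2]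
  congr 1
  have : 1 - δ * xiPlus C ≠ 0 := by linarith
  field_simp
  ring

theorem bellmanLower_eq_bCand {p : ℝ} (hp : 1 < p) (hp2 : p ≤ 2) (hC : 1 ≤ C)
    (hpC : Real.exp (p - 2) / (p - 1) ≤ C) (hab : a < b) (hx : x ∈ Omega C) :
    bellmanLower p C a b x = (bCand p C x : EReal) := by
  obtain ⟨h0, h1⟩ := exists_expClass_pow hp hp2 hC hx
  refine biInf_coe_eq h0 (fun φ hφ => ?_) ?_
  · obtain ⟨h2, rfl⟩ := (mem_testFunctions_iff hab (by linarith)).1 hφ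
    exact ofReal_le_setLAverage hab (le_lintegral_pow hp hp2 hC hpC hab h2)
  · obtain ⟨φ, hφ, h⟩ :=
      exists_mem_testFunctions hC hab (fun t => ENNReal.ofReal (|t| ^ p)) h1
    exact ⟨φ, hφ, h.le⟩

theorem bellmanLower_one_eq (hC : 1 ≤ C) (hab : a < b) (hx : x ∈ Omega C) :
    bellmanLower 1 C a b x = (b1Cand C x : EReal) := by
  have key : 0 ≤ b1Cand C x ∧ ∃ ψ, ExpClass C ψ 0 1 ∧ meanPoint ψ 0 1 = x ∧
      ∫⁻ t in Ioc 0 1, ENNReal.ofReal |ψ t| = ENNReal.ofReal (b1Cand C x) := by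
    rcases eq_exp_or_lt hx with h | h
    · rw [b1Cand_of_eq_exp hC hx h]
      exact ⟨abs_nonneg _, exists_expClass_const hC h fun t => ENNReal.ofReal |t|⟩
    · have hC1 := one_lt_of_exp_lt hx h
      exact ⟨b1Cand_nonneg hC1 hx, exists_expClass_abs hC1 hx⟩
  simp only [bellmanLower, Real.rpow_one]
  refine biInf_coe_eq key.1 (fun φ hφ => ?_) ?_
  · obtain ⟨h2, rfl⟩ := (mem_testFunctions_iff hab (by linarith)).1 hφ
    exact ofReal_le_setLAverage hab (le_lintegral_abs hC hab h2)
  · obtain ⟨φ, hφ, h⟩ := exists_mem_testFunctions hC hab (fun t => ENNReal.ofReal |t|) key.2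
    exact ⟨φ, hφ, h.le⟩

theorem bellmanSq_eq (hC : 1 ≤ C) (hab : a < b) (hx : x ∈ Omega C) :
    bellmanSq C a b x = (B2Cand C x : EReal) := by
  refine biSup_coe_eq ((sq_nonneg _).trans (sq_le_B2Cand hC hx)) (fun φ hφ => ?_) ?_
  · obtain ⟨h2, rfl⟩ := (mem_testFunctions_iff hab (by linarith)).1 hφ
    exact setLAverage_le_ofReal hab (lintegral_sq_le hC hab h2)
  · obtain ⟨φ, hφ, h⟩ := exists_mem_testFunctions hC hab (fun t => ENNReal.ofReal (t ^ 2))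
      (exists_expClass_sq hC hx)
    exact ⟨φ, hφ, h.ge⟩

theorem bellmanExp_eq {δ : ℝ} (hδ : 1 ≤ δ) (hδξ : δ * xiPlus C < 1) (hC : 1 ≤ C) (hab : a < b)
    (hx : x ∈ Omega C) : bellmanExp δ C a b x = (ACand δ C x : EReal) := by
  refine biSup_coe_eq ((Real.exp_pos _).le.trans (exp_le_ACand hC hδ hδξ hx)) (fun φ hφ => ?_) ?_
  · obtain ⟨h2, rfl⟩ := (mem_testFunctions_iff hab (by linarith)).1 hφ
    exact setLAverage_le_ofReal hab (lintegral_exp_le hC hδ hδξ hab h2)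
  · obtain ⟨φ, hφ, h⟩ := exists_mem_testFunctions hC hab
      (fun t => ENNReal.ofReal (Real.exp (δ * t))) (exists_expClass_exp hδξ hC hx)
    exact ⟨φ, hφ, h.ge⟩

theorem bellmanExp_of_eq_exp {δ : ℝ} (hC : 1 ≤ C) (hab : a < b) (h : x.2 = Real.exp x.1) :
    bellmanExp δ C a b x = (Real.exp (δ * x.1) : EReal) := by
  refine biSup_coe_eq (Real.exp_pos _).le (fun φ hφ => ?_) ?_
  · obtain ⟨h2, rfl⟩ := (mem_testFunctions_iff hab (by linarith)).1 hφ
    refine setLAverage_le_ofReal hab ?_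
    rw [lintegral_const_of_mem hab h2 h (fun t => ENNReal.ofReal (Real.exp (δ * t))),
      ← ENNReal.ofReal_mul (by linarith)]
  · obtain ⟨φ, hφ, h⟩ := exists_mem_testFunctions hC hab
      (fun t => ENNReal.ofReal (Real.exp (δ * t))) (exists_expClass_const hC h fun t => ENNReal.ofReal (Real.exp (δ * t)))
    exact ⟨φ, hφ, h.ge⟩

theorem bellmanExp_eq_top {δ : ℝ} (hδξ : 1 ≤ δ * xiPlus C) (hC : 1 ≤ C) (hab : a < b)
    (hx : x ∈ Omega C) (h : Real.exp x.1 < x.2) : bellmanExp δ C a b x = ⊤ := by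
  have hC1 := one_lt_of_exp_lt hx h
  obtain ⟨β, h0, h1, -, h3, h4⟩ := exists_expClass_plus hC1 hx
  have hβ : 0 < β := by
    refine h0.lt_of_ne fun h0 => h.ne' ?_
    rw [← h0] at h4
    rw [← h4, meanPoint_logTail_of_ge (xiPlus_spec hC).2.1 le_rfl one_pos zero_le_one]
    simp
  obtain ⟨φ, hφ, h⟩ := exists_mem_testFunctions hC hab
    (fun t => ENNReal.ofReal (Real.exp (δ * t)))
    ⟨_, h3, h4, lintegral_exp_logTail_eq_top hδξ hβ h1⟩
  refine top_unique (le_iSup₂_of_le φ hφ ?_)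
  rw [h, EReal.coe_ennreal_top]

theorem DCand_nonneg_of_mem (lam : ℝ) (hC : 1 ≤ C) (hx : x ∈ Omega C) : 0 ≤ DCand lam C x := by
  rcases eq_exp_or_lt hx with h | h
  · rw [DCand_of_eq_exp hC hx h]
    exact indicator_nonneg (fun _ _ => zero_le_one) _
  · rw [← DCand_shiftPoint hC hx]
    exact DCand_nonneg (one_lt_of_exp_lt hx h) (shiftPoint_mem_Omega.2 hx)

theorem bellmanDist_eq (lam : ℝ) (hC : 1 ≤ C) (hab : a < b) (hx : x ∈ Omega C) :
    bellmanDist lam C a b x = (DCand lam C x : EReal) := by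
  have hdiv : ∀ φ, ExpClass C φ a b → volume {t ∈ Ioo a b | lam ≤ φ t} / volume (Ioo a b) =
      ⨍⁻ t in Ioo a b, ENNReal.ofReal ((Ici lam).indicator 1 (φ t)) ∂volume := fun φ hφ => by
    rw [volume_le_eq_lintegral (hφ.aemeasurable hab), Real.volume_Ioo, setLAverage_Ioo_eq_div]
  refine biSup_coe_eq (DCand_nonneg_of_mem lam hC hx) (fun φ hφ => ?_) ?_
  · obtain ⟨h2, rfl⟩ := (mem_testFunctions_iff hab (by linarith)).1 hφ
    rw [hdiv φ h2]
    refine setLAverage_le_ofReal hab ?_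
    rw [← volume_le_eq_lintegral (h2.aemeasurable hab)]
    exact volume_le_DCand hC hab h2
  · have key : ∃ y, ENNReal.ofReal (DCand lam C x) ≤ y ∧ ∃ ψ, ExpClass C ψ 0 1 ∧
        meanPoint ψ 0 1 = x ∧
        ∫⁻ t in Ioc 0 1, ENNReal.ofReal ((Ici lam).indicator 1 (ψ t)) = y := by
      rcases eq_exp_or_lt hx with h | h
      · rw [DCand_of_eq_exp hC hx h]
        exact ⟨_, le_rfl,
          exists_expClass_const hC h fun t => ENNReal.ofReal ((Ici lam).indicator 1 t)⟩
      · obtain ⟨ψ, h1, h2, h3⟩ := exists_expClass_dist lam (one_lt_of_exp_lt hx h) hx h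
        exact ⟨_, h3, ψ, h1, h2, rfl⟩
    obtain ⟨y, hy, hψ⟩ := key
    obtain ⟨φ, hφ, h⟩ := exists_mem_testFunctions hC hab
      (fun t => ENNReal.ofReal ((Ici lam).indicator 1 t)) hψ
    refine ⟨φ, hφ, ?_⟩
    rw [hdiv φ ((mem_testFunctions_iff hab (by linarith)).1 hφ).1, h]
    exact hy

end

end AInfBellman

theorem theorem2p1 (C : ℝ) (hC : 1 ≤ C) (a b : ℝ) (hab : a < b) :
    -- (1)
    (∀ p : ℝ, 1 < p → p ≤ 2 → Real.exp (p - 2) / (p - 1) ≤ C →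
      ∀ x ∈ AInfBellman.Omega C,
        AInfBellman.bellmanLower p C a b x = ((AInfBellman.bCand p C x : ℝ) : EReal)) ∧
    (∀ x ∈ AInfBellman.Omega C,
      AInfBellman.bellmanLower 2 C a b x = ((AInfBellman.b2Cand C x : ℝ) : EReal)) ∧
    -- (2)
    (∀ x ∈ AInfBellman.Omega C,
      AInfBellman.bellmanLower 1 C a b x = ((AInfBellman.b1Cand C x : ℝ) : EReal)) ∧
    -- (3)
    (∀ x ∈ AInfBellman.Omega C,
      AInfBellman.bellmanSq C a b x = ((AInfBellman.B2Cand C x : ℝ) : EReal)) ∧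
    -- (4): `δ < 1 / ξ⁺` is written `δ * ξ⁺ < 1`, since `1 / ξ⁺ = ∞` when `C = 1`
    (∀ δ : ℝ, 1 ≤ δ → δ * AInfBellman.xiPlus C < 1 →
      ∀ x ∈ AInfBellman.Omega C,
        AInfBellman.bellmanExp δ C a b x = ((AInfBellman.ACand δ C x : ℝ) : EReal)) ∧
    (∀ δ : ℝ, 1 ≤ δ → 1 ≤ δ * AInfBellman.xiPlus C →
      ∀ x ∈ AInfBellman.Omega C,
        (x.2 = Real.exp x.1 →
          AInfBellman.bellmanExp δ C a b x = ((Real.exp (δ * x.1) : ℝ) : EReal)) ∧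
        (Real.exp x.1 < x.2 → AInfBellman.bellmanExp δ C a b x = ⊤)) ∧
    -- (5)
    (∀ lam : ℝ, ∀ x ∈ AInfBellman.Omega C,
      AInfBellman.bellmanDist lam C a b x = ((AInfBellman.DCand lam C x : ℝ) : EReal)) := by
  exact ⟨fun p hp hp2 hpC x hx => AInfBellman.bellmanLower_eq_bCand hp hp2 hC hpC hab hx,
    fun x hx => by
      -- For `p = 2` the condition on `C` reduces to `1 ≤ C`.
      rw [AInfBellman.bellmanLower_eq_bCand one_lt_two le_rfl hC (by norm_num; exact hC) hab hx,
        AInfBellman.bCand_two hC hx],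
    fun x hx => AInfBellman.bellmanLower_one_eq hC hab hx,
    fun x hx => AInfBellman.bellmanSq_eq hC hab hx,
    fun δ hδ hδξ x hx => AInfBellman.bellmanExp_eq hδ hδξ hC hab hx,
    fun δ _ hδξ x hx => ⟨AInfBellman.bellmanExp_of_eq_exp hC hab,
      AInfBellman.bellmanExp_eq_top hδξ hC hab hx⟩,
    fun lam x hx => AInfBellman.bellmanDist_eq lam hC hab hx⟩
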